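/- Graphs are finite and may have parallel edges (and loops). A circuit is identified with its edge set. For an orientation of $G$, an even circuit (a circuit of even length) is clockwise even or clockwise odd according to the parity of the number of its edges directed in agreement with a chosen sense of traversal; this does not depend on the sense. Let $J$ assign to each even circuit of $G$ a clockwise parity (even or odd). $G$ is $J$-compatible if it has an orientation under which every even circuit has the clockwise parity prescribed by $J$, and $J$-incompatible otherwise. If a vertex $v$ of a graph $H'$ has degree $2$ and is incident on two distinct edges $e,f$, and $G'$ is obtained from $H'$ by contracting $e$ and $f$, then $H'$ is an even vertex splitting of $G'$. An even splitting of $G'$ is a graph obtained from (an isomorphic copy of) $G'$ by a finite, possibly empty, sequence of even vertex splittings. Let $O_1=K_{2,3}$; let $O_2$ be $K_4$ with the three edges at one fixed vertex subdivided once each; let $E_1$ be the graph with two vertices and three edges joining them; let $E_2=K_4$; let $E_3$ be $K_4$ with each edge of one fixed circuit of length $4$ subdivided once. Let $\Delta_1$ be the graph consisting of three vertex-disjoint triangles, with two distinguished vertices in each, in which the triangles are joined cyclically in a ring by three pairwise disjoint edges, each joining a distinguished vertex of one triangle to a distinguished vertex of the next; let $\Delta_2,\Delta_3,\Delta_4$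 be obtained from $\Delta_1$ by contracting one, two and all three of these joining edges, respectively. **Theorem.** Let $G$ be a finite graph and $J$ an assignment of clockwise parities to the even circuits of $G$. Then $G$ is $J$-incompatible if and only if $G$ has a subgraph $H$ such that one of the following holds: (i) $H$ is an even splitting of $O_1$ or $O_2$, $H$ has exactly three even circuits, and $J$ prescribes an even number of them to be clockwise even; (ii) $H$ is an even splitting of $E_1$, $E_2$ or $E_3$, $H$ has exactly three even circuits, and $J$ prescribes an odd number of them to be clockwise even; (iii) $H$ is an even splitting of $\Delta_1$, $\Delta_2$, $\Delta_3$ or $\Delta_4$, $H$ has exactly four even circuits, and $J$ prescribes an odd number of them to be clockwise even. -/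

import Mathlib

open scoped Graph

namespace Graph

variable {α β : Type*}

/-- A traversal of a circuit of length `n ≥ 1` in a multigraph: pairwise distinct vertices `v i` and
pairwise distinct edges `e i`, indexed cyclically, with `e i` joining `v i` to `v (i + 1)`.
It fixes a sense of the circuit; the circuit itself is identified with its edge set. For `n = 1`
this is a loop, for `n = 2` a pair of parallel edges. -/
structure IsCircuitSeq (G : Graph α β) (n : ℕ) (v : ZMod n → α) (e : ZMod n → β) : Prop where
  pos : 0 < n
  injective_vertex : Function.Injective v
  injective_edge : Function.Injective e
  isLink : ∀ i, G.IsLink (e i) (v i) (v (i + 1))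

/-- `C` is (the edge set of) a circuit of `G` of even length. -/
def IsEvenCircuit (G : Graph α β) (C : Set β) : Prop :=
  ∃ (n : ℕ) (v : ZMod n → α) (e : ZMod n → β),
    G.IsCircuitSeq n v e ∧ Even n ∧ Set.range e = C

/-- An orientation of `G`: every edge is directed from its tail to its head. -/
structure Orientation (G : Graph α β) where
  tail : E(G) → α
  head : E(G) → α
  isLink : ∀ e : E(G), G.IsLink e (tail e) (head e)

/-- The number of edges of a traversed circuit that are directed in agreement with the sense
of the traversal. -/
noncomputable def Orientation.agreement {G : Graph α β} (D : G.Orientation) {n : ℕ}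
    (v : ZMod n → α) (e : ZMod n → β) : ℕ :=
  {i : ZMod n | ∃ h : e i ∈ E(G), D.tail ⟨e i, h⟩ = v i ∧ D.head ⟨e i, h⟩ = v (i + 1)}.ncard

/-- The orientation `D` gives each even circuit `C` of `G` the clockwise parity `J C`, where `0`
stands for clockwise even and `1` for clockwise odd. (The clockwise parity of an even circuit does
not depend on the sense; only the values of `J` at even circuits of `G` matter.) -/
def Orientation.IsCompatible {G : Graph α β} (D : G.Orientation) (J : Set β → ZMod 2) : Prop :=
  ∀ (n : ℕ) (v : ZMod n → α) (e : ZMod n → β), G.IsCircuitSeq n v e → Even n →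
    (D.agreement v e : ZMod 2) = J (Set.range e)

/-- `G` is `J`-compatible: it admits a `J`-compatible orientation. -/
def IsParityCompatible (G : Graph α β) (J : Set β → ZMod 2) : Prop :=
  ∃ D : G.Orientation, D.IsCompatible J

/-- `H` is an even vertex splitting of `G`: some vertex `v` of `H` of degree `2` is incident on
exactly the two edges `e` and `f`, and `G` arises from `H` by contracting `e` and `f`, that is,
by deleting `e` and `f` and identifying `v` with their other ends `u` and `w` (through the map `φ`,
which identifies no other vertices of `H`). -/
def IsEvenVertexSplitting (H G : Graph α β) : Prop :=
  ∃ (e f : β) (u v w : α) (φ : α → α),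
    e ≠ f ∧ u ≠ v ∧ w ≠ v ∧ H.IsLink e v u ∧ H.IsLink f v w ∧
    (∀ g, H.Inc g v → g = e ∨ g = f) ∧
    (∀ x ∈ V(H), ∀ y ∈ V(H),
      φ x = φ y ↔ x = y ∨ (x ∈ ({u, v, w} : Set α) ∧ y ∈ ({u, v, w} : Set α))) ∧
    G = (H.deleteEdges {e, f}).map φ

/-- Isomorphism of multigraphs. -/
def IsIsomorphic {α' β' : Type*} (G : Graph α β) (G' : Graph α' β') : Prop :=
  ∃ (f : α → α') (g : β → β'), Set.BijOn f V(G) V(G') ∧ Set.BijOn g E(G) E(G') ∧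
    ∀ e ∈ E(G), ∀ x ∈ V(G), ∀ y ∈ V(G), G.IsLink e x y ↔ G'.IsLink (g e) (f x) (f y)

/-- `H` is an even splitting of (a graph isomorphic to) `G₀`: it is obtained by a finite, possibly
empty, sequence of even vertex splittings. -/
def IsEvenSplitting {α' β' : Type*} (H : Graph α β) (G₀ : Graph α' β') : Prop :=
  ∃ K : Graph α β, K.IsIsomorphic G₀ ∧
    Relation.ReflTransGen (fun A B : Graph α β => B.IsEvenVertexSplitting A) K H

/-- The graph with vertices `0, …, n - 1` and edges `0, …, m - 1` in which the edge `i` joins the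
two entries of `ends i`. -/
def ofEnds {n m : ℕ} (ends : Fin m → Fin n × Fin n) : Graph (Fin n) (Fin m) where
  vertexSet := Set.univ
  IsLink e x y := ends e = (x, y) ∨ ends e = (y, x)
  edgeSet := Set.univ
  isLink_symm _ _ := ⟨fun _ _ h => h.symm⟩
  eq_or_eq_of_isLink_of_isLink := by
    rintro e x y v w (h | h) (h' | h') <;> simp_all
  edge_mem_iff_exists_isLink e :=
    ⟨fun _ => ⟨(ends e).1, (ends e).2, Or.inl rfl⟩, fun _ => Set.mem_univ e⟩
  left_mem_of_isLink _ _ _ _ := Set.mem_univ _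

/-- `K_{2,3}`, with colour classes `{0, 1}` and `{2, 3, 4}`. -/
def graphO1 : Graph (Fin 5) (Fin 6) :=
  ofEnds ![(0, 2), (0, 3), (0, 4), (1, 2), (1, 3), (1, 4)]

/-- `K_4` on `0, 1, 2, 3`, with the three edges at `0` subdivided once by `4, 5, 6`. -/
def graphO2 : Graph (Fin 7) (Fin 9) :=
  ofEnds ![(0, 4), (4, 1), (0, 5), (5, 2), (0, 6), (6, 3), (1, 2), (1, 3), (2, 3)]

/-- Two vertices joined by three edges. -/
def graphE1 : Graph (Fin 2) (Fin 3) :=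
  ofEnds ![(0, 1), (0, 1), (0, 1)]

/-- `K_4`. -/
def graphE2 : Graph (Fin 4) (Fin 6) :=
  ofEnds ![(0, 1), (0, 2), (0, 3), (1, 2), (1, 3), (2, 3)]

/-- `K_4` on `0, 1, 2, 3`, with the edges of the circuit `0 1 2 3` subdivided once
by `4, 5, 6, 7`. -/
def graphE3 : Graph (Fin 8) (Fin 10) :=
  ofEnds ![(0, 4), (4, 1), (1, 5), (5, 2), (2, 6), (6, 3), (3, 7), (7, 0), (0, 2), (1, 3)]

/-- Three vertex-disjoint triangles `0 1 2`, `3 4 5`, `6 7 8`, joined in a ring by the three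
pairwise disjoint edges `1 3`, `4 6`, `7 0`. -/
def graphDelta1 : Graph (Fin 9) (Fin 12) :=
  ofEnds ![(0, 1), (1, 2), (2, 0), (3, 4), (4, 5), (5, 3), (6, 7), (7, 8), (8, 6),
    (1, 3), (4, 6), (7, 0)]

/-- The previous graph with one of the three joining edges contracted: triangles `0 1 2`, `3 4 5`,
`4 6 7` and joining edges `1 3`, `6 0`. -/
def graphDelta2 : Graph (Fin 8) (Fin 11) :=
  ofEnds ![(0, 1), (1, 2), (2, 0), (3, 4), (4, 5), (5, 3), (4, 6), (6, 7), (7, 4),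
    (1, 3), (6, 0)]

/-- Two of the three joining edges contracted: triangles `0 1 2`, `1 3 4`, `3 5 6` and joining
edge `5 0`. -/
def graphDelta3 : Graph (Fin 7) (Fin 10) :=
  ofEnds ![(0, 1), (1, 2), (2, 0), (1, 3), (3, 4), (4, 1), (3, 5), (5, 6), (6, 3), (5, 0)]

/-- All three joining edges contracted: triangles `0 1 2`, `1 3 4`, `3 0 5`. -/
def graphDelta4 : Graph (Fin 6) (Fin 9) :=
  ofEnds ![(0, 1), (1, 2), (2, 0), (1, 3), (3, 4), (4, 1), (3, 0), (0, 5), (5, 3)]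

/-- The number of even circuits of `H`. -/
noncomputable def numEvenCircuits (H : Graph α β) : ℕ :=
  {C : Set β | H.IsEvenCircuit C}.ncard

/-- The number of even circuits of `H` that `J` prescribes to be clockwise even. -/
noncomputable def numPrescribedEven (H : Graph α β) (J : Set β → ZMod 2) : ℕ :=
  {C : Set β | H.IsEvenCircuit C ∧ J C = 0}.ncard

end Graph

/-! Fix any orientation and give each even circuit `C` the weight `w C` in `ZMod 2` by which its
clockwise parity differs from the one prescribed by `J`. Reversing the edges of a set with indicator
function `f` changes the parity of `C` by the sum of `f` over `C`. Hence `G` is `J`-compatible if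
and only if `w` has a potential: an edge function `f` with `w C = ∑ e ∈ C, f e` for every even
circuit `C`.

Necessity of compatibility conditions: in each base graph the three or four even circuits cover
every edge an even number of times, so the sum of their clockwise parities is the same constant for
all orientations. This survives even vertex splittings (`IsSplit.hasEvenFamily`). If these are all
the even circuits of `H`, the number prescribed to be clockwise even is determined modulo 2 whenever
`J` can be realized; the obstructions are the subgraphs where it is wrong.

Conversely, absence of obstructions says that `w` satisfies three relations (`thetaRel`, `k4Rel`,
`deltaRel`): it sums to zero over the even circuits of every theta graph with only even circuits, of
every subdivided `K₄` with only odd triangles, and of every ring of three odd circuits that has an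
even circuit running round the ring through one arc of each. Indeed, contracting pairs of
consecutive edges on the paths of such a subgraph leaves one of the nine base graphs.

It remains to show that the relations imply a potential (`Rels.hasPotential`), by induction on an
edge set `F`. If `F` has no odd circuit, the theta relation makes all circuits through a given edge
equally heavy, once the others have weight zero. Otherwise take a maximal subgraph of `F` that
arises from an odd circuit by adding ears. If it is proper, every circuit lies inside or outside it
and two potentials are glued. If it is all of `F`, remove the last ear `P` and subtract a potential
of the rest, so that only the even circuits through `P` matter. Comparison with the graph without
the preceding ear `R` settles those that avoid `R`, and a circuit through both consists of `P`, `R`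
and two disjoint paths `A`, `B` in the remaining graph `M` (one of the two may be trivial, and `M`
may contain a part of the ear that `R` belongs to).

The core is that such a circuit has weight zero as well (`Frame.not_bad`). Suppose that it has
weight one. The theta relation forces the parity of every path of `M` joining `A` to `B`. An ear of
`A` (or `B`) must be even: an odd ear together with connections from `A` to `B` produces a `K₄` or a
ring of three odd circuits that contains the heavy circuit and otherwise only circuits of weight
zero, unless the connectivity of `M` fails. So lengths along `A` and `B` determine the parities of
all paths of `M` between their vertices. But `M` contains paths of both parities between the same
two vertices, because it contains an ear union over an odd circuit. -/

namespace Graph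

/-! ### Paths -/

/-- A path of `G` from `x` to `y` with vertex set `V` and edge set `E`. -/
inductive IsPath {α β : Type*} [DecidableEq α] [DecidableEq β] (G : Graph α β) :
    α → α → Finset α → Finset β → Prop
  | nil (x : α) : IsPath G x x {x} ∅
  | cons {x y z : α} {e : β} {V : Finset α} {E : Finset β} (h : G.IsLink e x y)
      (p : IsPath G y z V E) (hx : x ∉ V) : IsPath G x z (insert x V) (insert e E)

section Path

variable {α β : Type*} [DecidableEq α] [DecidableEq β] {G H : Graph α β} {x y z m : α}
  {V V₁ V₂ X : Finset α} {E E₁ E₂ : Finset β} {e : β}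

namespace IsPath

lemma left_mem (h : G.IsPath x y V E) : x ∈ V := by
  cases h <;> simp

lemma right_mem (h : G.IsPath x y V E) : y ∈ V := by
  induction h <;> simp_all

lemma exists_isLink (h : G.IsPath x y V E) (he : e ∈ E) :
    ∃ u v, G.IsLink e u v ∧ u ∈ V ∧ v ∈ V ∧ u ≠ v := by
  induction h with
  | nil => simp at he
  | @cons x y z f V E h p hx ih =>
    rcases Finset.mem_insert.1 he with rfl | he
    · exact ⟨x, y, h, by simp, by simp [p.left_mem], by rintro rfl; exact hx p.left_mem⟩
    · obtain ⟨u, v, h1, h2, h3, h4⟩ := ih he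
      exact ⟨u, v, h1, by simp [h2], by simp [h3], h4⟩

lemma mem_of_inc (h : G.IsPath x y V E) (he : e ∈ E) (hz : G.Inc e z) : z ∈ V := by
  obtain ⟨u, v, h1, h2, h3, -⟩ := h.exists_isLink he
  rcases hz.eq_or_eq_of_isLink h1 with rfl | rfl <;> assumption

lemma exists_inc (h : G.IsPath x y V E) (hxy : x ≠ y) (hz : z ∈ V) : ∃ e ∈ E, G.Inc e z := by
  induction h with
  | nil => exact absurd rfl hxy
  | @cons x y w f V E h p hx ih =>
    rcases Finset.mem_insert.1 hz with rfl | hz'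
    · exact ⟨f, by simp, h.inc_left⟩
    · by_cases hyw : y = w
      · subst hyw
        cases p with
        | nil => simp at hz'; subst hz'; exact ⟨f, by simp, h.inc_right⟩
        | cons h' p' hy => exact absurd p'.right_mem hy
      · obtain ⟨e, he, hi⟩ := ih hyw hz'
        exact ⟨e, by simp [he], hi⟩

lemma single (h : G.IsLink e x y) (hxy : x ≠ y) : G.IsPath x y {x, y} {e} := by
  have := IsPath.cons h (IsPath.nil y) (by simpa using hxy)
  simpa using this

lemma eq_singleton (h : G.IsPath x x V E) : V = {x} ∧ E = ∅ := by
  cases h with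
  | nil => simp
  | cons h p hx => exact absurd p.right_mem hx

lemma edges_nonempty (h : G.IsPath x y V E) (hxy : x ≠ y) : E.Nonempty := by
  cases h with
  | nil => exact absurd rfl hxy
  | cons h p hx => simp

/-- An edge of a path has two distinct ends on it, so a common edge would force two common vertices.
-/
lemma disjoint_edges {x' y' : α} (h : G.IsPath x y V₁ E₁) (h' : G.IsPath x' y' V₂ E₂)
    (hm : ∀ v ∈ V₁, v ∈ V₂ → v = m) : Disjoint E₁ E₂ := by
  rw [Finset.disjoint_left]
  intro e h1 h2
  obtain ⟨u, v, hl, hu, hv, huv⟩ := h.exists_isLink h1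
  exact huv ((hm u hu (h'.mem_of_inc h2 hl.inc_left)).trans
    (hm v hv (h'.mem_of_inc h2 hl.inc_right)).symm)

lemma append (h : G.IsPath x y V₁ E₁) (h' : G.IsPath y z V₂ E₂)
    (hm : ∀ v ∈ V₁, v ∈ V₂ → v = y) : G.IsPath x z (V₁ ∪ V₂) (E₁ ∪ E₂) := by
  induction h with
  | nil x =>
    rw [Finset.singleton_union, Finset.empty_union, Finset.insert_eq_of_mem h'.left_mem]
    exact h'
  | @cons x y w f V E h p hx ih =>
    rw [Finset.insert_union, Finset.insert_union]
    refine .cons h (ih h' fun v hv hv' => hm v (by simp [hv]) hv') ?_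
    simp only [Finset.mem_union, not_or]
    refine ⟨hx, fun hx' => ?_⟩
    have := hm x (by simp) hx'
    subst this
    exact hx p.right_mem

lemma symm (h : G.IsPath x y V E) : G.IsPath y x V E := by
  induction h with
  | nil => exact .nil _
  | @cons x y z f V E h p hx ih =>
    have hxy : x ≠ y := by rintro rfl; exact hx p.left_mem
    have h2 := ih.append (IsPath.single h.symm hxy.symm) (by
      intro v hv hv'
      simp only [Finset.mem_insert, Finset.mem_singleton] at hv'
      rcases hv' with rfl | rfl
      · rfl
      · exact absurd hv hx)
    have e1 : V ∪ {y, x} = insert x V := by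
      ext v
      have := p.left_mem
      simp only [Finset.mem_union, Finset.mem_insert, Finset.mem_singleton]
      grind
    rw [e1, Finset.union_comm, Finset.singleton_union] at h2
    exact h2

lemma exists_split (h : G.IsPath x y V E) (hm : m ∈ V) : ∃ V₁ E₁ V₂ E₂,
    G.IsPath x m V₁ E₁ ∧ G.IsPath m y V₂ E₂ ∧ V = V₁ ∪ V₂ ∧ E = E₁ ∪ E₂ ∧
    (∀ v ∈ V₁, v ∈ V₂ → v = m) ∧ Disjoint E₁ E₂ := by
  induction h with
  | nil x =>
    simp only [Finset.mem_singleton] at hm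
    subst hm
    exact ⟨_, _, _, _, .nil m, .nil m, by simp, by simp, by simp, by simp⟩
  | @cons x y z f V E h p hx ih =>
    by_cases hmx : m = x
    · subst hmx
      exact ⟨_, _, _, _, .nil m, .cons h p hx, by simp, by simp, by simp, by simp⟩
    · obtain ⟨V₁, E₁, V₂, E₂, p₁, p₂, rfl, rfl, hi, hd⟩ := ih (by grind)
      have hx2 : ∀ v ∈ insert x V₁, v ∈ V₂ → v = m := by grind
      have p1 := IsPath.cons h p₁ (by grind : x ∉ V₁)
      exact ⟨_, _, _, _, p1, p₂, by simp, by simp, hx2, p1.disjoint_edges p₂ hx2⟩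

/-- Cutting at the first vertex in `X` leaves an initial segment that meets `X` only at its end.
With `exists_last` this is how ears and connecting paths are extracted from arbitrary paths. -/
lemma exists_first (h : G.IsPath x y V E) (hm : ∃ m ∈ V, m ∈ X) : ∃ m V₁ E₁ V₂ E₂,
    m ∈ X ∧ G.IsPath x m V₁ E₁ ∧ G.IsPath m y V₂ E₂ ∧ V = V₁ ∪ V₂ ∧ E = E₁ ∪ E₂ ∧
    (∀ v ∈ V₁, v ∈ V₂ → v = m) ∧ Disjoint E₁ E₂ ∧ (∀ v ∈ V₁, v ∈ X → v = m) := by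
  induction h with
  | nil x =>
    obtain ⟨m, hm, hX⟩ := hm
    simp only [Finset.mem_singleton] at hm
    subst hm
    exact ⟨m, _, _, _, _, hX, .nil m, .nil m, by simp, by simp, by simp, by simp, by simp⟩
  | @cons x y z f V E h p hx ih =>
    by_cases hxX : x ∈ X
    · exact ⟨x, _, _, _, _, hxX, .nil x, .cons h p hx, by simp, by simp, by simp, by simp, by simp⟩
    · obtain ⟨m, V₁, E₁, V₂, E₂, hmX, p₁, p₂, rfl, rfl, hi, hd, hf⟩ := ih (by grind)
      have hx2 : ∀ v ∈ insert x V₁, v ∈ V₂ → v = m := by grind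
      have p1 := IsPath.cons h p₁ (by grind : x ∉ V₁)
      exact ⟨m, _, _, _, _, hmX, p1, p₂, by simp, by simp, hx2, p1.disjoint_edges p₂ hx2, by grind⟩

lemma exists_last (h : G.IsPath x y V E) (hm : ∃ m ∈ V, m ∈ X) : ∃ m V₁ E₁ V₂ E₂,
    m ∈ X ∧ G.IsPath x m V₁ E₁ ∧ G.IsPath m y V₂ E₂ ∧ V = V₁ ∪ V₂ ∧ E = E₁ ∪ E₂ ∧
    (∀ v ∈ V₁, v ∈ V₂ → v = m) ∧ Disjoint E₁ E₂ ∧ (∀ v ∈ V₂, v ∈ X → v = m) := by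
  obtain ⟨m, V₁, E₁, V₂, E₂, hmX, p₁, p₂, rfl, rfl, hi, hd, hf⟩ := h.symm.exists_first hm
  exact ⟨m, V₂, E₂, V₁, E₁, hmX, p₂.symm, p₁.symm, Finset.union_comm _ _, Finset.union_comm _ _,
    fun v h h' => hi v h' h, hd.symm, hf⟩

/-- Follow the first path up to its first vertex on the second one, and then the second one. -/
lemma exists_trans (h : G.IsPath x y V₁ E₁) (h' : G.IsPath y z V₂ E₂) :
    ∃ V E, G.IsPath x z V E ∧ V ⊆ V₁ ∪ V₂ ∧ E ⊆ E₁ ∪ E₂ := by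
  obtain ⟨m, A₁, F₁, A₂, F₂, hmX, p₁, p₂, rfl, rfl, hi, hd, hf⟩ :=
    h.exists_first (X := V₂) ⟨y, h.right_mem, h'.left_mem⟩
  obtain ⟨B₁, D₁, B₂, D₂, q₁, q₂, rfl, rfl, hi', hd'⟩ := h'.exists_split hmX
  exact ⟨_, _, p₁.append q₂ (by grind), by grind, by grind⟩

lemma eq_singleton_of_isLink (h : G.IsPath x y V E) (he : e ∈ E) (hl : G.IsLink e x y) :
    V = {x, y} ∧ E = {e} := by
  cases h with
  | nil => simp at he
  | @cons _ w _ f V E h p hx =>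
    rcases Finset.mem_insert.1 he with rfl | he
    · have := h.right_unique hl
      subst this
      rw [p.eq_singleton.2, p.eq_singleton.1]; simp
    · exact absurd (p.mem_of_inc he hl.inc_left) hx

/-- A shared edge joins two common vertices, hence joins `x` to `y`, and then each of the two paths
consists of this edge alone. Later on it suffices to check that the edge sets differ. -/
lemma eq_or_disjoint (h : G.IsPath x y V₁ E₁) (h' : G.IsPath x y V₂ E₂)
    (hm : ∀ v ∈ V₁, v ∈ V₂ → v = x ∨ v = y) : E₁ = E₂ ∨ Disjoint E₁ E₂ := by
  by_cases hd : Disjoint E₁ E₂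
  · exact .inr hd
  left
  rw [Finset.not_disjoint_iff] at hd
  obtain ⟨e, h1, h2⟩ := hd
  obtain ⟨u, v, hl, hu, hv, huv⟩ := h.exists_isLink h1
  have hl' : G.IsLink e x y := by
    have := hm u hu (h'.mem_of_inc h2 hl.inc_left)
    have := hm v hv (h'.mem_of_inc h2 hl.inc_right)
    have := hl.symm
    grind
  rw [(h.eq_singleton_of_isLink h1 hl').2, (h'.eq_singleton_of_isLink h2 hl').2]

end IsPath

end Path

end Graph

/-! ### Circuits, degree parities and exchange of segments -/

namespace Graph

set_option linter.unusedSectionVars false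

section Circuit

variable {α β : Type*} [DecidableEq α] [DecidableEq β] {G H : Graph α β} {x y z m a b : α}
  {V V' V₁ V₂ X : Finset α} {E E₁ E₂ N C C' K : Finset β} {e : β}

/-- The parity of the number of edges of `E` incident on `z`. -/
noncomputable def degPar (G : Graph α β) (z : α) (E : Finset β) : ZMod 2 :=
  open scoped Classical in ∑ e ∈ E, if G.Inc e z then 1 else 0

lemma degPar_union (h : Disjoint E₁ E₂) :
    G.degPar z (E₁ ∪ E₂) = G.degPar z E₁ + G.degPar z E₂ :=
  Finset.sum_union h

lemma IsPath.degPar_eq (h : G.IsPath x y V E) :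
    G.degPar z E = (if z = x then 1 else 0) + (if z = y then 1 else 0) := by
  induction h with
  | nil x => simp only [degPar, Finset.sum_empty]; split_ifs <;> decide
  | @cons x y w f V E h p hx ih =>
    have hf : f ∉ E := fun hf => hx (p.mem_of_inc hf h.inc_left)
    have hxy : x ≠ y := by rintro rfl; exact hx p.left_mem
    have hz : G.Inc f z ↔ z = x ∨ z = y :=
      ⟨fun hz => hz.eq_or_eq_of_isLink h, by rintro (rfl | rfl); exacts [h.inc_left, h.inc_right]⟩
    rw [degPar, Finset.sum_insert hf]
    change _ + G.degPar z E = _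
    rw [ih]
    by_cases h1 : z = x
    · subst h1; simp [h.inc_left, hxy]
    · by_cases h2 : z = y
      · subst h2; simp only [h.inc_right, if_true, h1, if_false, ← add_assoc]
        rw [show (1 : ZMod 2) + 1 = 0 from by decide]
      · simp [hz, h1, h2]

/-- `C` is the edge set, and `V` the vertex set, of a circuit of length at least `2`. -/
def IsCirc (G : Graph α β) (V : Finset α) (C : Finset β) : Prop :=
  ∃ x y V₁ E₁ V₂ E₂, x ≠ y ∧ G.IsPath x y V₁ E₁ ∧ G.IsPath x y V₂ E₂ ∧
    (∀ v ∈ V₁, v ∈ V₂ → v = x ∨ v = y) ∧ Disjoint E₁ E₂ ∧ V = V₁ ∪ V₂ ∧ C = E₁ ∪ E₂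

lemma IsPath.isCirc (h₁ : G.IsPath x y V₁ E₁) (h₂ : G.IsPath x y V₂ E₂) (hxy : x ≠ y)
    (hm : ∀ v ∈ V₁, v ∈ V₂ → v = x ∨ v = y) (hE : E₁ ≠ E₂) : G.IsCirc (V₁ ∪ V₂) (E₁ ∪ E₂) :=
  ⟨x, y, V₁, E₁, V₂, E₂, hxy, h₁, h₂, hm, (h₁.eq_or_disjoint h₂ hm).resolve_left hE, rfl, rfl⟩

/-- The choice of the two vertices in `IsCirc` is immaterial. The pair of arcs is moved to `a` first
and then to `b`: the arc containing the new vertex is split there, and the part cut off is appended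
to the other arc. -/
lemma IsCirc.exists_split (h : G.IsCirc V C) (ha : a ∈ V) (hb : b ∈ V) (hab : a ≠ b) :
    ∃ V₁ E₁ V₂ E₂, G.IsPath a b V₁ E₁ ∧ G.IsPath a b V₂ E₂ ∧
    (∀ v ∈ V₁, v ∈ V₂ → v = a ∨ v = b) ∧ Disjoint E₁ E₂ ∧ V = V₁ ∪ V₂ ∧ C = E₁ ∪ E₂ := by
  -- opening a pair of paths at one inner vertex
  have open1 : ∀ {C V}, G.IsCirc V C → ∀ {a}, a ∈ V → ∃ y V₁ E₁ V₂ E₂, a ≠ y ∧ G.IsPath a y V₁ E₁ ∧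
      G.IsPath a y V₂ E₂ ∧ (∀ v ∈ V₁, v ∈ V₂ → v = a ∨ v = y) ∧ Disjoint E₁ E₂ ∧ V = V₁ ∪ V₂ ∧
      C = E₁ ∪ E₂ := by
    rintro C V ⟨x, y, V₁, E₁, V₂, E₂, hxy, p₁, p₂, hi, hd, rfl, rfl⟩ a ha
    wlog ha1 : a ∈ V₁ generalizing V₁ E₁ V₂ E₂
    · obtain ⟨y', A, F, B, D, h1, h2, h3, h4, h5, h6, h7⟩ :=
        this V₂ E₂ V₁ E₁ p₂ p₁ (by grind) hd.symm (by grind) (by grind)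
      exact ⟨y', A, F, B, D, h1, h2, h3, h4, h5, by rw [← h6, Finset.union_comm],
        by rw [← h7, Finset.union_comm]⟩
    by_cases hax : a = y
    · subst hax
      exact ⟨x, _, _, _, _, hxy.symm, p₁.symm, p₂.symm, by grind, hd, rfl, rfl⟩
    · obtain ⟨A, F, B, D, q₁, q₂, rfl, rfl, hi', hd'⟩ := p₁.exists_split ha1
      refine ⟨y, B, D, A ∪ V₂, F ∪ E₂, hax, q₂, q₁.symm.append p₂ ?_, ?_, ?_, ?_, ?_⟩
      · have := q₂.right_mem
        have := q₁.right_mem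
        grind
      · have := q₁.left_mem
        have := q₂.left_mem
        grind
      · rw [Finset.disjoint_union_left] at hd
        rw [Finset.disjoint_union_right]
        exact ⟨hd'.symm, hd.2⟩
      · ext v; simp only [Finset.mem_union]; tauto
      · ext v; simp only [Finset.mem_union]; tauto
  obtain ⟨y, V₁, E₁, V₂, E₂, hay, p₁, p₂, hi, hd, rfl, rfl⟩ := open1 h ha
  wlog hb1 : b ∈ V₁ generalizing V₁ E₁ V₂ E₂
  · obtain ⟨A, F, B, D, h1, h2, h3, h4, h5, h6⟩ := this V₂ E₂ V₁ E₁ p₂ p₁ (by grind) hd.symm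
      (by grind) (by grind) (by rwa [Finset.union_comm V₂, Finset.union_comm E₂]) (by grind)
    exact ⟨A, F, B, D, h1, h2, h3, h4, by rw [← h5, Finset.union_comm],
        by rw [← h6, Finset.union_comm]⟩
  obtain ⟨A, F, B, D, q₁, q₂, rfl, rfl, hi', hd'⟩ := p₁.exists_split hb1
  refine ⟨A, F, B ∪ V₂, D ∪ E₂, q₁, (q₂.append p₂.symm ?_).symm, ?_, ?_, ?_, ?_⟩
  · have := q₁.left_mem
    grind
  · have := q₁.left_mem
    have := q₂.right_mem
    grind
  · rw [Finset.disjoint_union_left] at hd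
    rw [Finset.disjoint_union_right]
    exact ⟨hd', hd.1⟩
  · ext v; simp only [Finset.mem_union]; tauto
  · ext v; simp only [Finset.mem_union]; tauto

lemma IsCirc.degPar_eq (h : G.IsCirc V C) : G.degPar z C = 0 := by
  obtain ⟨x, y, V₁, E₁, V₂, E₂, hxy, p₁, p₂, hi, hd, rfl, rfl⟩ := h
  rw [degPar_union hd, p₁.degPar_eq, p₂.degPar_eq]
  generalize (if z = x then (1 : ZMod 2) else 0) + (if z = y then (1 : ZMod 2) else 0) = q
  revert q; decide

lemma IsCirc.nonempty (h : G.IsCirc V C) : C.Nonempty := by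
  obtain ⟨x, y, V₁, E₁, V₂, E₂, hxy, p₁, p₂, hi, hd, rfl, rfl⟩ := h
  exact (p₁.edges_nonempty hxy).mono Finset.subset_union_left

lemma IsCirc.exists_isLink (h : G.IsCirc V C) (he : e ∈ C) :
    ∃ u v, G.IsLink e u v ∧ u ∈ V ∧ v ∈ V ∧ u ≠ v := by
  obtain ⟨x, y, V₁, E₁, V₂, E₂, hxy, p₁, p₂, hi, hd, rfl, rfl⟩ := h
  rcases Finset.mem_union.1 he with he | he
  · obtain ⟨u, v, h⟩ := p₁.exists_isLink he; exact ⟨u, v, by grind⟩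
  · obtain ⟨u, v, h⟩ := p₂.exists_isLink he; exact ⟨u, v, by grind⟩

lemma IsCirc.mem_of_inc (h : G.IsCirc V C) (he : e ∈ C) (hz : G.Inc e z) : z ∈ V := by
  obtain ⟨u, v, h1, h2, h3, -⟩ := h.exists_isLink he
  rcases hz.eq_or_eq_of_isLink h1 with rfl | rfl <;> assumption

lemma IsCirc.mem_edgeSet (h : G.IsCirc V C) (he : e ∈ C) : e ∈ E(G) := by
  obtain ⟨u, v, h1, -⟩ := h.exists_isLink he
  exact h1.edge_mem

lemma IsCirc.exists_inc (h : G.IsCirc V C) (hz : z ∈ V) : ∃ e ∈ C, G.Inc e z := by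
  obtain ⟨x, y, V₁, E₁, V₂, E₂, hxy, p₁, p₂, hi, hd, rfl, rfl⟩ := h
  rcases Finset.mem_union.1 hz with hz | hz
  · obtain ⟨e, h1, h2⟩ := p₁.exists_inc hxy hz; exact ⟨e, by simp [h1], h2⟩
  · obtain ⟨e, h1, h2⟩ := p₂.exists_inc hxy hz; exact ⟨e, by simp [h1], h2⟩

lemma IsCirc.exists_path (h : G.IsCirc V C) (he : e ∈ C) : ∃ x y E, x ≠ y ∧ G.IsLink e x y ∧
    G.IsPath x y V E ∧ e ∉ E ∧ C = insert e E := by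
  obtain ⟨x, y, hl, hx, hy, hxy⟩ := h.exists_isLink he
  obtain ⟨V₁, E₁, V₂, E₂, p₁, p₂, hi, hd, rfl, rfl⟩ := h.exists_split hx hy hxy
  refine ⟨x, y, ?_⟩
  rcases Finset.mem_union.1 he with he | he
  · obtain ⟨rfl, rfl⟩ := p₁.eq_singleton_of_isLink he hl
    have := p₂.left_mem
    have := p₂.right_mem
    refine ⟨E₂, hxy, hl, ?_, by simpa using hd, by simp⟩
    rwa [Finset.union_eq_right.2 (by grind)]
  · obtain ⟨rfl, rfl⟩ := p₂.eq_singleton_of_isLink he hl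
    have := p₁.left_mem
    have := p₁.right_mem
    refine ⟨E₁, hxy, hl, ?_, by simpa using hd, by rw [Finset.union_comm]; simp⟩
    rwa [Finset.union_eq_left.2 (by grind)]

lemma IsPath.isCirc_insert (h : G.IsPath x y V E) (hl : G.IsLink e x y) (hxy : x ≠ y) (he : e ∉ E) :
    G.IsCirc V (insert e E) := by
  have := (IsPath.single hl hxy).isCirc h hxy (by simp) (by rintro rfl; simp at he)
  have h1 := h.left_mem
  have h2 := h.right_mem
  rwa [Finset.union_eq_right.2 (by grind), Finset.singleton_union] at this

/-- At an inner vertex of the path, `K` has even degree and uses path edges only, so it contains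
both path edges there or neither. Membership in `K` thus propagates along the path. -/
lemma IsPath.subset_or_disjoint (h : G.IsPath x y V E) (hK : ∀ z ∈ V, G.degPar z K = 0)
    (hi : ∀ z ∈ V, z ≠ x → z ≠ y → ∀ g ∈ K, G.Inc g z → g ∈ E) : E ⊆ K ∨ Disjoint E K := by
  induction h with
  | nil => simp
  | @cons x y z f V E h p hx ih =>
    have hxy : x ≠ y := by rintro rfl; exact hx p.left_mem
    have hf : f ∉ E := fun hf => hx (p.mem_of_inc hf h.inc_left)
    by_cases hyz : y = z
    · subst hyz
      obtain ⟨rfl, rfl⟩ := p.eq_singleton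
      by_cases hfK : f ∈ K <;> simp [hfK]
    have hat : ∀ g ∈ K, G.Inc g y → g ∈ insert f E := fun g hg hgy =>
      hi y (by simp [p.left_mem]) hxy.symm hyz g hg hgy
    have hdy := hK y (by simp [p.left_mem])
    have hpy := p.degPar_eq (z := y)
    simp only [if_true, hyz, if_false, add_zero] at hpy
    rcases ih (fun z hz => hK z (by simp [hz])) (fun w hw hwy hwz g hg hgw => by
        have := hi w (by simp [hw]) (by rintro rfl; exact hx hw) hwz g hg hgw
        rcases Finset.mem_insert.1 this with rfl | h'
        · rcases hgw.eq_or_eq_of_isLink h with rfl | rfl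
          · exact absurd hw hx
          · exact absurd rfl hwy
        · exact h') with hE | hE
    · by_cases hfK : f ∈ K
      · exact .inl (Finset.insert_subset hfK hE)
      · exfalso
        have : G.degPar y K = G.degPar y E := by
          symm
          apply Finset.sum_subset hE
          intro g hg hgE
          rw [if_neg]
          intro hgy
          have := hat g hg hgy
          grind
        rw [hdy, hpy] at this
        exact absurd this (by decide)
    · by_cases hfK : f ∈ K
      · exfalso
        have : G.degPar y K = 1 := by
          rw [degPar, Finset.sum_eq_single_of_mem f hfK, if_pos h.inc_right]
          intro g hg hgf
          rw [if_neg]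
          intro hgy
          have := hat g hg hgy
          exact Finset.disjoint_left.1 hE (by grind : g ∈ E) hg
        rw [hdy] at this
        exact absurd this (by decide)
      · right
        rw [Finset.disjoint_insert_left]
        exact ⟨hfK, hE⟩

/-- A circuit inside the path would contain all of its edges, but a nontrivial path has odd degree
at its ends. -/
lemma IsPath.not_isCirc (h : G.IsPath x y V E) (hK : G.IsCirc V' K) : ¬ K ⊆ E := by
  intro hKE
  rcases h.subset_or_disjoint (K := K) (fun z _ => hK.degPar_eq) (fun z _ _ _ g hg _ => hKE hg)
    with h1 | h1
  · obtain rfl := Finset.Subset.antisymm h1 hKE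
    by_cases hxy : x = y
    · subst hxy
      exact hK.nonempty.ne_empty h.eq_singleton.2
    · have := h.degPar_eq (z := x)
      rw [hK.degPar_eq] at this
      simp [hxy] at this
  · obtain ⟨e, he⟩ := hK.nonempty
    exact Finset.disjoint_left.1 h1 (hKE he) he

/-- Each arc of `C` lies in `K` or misses `K`. If `K` missed an arc, it would lie within the other
one, which is a path and contains no circuit. -/
lemma IsCirc.eq_of_subset (h : G.IsCirc V C) (h' : G.IsCirc V' K) (hKC : K ⊆ C) : K = C := by
  obtain ⟨x, y, V₁, E₁, V₂, E₂, hxy, p₁, p₂, hi, hd, rfl, rfl⟩ := h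
  have d1 := p₁.subset_or_disjoint (K := K) (fun z _ => h'.degPar_eq) (fun z hz hzx hzy g hg hgz => by
    rcases Finset.mem_union.1 (hKC hg) with h | h
    · exact h
    · have := hi z hz (p₂.mem_of_inc h hgz); grind)
  have d2 := p₂.subset_or_disjoint (K := K) (fun z _ => h'.degPar_eq) (fun z hz hzx hzy g hg hgz => by
    rcases Finset.mem_union.1 (hKC hg) with h | h
    · have := hi z (p₁.mem_of_inc h hgz) hz; grind
    · exact h)
  have e1 : K = E₁ → False := by
    rintro rfl
    exact p₁.not_isCirc h' (Finset.Subset.refl _)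
  have e2 : K = E₂ → False := by
    rintro rfl
    exact p₂.not_isCirc h' (Finset.Subset.refl _)
  rcases d1 with d1 | d1 <;> rcases d2 with d2 | d2
  · exact Finset.Subset.antisymm hKC (Finset.union_subset d1 d2)
  · exact absurd (Finset.Subset.antisymm (fun g hg => by
      have := Finset.disjoint_left.1 d2; grind) d1) e1
  · exact absurd (Finset.Subset.antisymm (fun g hg => by
      have := Finset.disjoint_left.1 d1; grind) d2) e2
  · obtain ⟨g, hg⟩ := h'.nonempty
    have := Finset.disjoint_left.1 d1
    have := Finset.disjoint_left.1 d2
    grind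

/-- A function of the edge sets of the paths from `a` to `b` is constant if it does not change when
a segment of the path is exchanged for an internally disjoint one. -/
lemma eq_of_exchange {γ : Type*} {h : Finset β → γ}
    (H : ∀ s t V₀ E₀ V₁ E₁ V₁' E₁' V₂ E₂, G.IsPath a s V₀ E₀ → G.IsPath s t V₁ E₁ →
      G.IsPath s t V₁' E₁' → G.IsPath t b V₂ E₂ → s ≠ t → E₁ ≠ E₁' →
      (∀ v ∈ V₀, v ∈ V₁ → v = s) → (∀ v ∈ V₀, v ∈ V₁' → v = s) → (∀ v ∈ V₀, v ∉ V₂) →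
      (∀ v ∈ V₁, v ∈ V₁' → v = s ∨ v = t) → (∀ v ∈ V₁, v ∈ V₂ → v = t) →
      (∀ v ∈ V₁', v ∈ V₂ → v = t) → E₀ ⊆ N → E₁ ⊆ N → E₁' ⊆ N → E₂ ⊆ N →
      h (E₀ ∪ E₁ ∪ E₂) = h (E₀ ∪ E₁' ∪ E₂))
    (h₁ : G.IsPath a b V₁ E₁) (h₂ : G.IsPath a b V₂ E₂) (hN₁ : E₁ ⊆ N) (hN₂ : E₂ ⊆ N) :
    h E₁ = h E₂ := by
  -- The two paths share the segment `E₀` from `a` to `s`. The induction is on the length of what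
  -- remains of the second path.
  have key : ∀ n, ∀ s V₀ E₀ V E V' E', G.IsPath a s V₀ E₀ → G.IsPath s b V E → G.IsPath s b V' E' →
      (∀ v ∈ V₀, v ∈ V → v = s) → (∀ v ∈ V₀, v ∈ V' → v = s) → E₀ ⊆ N → E ⊆ N → E' ⊆ N →
      E'.card ≤ n → h (E₀ ∪ E) = h (E₀ ∪ E') := by
    intro n
    induction n with
    | zero =>
      intro s V₀ E₀ V E V' E' p₀ p p' _ _ _ _ _ hc
      have : s = b := by
        by_contra hsb
        have := (p'.edges_nonempty hsb).card_pos
        omega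
      subst this
      rw [p.eq_singleton.2, p'.eq_singleton.2]
    | succ n ih =>
      intro s V₀ E₀ V E V' E' p₀ p p' hi hi' hN₀ hN hN' hc
      cases p' with
      | nil => rw [p.eq_singleton.2]
      | @cons _ w _ f V' E' hl p' hs =>
        have hf : f ∉ E' := fun hf => hs (p'.mem_of_inc hf hl.inc_left)
        -- `t` is the next vertex of the second path on the first one. Exchanging the segment of the
        -- first path between `s` and `t` for that of the second extends the common initial segment
        -- to `t`.
        obtain ⟨t, A, F, B, D, htV, q₁, q₂, rfl, rfl, hq, hqd, hfst⟩ :=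
          p'.exists_first (X := V) ⟨b, p'.right_mem, p.right_mem⟩
        have q1 := IsPath.cons hl q₁ (by grind : s ∉ A)
        obtain ⟨V₁, E₁, V₂, E₂, p₁, p₂, rfl, rfl, hp, hpd⟩ := p.exists_split htV
        have hst : s ≠ t := by
          rintro rfl
          exact hs (by simp [q₂.left_mem])
        have hsV := p₁.left_mem
        have htV2 := p₂.left_mem
        have htV1 := p₁.right_mem
        have step : h (E₀ ∪ E₁ ∪ E₂) = h (E₀ ∪ insert f F ∪ E₂) := by
          by_cases hE : E₁ = insert f F
          · rw [hE]
          · exact H s t V₀ E₀ V₁ E₁ _ _ V₂ E₂ p₀ p₁ q1 p₂ hst hE (by grind) (by grind) (by grind)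
              (by grind) (by grind) (by grind) hN₀ (by grind) (by grind) (by grind)
        have e1 : E₀ ∪ (E₁ ∪ E₂) = E₀ ∪ E₁ ∪ E₂ := by rw [Finset.union_assoc]
        have e2 : E₀ ∪ insert f (F ∪ D) = E₀ ∪ insert f F ∪ D := by
          rw [Finset.union_assoc, Finset.insert_union]
        rw [e1, e2, step]
        refine ih t _ _ V₂ E₂ B D (p₀.append q1 (by grind)) p₂ q₂ (by grind) (by grind) (by grind)
          (by grind) (by grind) ?_
        rw [Finset.card_insert_of_notMem hf, Finset.card_union_of_disjoint hqd] at hc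
        omega
  have := key _ a _ _ V₁ E₁ V₂ E₂ (.nil a) h₁ h₂ (by simp) (by simp) (by simp) hN₁ hN₂ le_rfl
  simpa using this

/-- Exchanging a segment changes the sum by the sum over a circuit, which is zero. -/
lemma sum_eq_of_isPath {f : β → ZMod 2} (hf : ∀ V C, G.IsCirc V C → C ⊆ N → ∑ e ∈ C, f e = 0)
    (h₁ : G.IsPath a b V₁ E₁) (h₂ : G.IsPath a b V₂ E₂) (hN₁ : E₁ ⊆ N) (hN₂ : E₂ ⊆ N) :
    ∑ e ∈ E₁, f e = ∑ e ∈ E₂, f e := by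
  refine eq_of_exchange (h := fun E => ∑ e ∈ E, f e) (N := N) ?_ h₁ h₂ hN₁ hN₂
  intro s t V₀ E₀ V₁ E₁ V₁' E₁' V₂ E₂ p₀ p₁ p₁' p₂ hst hE h1 h2 h3 h4 h5 h6 n0 n1 n1' n2
  have hc := hf _ _ (p₁.isCirc p₁' hst h4 hE) (by grind)
  have hd := (p₁.eq_or_disjoint p₁' h4).resolve_left hE
  rw [Finset.sum_union hd] at hc
  have hs : ∑ e ∈ E₁, f e = ∑ e ∈ E₁', f e := by
    generalize ∑ e ∈ E₁, f e = p at *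
    generalize ∑ e ∈ E₁', f e = q at *
    revert p q; decide
  have d01 := p₀.disjoint_edges p₁ h1
  have d01' := p₀.disjoint_edges p₁' h2
  have d2 := (p₀.append p₁ h1).disjoint_edges p₂ (m := t) (by grind)
  have d2' := (p₀.append p₁' h2).disjoint_edges p₂ (m := t) (by grind)
  rw [Finset.sum_union d2, Finset.sum_union d2', Finset.sum_union d01, Finset.sum_union d01', hs]

/-- A path within a circuit is one of the two arcs between its ends. -/
lemma IsPath.eq_or_eq_of_isCirc (hd : Disjoint E₁ E₂) (hC : G.IsCirc V (E₁ ∪ E₂))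
    (h₁ : G.IsPath a b V₁ E₁) (hK : G.IsPath a b V' K) (hab : a ≠ b) (hKC : K ⊆ E₁ ∪ E₂) :
    K = E₁ ∨ K = E₂ := by
  -- The indicator function of two edges `g`, `h` of the circuit sums to zero over the only circuit
  -- in `E₁ ∪ E₂`. By `sum_eq_of_isPath` its sums over `E₁` and `K` agree, so `E₁` and `K` agree at
  -- `h` if they agree at `g`.
  have key : ∀ g ∈ E₁ ∪ E₂, ∀ h ∈ E₁ ∪ E₂, (g ∈ E₁ ↔ g ∈ K) → (h ∈ E₁ ↔ h ∈ K) := by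
    intro g hg h hh hgK
    by_cases hgh : g = h
    · subst hgh; exact hgK
    have := sum_eq_of_isPath (N := E₁ ∪ E₂)
      (f := fun i => (if i = g then 1 else 0) + (if i = h then 1 else 0))
      (fun V' C' hC' hCE => by
        rw [hC.eq_of_subset hC' hCE, Finset.sum_add_distrib, Finset.sum_ite_eq',
          Finset.sum_ite_eq', if_pos hg, if_pos hh]; decide) h₁ hK Finset.subset_union_left hKC
    rw [Finset.sum_add_distrib, Finset.sum_add_distrib, Finset.sum_ite_eq', Finset.sum_ite_eq',
      Finset.sum_ite_eq', Finset.sum_ite_eq'] at this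
    by_cases a1 : g ∈ E₁ <;> by_cases a2 : h ∈ E₁ <;> by_cases a3 : h ∈ K <;> simp_all
  rw [Finset.disjoint_left] at hd
  obtain ⟨g, hg⟩ := h₁.edges_nonempty hab
  by_cases hgK : g ∈ K
  · left
    ext h
    have := key g (by grind) h
    grind
  · right
    ext h
    have h1 := key h
    have h2 := key g (by grind) h
    grind

end Circuit

end Graph

/-! ### The three relations, frames and bad pairs -/

namespace Graph

section Relations

variable {α β : Type*} [DecidableEq α] [DecidableEq β]

/-- The weights of the three circuits of a theta graph whose circuits are all even sum to zero. -/
def ThetaRel (G : Graph α β) (w : Finset β → ZMod 2) : Prop :=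
  ∀ ⦃x y V₁ E₁ V₂ E₂ V₃ E₃⦄, x ≠ y → G.IsPath x y V₁ E₁ → G.IsPath x y V₂ E₂ →
    G.IsPath x y V₃ E₃ → (∀ v ∈ V₁, v ∈ V₂ → v = x ∨ v = y) → (∀ v ∈ V₁, v ∈ V₃ → v = x ∨ v = y) →
    (∀ v ∈ V₂, v ∈ V₃ → v = x ∨ v = y) → E₁ ≠ E₂ → E₁ ≠ E₃ → E₂ ≠ E₃ →
    (E₁.card + E₂.card) % 2 = 0 → (E₁.card + E₃.card) % 2 = 0 →
    w (E₁ ∪ E₂) + w (E₁ ∪ E₃) + w (E₂ ∪ E₃) = 0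

/-- The weights of the three even circuits of a subdivision of `K₄` all of whose triangles are odd
sum to zero. -/
def K4Rel (G : Graph α β) (w : Finset β → ZMod 2) : Prop :=
  ∀ ⦃x y z t VA EA VB EB VC EC VD ED VS ES VT ET⦄,
    x ≠ y → x ≠ z → x ≠ t → y ≠ z → y ≠ t → z ≠ t →
    G.IsPath x y VA EA → G.IsPath y z VB EB → G.IsPath z t VC EC → G.IsPath t x VD ED →
    G.IsPath x z VS ES → G.IsPath y t VT ET →
    (∀ v ∈ VA, v ∈ VB → v = y) → (∀ v ∈ VB, v ∈ VC → v = z) → (∀ v ∈ VC, v ∈ VD → v = t) →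
    (∀ v ∈ VD, v ∈ VA → v = x) → (∀ v ∈ VA, v ∉ VC) → (∀ v ∈ VB, v ∉ VD) →
    (∀ v ∈ VS, v ∈ VA → v = x) → (∀ v ∈ VS, v ∈ VB → v = z) → (∀ v ∈ VS, v ∈ VC → v = z) →
    (∀ v ∈ VS, v ∈ VD → v = x) → (∀ v ∈ VT, v ∈ VA → v = y) → (∀ v ∈ VT, v ∈ VB → v = y) →
    (∀ v ∈ VT, v ∈ VC → v = t) → (∀ v ∈ VT, v ∈ VD → v = t) → (∀ v ∈ VS, v ∉ VT) →
    (EA.card + EB.card + ES.card) % 2 = 1 → (EC.card + ED.card + ES.card) % 2 = 1 →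
    (EA.card + ED.card + ET.card) % 2 = 1 →
    w (EA ∪ EB ∪ EC ∪ ED) + w (ES ∪ ET ∪ EA ∪ EC) + w (ES ∪ ET ∪ EB ∪ ED) = 0

/-- The weights of the four even circuits of a ring of three odd circuits sum to zero. -/
def DeltaRel (G : Graph α β) (w : Finset β → ZMod 2) : Prop :=
  ∀ ⦃s₁ t₁ s₂ t₂ s₃ t₃ VP₁ P₁ VQ₁ Q₁ VP₂ P₂ VQ₂ Q₂ VP₃ P₃ VQ₃ Q₃ VJ₁ J₁ VJ₂ J₂ VJ₃ J₃⦄,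
    s₁ ≠ t₁ → s₂ ≠ t₂ → s₃ ≠ t₃ → s₁ ≠ s₂ → s₁ ≠ s₃ → s₂ ≠ s₃ → t₁ ≠ t₂ → t₁ ≠ t₃ → t₂ ≠ t₃ →
    s₁ ≠ t₂ → s₂ ≠ t₃ → s₃ ≠ t₁ →
    G.IsPath s₁ t₁ VP₁ P₁ → G.IsPath s₁ t₁ VQ₁ Q₁ → G.IsPath s₂ t₂ VP₂ P₂ →
    G.IsPath s₂ t₂ VQ₂ Q₂ → G.IsPath s₃ t₃ VP₃ P₃ → G.IsPath s₃ t₃ VQ₃ Q₃ →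
    G.IsPath t₁ s₂ VJ₁ J₁ → G.IsPath t₂ s₃ VJ₂ J₂ → G.IsPath t₃ s₁ VJ₃ J₃ →
    (∀ v ∈ VP₁, v ∈ VQ₁ → v = s₁ ∨ v = t₁) → (∀ v ∈ VP₂, v ∈ VQ₂ → v = s₂ ∨ v = t₂) →
    (∀ v ∈ VP₃, v ∈ VQ₃ → v = s₃ ∨ v = t₃) →
    (∀ v ∈ VP₁ ∪ VQ₁, v ∈ VP₂ ∪ VQ₂ → v = t₁ ∧ v = s₂) →
    (∀ v ∈ VP₂ ∪ VQ₂, v ∈ VP₃ ∪ VQ₃ → v = t₂ ∧ v = s₃) →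
    (∀ v ∈ VP₃ ∪ VQ₃, v ∈ VP₁ ∪ VQ₁ → v = t₃ ∧ v = s₁) →
    (∀ v ∈ VP₁ ∪ VQ₁, v ∈ VJ₁ → v = t₁) → (∀ v ∈ VP₁ ∪ VQ₁, v ∈ VJ₃ → v = s₁) →
    (∀ v ∈ VP₁ ∪ VQ₁, v ∉ VJ₂) →
    (∀ v ∈ VP₂ ∪ VQ₂, v ∈ VJ₂ → v = t₂) → (∀ v ∈ VP₂ ∪ VQ₂, v ∈ VJ₁ → v = s₂) →
    (∀ v ∈ VP₂ ∪ VQ₂, v ∉ VJ₃) →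
    (∀ v ∈ VP₃ ∪ VQ₃, v ∈ VJ₃ → v = t₃) → (∀ v ∈ VP₃ ∪ VQ₃, v ∈ VJ₂ → v = s₃) →
    (∀ v ∈ VP₃ ∪ VQ₃, v ∉ VJ₁) →
    (∀ v ∈ VJ₁, v ∉ VJ₂) → (∀ v ∈ VJ₂, v ∉ VJ₃) → (∀ v ∈ VJ₃, v ∉ VJ₁) →
    (P₁.card + Q₁.card) % 2 = 1 → (P₂.card + Q₂.card) % 2 = 1 → (P₃.card + Q₃.card) % 2 = 1 →
    (P₁.card + P₂.card + P₃.card + J₁.card + J₂.card + J₃.card) % 2 = 0 →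
    w (P₁ ∪ P₂ ∪ P₃ ∪ (J₁ ∪ J₂ ∪ J₃)) + w (P₁ ∪ Q₂ ∪ Q₃ ∪ (J₁ ∪ J₂ ∪ J₃)) +
      w (Q₁ ∪ P₂ ∪ Q₃ ∪ (J₁ ∪ J₂ ∪ J₃)) + w (Q₁ ∪ Q₂ ∪ P₃ ∪ (J₁ ∪ J₂ ∪ J₃)) = 0

end Relations

section Linkage

variable {α β : Type*} [DecidableEq α] [DecidableEq β] {G : Graph α β} {w : Finset β → ZMod 2}
  {M EP ER : Finset β} {VP VR : Finset α} {a b c d : α} {e₀ f₀ : β}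

lemma IsPath.card_append {x y y' z : α} {V₁ V₂ : Finset α} {E₁ E₂ : Finset β}
    (h : G.IsPath x y V₁ E₁) (h' : G.IsPath y' z V₂ E₂) (hm : ∀ v ∈ V₁, v ∈ V₂ → v = y) :
    (E₁ ∪ E₂).card = E₁.card + E₂.card :=
  Finset.card_union_of_disjoint (h.disjoint_edges h' hm)

lemma IsCirc.of_theta {x y : α} {V₁ V₂ : Finset α} {E₁ E₂ : Finset β}
    (h : G.IsPath x y V₁ E₁) (h' : G.IsPath x y V₂ E₂) (hxy : x ≠ y)
    (hm : ∀ v ∈ V₁, v ∈ V₂ → v = x ∨ v = y) (hE : E₁ ≠ E₂) :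
    ∃ V, G.IsCirc V (E₁ ∪ E₂) ∧ (E₁ ∪ E₂).card = E₁.card + E₂.card :=
  ⟨_, h.isCirc h' hxy hm hE,
    Finset.card_union_of_disjoint ((h.eq_or_disjoint h' hm).resolve_left hE)⟩

/-- Two paths `P`, `R` attached at their ends to the edge set `M`, where the even circuits that
avoid the edge `e₀` of `P` or the edge `f₀` of `R` have weight zero. -/
structure Frame (G : Graph α β) (w : Finset β → ZMod 2) (M : Finset β) (a b c d : α)
    (VP VR : Finset α) (EP ER : Finset β) (e₀ f₀ : β) : Prop where
  theta : G.ThetaRel w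
  k4 : G.K4Rel w
  delta : G.DeltaRel w
  pathP : G.IsPath a b VP EP
  pathR : G.IsPath c d VR ER
  ne_P : a ≠ b
  ne_R : c ≠ d
  meet : ∀ v ∈ VP, v ∈ VR → (v = a ∧ v = c) ∨ (v = b ∧ v = d)
  meetP : ∀ g ∈ M, ∀ v, G.Inc g v → v ∈ VP → v = a ∨ v = b
  meetR : ∀ g ∈ M, ∀ v, G.Inc g v → v ∈ VR → v = c ∨ v = d
  memP : e₀ ∈ EP
  memR : f₀ ∈ ER
  notMem_P : f₀ ∉ EP
  notMem_R : e₀ ∉ ER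
  notMem_M : e₀ ∉ M
  notMem_M' : f₀ ∉ M
  zero : ∀ V C, G.IsCirc V C → C ⊆ M ∪ EP ∪ ER → C.card % 2 = 0 → (e₀ ∉ C ∨ f₀ ∉ C) → w C = 0

/-- A pair of disjoint paths that closes `P` and `R` up to an even circuit of weight one. -/
structure Bad (G : Graph α β) (w : Finset β → ZMod 2) (M : Finset β) (a b c d : α)
    (EP ER : Finset β) (VA : Finset α) (EA : Finset β) (VB : Finset α) (EB : Finset β) : Prop where
  pathA : G.IsPath b d VA EA
  pathB : G.IsPath a c VB EB
  subA : EA ⊆ M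
  subB : EB ⊆ M
  disj : ∀ v ∈ VA, v ∉ VB
  even : (EA.card + EP.card + EB.card + ER.card) % 2 = 0
  weight : w (EA ∪ EB ∪ EP ∪ ER) = 1

namespace Frame

variable (F : G.Frame w M a b c d VP VR EP ER e₀ f₀) {VA VB VT VS : Finset α}
  {EA EB ET ES : Finset β}

include F

lemma path_meetP {x y : α} {V : Finset α} {E : Finset β} (h : G.IsPath x y V E) (hE : E ⊆ M)
    (hxy : x ≠ y) : ∀ v ∈ V, v ∈ VP → v = a ∨ v = b := by
  intro v hv hvP
  obtain ⟨e, he, hi⟩ := h.exists_inc hxy hv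
  exact F.meetP e (hE he) v hi hvP

lemma path_meetR {x y : α} {V : Finset α} {E : Finset β} (h : G.IsPath x y V E) (hE : E ⊆ M)
    (hxy : x ≠ y) : ∀ v ∈ V, v ∈ VR → v = c ∨ v = d := by
  intro v hv hvP
  obtain ⟨e, he, hi⟩ := h.exists_inc hxy hv
  exact F.meetR e (hE he) v hi hvP

lemma meetA (B : G.Bad w M a b c d EP ER VA EA VB EB) :
    (∀ v ∈ VA, v ∈ VP → v = b) ∧ (∀ v ∈ VA, v ∈ VR → v = d) := by
  have ha := B.pathB.left_mem
  have hc := B.pathB.right_mem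
  have hd := B.disj
  by_cases hbd : b = d
  · subst hbd
    have := B.pathA.eq_singleton.1
    grind
  · have := F.path_meetP B.pathA B.subA hbd
    have := F.path_meetR B.pathA B.subA hbd
    grind

lemma meetB (B : G.Bad w M a b c d EP ER VA EA VB EB) :
    (∀ v ∈ VB, v ∈ VP → v = a) ∧ (∀ v ∈ VB, v ∈ VR → v = c) := by
  have ha := B.pathA.left_mem
  have hc := B.pathA.right_mem
  have hd := B.disj
  by_cases hbd : a = c
  · subst hbd
    have := B.pathB.eq_singleton.1
    grind
  · have := F.path_meetP B.pathB B.subB hbd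
    have := F.path_meetR B.pathB B.subB hbd
    grind

/-- A path of `M` joining the two paths of a bad pair forms odd circuits. -/
lemma odd_of_mixed (B : G.Bad w M a b c d EP ER VA EA VB EB) {y t : α}
    {VA₀ VA₁ VB₀ VB₁ : Finset α} {EA₀ EA₁ EB₀ EB₁ : Finset β}
    (pA₀ : G.IsPath b y VA₀ EA₀) (pA₁ : G.IsPath y d VA₁ EA₁) (hVA : VA = VA₀ ∪ VA₁)
    (hEA : EA = EA₀ ∪ EA₁) (hA : ∀ v ∈ VA₀, v ∈ VA₁ → v = y)
    (pB₀ : G.IsPath a t VB₀ EB₀) (pB₁ : G.IsPath t c VB₁ EB₁) (hVB : VB = VB₀ ∪ VB₁)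
    (hEB : EB = EB₀ ∪ EB₁) (hB : ∀ v ∈ VB₀, v ∈ VB₁ → v = t)
    (pT : G.IsPath y t VT ET) (hT : ET ⊆ M) (hTA : ∀ v ∈ VT, v ∈ VA → v = y)
    (hTB : ∀ v ∈ VT, v ∈ VB → v = t) :
    (ET.card + EA₀.card + EP.card + EB₀.card) % 2 = 1 := by
  -- If this circuit were even, `T`, `A₀PB₀` and `A₁RB₁` would be the branches of a theta graph with
  -- even circuits only. The circuits through `T` miss `f₀` or `e₀` and have weight zero, whereas
  -- the third one is the bad circuit, of weight one.
  by_contra hodd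
  obtain ⟨mA, mA'⟩ := F.meetA B
  obtain ⟨mB, mB'⟩ := F.meetB B
  have hdis := B.disj
  have hsA := B.subA
  have hsB := B.subB
  have hw := B.weight
  have hev := B.even
  subst hVA hEA hVB hEB
  have hPR := F.meet
  have hyt : y ≠ t := by
    rintro rfl
    exact hdis y (by simp [pA₀.right_mem]) (by simp [pB₀.right_mem])
  have y0 := pA₀.right_mem
  have t0 := pB₀.right_mem
  have b0 := pA₀.left_mem
  have d0 := pA₁.right_mem
  have a0 := pB₀.left_mem
  have c0 := pB₁.right_mem
  have mTP := F.path_meetP pT hT hyt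
  have mTR := F.path_meetR pT hT hyt
  have q₁ := pA₀.symm.append F.pathP.symm (by grind)
  have q₂ := q₁.append pB₀ (by grind)
  have r₁ := pA₁.append F.pathR.symm (by grind)
  have r₂ := r₁.append pB₁.symm (by grind)
  have k₁ := pA₀.symm.card_append F.pathP.symm (by grind)
  have k₂ := q₁.card_append pB₀ (by grind)
  have k₃ := pA₁.card_append F.pathR.symm (by grind)
  have k₄ := r₁.card_append pB₁.symm (by grind)
  have k₅ := pA₀.card_append pA₁ (by grind)
  have k₆ := pB₀.card_append pB₁ (by grind)
  have i₁ : ∀ v ∈ VT, v ∈ VA₀ ∪ VP ∪ VB₀ → v = y ∨ v = t := by grind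
  have i₂ : ∀ v ∈ VT, v ∈ VA₁ ∪ VR ∪ VB₁ → v = y ∨ v = t := by grind
  have i₃ : ∀ v ∈ VA₀ ∪ VP ∪ VB₀, v ∈ VA₁ ∪ VR ∪ VB₁ → v = y ∨ v = t := by grind
  have he := F.memP
  have hf := F.memR
  have heM := F.notMem_M
  have hfM := F.notMem_M'
  have heR := F.notMem_R
  have hfP := F.notMem_P
  have n₁ : ET ≠ EA₀ ∪ EP ∪ EB₀ := by rintro rfl; grind
  have n₂ : ET ≠ EA₁ ∪ ER ∪ EB₁ := by rintro rfl; grind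
  have n₃ : EA₀ ∪ EP ∪ EB₀ ≠ EA₁ ∪ ER ∪ EB₁ := by
    intro h
    have := Finset.ext_iff.1 h e₀
    grind
  have key := F.theta hyt pT q₂ r₂ i₁ i₂ i₃ n₁ n₂ n₃ (by omega) (by omega)
  obtain ⟨_, c₁, l₁⟩ := IsCirc.of_theta pT q₂ hyt i₁ n₁
  obtain ⟨_, c₂, l₂⟩ := IsCirc.of_theta pT r₂ hyt i₂ n₂
  rw [F.zero _ _ c₁ (by grind) (by omega) (by grind),
    F.zero _ _ c₂ (by grind) (by omega) (by grind)] at key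
  have e₁ : EA₀ ∪ EP ∪ EB₀ ∪ (EA₁ ∪ ER ∪ EB₁) = EA₀ ∪ EA₁ ∪ (EB₀ ∪ EB₁) ∪ EP ∪ ER := by grind
  rw [e₁, hw] at key
  exact absurd key (by decide)

end Frame

end Linkage

end Graph

namespace Graph

section Linkage

variable {α β : Type*} [DecidableEq α] [DecidableEq β] {G : Graph α β} {w : Finset β → ZMod 2}
  {M EP ER : Finset β} {VP VR : Finset α} {a b c d : α} {e₀ f₀ : β}

namespace Frame

variable (F : G.Frame w M a b c d VP VR EP ER e₀ f₀) {VA VB VT VS : Finset α}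
  {EA EB ET ES : Finset β}

include F

/-- An even ear of the first path of a bad pair can replace the segment between its ends. -/
lemma reroute (B : G.Bad w M a b c d EP ER VA EA VB EB) {x z : α}
    {VA₀ VA₁ VA₂ : Finset α} {EA₀ EA₁ EA₂ : Finset β}
    (pA₀ : G.IsPath b x VA₀ EA₀) (pA₁ : G.IsPath x z VA₁ EA₁) (pA₂ : G.IsPath z d VA₂ EA₂)
    (hVA : VA = VA₀ ∪ VA₁ ∪ VA₂) (hEA : EA = EA₀ ∪ EA₁ ∪ EA₂) (h01 : ∀ v ∈ VA₀, v ∈ VA₁ → v = x)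
    (h12 : ∀ v ∈ VA₁, v ∈ VA₂ → v = z) (h02 : ∀ v ∈ VA₀, v ∉ VA₂) (hxz : x ≠ z)
    (pT : G.IsPath x z VT ET) (hT : ET ⊆ M) (hTA : ∀ v ∈ VT, v ∈ VA → v = x ∨ v = z)
    (hTB : ∀ v ∈ VT, v ∉ VB) (hpar : (ET.card + EA₁.card) % 2 = 0) :
    G.Bad w M a b c d EP ER (VA₀ ∪ VT ∪ VA₂) (EA₀ ∪ ET ∪ EA₂) VB EB := by
  obtain ⟨mA, mA'⟩ := F.meetA B
  obtain ⟨mB, mB'⟩ := F.meetB B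
  have hdis := B.disj
  have hsA := B.subA
  have hsB := B.subB
  have hw := B.weight
  have hev := B.even
  have pB := B.pathB
  subst hVA hEA
  have hPR := F.meet
  have x0 := pA₀.right_mem
  have x1 := pA₁.left_mem
  have z1 := pA₁.right_mem
  have z2 := pA₂.left_mem
  have b0 := pA₀.left_mem
  have d0 := pA₂.right_mem
  have a0 := pB.left_mem
  have c0 := pB.right_mem
  have mTP := F.path_meetP pT hT hxz
  have mTR := F.path_meetR pT hT hxz
  have s₁ := pA₀.append pT (by grind)
  have s₂ := s₁.append pA₂ (by grind)
  have l₁ := pA₀.card_append pT (by grind)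
  have l₂ := s₁.card_append pA₂ (by grind)
  have l₃ := pA₀.card_append pA₁ (by grind)
  have l₄ := (pA₀.append pA₁ (by grind)).card_append pA₂ (by grind)
  refine ⟨s₂, pB, by grind, hsB, by grind, by omega, ?_⟩
  -- Otherwise `T`, `A₁` and the rest of the bad circuit form a theta graph. The circuit `T ∪ A₁`
  -- lies in `M` and has weight zero, so the other two have equal weight.
  by_cases hE : ET = EA₁
  · subst hE; exact hw
  have q₁ := pA₀.symm.append F.pathP.symm (by grind)
  have q₂ := q₁.append pB (by grind)
  have q₃ := q₂.append F.pathR (by grind)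
  have q₄ := q₃.append pA₂.symm (by grind)
  have k₁ := pA₀.symm.card_append F.pathP.symm (by grind)
  have k₂ := q₁.card_append pB (by grind)
  have k₃ := q₂.card_append F.pathR (by grind)
  have k₄ := q₃.card_append pA₂.symm (by grind)
  have i₁ : ∀ v ∈ VT, v ∈ VA₁ → v = x ∨ v = z := by grind
  have i₂ : ∀ v ∈ VT, v ∈ VA₀ ∪ VP ∪ VB ∪ VR ∪ VA₂ → v = x ∨ v = z := by grind
  have i₃ : ∀ v ∈ VA₁, v ∈ VA₀ ∪ VP ∪ VB ∪ VR ∪ VA₂ → v = x ∨ v = z := by grind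
  have he := F.memP
  have heM := F.notMem_M
  have n₁ : ET ≠ EA₀ ∪ EP ∪ EB ∪ ER ∪ EA₂ := by rintro rfl; grind
  have n₂ : EA₁ ≠ EA₀ ∪ EP ∪ EB ∪ ER ∪ EA₂ := by
    intro h
    have := Finset.ext_iff.1 h e₀
    grind
  have key := F.theta hxz pT pA₁ q₄ i₁ i₂ i₃ hE n₁ n₂ (by omega) (by omega)
  obtain ⟨_, c₁, m₁⟩ := IsCirc.of_theta pT pA₁ hxz i₁ hE
  rw [F.zero _ _ c₁ (by grind) (by omega) (by grind)] at key
  have e₁ : EA₁ ∪ (EA₀ ∪ EP ∪ EB ∪ ER ∪ EA₂) = EA₀ ∪ EA₁ ∪ EA₂ ∪ EB ∪ EP ∪ ER := by grind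
  have e₂ : ET ∪ (EA₀ ∪ EP ∪ EB ∪ ER ∪ EA₂) = EA₀ ∪ ET ∪ EA₂ ∪ EB ∪ EP ∪ ER := by grind
  rw [e₁, hw, e₂] at key
  generalize w (EA₀ ∪ ET ∪ EA₂ ∪ EB ∪ EP ∪ ER) = q at *
  revert key; revert q; decide

/-- An odd ear of the first path of a bad pair is separated from the second path. -/
lemma false_of_hit (B : G.Bad w M a b c d EP ER VA EA VB EB) {x z t m : α}
    {VA₀ VA₁ VA₂ : Finset α} {EA₀ EA₁ EA₂ : Finset β}
    (pA₀ : G.IsPath b x VA₀ EA₀) (pA₁ : G.IsPath x z VA₁ EA₁) (pA₂ : G.IsPath z d VA₂ EA₂)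
    (hVA : VA = VA₀ ∪ VA₁ ∪ VA₂) (hEA : EA = EA₀ ∪ EA₁ ∪ EA₂) (h01 : ∀ v ∈ VA₀, v ∈ VA₁ → v = x)
    (h12 : ∀ v ∈ VA₁, v ∈ VA₂ → v = z) (h02 : ∀ v ∈ VA₀, v ∉ VA₂)
    (pS : G.IsPath x z VS ES) (hS : ES ⊆ M) (hSA : ∀ v ∈ VS, v ∈ VA → v = x ∨ v = z)
    (hSB : ∀ v ∈ VS, v ∉ VB) (hpar : (ES.card + EA₁.card) % 2 = 1)
    (pT : G.IsPath t m VT ET) (hT : ET ⊆ M) (ht : t ∈ VB) (hmS : m ∈ VS) (hmx : m ≠ x) (hmz : m ≠ z)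
    (hTB : ∀ v ∈ VT, v ∈ VB → v = t) (hTA : ∀ v ∈ VT, v ∉ VA)
    (hTS : ∀ v ∈ VT, v ∈ VS → v = m) : False := by
  obtain ⟨VB₀, EB₀, VB₁, EB₁, pB₀, pB₁, hVB, hEB, hB, -⟩ := B.pathB.exists_split ht
  obtain ⟨VS₀, ES₀, VS₁, ES₁, pS₀, pS₁, rfl, rfl, hSS, hSd⟩ := pS.exists_split hmS
  have hdis := B.disj
  have x0 := pA₀.right_mem
  have x1 := pA₁.left_mem
  have z1 := pA₁.right_mem
  have z2 := pA₂.left_mem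
  have sx := pS₀.left_mem
  have sz := pS₁.right_mem
  have sm := pS₀.right_mem
  subst hVA hEA
  -- From `m` the path `T` can be prolonged along `S` to `x` or to `z`. Applying `odd_of_mixed` to
  -- both connections and adding shows that `S ∪ A₁` is even.
  have u₀ := pS₀.append pT.symm (by grind)
  have u₁ := pS₁.symm.append pT.symm (by grind)
  have k₀ := pS₀.card_append pT.symm (by grind)
  have k₁ := pS₁.symm.card_append pT.symm (by grind)
  have kS := pS₀.card_append pS₁ (by grind)
  have kA := pA₀.card_append pA₁ (by grind)
  have r₀ := F.odd_of_mixed B pA₀ (pA₁.append pA₂ h12) (by grind) (by grind) (by grind)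
    pB₀ pB₁ hVB hEB hB u₀ (by grind) (by grind) (by grind)
  have r₁ := F.odd_of_mixed B (pA₀.append pA₁ h01) pA₂ (by grind) (by grind) (by grind)
    pB₀ pB₁ hVB hEB hB u₁ (by grind) (by grind) (by grind)
  omega

set_option maxHeartbeats 2000000 in
/-- No path to the second path of a bad pair leaves the first one inside an odd ear. -/
lemma false_of_inside (B : G.Bad w M a b c d EP ER VA EA VB EB) {x y z t : α}
    {VA₀ VA₁ VA₂ VA₃ : Finset α} {EA₀ EA₁ EA₂ EA₃ : Finset β}
    (pA₀ : G.IsPath b x VA₀ EA₀) (pA₁ : G.IsPath x y VA₁ EA₁) (pA₂ : G.IsPath y z VA₂ EA₂)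
    (pA₃ : G.IsPath z d VA₃ EA₃)
    (hVA : VA = VA₀ ∪ VA₁ ∪ VA₂ ∪ VA₃) (hEA : EA = EA₀ ∪ EA₁ ∪ EA₂ ∪ EA₃)
    (h01 : ∀ v ∈ VA₀, v ∈ VA₁ → v = x) (h12 : ∀ v ∈ VA₁, v ∈ VA₂ → v = y)
    (h23 : ∀ v ∈ VA₂, v ∈ VA₃ → v = z) (h02 : ∀ v ∈ VA₀, v ∉ VA₂) (h03 : ∀ v ∈ VA₀, v ∉ VA₃)
    (h13 : ∀ v ∈ VA₁, v ∉ VA₃)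
    (pS : G.IsPath x z VS ES) (hS : ES ⊆ M) (hSA : ∀ v ∈ VS, v ∈ VA → v = x ∨ v = z)
    (hSB : ∀ v ∈ VS, v ∉ VB) (hpar : (ES.card + EA₁.card + EA₂.card) % 2 = 1)
    (pT : G.IsPath y t VT ET) (hT : ET ⊆ M) (ht : t ∈ VB) (hTB : ∀ v ∈ VT, v ∈ VB → v = t)
    (hTA : ∀ v ∈ VT, v ∈ VA → v = y) : False := by
  obtain ⟨VB₀, EB₀, VB₁, EB₁, pB₀, pB₁, hVB, hEB, hB, -⟩ := B.pathB.exists_split ht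
  have hdis := B.disj
  have x0 := pA₀.right_mem
  have x1 := pA₁.left_mem
  have y1 := pA₁.right_mem
  have y2 := pA₂.left_mem
  have z2 := pA₂.right_mem
  have z3 := pA₃.left_mem
  have sx := pS.left_mem
  have sz := pS.right_mem
  have ty := pT.left_mem
  have tt := pT.right_mem
  have hxy : x ≠ y := by rintro rfl; grind
  have hyz : y ≠ z := by rintro rfl; grind
  have hxz : x ≠ z := by rintro rfl; grind
  -- If `T` meets `S`, then its part between `B` and the nearest vertex of `S` is excluded by
  -- `false_of_hit`.
  by_cases hST : ∃ v ∈ VT, v ∈ VS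
  · obtain ⟨m, VT₀, ET₀, VT₁, ET₁, hmS, pT₀, pT₁, rfl, rfl, hTT, hTd, hfst⟩ :=
      pT.symm.exists_first hST
    have yT := pT₁.right_mem
    have mT := pT₁.left_mem
    subst hVA hEA
    refine F.false_of_hit B pA₀ (pA₁.append pA₂ h12) pA₃ (by grind) (by grind) (by grind)
      (by grind) (by grind) pS hS (by grind) (by grind) ?_ pT₀ (by grind) ht hmS
      (by grind) (by grind) (by grind) (by grind) hfst
    rw [pA₁.card_append pA₂ h12]; omega
  · push Not at hST
    have tB0 := pB₀.right_mem
    have tB1 := pB₁.left_mem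
    have hyt : y ≠ t := by rintro rfl; grind
    have hxt : x ≠ t := by rintro rfl; grind
    have hzt : z ≠ t := by rintro rfl; grind
    have r₀ := F.odd_of_mixed B (pA₀.append pA₁ h01) (pA₂.append pA₃ h23) (by grind) (by grind)
      (by grind) pB₀ pB₁ hVB hEB hB pT (by grind) (by grind) (by grind)
    rw [pA₀.card_append pA₁ h01] at r₀
    obtain ⟨mA, mA'⟩ := F.meetA B
    obtain ⟨mB, mB'⟩ := F.meetB B
    have hsA := B.subA
    have hsB := B.subB
    have hw := B.weight
    have hev := B.even
    subst hVA hEA hVB hEB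
    have hPR := F.meet
    have b0 := pA₀.left_mem
    have d0 := pA₃.right_mem
    have a0 := pB₀.left_mem
    have c0 := pB₁.right_mem
    have mTP := F.path_meetP pT hT hyt
    have mTR := F.path_meetR pT hT hyt
    have mSP := F.path_meetP pS hS hxz
    have mSR := F.path_meetR pS hS hxz
    have q₁ := pA₃.append F.pathR.symm (by grind)
    have q₂ := q₁.append pB₁.symm (by grind)
    have r₁ := pB₀.symm.append F.pathP (by grind)
    have r₂ := r₁.append pA₀ (by grind)
    have k₁ := pA₃.card_append F.pathR.symm (by grind)
    have k₂ := q₁.card_append pB₁.symm (by grind)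
    have k₃ := pB₀.symm.card_append F.pathP (by grind)
    have k₄ := r₁.card_append pA₀ (by grind)
    have k₅ := pB₀.card_append pB₁ (by grind)
    have k₆ := pA₀.card_append pA₁ h01
    have k₇ := (pA₀.append pA₁ h01).card_append pA₂ (by grind)
    have k₈ := ((pA₀.append pA₁ h01).append pA₂ (by grind)).card_append pA₃ (by grind)
    have g₁ : ∀ v ∈ VA₂, v ∈ VA₃ ∪ VR ∪ VB₁ → v = z := by grind
    have g₂ : ∀ v ∈ VA₃ ∪ VR ∪ VB₁, v ∈ VB₀ ∪ VP ∪ VA₀ → v = t := by grind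
    have g₃ : ∀ v ∈ VB₀ ∪ VP ∪ VA₀, v ∈ VA₁ → v = x := by grind
    have g₄ : ∀ v ∈ VA₁, v ∉ VA₃ ∪ VR ∪ VB₁ := by grind
    have g₅ : ∀ v ∈ VA₂, v ∉ VB₀ ∪ VP ∪ VA₀ := by grind
    have g₆ : ∀ v ∈ VS, v ∈ VA₃ ∪ VR ∪ VB₁ → v = z := by grind
    have g₇ : ∀ v ∈ VS, v ∈ VB₀ ∪ VP ∪ VA₀ → v = x := by grind
    have g₈ : ∀ v ∈ VT, v ∈ VA₃ ∪ VR ∪ VB₁ → v = t := by grind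
    have g₉ : ∀ v ∈ VT, v ∈ VB₀ ∪ VP ∪ VA₀ → v = t := by grind
    -- A subdivided `K₄` on `x`, `y`, `z`, `t` whose rim is the bad circuit, with sides `A₁`, `A₂`,
    -- `A₃RB₁`, `B₀PA₀` and diagonals `S`, `T`. Its triangles are odd by `hpar`, `r₀` and the
    -- evenness of the rim.
    have key := F.k4 hxy hxz hxt hyz hyt hzt pA₁ pA₂ q₂ r₂ pS pT h12 g₁ g₂ g₃ g₄ g₅
      (by grind) (by grind) g₆ g₇ (by grind) (by grind) g₈ g₉ (by grind) (by omega) (by omega)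
      (by omega)
    have he := F.memP
    have hf := F.memR
    have heM := F.notMem_M
    have hfM := F.notMem_M'
    have heR := F.notMem_R
    have hfP := F.notMem_P
    -- the two other circuits
    have s₁ := pS.append q₂ (by grind)
    have s₂ := pA₁.append pT (by grind)
    have s₃ := pS.symm.append r₂.symm (by grind)
    have s₄ := pA₂.symm.append pT (by grind)
    have l₁ := pS.card_append q₂ (by grind)
    have l₂ := pA₁.card_append pT (by grind)
    have l₃ := pS.symm.card_append r₂.symm (by grind)
    have l₄ := pA₂.symm.card_append pT (by grind)
    obtain ⟨_, c₁, n₁⟩ := IsCirc.of_theta s₁ s₂ hxt (by grind) (by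
      intro h
      have := Finset.ext_iff.1 h f₀
      grind)
    obtain ⟨_, c₂, n₂⟩ := IsCirc.of_theta s₃ s₄ hzt (by grind) (by
      intro h
      have := Finset.ext_iff.1 h e₀
      grind)
    have z₁ := F.zero _ _ c₁ (by grind) (by omega) (by grind)
    have z₂ := F.zero _ _ c₂ (by grind) (by omega) (by grind)
    have e₁ : ES ∪ (EA₃ ∪ ER ∪ EB₁) ∪ (EA₁ ∪ ET) = ES ∪ ET ∪ EA₁ ∪ (EA₃ ∪ ER ∪ EB₁) := by grind
    have e₂ : ES ∪ (EB₀ ∪ EP ∪ EA₀) ∪ (EA₂ ∪ ET) = ES ∪ ET ∪ EA₂ ∪ (EB₀ ∪ EP ∪ EA₀) := by grind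
    have e₃ : EA₁ ∪ EA₂ ∪ (EA₃ ∪ ER ∪ EB₁) ∪ (EB₀ ∪ EP ∪ EA₀) =
      EA₀ ∪ EA₁ ∪ EA₂ ∪ EA₃ ∪ (EB₀ ∪ EB₁) ∪ EP ∪ ER := by grind
    rw [e₁] at z₁
    rw [e₂] at z₂
    rw [z₁, z₂, e₃, hw] at key
    exact absurd key (by decide)

end Frame

end Linkage

end Graph

/-! ### Odd ears with connections on both sides -/

namespace Graph

section Linkage

variable {α β : Type*} [DecidableEq α] [DecidableEq β] {G : Graph α β} {w : Finset β → ZMod 2}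
  {M EP ER : Finset β} {VP VR : Finset α} {a b c d : α} {e₀ f₀ : β}

lemma forall_mem_union₂ {α : Type*} [DecidableEq α] {A B C D : Finset α} {p : α → Prop}
    (h : ∀ v ∈ A ∪ B, v ∈ C ∪ D → p v) : (∀ v ∈ A, v ∈ C → p v) ∧ (∀ v ∈ A, v ∈ D → p v) ∧
      (∀ v ∈ B, v ∈ C → p v) ∧ ∀ v ∈ B, v ∈ D → p v :=
  ⟨fun v a c => h v (by simp [a]) (by simp [c]), fun v a c => h v (by simp [a]) (by simp [c]),
    fun v a c => h v (by simp [a]) (by simp [c]), fun v a c => h v (by simp [a]) (by simp [c])⟩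

lemma forall_mem_union₁ {α : Type*} [DecidableEq α] {A B : Finset α} {p : α → Prop}
    (h : ∀ v ∈ A ∪ B, p v) :
    (∀ v ∈ A, p v) ∧ ∀ v ∈ B, p v :=
  ⟨fun v a => h v (by simp [a]), fun v a => h v (by simp [a])⟩

/-- A ring with one arc chosen in each of the three circuits, seen as two paths from `s₁` to `s₃`.
-/
lemma isCirc_ring {s₁ t₁ s₂ t₂ s₃ t₃ : α} {V₁ V₂ V₃ U₁ U₂ U₃ : Finset α}
    {P₁ P₂ P₃ J₁ J₂ J₃ : Finset β} (h₁ : s₁ ≠ t₁) (h₁₃ : s₁ ≠ s₃)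
    (p₁ : G.IsPath s₁ t₁ V₁ P₁) (p₂ : G.IsPath s₂ t₂ V₂ P₂) (p₃ : G.IsPath s₃ t₃ V₃ P₃)
    (j₁ : G.IsPath t₁ s₂ U₁ J₁) (j₂ : G.IsPath t₂ s₃ U₂ J₂) (j₃ : G.IsPath t₃ s₁ U₃ J₃)
    (c₁₂ : ∀ v ∈ V₁, v ∈ V₂ → v = t₁ ∧ v = s₂) (c₂₃ : ∀ v ∈ V₂, v ∈ V₃ → v = t₂ ∧ v = s₃)
    (c₃₁ : ∀ v ∈ V₃, v ∈ V₁ → v = t₃ ∧ v = s₁)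
    (d₁₁ : ∀ v ∈ V₁, v ∈ U₁ → v = t₁) (d₁₃ : ∀ v ∈ V₁, v ∈ U₃ → v = s₁) (d₁₂ : ∀ v ∈ V₁, v ∉ U₂)
    (d₂₂ : ∀ v ∈ V₂, v ∈ U₂ → v = t₂) (d₂₁ : ∀ v ∈ V₂, v ∈ U₁ → v = s₂) (d₂₃ : ∀ v ∈ V₂, v ∉ U₃)
    (d₃₃ : ∀ v ∈ V₃, v ∈ U₃ → v = t₃) (d₃₂ : ∀ v ∈ V₃, v ∈ U₂ → v = s₃) (d₃₁ : ∀ v ∈ V₃, v ∉ U₁)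
    (u₁₂ : ∀ v ∈ U₁, v ∉ U₂) (u₂₃ : ∀ v ∈ U₂, v ∉ U₃) (u₃₁ : ∀ v ∈ U₃, v ∉ U₁) :
    ∃ V, G.IsCirc V (P₁ ∪ P₂ ∪ P₃ ∪ (J₁ ∪ J₂ ∪ J₃)) ∧ (P₁ ∪ P₂ ∪ P₃ ∪ (J₁ ∪ J₂ ∪ J₃)).card =
      P₁.card + P₂.card + P₃.card + J₁.card + J₂.card + J₃.card := by
  have q₁ := p₁.append j₁ d₁₁
  have q₂ := q₁.append p₂ (by grind)
  have q₃ := q₂.append j₂ (by grind)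
  have r := j₃.symm.append p₃.symm (by grind)
  have k₁ := p₁.card_append j₁ d₁₁
  have k₂ := q₁.card_append p₂ (by grind)
  have k₃ := q₂.card_append j₂ (by grind)
  have k₄ := j₃.symm.card_append p₃.symm (by grind)
  obtain ⟨e, he⟩ := p₁.edges_nonempty h₁
  have n₁ := Finset.disjoint_left.1 (p₁.disjoint_edges j₃ (m := s₁) (by grind)) he
  have n₂ := Finset.disjoint_left.1 (p₁.disjoint_edges p₃ (m := s₁) (by grind)) he
  obtain ⟨V, hc, hk⟩ := IsCirc.of_theta q₃ r h₁₃ (by grind) (by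
    intro h
    have := Finset.ext_iff.1 h e
    grind)
  have e₁ : P₁ ∪ J₁ ∪ P₂ ∪ J₂ ∪ (J₃ ∪ P₃) = P₁ ∪ P₂ ∪ P₃ ∪ (J₁ ∪ J₂ ∪ J₃) := by grind
  rw [e₁] at hc hk
  exact ⟨V, hc, by omega⟩

namespace Frame

variable (F : G.Frame w M a b c d VP VR EP ER e₀ f₀) {VA VB VT VS VS₁ VS₂ : Finset α}
  {EA EB ET ES ES₁ ES₂ : Finset β}

include F

/-- An odd ear of the first path of a bad pair meets a path to the second one at most at an end. -/
lemma mem_of_mem_inter (B : G.Bad w M a b c d EP ER VA EA VB EB) {x y z t : α}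
    {VA₀ VA₁ VA₂ : Finset α} {EA₀ EA₁ EA₂ : Finset β}
    (pA₀ : G.IsPath b x VA₀ EA₀) (pA₁ : G.IsPath x z VA₁ EA₁) (pA₂ : G.IsPath z d VA₂ EA₂)
    (hVA : VA = VA₀ ∪ VA₁ ∪ VA₂) (hEA : EA = EA₀ ∪ EA₁ ∪ EA₂) (h01 : ∀ v ∈ VA₀, v ∈ VA₁ → v = x)
    (h12 : ∀ v ∈ VA₁, v ∈ VA₂ → v = z) (h02 : ∀ v ∈ VA₀, v ∉ VA₂)
    (pS : G.IsPath x z VS ES) (hS : ES ⊆ M) (hSA : ∀ v ∈ VS, v ∈ VA → v = x ∨ v = z)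
    (hSB : ∀ v ∈ VS, v ∉ VB) (hpar : (ES.card + EA₁.card) % 2 = 1)
    (pT : G.IsPath y t VT ET) (hT : ET ⊆ M) (ht : t ∈ VB)
    (hTB : ∀ v ∈ VT, v ∈ VB → v = t) (hTA : ∀ v ∈ VT, v ∈ VA → v = y) (hy : y ∈ VA) :
    ∀ v ∈ VS, v ∈ VT → v ∈ VA := by
  intro v hvS hvT
  -- A common vertex outside `A` would be an inner vertex of `S`. The one nearest to `t` along `T`
  -- is excluded by `false_of_hit`.
  by_contra hvA
  obtain ⟨m, VT₀, ET₀, VT₁, ET₁, hmS, pT₀, pT₁, rfl, rfl, hTT, hTd, hfst⟩ :=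
    pT.symm.exists_first (X := VS \ VA) ⟨v, hvT, by grind⟩
  have yT := pT₁.right_mem
  have mT := pT₁.left_mem
  have x0 := pA₀.right_mem
  have z0 := pA₁.right_mem
  refine F.false_of_hit B pA₀ pA₁ pA₂ hVA hEA h01 h12 h02 pS hS hSA hSB hpar pT₀ (by grind) ht
      (by grind) (by grind) (by grind) (by grind) (by grind) (by grind)

set_option maxHeartbeats 2000000 in
-- Here `y₁`, `x`, `z`, `y₂` follow each other on `A`, and `t₁`, `t₂` on `B` in the corresponding
-- order. The odd circuits `B₀PA₀ ∪ S₁`, `A₂ ∪ S` and `A₄RB₂ ∪ S₂` form a ring joined by `A₁`, `A₃`,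
-- `B₁`; the first and the last are odd by `odd_of_mixed`. The bad circuit is one of the four even
-- circuits of the ring. Each of the other three uses `S₁` instead of the arc through `P` or `S₂`
-- instead of the arc through `R`, hence has weight zero, contrary to the relation.
lemma false_of_parallel (B : G.Bad w M a b c d EP ER VA EA VB EB) {x z y₁ y₂ t₁ t₂ : α}
    {VA₀ VA₁ VA₂ VA₃ VA₄ VB₀ VB₁ VB₂ : Finset α} {EA₀ EA₁ EA₂ EA₃ EA₄ EB₀ EB₁ EB₂ : Finset β}
    (pA₀ : G.IsPath b y₁ VA₀ EA₀) (pA₁ : G.IsPath y₁ x VA₁ EA₁) (pA₂ : G.IsPath x z VA₂ EA₂)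
    (pA₃ : G.IsPath z y₂ VA₃ EA₃) (pA₄ : G.IsPath y₂ d VA₄ EA₄)
    (hVA : VA = VA₀ ∪ VA₁ ∪ VA₂ ∪ VA₃ ∪ VA₄) (hEA : EA = EA₀ ∪ EA₁ ∪ EA₂ ∪ EA₃ ∪ EA₄)
    (h01 : ∀ v ∈ VA₀, v ∈ VA₁ → v = y₁) (h012 : ∀ v ∈ VA₀ ∪ VA₁, v ∈ VA₂ → v = x)
    (h34 : ∀ v ∈ VA₃, v ∈ VA₄ → v = y₂) (h234 : ∀ v ∈ VA₂, v ∈ VA₃ ∪ VA₄ → v = z)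
    (hh : ∀ v ∈ VA₀ ∪ VA₁, v ∉ VA₃ ∪ VA₄)
    (pB₀ : G.IsPath a t₁ VB₀ EB₀) (pB₁ : G.IsPath t₁ t₂ VB₁ EB₁) (pB₂ : G.IsPath t₂ c VB₂ EB₂)
    (hVB : VB = VB₀ ∪ VB₁ ∪ VB₂) (hEB : EB = EB₀ ∪ EB₁ ∪ EB₂)
    (g01 : ∀ v ∈ VB₀, v ∈ VB₁ ∪ VB₂ → v = t₁) (g12 : ∀ v ∈ VB₀ ∪ VB₁, v ∈ VB₂ → v = t₂)
    (hxz : x ≠ z) (pS : G.IsPath x z VS ES) (hS : ES ⊆ M)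
    (hSA : ∀ v ∈ VS, v ∈ VA → v = x ∨ v = z)
    (hSB : ∀ v ∈ VS, v ∉ VB) (hpar : (ES.card + EA₂.card) % 2 = 1)
    (pS₁ : G.IsPath y₁ t₁ VS₁ ES₁) (hS₁ : ES₁ ⊆ M) (hS₁A : ∀ v ∈ VS₁, v ∈ VA → v = y₁)
    (hS₁B : ∀ v ∈ VS₁, v ∈ VB → v = t₁)
    (pS₂ : G.IsPath y₂ t₂ VS₂ ES₂) (hS₂ : ES₂ ⊆ M) (hS₂A : ∀ v ∈ VS₂, v ∈ VA → v = y₂)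
    (hS₂B : ∀ v ∈ VS₂, v ∈ VB → v = t₂)
    (hSS₁ : ∀ v ∈ VS, v ∈ VS₁ → v ∈ VA) (hSS₂ : ∀ v ∈ VS, v ∈ VS₂ → v ∈ VA)
    (hS₁₂ : ∀ v ∈ VS₁, v ∈ VS₂ → v ∈ VB) : False := by
  have hdis := B.disj
  have y0 := pA₀.right_mem
  have y1 := pA₁.left_mem
  have x1 := pA₁.right_mem
  have x2 := pA₂.left_mem
  have z2 := pA₂.right_mem
  have z3 := pA₃.left_mem
  have y3 := pA₃.right_mem
  have y4 := pA₄.left_mem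
  have t0 := pB₀.right_mem
  have t1 := pB₁.left_mem
  have t2 := pB₁.right_mem
  have t3 := pB₂.left_mem
  have k₀ := pA₀.card_append pA₁ h01
  have k₁ := (pA₀.append pA₁ h01).card_append pA₂ h012
  have k₂ := ((pA₀.append pA₁ h01).append pA₂ h012).card_append pA₃ (by grind)
  have k₃ := (((pA₀.append pA₁ h01).append pA₂ h012).append pA₃ (by grind)).card_append pA₄
    (by grind)
  have m₁ := pB₀.card_append pB₁ (by grind)
  have m₂ := (pB₀.append pB₁ (by grind)).card_append pB₂ g12
  have a₁₂ := pA₁.append pA₂ (by grind)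
  have a₁₂₃ := a₁₂.append pA₃ (by grind)
  have a₁₂₃₄ := a₁₂₃.append pA₄ (by grind)
  have b₁₂ := pB₁.append pB₂ (by grind)
  have r₁ := F.odd_of_mixed B pA₀ a₁₂₃₄ (by grind) (by grind) (by grind) pB₀ b₁₂ (by grind)
    (by grind) (by grind) pS₁ hS₁ (by grind) (by grind)
  have r₂ := F.odd_of_mixed B (((pA₀.append pA₁ h01).append pA₂ h012).append pA₃ (by grind)) pA₄
    (by grind) (by grind) (by grind) (pB₀.append pB₁ (by grind)) pB₂ (by grind)
    (by grind) (by grind) pS₂ hS₂ (by grind) (by grind)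
  obtain ⟨mA, mA'⟩ := F.meetA B
  obtain ⟨mB, mB'⟩ := F.meetB B
  have hsA := B.subA
  have hsB := B.subB
  have hw := B.weight
  have hev := B.even
  subst hVA hEA hVB hEB
  have hPR := F.meet
  have hAB : ∀ u v, u ∈ VA₀ ∪ VA₁ ∪ VA₂ ∪ VA₃ ∪ VA₄ → v ∈ VB₀ ∪ VB₁ ∪ VB₂ → u ≠ v :=
    fun u v hu hv huv => hdis u hu (huv ▸ hv)
  have n₁ : y₁ ≠ t₁ := hAB _ _ (by simp [y0]) (by simp [t0])
  have n₂ : y₂ ≠ t₂ := hAB _ _ (by simp [y3]) (by simp [t3])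
  have v₁ : x ≠ t₁ := hAB _ _ (by simp [x1]) (by simp [t0])
  have v₂ : z ≠ t₂ := hAB _ _ (by simp [z3]) (by simp [t3])
  have v₃ : z ≠ t₁ := hAB _ _ (by simp [z3]) (by simp [t0])
  have v₄ : x ≠ t₂ := hAB _ _ (by simp [x1]) (by simp [t3])
  have v₅ : y₁ ≠ t₂ := hAB _ _ (by simp [y0]) (by simp [t3])
  have u₁ : t₁ ≠ y₂ := (hAB _ _ (by simp [y3]) (by simp [t0])).symm
  have v₆ : x ≠ y₂ := fun h => hxz (h234 x x2 (by simp [h, y3]))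
  have v₇ : y₁ ≠ z := fun h => hh y₁ (by simp [y0]) (by simp [h, z3])
  have v₈ : y₂ ≠ y₁ := fun h => hh y₁ (by simp [y0]) (by simp [← h, y3])
  have b0 := pA₀.left_mem
  have d0 := pA₄.right_mem
  have a0 := pB₀.left_mem
  have c0 := pB₂.right_mem
  have mTP := F.path_meetP pS₁ hS₁ n₁
  have mTR := F.path_meetR pS₁ hS₁ n₁
  have mUP := F.path_meetP pS₂ hS₂ n₂
  have mUR := F.path_meetR pS₂ hS₂ n₂
  have mSP := F.path_meetP pS hS hxz
  have mSR := F.path_meetR pS hS hxz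
  have p₁ := pB₀.symm.append F.pathP (by grind)
  have p₂ := p₁.append pA₀ (by grind)
  have q₁ := pA₄.append F.pathR.symm (by grind)
  have q₂ := q₁.append pB₂.symm (by grind)
  have l₁ := pB₀.symm.card_append F.pathP (by grind)
  have l₂ := p₁.card_append pA₀ (by grind)
  have l₃ := pA₄.card_append F.pathR.symm (by grind)
  have l₄ := q₁.card_append pB₂.symm (by grind)
  have i₁ : ∀ v ∈ VB₀ ∪ VP ∪ VA₀, v ∈ VS₁ → v = t₁ ∨ v = y₁ := by grind
  have i₂ : ∀ v ∈ VA₂, v ∈ VS → v = x ∨ v = z := by grind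
  have i₃ : ∀ v ∈ VA₄ ∪ VR ∪ VB₂, v ∈ VS₂ → v = y₂ ∨ v = t₂ := by grind
  have i₄ : ∀ v ∈ VB₀ ∪ VP ∪ VA₀ ∪ VS₁, v ∈ VA₂ ∪ VS → v = y₁ ∧ v = x := by grind
  have i₅ : ∀ v ∈ VA₂ ∪ VS, v ∈ VA₄ ∪ VR ∪ VB₂ ∪ VS₂ → v = z ∧ v = y₂ := by grind
  have i₆ : ∀ v ∈ VA₄ ∪ VR ∪ VB₂ ∪ VS₂, v ∈ VB₀ ∪ VP ∪ VA₀ ∪ VS₁ → v = t₂ ∧ v = t₁ := by grind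
  have i₇ : ∀ v ∈ VB₀ ∪ VP ∪ VA₀ ∪ VS₁, v ∈ VA₁ → v = y₁ := by grind
  have i₈ : ∀ v ∈ VB₀ ∪ VP ∪ VA₀ ∪ VS₁, v ∈ VB₁ → v = t₁ := by grind
  have i₉ : ∀ v ∈ VB₀ ∪ VP ∪ VA₀ ∪ VS₁, v ∉ VA₃ := by grind
  have j₁ : ∀ v ∈ VA₂ ∪ VS, v ∈ VA₃ → v = z := by grind
  have j₂ : ∀ v ∈ VA₂ ∪ VS, v ∈ VA₁ → v = x := by grind
  have j₃ : ∀ v ∈ VA₂ ∪ VS, v ∉ VB₁ := by grind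
  have j₄ : ∀ v ∈ VA₄ ∪ VR ∪ VB₂ ∪ VS₂, v ∈ VB₁ → v = t₂ := by grind
  have j₅ : ∀ v ∈ VA₄ ∪ VR ∪ VB₂ ∪ VS₂, v ∈ VA₃ → v = y₂ := by grind
  have j₆ : ∀ v ∈ VA₄ ∪ VR ∪ VB₂ ∪ VS₂, v ∉ VA₁ := by grind
  have j₇ : ∀ v ∈ VA₁, v ∉ VA₃ := by grind
  have j₈ : ∀ v ∈ VA₃, v ∉ VB₁ := by grind
  have j₉ : ∀ v ∈ VB₁, v ∉ VA₁ := by grind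
  have key := F.delta n₁.symm hxz n₂ v₁.symm u₁ v₆ v₇ v₅ v₂ v₃.symm v₄ v₈ p₂ pS₁.symm pA₂ pS q₂ pS₂ pA₁ pA₃ pB₁.symm i₁ i₂ i₃ i₄ i₅ i₆
    i₇ i₈ i₉ j₁ j₂ j₃ j₄ j₅ j₆ j₇ j₈ j₉ (by omega) (by omega) (by omega) (by omega)
  obtain ⟨i₄a, i₄b, i₄c, i₄d⟩ := forall_mem_union₂ i₄
  obtain ⟨i₅a, i₅b, i₅c, i₅d⟩ := forall_mem_union₂ i₅
  obtain ⟨i₆a, i₆b, i₆c, i₆d⟩ := forall_mem_union₂ i₆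
  replace i₇ := forall_mem_union₁ i₇
  replace i₈ := forall_mem_union₁ i₈
  replace i₉ := forall_mem_union₁ i₉
  replace j₁ := forall_mem_union₁ j₁
  replace j₂ := forall_mem_union₁ j₂
  replace j₃ := forall_mem_union₁ j₃
  replace j₄ := forall_mem_union₁ j₄
  replace j₅ := forall_mem_union₁ j₅
  replace j₆ := forall_mem_union₁ j₆
  obtain ⟨_, c₁, o₁⟩ := isCirc_ring n₁.symm u₁ p₂ pS pS₂ pA₁ pA₃ pB₁.symm i₄b i₅d i₆c
    i₇.1 i₈.1 i₉.1 j₁.2 j₂.2 j₃.2 j₄.2 j₅.2 j₆.2 j₇ j₈ j₉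
  obtain ⟨_, c₂, o₂⟩ := isCirc_ring n₁.symm u₁ pS₁.symm pA₂ pS₂ pA₁ pA₃ pB₁.symm i₄c i₅b i₆d
    i₇.2 i₈.2 i₉.2 j₁.1 j₂.1 j₃.1 j₄.2 j₅.2 j₆.2 j₇ j₈ j₉
  obtain ⟨_, c₃, o₃⟩ := isCirc_ring n₁.symm u₁ pS₁.symm pS q₂ pA₁ pA₃ pB₁.symm i₄d i₅c i₆b
    i₇.2 i₈.2 i₉.2 j₁.2 j₂.2 j₃.2 j₄.1 j₅.1 j₆.1 j₇ j₈ j₉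
  have hM : ES₁ ∪ EA₂ ∪ ES₂ ∪ (EA₁ ∪ EA₃ ∪ EB₁) ⊆ M := by
    simp only [Finset.union_subset_iff] at hsA hsB ⊢
    exact ⟨⟨⟨hS₁, hsA.1.1.2⟩, hS₂⟩, ⟨hsA.1.1.1.2, hsA.1.2⟩, hsB.1.2⟩
  have heM := F.notMem_M
  have hfM := F.notMem_M'
  have heR := F.notMem_R
  have hfP := F.notMem_P
  rw [F.zero _ _ c₁ (by clear * - hsA hsB hS hS₁ hS₂; grind) (by omega)
      (by clear * - hsA hsB hS hS₁ hS₂ heM hfM heR hfP; grind),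
    F.zero _ _ c₂ (hM.trans (Finset.subset_union_left.trans Finset.subset_union_left)) (by omega)
      (.inl fun h => heM (hM h)),
    F.zero _ _ c₃ (by clear * - hsA hsB hS hS₁ hS₂; grind) (by omega)
      (by clear * - hsA hsB hS hS₁ hS₂ heM hfM heR hfP; grind)] at key
  have e₁ : EB₀ ∪ EP ∪ EA₀ ∪ EA₂ ∪ (EA₄ ∪ ER ∪ EB₂) ∪ (EA₁ ∪ EA₃ ∪ EB₁) =
      EA₀ ∪ EA₁ ∪ EA₂ ∪ EA₃ ∪ EA₄ ∪ (EB₀ ∪ EB₁ ∪ EB₂) ∪ EP ∪ ER := by clear * -; grind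
  rw [e₁, hw] at key
  exact absurd key (by decide)

end Frame

end Linkage

end Graph

namespace Graph

section Linkage

variable {α β : Type*} [DecidableEq α] [DecidableEq β] {G : Graph α β} {w : Finset β → ZMod 2}
  {M EP ER : Finset β} {VP VR : Finset α} {a b c d : α} {e₀ f₀ : β}

namespace Frame

variable (F : G.Frame w M a b c d VP VR EP ER e₀ f₀) {VA VB VT VS VS₁ VS₂ VU : Finset α}
  {EA EB ET ES ES₁ ES₂ EU : Finset β}

include F

set_option maxHeartbeats 2000000 in
/-- Two crossing paths between the two paths of a bad pair exclude an odd ear between them. -/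
lemma false_of_cross (B : G.Bad w M a b c d EP ER VA EA VB EB) {y₁ y₂ t₁ t₂ : α}
    {VA₀ VA₁ VA₂ VB₀ VB₁ VB₂ : Finset α} {EA₀ EA₁ EA₂ EB₀ EB₁ EB₂ : Finset β}
    (pA₀ : G.IsPath b y₁ VA₀ EA₀) (pA₁ : G.IsPath y₁ y₂ VA₁ EA₁) (pA₂ : G.IsPath y₂ d VA₂ EA₂)
    (hVA : VA = VA₀ ∪ VA₁ ∪ VA₂) (hEA : EA = EA₀ ∪ EA₁ ∪ EA₂)
    (h01 : ∀ v ∈ VA₀, v ∈ VA₁ → v = y₁) (h12 : ∀ v ∈ VA₁, v ∈ VA₂ → v = y₂)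
    (h02 : ∀ v ∈ VA₀, v ∉ VA₂)
    (pB₀ : G.IsPath a t₂ VB₀ EB₀) (pB₁ : G.IsPath t₂ t₁ VB₁ EB₁) (pB₂ : G.IsPath t₁ c VB₂ EB₂)
    (hVB : VB = VB₀ ∪ VB₁ ∪ VB₂) (hEB : EB = EB₀ ∪ EB₁ ∪ EB₂)
    (g01 : ∀ v ∈ VB₀, v ∈ VB₁ → v = t₂) (g12 : ∀ v ∈ VB₁, v ∈ VB₂ → v = t₁)
    (g02 : ∀ v ∈ VB₀, v ∉ VB₂)
    (pU : G.IsPath y₁ y₂ VU EU) (hU : EU ⊆ M)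
    (hUA : ∀ v ∈ VU, v ∈ VA → v ∈ VA₁) (hUB : ∀ v ∈ VU, v ∉ VB)
    (hpar : (EU.card + EA₁.card) % 2 = 1)
    (pS₁ : G.IsPath y₁ t₁ VS₁ ES₁) (hS₁ : ES₁ ⊆ M) (hS₁A : ∀ v ∈ VS₁, v ∈ VA → v = y₁)
    (hS₁B : ∀ v ∈ VS₁, v ∈ VB → v = t₁)
    (pS₂ : G.IsPath y₂ t₂ VS₂ ES₂) (hS₂ : ES₂ ⊆ M) (hS₂A : ∀ v ∈ VS₂, v ∈ VA → v = y₂)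
    (hS₂B : ∀ v ∈ VS₂, v ∈ VB → v = t₂)
    (hUS₁ : ∀ v ∈ VU, v ∈ VS₁ → v = y₁) (hUS₂ : ∀ v ∈ VU, v ∈ VS₂ → v = y₂)
    (hS₁₂ : ∀ v ∈ VS₁, v ∉ VS₂) : False := by
  have hdis := B.disj
  have y0 := pA₀.right_mem
  have y1 := pA₁.left_mem
  have y3 := pA₁.right_mem
  have y4 := pA₂.left_mem
  have t0 := pB₀.right_mem
  have t1 := pB₁.left_mem
  have t2 := pB₁.right_mem
  have t3 := pB₂.left_mem
  have k₀ := pA₀.card_append pA₁ h01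
  have k₁ := (pA₀.append pA₁ h01).card_append pA₂ (by grind)
  have m₁ := pB₀.card_append pB₁ (by grind)
  have m₂ := (pB₀.append pB₁ (by grind)).card_append pB₂ (by grind)
  have r₁ := F.odd_of_mixed B pA₀ (pA₁.append pA₂ h12) (by grind) (by grind) (by grind)
    (pB₀.append pB₁ g01) pB₂ (by grind) (by grind) (by grind) pS₁ hS₁ (by grind) (by grind)
  have r₂ := F.odd_of_mixed B (pA₀.append pA₁ h01) pA₂
    (by grind) (by grind) (by grind) pB₀ (pB₁.append pB₂ g12) (by grind)
    (by grind) (by grind) pS₂ hS₂ (by grind) (by grind)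
  obtain ⟨mA, mA'⟩ := F.meetA B
  obtain ⟨mB, mB'⟩ := F.meetB B
  have hsA := B.subA
  have hsB := B.subB
  have hw := B.weight
  have hev := B.even
  subst hVA hEA hVB hEB
  have hPR := F.meet
  have hAB : ∀ u v, u ∈ VA₀ ∪ VA₁ ∪ VA₂ → v ∈ VB₀ ∪ VB₁ ∪ VB₂ → u ≠ v :=
    fun u v hu hv huv => hdis u hu (huv ▸ hv)
  have n₁ : y₁ ≠ t₁ := hAB _ _ (by simp [y0]) (by simp [t2])
  have n₂ : y₂ ≠ t₂ := hAB _ _ (by simp [y3]) (by simp [t0])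
  have n₃ : y₁ ≠ t₂ := hAB _ _ (by simp [y0]) (by simp [t0])
  have n₄ : y₂ ≠ t₁ := hAB _ _ (by simp [y3]) (by simp [t3])
  have n₅ : y₁ ≠ y₂ := fun h => h02 y₁ y0 (h ▸ y4)
  have n₆ : t₁ ≠ t₂ := fun h => g02 t₂ t0 (h ▸ t3)
  have b0 := pA₀.left_mem
  have d0 := pA₂.right_mem
  have a0 := pB₀.left_mem
  have c0 := pB₂.right_mem
  have mTP := F.path_meetP pS₁ hS₁ n₁
  have mTR := F.path_meetR pS₁ hS₁ n₁
  have mUP := F.path_meetP pS₂ hS₂ n₂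
  have mUR := F.path_meetR pS₂ hS₂ n₂
  have mSP := F.path_meetP pU hU n₅
  have mSR := F.path_meetR pU hU n₅
  have p₁ := pB₀.symm.append F.pathP (by grind)
  have p₂ := p₁.append pA₀ (by grind)
  have q₁ := pA₂.append F.pathR.symm (by grind)
  have q₂ := q₁.append pB₂.symm (by grind)
  have l₁ := pB₀.symm.card_append F.pathP (by grind)
  have l₂ := p₁.card_append pA₀ (by grind)
  have l₃ := pA₂.card_append F.pathR.symm (by grind)
  have l₄ := q₁.card_append pB₂.symm (by grind)
  have heM := F.notMem_M
  have hfM := F.notMem_M'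
  have heR := F.notMem_R
  have hfP := F.notMem_P
  have he := F.memP
  have hf := F.memR
  have i₁ : ∀ v ∈ VB₀ ∪ VP ∪ VA₀, v ∉ VA₂ ∪ VR ∪ VB₂ := by grind
  have i₂ : ∀ v ∈ VS₁, v ∈ VB₀ ∪ VP ∪ VA₀ → v = y₁ := by grind
  have i₃ : ∀ v ∈ VS₁, v ∈ VA₂ ∪ VR ∪ VB₂ → v = t₁ := by grind
  have i₄ : ∀ v ∈ VS₂, v ∈ VB₀ ∪ VP ∪ VA₀ → v = t₂ := by grind
  have i₅ : ∀ v ∈ VS₂, v ∈ VA₂ ∪ VR ∪ VB₂ → v = y₂ := by grind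
  have i₆ : ∀ v ∈ VB₁, v ∈ VB₀ ∪ VP ∪ VA₀ → v = t₂ := by grind
  have i₇ : ∀ v ∈ VA₂ ∪ VR ∪ VB₂, v ∈ VB₁ → v = t₁ := by grind
  have i₈ : ∀ v ∈ VB₀ ∪ VP ∪ VA₀, v ∈ VA₁ → v = y₁ := by grind
  have i₉ : ∀ v ∈ VA₁, v ∈ VA₂ ∪ VR ∪ VB₂ → v = y₂ := by grind
  have j₈ : ∀ v ∈ VB₀ ∪ VP ∪ VA₀, v ∈ VU → v = y₁ := by grind
  have j₉ : ∀ v ∈ VU, v ∈ VA₂ ∪ VR ∪ VB₂ → v = y₂ := by grind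
  -- A subdivided `K₄` on `y₁`, `y₂`, `t₁`, `t₂` whose rim is the bad circuit and whose diagonals
  -- are `S₁` and `S₂`. The even circuit through the diagonals, `A₁` and `B₁` lies in `M`, so the
  -- remaining one, through `P` and `R`, has weight one.
  have key := F.k4 n₅ n₁ n₃ n₄ n₂ n₆ pA₁ q₂ pB₁.symm p₂ pS₁ pS₂ i₉ i₇ i₆ i₈ (by grind)
    (fun v h h' => i₁ v h' h) (by grind) i₃ (by grind) i₂ (by grind) i₅ (by grind) i₄ hS₁₂
    (by omega) (by omega) (by omega)
  have e₁ : EA₁ ∪ (EA₂ ∪ ER ∪ EB₂) ∪ EB₁ ∪ (EB₀ ∪ EP ∪ EA₀) =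
      EA₀ ∪ EA₁ ∪ EA₂ ∪ (EB₀ ∪ EB₁ ∪ EB₂) ∪ EP ∪ ER := by grind
  rw [e₁, hw] at key
  have s₁ := pS₁.append pB₁.symm (by grind)
  have s₂ := pA₁.append pS₂ (by grind)
  have l₅ := pS₁.card_append pB₁.symm (by grind)
  have l₆ := pA₁.card_append pS₂ (by grind)
  obtain ⟨_, c₁, o₁⟩ := IsCirc.of_theta s₁ s₂ n₃ (by grind) (by
    obtain ⟨e, he⟩ := pS₁.edges_nonempty n₁
    have := Finset.disjoint_left.1 (pS₁.disjoint_edges pA₁ (m := y₁) (by grind)) he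
    have := Finset.disjoint_left.1 (pS₁.disjoint_edges pS₂ (m := y₁) (by grind)) he
    intro h
    have := Finset.ext_iff.1 h e
    grind)
  have e₂ : ES₁ ∪ EB₁ ∪ (EA₁ ∪ ES₂) = ES₁ ∪ ES₂ ∪ EA₁ ∪ EB₁ := by grind
  have z₁ := F.zero _ _ c₁ (by grind) (by omega) (by grind)
  rw [e₂] at z₁
  rw [z₁] at key
  -- the arcs of the circuit of weight one, and a third path of the right parity
  have u₁ := p₂.symm.append pS₂.symm (by grind)
  have u₂ := pS₁.append q₂.symm (by grind)
  have l₇ := p₂.symm.card_append pS₂.symm (by grind)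
  have l₈ := pS₁.card_append q₂.symm (by grind)
  have f₁ : ∀ v ∈ VB₀ ∪ VP ∪ VA₀ ∪ VS₂, v ∈ VS₁ ∪ (VA₂ ∪ VR ∪ VB₂) → v = y₁ ∨ v = y₂ := by grind
  have f₂ : EB₀ ∪ EP ∪ EA₀ ∪ ES₂ ≠ ES₁ ∪ (EA₂ ∪ ER ∪ EB₂) := by
    intro h
    have := Finset.ext_iff.1 h e₀
    grind
  have e₃ : EB₀ ∪ EP ∪ EA₀ ∪ ES₂ ∪ (ES₁ ∪ (EA₂ ∪ ER ∪ EB₂)) =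
      ES₁ ∪ ES₂ ∪ (EA₂ ∪ ER ∪ EB₂) ∪ (EB₀ ∪ EP ∪ EA₀) := by grind
  have fin : ∀ VX EX, G.IsPath y₁ y₂ VX EX → EX ⊆ M →
      (∀ v ∈ VB₀ ∪ VP ∪ VA₀ ∪ VS₂, v ∈ VX → v = y₁ ∨ v = y₂) →
      (∀ v ∈ VS₁ ∪ (VA₂ ∪ VR ∪ VB₂), v ∈ VX → v = y₁ ∨ v = y₂) →
      ((EB₀ ∪ EP ∪ EA₀ ∪ ES₂).card + EX.card) % 2 = 0 → False := by
    intro VX EX pX hX x₁ x₂ hp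
    have f₃ : EB₀ ∪ EP ∪ EA₀ ∪ ES₂ ≠ EX := by rintro rfl; grind
    have f₄ : ES₁ ∪ (EA₂ ∪ ER ∪ EB₂) ≠ EX := by rintro rfl; grind
    have key' := F.theta n₅ u₁ u₂ pX f₁ x₁ x₂ f₂ f₃ f₄ (by omega) hp
    obtain ⟨_, c₃, o₃⟩ := IsCirc.of_theta u₁ pX n₅ x₁ f₃
    obtain ⟨_, c₄, o₄⟩ := IsCirc.of_theta u₂ pX n₅ x₂ f₄
    rw [F.zero _ _ c₃ (by grind) (by omega) (by grind),
      F.zero _ _ c₄ (by grind) (by omega) (by grind), e₃] at key'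
    generalize w (ES₁ ∪ ES₂ ∪ (EA₂ ∪ ER ∪ EB₂) ∪ (EB₀ ∪ EP ∪ EA₀)) = q at key key'
    revert key key'; revert q; decide
  have o := fin _ _ pA₁ (by grind) (by grind) (by grind)
  have o' := fin _ _ pU hU (by grind) (by grind)
  -- `A₁` and `U` have different parities, so one of them forms a theta graph with even circuits
  -- only with the two arcs from `y₁` to `y₂`.
  by_cases hp : ((EB₀ ∪ EP ∪ EA₀ ∪ ES₂).card + EA₁.card) % 2 = 0
  · exact o hp
  · exact o' (by omega)

end Frame

end Linkage

end Graph

namespace Graph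

section Linkage

variable {α β : Type*} [DecidableEq α] [DecidableEq β] {G : Graph α β} {w : Finset β → ZMod 2}
  {M EP ER : Finset β} {VP VR : Finset α} {a b c d : α} {e₀ f₀ : β}

namespace Frame

variable (F : G.Frame w M a b c d VP VR EP ER e₀ f₀) {VA VB VT VS VS₁ VS₂ VU : Finset α}
  {EA EB ET ES ES₁ ES₂ EU : Finset β}

include F

/-- Two paths between the paths of a bad pair, one on each side of an odd ear, do not meet
outside the second path. -/
lemma false_of_join (B : G.Bad w M a b c d EP ER VA EA VB EB) {y₁ y₂ t₁ t₂ m : α}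
    {VA₀ VA₁ VA₂ : Finset α} {EA₀ EA₁ EA₂ : Finset β}
    (pA₀ : G.IsPath b y₁ VA₀ EA₀) (pA₁ : G.IsPath y₁ y₂ VA₁ EA₁) (pA₂ : G.IsPath y₂ d VA₂ EA₂)
    (hVA : VA = VA₀ ∪ VA₁ ∪ VA₂) (hEA : EA = EA₀ ∪ EA₁ ∪ EA₂)
    (h01 : ∀ v ∈ VA₀, v ∈ VA₁ → v = y₁) (h12 : ∀ v ∈ VA₁, v ∈ VA₂ → v = y₂)
    (h02 : ∀ v ∈ VA₀, v ∉ VA₂)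
    (pU : G.IsPath y₁ y₂ VU EU) (hU : EU ⊆ M)
    (hUA : ∀ v ∈ VU, v ∈ VA → v ∈ VA₁) (hUB : ∀ v ∈ VU, v ∉ VB)
    (hpar : (EU.card + EA₁.card) % 2 = 1)
    (pS₁ : G.IsPath y₁ t₁ VS₁ ES₁) (hS₁ : ES₁ ⊆ M) (hS₁A : ∀ v ∈ VS₁, v ∈ VA → v = y₁)
    (hS₁B : ∀ v ∈ VS₁, v ∈ VB → v = t₁) (ht₁ : t₁ ∈ VB)
    (pS₂ : G.IsPath y₂ t₂ VS₂ ES₂) (hS₂ : ES₂ ⊆ M) (hS₂A : ∀ v ∈ VS₂, v ∈ VA → v = y₂)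
    (hS₂B : ∀ v ∈ VS₂, v ∈ VB → v = t₂) (ht₂ : t₂ ∈ VB)
    (hUS₁ : ∀ v ∈ VU, v ∈ VS₁ → v = y₁) (hUS₂ : ∀ v ∈ VU, v ∈ VS₂ → v = y₂)
    (hm : m ∈ VS₁) (hm' : m ∈ VS₂) (hmB : m ∉ VB) : False := by
  have hdis := B.disj
  have y0 := pA₀.right_mem
  have y1 := pA₁.left_mem
  have y3 := pA₁.right_mem
  have y4 := pA₂.left_mem
  have n₅ : y₁ ≠ y₂ := fun h => h02 y₁ y0 (h ▸ y4)
  -- `n` is the first vertex of `S₁` on `S₂`. Since `S₁` meets `B` only at its end and also meets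
  -- `S₂` outside `B`, `n` is not on `B`.
  obtain ⟨n, VX₀, EX₀, VX₁, EX₁, hn, pX₀, pX₁, hVX, hEX, hX, -, hXf⟩ :=
    pS₁.exists_first (X := VS₂) ⟨m, hm, hm'⟩
  have hnB : n ∉ VB := by
    intro hnB
    have h1 := hS₁B n (by rw [hVX]; simp [pX₀.right_mem]) hnB
    subst h1
    have := (pX₁.eq_singleton.1)
    grind
  obtain ⟨VY₀, EY₀, VY₁, EY₁, pY₀, pY₁, hVY, hEY, hY, -⟩ := pS₂.exists_split hn
  obtain ⟨VB₀, EB₀, VB₁, EB₁, pB₀, pB₁, hVB, hEB, hB, -⟩ := B.pathB.exists_split ht₂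
  have x0 := pX₀.left_mem
  have x1 := pX₀.right_mem
  have x2 := pX₁.left_mem
  have x3 := pY₀.left_mem
  have x4 := pY₀.right_mem
  have x5 := pY₁.left_mem
  have x6 := pY₁.right_mem
  have x7 := pX₁.right_mem
  have x8 : n ≠ y₁ := by rintro rfl; grind
  have x9 : n ≠ y₂ := by rintro rfl; grind
  have x10 : ∀ v ∈ VX₀, v ∉ VB := by grind
  have k₀ := pA₀.card_append pA₁ h01
  subst hVX hEX hVY hEY
  have s := pX₀.append pY₁ (by grind)
  have l := pX₀.card_append pY₁ (by grind)
  have l' := pY₀.card_append pY₁ (by grind)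
  have r₁ := F.odd_of_mixed B pA₀ (pA₁.append pA₂ h12) (by grind) (by grind) (by grind)
    pB₀ pB₁ hVB hEB hB s (by grind) (by grind) (by grind)
  have r₂ := F.odd_of_mixed B (pA₀.append pA₁ h01) pA₂
    (by grind) (by grind) (by grind) pB₀ pB₁ hVB hEB hB pS₂ hS₂ (by grind) (by grind)
  have u := pX₀.append pY₀.symm (by grind)
  have o := pX₀.card_append pY₀.symm (by grind)
  -- Both `y₁` and `y₂` are connected to `t₂` through `n`, so by `odd_of_mixed` the ear `y₁ n y₂` is
  -- even and may replace `A₁`. Then `U` is an odd ear of the new path, over a segment with the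
  -- inner vertex `n`, from which `Y₁` leads to `B`.
  have B' := F.reroute B pA₀ pA₁ pA₂ hVA hEA h01 h12 h02 n₅ u (by grind) (by grind) (by grind)
    (by omega)
  exact F.false_of_inside B' pA₀ pX₀ pY₀.symm pA₂ (by grind) (by grind) (by grind) (by grind)
    (by grind) (by grind) h02 (by grind) pU hU (by grind) (by grind) (by omega) pY₁ (by grind) ht₂
    (by grind) (by grind)

/-- An odd ear of the first path of a bad pair separates it from the second one on one side. -/
lemma false_of_both (B : G.Bad w M a b c d EP ER VA EA VB EB) {x z y₁ y₂ t₁ t₂ : α}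
    {VA₀ VA₁ VA₂ VA₃ VA₄ : Finset α} {EA₀ EA₁ EA₂ EA₃ EA₄ : Finset β}
    (pA₀ : G.IsPath b y₁ VA₀ EA₀) (pA₁ : G.IsPath y₁ x VA₁ EA₁) (pA₂ : G.IsPath x z VA₂ EA₂)
    (pA₃ : G.IsPath z y₂ VA₃ EA₃) (pA₄ : G.IsPath y₂ d VA₄ EA₄)
    (hVA : VA = VA₀ ∪ VA₁ ∪ VA₂ ∪ VA₃ ∪ VA₄) (hEA : EA = EA₀ ∪ EA₁ ∪ EA₂ ∪ EA₃ ∪ EA₄)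
    (h01 : ∀ v ∈ VA₀, v ∈ VA₁ → v = y₁) (h012 : ∀ v ∈ VA₀ ∪ VA₁, v ∈ VA₂ → v = x)
    (h34 : ∀ v ∈ VA₃, v ∈ VA₄ → v = y₂) (h234 : ∀ v ∈ VA₂, v ∈ VA₃ ∪ VA₄ → v = z)
    (hh : ∀ v ∈ VA₀ ∪ VA₁, v ∉ VA₃ ∪ VA₄)
    (hxz : x ≠ z) (pS : G.IsPath x z VS ES) (hS : ES ⊆ M)
    (hSA : ∀ v ∈ VS, v ∈ VA → v = x ∨ v = z)
    (hSB : ∀ v ∈ VS, v ∉ VB) (hpar : (ES.card + EA₂.card) % 2 = 1)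
    (pS₁ : G.IsPath y₁ t₁ VS₁ ES₁) (hS₁ : ES₁ ⊆ M) (hS₁A : ∀ v ∈ VS₁, v ∈ VA → v = y₁)
    (hS₁B : ∀ v ∈ VS₁, v ∈ VB → v = t₁) (ht₁ : t₁ ∈ VB)
    (pS₂ : G.IsPath y₂ t₂ VS₂ ES₂) (hS₂ : ES₂ ⊆ M) (hS₂A : ∀ v ∈ VS₂, v ∈ VA → v = y₂)
    (hS₂B : ∀ v ∈ VS₂, v ∈ VB → v = t₂) (ht₂ : t₂ ∈ VB) : False := by
  have hdis := B.disj
  have h04 : ∀ v ∈ VA₀, v ∉ VA₄ := fun v h h' => hh v (by simp [h]) (by simp [h'])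
  have h03 : ∀ v ∈ VA₀, v ∉ VA₃ := fun v h h' => hh v (by simp [h]) (by simp [h'])
  have h14 : ∀ v ∈ VA₁, v ∉ VA₄ := fun v h h' => hh v (by simp [h]) (by simp [h'])
  have h13 : ∀ v ∈ VA₁, v ∉ VA₃ := fun v h h' => hh v (by simp [h]) (by simp [h'])
  have y0 := pA₀.right_mem
  have y1 := pA₁.left_mem
  have x1 := pA₁.right_mem
  have x2 := pA₂.left_mem
  have z2 := pA₂.right_mem
  have z3 := pA₃.left_mem
  have y3 := pA₃.right_mem
  have y4 := pA₄.left_mem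
  have sx := pS.left_mem
  have sz := pS.right_mem
  have hSS₁ : ∀ v ∈ VS, v ∈ VS₁ → v ∈ VA :=
    F.mem_of_mem_inter B (pA₀.append pA₁ h01) pA₂ (pA₃.append pA₄ h34) (by grind) (by grind)
      h012 h234 hh pS hS hSA hSB hpar pS₁ hS₁ ht₁ hS₁B hS₁A (by grind)
  have hSS₂ : ∀ v ∈ VS, v ∈ VS₂ → v ∈ VA :=
    F.mem_of_mem_inter B (pA₀.append pA₁ h01) pA₂ (pA₃.append pA₄ h34) (by grind) (by grind)
      h012 h234 hh pS hS hSA hSB hpar pS₂ hS₂ ht₂ hS₂B hS₂A (by grind)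
  have a₁₂ := pA₁.append pA₂ (by grind)
  have a₁₂₃ := a₁₂.append pA₃ (by grind)
  have k₁ := pA₁.card_append pA₂ (by grind)
  have k₂ := a₁₂.card_append pA₃ (by grind)
  -- Prolonged by `A₁` and `A₃`, the odd ear becomes a path from `y₁` to `y₂` whose parity differs
  -- from that of the segment of `A` between them.
  have u₁ := pA₁.append pS (by grind)
  have u := u₁.append pA₃ (by grind)
  have l₁ := pA₁.card_append pS (by grind)
  have l₂ := u₁.card_append pA₃ (by grind)
  have huM : EA₁ ∪ ES ∪ EA₃ ⊆ M := by
    have hsA := B.subA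
    simp only [hEA, Finset.union_subset_iff] at hsA ⊢
    tauto
  by_cases hm : ∃ m ∈ VS₁, m ∈ VS₂ ∧ m ∉ VB
  · obtain ⟨m, hm, hm', hmB⟩ := hm
    exact F.false_of_join B pA₀ a₁₂₃ pA₄ (by grind) (by grind) (by grind) (by grind) (by grind)
      u huM (by grind) (by grind) (by omega) pS₁ hS₁ hS₁A hS₁B ht₁ pS₂ hS₂ hS₂A hS₂B ht₂
      (by grind) (by grind) hm hm' hmB
  push Not at hm
  obtain ⟨VB₀, EB₀, VB₁, EB₁, pB₀, pB₁, hVB, hEB, hB, -⟩ := B.pathB.exists_split ht₁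
  have tB := pB₀.right_mem
  -- The order of `t₁` and `t₂` on `B` decides whether the two connections are parallel or cross. If
  -- `t₁ = t₂`, they count as parallel and the joining path on `B` is trivial.
  by_cases ht : t₂ ∈ VB₁
  · obtain ⟨VC₀, EC₀, VC₁, EC₁, pC₀, pC₁, hVC, hEC, hC, -⟩ := pB₁.exists_split ht
    have := pC₀.left_mem
    exact F.false_of_parallel B pA₀ pA₁ pA₂ pA₃ pA₄ hVA hEA h01 h012 h34 h234 hh pB₀ pC₀ pC₁
      (by grind) (by grind) (by grind) (by grind) hxz pS hS hSA hSB hpar pS₁ hS₁ hS₁A hS₁B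
      pS₂ hS₂ hS₂A hS₂B hSS₁ hSS₂ hm
  · obtain ⟨VC₀, EC₀, VC₁, EC₁, pC₀, pC₁, hVC, hEC, hC, -⟩ := pB₀.exists_split
      (by grind : t₂ ∈ VB₀)
    have := pC₁.right_mem
    have := pC₀.right_mem
    have := pB₁.left_mem
    exact F.false_of_cross B pA₀ a₁₂₃ pA₄ (by grind) (by grind) (by grind) (by grind) (by grind)
      pC₀ pC₁ pB₁ (by grind) (by grind) (by grind) (by grind) (by grind) u huM (by grind)
      (by grind) (by omega) pS₁ hS₁ hS₁A hS₁B pS₂ hS₂ hS₂A hS₂B (by grind) (by grind) (by grind)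

end Frame

end Linkage

end Graph

/-! ### Odd ears with a connection on one side -/

namespace Graph

section Linkage

variable {α β : Type*} [DecidableEq α] [DecidableEq β] {G : Graph α β} {w : Finset β → ZMod 2}
  {M EP ER : Finset β} {VP VR : Finset α} {a b c d : α} {e₀ f₀ : β}

namespace Frame

variable (F : G.Frame w M a b c d VP VR EP ER e₀ f₀) {VA VB VT VS VS₁ VS₂ VU : Finset α}
  {EA EB ET ES ES₁ ES₂ EU : Finset β}

include F

/-- Paths from two vertices of the first path of a bad pair to the same vertex of the second. -/
lemma even_of_two_mixed (B : G.Bad w M a b c d EP ER VA EA VB EB) {m z t : α}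
    {VA₀ VA₁ VA₂ : Finset α} {EA₀ EA₁ EA₂ : Finset β}
    (pA₀ : G.IsPath b m VA₀ EA₀) (pA₁ : G.IsPath m z VA₁ EA₁) (pA₂ : G.IsPath z d VA₂ EA₂)
    (hVA : VA = VA₀ ∪ VA₁ ∪ VA₂) (hEA : EA = EA₀ ∪ EA₁ ∪ EA₂)
    (h01 : ∀ v ∈ VA₀, v ∈ VA₁ → v = m) (h012 : ∀ v ∈ VA₀ ∪ VA₁, v ∈ VA₂ → v = z)
    (h02 : ∀ v ∈ VA₀, v ∈ VA₁ ∪ VA₂ → v = m)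
    (ht : t ∈ VB)
    (pS₁ : G.IsPath m t VS₁ ES₁) (hS₁ : ES₁ ⊆ M) (hS₁A : ∀ v ∈ VS₁, v ∈ VA → v = m)
    (hS₁B : ∀ v ∈ VS₁, v ∈ VB → v = t)
    (pS₂ : G.IsPath z t VS₂ ES₂) (hS₂ : ES₂ ⊆ M) (hS₂A : ∀ v ∈ VS₂, v ∈ VA → v = z)
    (hS₂B : ∀ v ∈ VS₂, v ∈ VB → v = t) : (ES₁.card + ES₂.card + EA₁.card) % 2 = 0 := by
  obtain ⟨VB₀, EB₀, VB₁, EB₁, pB₀, pB₁, hVB, hEB, hB, -⟩ := B.pathB.exists_split ht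
  have k := pA₀.card_append pA₁ h01
  have r₁ := F.odd_of_mixed B pA₀ (pA₁.append pA₂ (by grind)) (by grind) (by grind) h02
    pB₀ pB₁ hVB hEB hB pS₁ hS₁ hS₁A hS₁B
  have r₂ := F.odd_of_mixed B (pA₀.append pA₁ h01) pA₂ hVA hEA h012
    pB₀ pB₁ hVB hEB hB pS₂ hS₂ hS₂A hS₂B
  omega

/-- Beyond the start of a path to the second path of a bad pair, an odd ear of the first one
separates it from the second. -/
lemma false_of_mixed_beyond (B : G.Bad w M a b c d EP ER VA EA VB EB) {x z y m t t' : α}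
    {VA₀ VA₁ VA₂ VA₃ V : Finset α} {EA₀ EA₁ EA₂ EA₃ E : Finset β}
    (pA₀ : G.IsPath b y VA₀ EA₀) (pA₁ : G.IsPath y x VA₁ EA₁) (pA₂ : G.IsPath x z VA₂ EA₂)
    (pA₃ : G.IsPath z d VA₃ EA₃)
    (hVA : VA = VA₀ ∪ VA₁ ∪ VA₂ ∪ VA₃) (hEA : EA = EA₀ ∪ EA₁ ∪ EA₂ ∪ EA₃)
    (h01 : ∀ v ∈ VA₀, v ∈ VA₁ → v = y) (h02 : ∀ v ∈ VA₀, v ∈ VA₂ → v = x)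
    (h12 : ∀ v ∈ VA₁, v ∈ VA₂ → v = x) (h03 : ∀ v ∈ VA₀, v ∉ VA₃) (h13 : ∀ v ∈ VA₁, v ∉ VA₃)
    (h23 : ∀ v ∈ VA₂, v ∈ VA₃ → v = z) (hxz : x ≠ z)
    (pS : G.IsPath x z VS ES) (hS : ES ⊆ M) (hSA : ∀ v ∈ VS, v ∈ VA → v = x ∨ v = z)
    (hSB : ∀ v ∈ VS, v ∉ VB) (hpar : (ES.card + EA₂.card) % 2 = 1)
    (pS₁ : G.IsPath y t VS₁ ES₁) (hS₁ : ES₁ ⊆ M) (hS₁A : ∀ v ∈ VS₁, v ∈ VA → v = y)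
    (hS₁B : ∀ v ∈ VS₁, v ∈ VB → v = t) (ht : t ∈ VB)
    (p : G.IsPath m t' V E) (hE : E ⊆ M) (ht' : t' ∈ VB) (hpB : ∀ v ∈ V, v ∈ VB → v = t')
    (hpA : ∀ v ∈ V, v ∈ VA → v = m) (hm : m ∈ VA₂ ∨ m ∈ VA₃) (hmx : m ≠ x) : False := by
  have y0 := pA₀.right_mem
  have y1 := pA₁.left_mem
  have x1 := pA₁.right_mem
  have x2 := pA₂.left_mem
  have z2 := pA₂.right_mem
  have z3 := pA₃.left_mem
  -- From `z` onwards the two connections lie on both sides of the odd ear. Otherwise the second one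
  -- starts strictly inside the segment that the ear closes.
  by_cases h3 : m ∈ VA₃
  · obtain ⟨VC₀, EC₀, VC₁, EC₁, pC₀, pC₁, hVC, hEC, hC, hCd⟩ := pA₃.exists_split h3
    have c0 := pC₀.right_mem
    exact F.false_of_both B pA₀ pA₁ pA₂ pC₀ pC₁ (by grind) (by grind) h01 (by grind) hC
      (by grind) (by grind) hxz pS hS hSA hSB hpar pS₁ hS₁ hS₁A hS₁B ht p hE hpA hpB ht'
  · obtain ⟨VC₀, EC₀, VC₁, EC₁, pC₀, pC₁, hVC, hEC, hC, hCd⟩ :=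
      pA₂.exists_split (by grind : m ∈ VA₂)
    have k := pC₀.card_append pC₁ hC
    have cx := pC₀.left_mem
    have c0 := pC₀.right_mem
    have c1 := pC₁.left_mem
    have c2 := pC₁.right_mem
    exact F.false_of_inside B (pA₀.append pA₁ h01) pC₀ pC₁ pA₃ (by grind) (by grind) (by grind)
      hC (by grind) (by grind) (by grind) (by grind) pS hS hSA hSB (by rw [hEC] at hpar; omega)
      p hE ht' hpB hpA

/-- No ear of the first path of a bad pair jumps over the start of a path to the second one and
into the segment closed by an odd ear. -/
lemma false_of_ear_mid (B : G.Bad w M a b c d EP ER VA EA VB EB) {x z s y m t : α}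
    {VA₀ VA₀' VA₁ VA₂ VA₂' VA₃ : Finset α} {EA₀ EA₀' EA₁ EA₂ EA₂' EA₃ : Finset β}
    (pA₀ : G.IsPath b s VA₀ EA₀) (pA₀' : G.IsPath s y VA₀' EA₀') (pA₁ : G.IsPath y x VA₁ EA₁)
    (pA₂ : G.IsPath x m VA₂ EA₂) (pA₂' : G.IsPath m z VA₂' EA₂') (pA₃ : G.IsPath z d VA₃ EA₃)
    (hVA : VA = VA₀ ∪ VA₀' ∪ VA₁ ∪ VA₂ ∪ VA₂' ∪ VA₃)
    (hEA : EA = EA₀ ∪ EA₀' ∪ EA₁ ∪ EA₂ ∪ EA₂' ∪ EA₃)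
    (h00 : ∀ v ∈ VA₀, v ∈ VA₀' → v = s)
    (h01 : ∀ v ∈ VA₀', v ∈ VA₁ → v = y) (h12 : ∀ v ∈ VA₁, v ∈ VA₂ → v = x)
    (h22 : ∀ v ∈ VA₂, v ∈ VA₂' → v = m) (h23 : ∀ v ∈ VA₂', v ∈ VA₃ → v = z)
    (g01 : ∀ v ∈ VA₀, v ∉ VA₁) (g02 : ∀ v ∈ VA₀, v ∉ VA₂) (g02' : ∀ v ∈ VA₀, v ∉ VA₂')
    (g03 : ∀ v ∈ VA₀, v ∉ VA₃) (i02 : ∀ v ∈ VA₀', v ∈ VA₂ → v = x) (i02' : ∀ v ∈ VA₀', v ∉ VA₂')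
    (i03 : ∀ v ∈ VA₀', v ∉ VA₃) (j12 : ∀ v ∈ VA₁, v ∉ VA₂') (j13 : ∀ v ∈ VA₁, v ∉ VA₃)
    (hmx : m ≠ x) (hxz : x ≠ z) (h2 : ∀ v ∈ VA₂, v ∈ VA₃ → v = z)
    (pS : G.IsPath x z VS ES) (hS : ES ⊆ M) (hSA : ∀ v ∈ VS, v ∈ VA → v = x ∨ v = z)
    (hSB : ∀ v ∈ VS, v ∉ VB) (hpar : (ES.card + EA₂.card + EA₂'.card) % 2 = 1)
    (pS₁ : G.IsPath y t VS₁ ES₁) (hS₁ : ES₁ ⊆ M) (hS₁A : ∀ v ∈ VS₁, v ∈ VA → v = y)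
    (hS₁B : ∀ v ∈ VS₁, v ∈ VB → v = t) (ht : t ∈ VB) (hSS₁ : ∀ v ∈ VS, v ∈ VS₁ → v ∈ VA)
    (pT : G.IsPath s m VT ET) (hT : ET ⊆ M) (hTA : ∀ v ∈ VT, v ∈ VA → v = s ∨ v = m)
    (hTB : ∀ v ∈ VT, v ∉ VB) (hTS : ∀ v ∈ VT, v ∈ VS → v = m)
    (hTS₁ : ∀ v ∈ VT, v ∉ VS₁) : False := by
  have s0 := pA₀.right_mem
  have s1 := pA₀'.left_mem
  have y0 := pA₀'.right_mem
  have y1 := pA₁.left_mem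
  have x1 := pA₁.right_mem
  have x2 := pA₂.left_mem
  have m2 := pA₂.right_mem
  have m3 := pA₂'.left_mem
  have z2 := pA₂'.right_mem
  have z3 := pA₃.left_mem
  have sx := pS.left_mem
  have sz := pS.right_mem
  have hsA : EA₀ ⊆ M ∧ EA₀' ⊆ M ∧ EA₁ ⊆ M ∧ EA₂ ⊆ M ∧ EA₂' ⊆ M ∧ EA₃ ⊆ M := by
    have := B.subA
    simp only [hEA, Finset.union_subset_iff] at this
    tauto
  have hdis := B.disj
  have a₁ := pA₁.append pA₂ h12
  have l₁ := pA₁.card_append pA₂ h12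
  have a₂ := pA₀'.append a₁ (by grind)
  have l₂ := pA₀'.card_append a₁ (by grind)
  have a₃ := pA₂'.append pA₃ h23
  have hsm : s ≠ m := by rintro rfl; exact g02 _ s0 m2
  -- `T` is an ear over a segment with the inner vertex `y`, where `S₁` starts, so it cannot be odd.
  by_cases hodd : (ET.card + EA₀'.card + (EA₁ ∪ EA₂).card) % 2 = 1
  · exact F.false_of_inside B pA₀ pA₀' a₁ a₃ (by grind) (by grind) h00 (by grind) (by grind)
      (by grind) (by grind) (by grind) pT hT hTA hTB hodd pS₁ hS₁ ht hS₁B hS₁A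
  have B' := F.reroute B pA₀ a₂ a₃ (by grind) (by grind) (by grind) (by grind) (by grind) hsm pT
    hT hTA hTB (by omega)
  -- Once `A` is rerouted along `T`, the vertices `x` and `y` are off the new path. From `m` along
  -- `A₂` and from `z` along `S` one reaches `x`, then `y` and `t`. The parities of these two
  -- connections contradict the oddness of `S` with `A₂` and `A₂'`.
  have u₁ := pA₁.symm.append pS₁ (by grind)
  have o₁ := pA₁.symm.card_append pS₁ (by grind)
  have u₂ := pA₂.symm.append u₁ (by grind)
  have o₂ := pA₂.symm.card_append u₁ (by grind)
  have u₃ := pS.symm.append u₁ (by grind)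
  have o₃ := pS.symm.card_append u₁ (by grind)
  have := F.even_of_two_mixed B' (pA₀.append pT (by grind)) pA₂' pA₃ (by grind) (by grind)
    (by grind) (by grind) (by grind) ht u₂ (by grind) (by grind) (by grind) u₃ (by grind)
    (by grind) (by grind)
  omega

/-- No ear of the first path of a bad pair jumps over the start of a path to the second one and
over an odd ear. -/
lemma false_of_ear_over (B : G.Bad w M a b c d EP ER VA EA VB EB) {x z s y m t : α}
    {VA₀ VA₀' VA₁ VA₂ VA₃ VA₃' : Finset α} {EA₀ EA₀' EA₁ EA₂ EA₃ EA₃' : Finset β}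
    (pA₀ : G.IsPath b s VA₀ EA₀) (pA₀' : G.IsPath s y VA₀' EA₀') (pA₁ : G.IsPath y x VA₁ EA₁)
    (pA₂ : G.IsPath x z VA₂ EA₂) (pA₃ : G.IsPath z m VA₃ EA₃) (pA₃' : G.IsPath m d VA₃' EA₃')
    (hVA : VA = VA₀ ∪ VA₀' ∪ VA₁ ∪ VA₂ ∪ VA₃ ∪ VA₃')
    (hEA : EA = EA₀ ∪ EA₀' ∪ EA₁ ∪ EA₂ ∪ EA₃ ∪ EA₃')
    (h00 : ∀ v ∈ VA₀, v ∈ VA₀' → v = s)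
    (h01 : ∀ v ∈ VA₀', v ∈ VA₁ → v = y) (h12 : ∀ v ∈ VA₁, v ∈ VA₂ → v = x)
    (h23 : ∀ v ∈ VA₂, v ∈ VA₃ → v = z) (h33 : ∀ v ∈ VA₃, v ∈ VA₃' → v = m)
    (g01 : ∀ v ∈ VA₀, v ∉ VA₁) (g02 : ∀ v ∈ VA₀, v ∉ VA₂) (g03 : ∀ v ∈ VA₀, v ∉ VA₃)
    (g03' : ∀ v ∈ VA₀, v ∉ VA₃') (i02 : ∀ v ∈ VA₀', v ∈ VA₂ → v = x) (i03 : ∀ v ∈ VA₀', v ∉ VA₃)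
    (i03' : ∀ v ∈ VA₀', v ∉ VA₃') (j13 : ∀ v ∈ VA₁, v ∉ VA₃) (j13' : ∀ v ∈ VA₁, v ∉ VA₃')
    (k23 : ∀ v ∈ VA₂, v ∉ VA₃') (hxz : x ≠ z)
    (pS : G.IsPath x z VS ES) (hS : ES ⊆ M) (hSA : ∀ v ∈ VS, v ∈ VA → v = x ∨ v = z)
    (hSB : ∀ v ∈ VS, v ∉ VB) (hpar : (ES.card + EA₂.card) % 2 = 1)
    (pS₁ : G.IsPath y t VS₁ ES₁) (hS₁ : ES₁ ⊆ M) (hS₁A : ∀ v ∈ VS₁, v ∈ VA → v = y)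
    (hS₁B : ∀ v ∈ VS₁, v ∈ VB → v = t) (ht : t ∈ VB) (hSS₁ : ∀ v ∈ VS, v ∈ VS₁ → v ∈ VA)
    (pT : G.IsPath s m VT ET) (hT : ET ⊆ M) (hTA : ∀ v ∈ VT, v ∈ VA → v = s ∨ v = m)
    (hTB : ∀ v ∈ VT, v ∉ VB) (hTS : ∀ v ∈ VT, v ∈ VS → v = m)
    (hTS₁ : ∀ v ∈ VT, v ∉ VS₁) : False := by
  have s0 := pA₀.right_mem
  have s1 := pA₀'.left_mem
  have y0 := pA₀'.right_mem
  have y1 := pA₁.left_mem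
  have x1 := pA₁.right_mem
  have x2 := pA₂.left_mem
  have z2 := pA₂.right_mem
  have z3 := pA₃.left_mem
  have m3 := pA₃.right_mem
  have m4 := pA₃'.left_mem
  have sx := pS.left_mem
  have sz := pS.right_mem
  have hsA : EA₀ ⊆ M ∧ EA₀' ⊆ M ∧ EA₁ ⊆ M ∧ EA₂ ⊆ M ∧ EA₃ ⊆ M ∧ EA₃' ⊆ M := by
    have := B.subA
    simp only [hEA, Finset.union_subset_iff] at this
    tauto
  have hdis := B.disj
  have a₀ := pA₂.append pA₃ h23
  have a₁ := pA₁.append a₀ (by grind)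
  have a₂ := pA₀'.append a₁ (by grind)
  have l₂ := pA₀'.card_append a₁ (by grind)
  have hsm : s ≠ m := by rintro rfl; exact g03 _ s0 m3
  by_cases hodd : (ET.card + EA₀'.card + (EA₁ ∪ (EA₂ ∪ EA₃)).card) % 2 = 1
  · exact F.false_of_inside B pA₀ pA₀' a₁ pA₃' (by grind) (by grind) h00 (by grind) (by grind)
      (by grind) (by grind) (by grind) pT hT hTA hTB hodd pS₁ hS₁ ht hS₁B hS₁A
  have B' := F.reroute B pA₀ a₂ pA₃' (by grind) (by grind) (by grind) (by grind) (by grind) hsm pT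
    hT hTA hTB (by omega)
  -- After rerouting, both arcs between `x` and `z` are off the new path. They give two connections
  -- from `m` to `t` that differ only in using `A₂` or `S`, hence are of different parities. The
  -- segment between their starts is the trivial path at `m`.
  have u₁ := pA₁.symm.append pS₁ (by grind)
  have u₂ := pA₂.symm.append u₁ (by grind)
  have o₂ := pA₂.symm.card_append u₁ (by grind)
  have u₃ := pS.symm.append u₁ (by grind)
  have o₃ := pS.symm.card_append u₁ (by grind)
  have u₄ := pA₃.symm.append u₂ (by grind)
  have o₄ := pA₃.symm.card_append u₂ (by grind)
  have u₅ := pA₃.symm.append u₃ (by grind)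
  have o₅ := pA₃.symm.card_append u₃ (by grind)
  have := F.even_of_two_mixed B' (pA₀.append pT (by grind)) (.nil m) pA₃' (by grind) (by grind)
    (by grind) (by grind) (by grind) ht u₄ (by grind) (by grind) (by grind) u₅ (by grind)
    (by grind) (by grind)
  rw [Finset.card_empty] at this
  omega

/-- No ear of the first path of a bad pair jumps over the start of a path to the second one and
ends inside an odd ear. -/
lemma false_of_ear_hit (B : G.Bad w M a b c d EP ER VA EA VB EB) {x z s y m t : α}
    {VA₀ VA₀' VA₁ VA₂ VA₃ VS' : Finset α} {EA₀ EA₀' EA₁ EA₂ EA₃ ES' : Finset β}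
    (pA₀ : G.IsPath b s VA₀ EA₀) (pA₀' : G.IsPath s y VA₀' EA₀') (pA₁ : G.IsPath y x VA₁ EA₁)
    (pA₂ : G.IsPath x z VA₂ EA₂) (pA₃ : G.IsPath z d VA₃ EA₃)
    (hVA : VA = VA₀ ∪ VA₀' ∪ VA₁ ∪ VA₂ ∪ VA₃)
    (hEA : EA = EA₀ ∪ EA₀' ∪ EA₁ ∪ EA₂ ∪ EA₃)
    (h00 : ∀ v ∈ VA₀, v ∈ VA₀' → v = s)
    (h01 : ∀ v ∈ VA₀', v ∈ VA₁ → v = y) (h12 : ∀ v ∈ VA₁, v ∈ VA₂ → v = x)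
    (h23 : ∀ v ∈ VA₂, v ∈ VA₃ → v = z)
    (g01 : ∀ v ∈ VA₀, v ∉ VA₁) (g02 : ∀ v ∈ VA₀, v ∉ VA₂) (g03 : ∀ v ∈ VA₀, v ∉ VA₃)
    (i02 : ∀ v ∈ VA₀', v ∈ VA₂ → v = x) (i03 : ∀ v ∈ VA₀', v ∉ VA₃)
    (j13 : ∀ v ∈ VA₁, v ∉ VA₃) (hxz : x ≠ z)
    (pS : G.IsPath x m VS ES) (pS' : G.IsPath m z VS' ES') (hS : ES ∪ ES' ⊆ M)
    (hSS : ∀ v ∈ VS, v ∈ VS' → v = m)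
    (hSA : ∀ v, v ∈ VS ∨ v ∈ VS' → v ∈ VA → v = x ∨ v = z) (hm : m ∉ VA)
    (hSB : ∀ v, v ∈ VS ∨ v ∈ VS' → v ∉ VB) (hpar : (ES.card + ES'.card + EA₂.card) % 2 = 1)
    (pS₁ : G.IsPath y t VS₁ ES₁) (hS₁ : ES₁ ⊆ M) (hS₁A : ∀ v ∈ VS₁, v ∈ VA → v = y)
    (hS₁B : ∀ v ∈ VS₁, v ∈ VB → v = t) (ht : t ∈ VB)
    (hSS₁ : ∀ v, v ∈ VS ∨ v ∈ VS' → v ∈ VS₁ → v ∈ VA)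
    (pT : G.IsPath s m VT ET) (hT : ET ⊆ M) (hTA : ∀ v ∈ VT, v ∈ VA → v = s)
    (hTB : ∀ v ∈ VT, v ∉ VB) (hTS : ∀ v ∈ VT, v ∈ VS ∨ v ∈ VS' → v = m)
    (hTS₁ : ∀ v ∈ VT, v ∉ VS₁) : False := by
  have s0 := pA₀.right_mem
  have s1 := pA₀'.left_mem
  have y0 := pA₀'.right_mem
  have y1 := pA₁.left_mem
  have x1 := pA₁.right_mem
  have x2 := pA₂.left_mem
  have z2 := pA₂.right_mem
  have z3 := pA₃.left_mem
  have sx := pS.left_mem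
  have sz := pS'.right_mem
  have sm := pS.right_mem
  have sm' := pS'.left_mem
  have hSx : x ∉ VS' := by
    intro h
    have := hSS x sx h
    grind
  have hSz : z ∉ VS := by
    intro h
    have := hSS z h sz
    grind
  have hsA : EA₀ ⊆ M ∧ EA₀' ⊆ M ∧ EA₁ ⊆ M ∧ EA₂ ⊆ M ∧ EA₃ ⊆ M := by
    have := B.subA
    simp only [hEA, Finset.union_subset_iff] at this
    tauto
  have hSM := Finset.union_subset_iff.1 hS
  have hdis := B.disj
  have a₁ := pA₁.append pA₂ (by grind)
  have l₁ := pA₁.card_append pA₂ (by grind)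
  have a₂ := pA₀'.append a₁ (by grind)
  have l₂ := pA₀'.card_append a₁ (by grind)
  have hsz : s ≠ z := by rintro rfl; exact g02 _ s0 z2
  -- `T` followed by the part `S'` of the odd ear is an ear of `A` from `s` to `z`. After rerouting
  -- along it, `m` and `z` are connected to `t` by way of `x`, along the first part of `S` and along
  -- `A₂` respectively.
  have uT := pT.append pS' (by grind)
  have oT := pT.card_append pS' (by grind)
  by_cases hodd : ((ET ∪ ES').card + EA₀'.card + (EA₁ ∪ EA₂).card) % 2 = 1
  · exact F.false_of_inside B pA₀ pA₀' a₁ pA₃ (by grind) (by grind) h00 (by grind) (by grind)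
      (by grind) (by grind) (by grind) uT (by grind) (by grind) (by grind) hodd pS₁ hS₁ ht hS₁B hS₁A
  have B' := F.reroute B pA₀ a₂ pA₃ (by grind) (by grind) (by grind) (by grind) (by grind) hsz uT
    (by grind) (by grind) (by grind) (by omega)
  have u₁ := pA₁.symm.append pS₁ (by grind)
  have u₂ := pA₂.symm.append u₁ (by grind)
  have o₂ := pA₂.symm.card_append u₁ (by grind)
  have u₃ := pS.symm.append u₁ (by grind)
  have o₃ := pS.symm.card_append u₁ (by grind)
  have := F.even_of_two_mixed B' (pA₀.append pT (by grind)) pS' pA₃ (by grind) (by grind)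
    (by grind) (by grind) (by grind) ht u₃ (by grind) (by grind) (by grind) u₂ (by grind)
    (by grind) (by grind)
  omega

end Frame

end Linkage

end Graph

/-! ### Advancing a connection towards an odd ear -/

namespace Graph

section Linkage

variable {α β : Type*} [DecidableEq α] [DecidableEq β] {G : Graph α β} {w : Finset β → ZMod 2}
  {M EP ER : Finset β} {VP VR : Finset α} {a b c d : α} {e₀ f₀ : β}

/-- A bad pair whose first path runs through `y`, `x` and `z`, with a path from `y` to the second
path and an odd ear from `x` to `z`. -/
structure Before (G : Graph α β) (w : Finset β → ZMod 2) (M : Finset β) (a b c d : α)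
    (EP ER : Finset β) (VA : Finset α) (EA : Finset β) (VB : Finset α) (EB : Finset β)
    (y x z t : α) (VA₀ : Finset α) (EA₀ : Finset β) (VA₁ : Finset α) (EA₁ : Finset β)
    (VA₂ : Finset α) (EA₂ : Finset β) (VA₃ : Finset α) (EA₃ : Finset β)
    (VS : Finset α) (ES : Finset β) (VS₁ : Finset α) (ES₁ : Finset β) : Prop where
  bad : G.Bad w M a b c d EP ER VA EA VB EB
  pA₀ : G.IsPath b y VA₀ EA₀
  pA₁ : G.IsPath y x VA₁ EA₁
  pA₂ : G.IsPath x z VA₂ EA₂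
  pA₃ : G.IsPath z d VA₃ EA₃
  hVA : VA = VA₀ ∪ VA₁ ∪ VA₂ ∪ VA₃
  hEA : EA = EA₀ ∪ EA₁ ∪ EA₂ ∪ EA₃
  h01 : ∀ v ∈ VA₀, v ∈ VA₁ → v = y
  h02 : ∀ v ∈ VA₀, v ∈ VA₂ → v = x
  h12 : ∀ v ∈ VA₁, v ∈ VA₂ → v = x
  h03 : ∀ v ∈ VA₀, v ∉ VA₃
  h13 : ∀ v ∈ VA₁, v ∉ VA₃
  h23 : ∀ v ∈ VA₂, v ∈ VA₃ → v = z
  hxz : x ≠ z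
  pS : G.IsPath x z VS ES
  hS : ES ⊆ M
  hSA : ∀ v ∈ VS, v ∈ VA → v = x ∨ v = z
  hSB : ∀ v ∈ VS, v ∉ VB
  hpar : (ES.card + EA₂.card) % 2 = 1
  pS₁ : G.IsPath y t VS₁ ES₁
  hS₁ : ES₁ ⊆ M
  hS₁A : ∀ v ∈ VS₁, v ∈ VA → v = y
  hS₁B : ∀ v ∈ VS₁, v ∈ VB → v = t
  ht : t ∈ VB

/-- A connection that starts later, but still before `x`, takes the place of the one from `y`. The
segment `A₁` gets shorter; its length is the measure of the induction in `false_of_before`. -/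
lemma Before.advance {VA VB VS VS₁ VA₀ VA₁ VA₂ VA₃ V : Finset α}
    {EA EB ES ES₁ EA₀ EA₁ EA₂ EA₃ E : Finset β} {y x z t m t' : α}
    (X : G.Before w M a b c d EP ER VA EA VB EB y x z t VA₀ EA₀ VA₁ EA₁ VA₂ EA₂ VA₃ EA₃ VS ES
      VS₁ ES₁)
    (p : G.IsPath m t' V E) (hE : E ⊆ M) (ht' : t' ∈ VB) (hpB : ∀ v ∈ V, v ∈ VB → v = t')
    (hpA : ∀ v ∈ V, v ∈ VA → v = m) (hm : m ∈ VA₁) (hmy : m ≠ y) :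
    ∃ VC₀ EC₀ VC₁ EC₁, G.Before w M a b c d EP ER VA EA VB EB m x z t' VC₀ EC₀ VC₁ EC₁ VA₂ EA₂ VA₃
      EA₃ VS ES V E ∧ EC₁.card < EA₁.card := by
  obtain ⟨B, pA₀, pA₁, pA₂, pA₃, hVA, hEA, h01, h02, h12, h03, h13, h23, hxz, pS, hS, hSA, hSB,
    hpar, pS₁, hS₁, hS₁A, hS₁B, ht⟩ := X
  obtain ⟨VC₀, EC₀, VC₁, EC₁, pC₀, pC₁, hVC, hEC, hC, hCd⟩ := pA₁.exists_split hm
  have c0 := pC₀.left_mem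
  have c1 := pC₁.left_mem
  have c2 := pC₀.right_mem
  have c3 := pC₁.right_mem
  have y0 := pA₀.right_mem
  have hcard : EC₁.card < EA₁.card := by
    have := pC₀.card_append pC₁ hC
    have := (pC₀.edges_nonempty hmy.symm).card_pos
    rw [hEC]
    omega
  exact ⟨_, _, _, _, ⟨B, pA₀.append pC₀ (by grind), pC₁, pA₂, pA₃, by grind, by grind, by grind,
    by grind, by grind, by grind, by grind, h23, hxz, pS, hS, hSA, hSB, hpar, p, hE, hpA, hpB,
    ht'⟩, hcard⟩

namespace Frame

variable (F : G.Frame w M a b c d VP VR EP ER e₀ f₀) {VA VB VT VS VS₁ VS₂ VU : Finset α}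
  {EA EB ET ES ES₁ ES₂ EU : Finset β}

include F

/-- A path from the second path of a bad pair that avoids the part of the first path before `y`
reaches neither the part after `y` nor an odd ear, if this is so for paths with no inner vertex on
the two paths. -/
lemma false_of_walk (B : G.Bad w M a b c d EP ER VA EA VB EB) {x z y u m : α}
    {VA₀ VA₁ VA₂ VA₃ V : Finset α} {EA₀ EA₁ EA₂ EA₃ E : Finset β}
    (pA₀ : G.IsPath b x (VA₀ ∪ VA₁) (EA₀ ∪ EA₁)) (pA₂ : G.IsPath x z VA₂ EA₂)
    (pA₃ : G.IsPath z d VA₃ EA₃)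
    (hVA : VA = VA₀ ∪ VA₁ ∪ VA₂ ∪ VA₃) (hEA : EA = EA₀ ∪ EA₁ ∪ EA₂ ∪ EA₃)
    (h02 : ∀ v ∈ VA₀, v ∈ VA₂ → v = x)
    (h12 : ∀ v ∈ VA₁, v ∈ VA₂ → v = x) (h03 : ∀ v ∈ VA₀, v ∉ VA₃) (h13 : ∀ v ∈ VA₁, v ∉ VA₃)
    (h23 : ∀ v ∈ VA₂, v ∈ VA₃ → v = z) (hy : y ∈ VA₀)
    (pS : G.IsPath x z VS ES) (hS : ES ⊆ M) (hSA : ∀ v ∈ VS, v ∈ VA → v = x ∨ v = z)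
    (hSB : ∀ v ∈ VS, v ∉ VB) (hpar : (ES.card + EA₂.card) % 2 = 1)
    (nomix : ∀ {m t' V E}, G.IsPath m t' V E → E ⊆ M → t' ∈ VB → (∀ v ∈ V, v ∈ VB → v = t') →
      (∀ v ∈ V, v ∈ VA → v = m) → m ∈ VA₁ ∨ m ∈ VA₂ ∨ m ∈ VA₃ → m ≠ y → False)
    (p : G.IsPath u m V E) (hE : E ⊆ M) (hu : u ∈ VB)
    (hm : m ∈ VA₁ ∨ m ∈ VA₂ ∨ m ∈ VA₃ ∨ m ∈ VS) (hV : ∀ v ∈ V, v ∉ VA₀) : False := by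
  have x1 := pA₀.right_mem
  have x2 := pA₂.left_mem
  have z2 := pA₂.right_mem
  have z3 := pA₃.left_mem
  -- Cut the path at its last vertex on `B`, and the rest at its first vertex on `A₁`, `A₂`, `A₃` or
  -- `S`. This gives a connection that starts beyond `y` on `A`, or one that starts inside the odd
  -- ear.
  obtain ⟨t', V₁, E₁, V₂, E₂, ht', p₁, p₂, rfl, rfl, -, -, hl⟩ :=
    p.exists_last (X := VB) ⟨u, p.left_mem, hu⟩
  obtain ⟨m', V₃, E₃, V₄, E₄, hm', p₃, p₄, rfl, rfl, h34, -, hf⟩ :=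
    p₂.exists_first (X := VA₁ ∪ VA₂ ∪ VA₃ ∪ VS) ⟨m, p₂.right_mem, by grind⟩
  have m3 := p₃.right_mem
  have hm0 : m' ∉ VA₀ := hV m' (by simp [m3])
  have hV' : ∀ v ∈ V₃, v ∈ VA → v = m' := by
    intro v hv hvA
    have := hV v (by simp [hv])
    exact hf v hv (by grind)
  have hE₃ : E₃ ⊆ M := by
    simp only [Finset.union_subset_iff] at hE
    tauto
  have hl' : ∀ v ∈ V₃, v ∈ VB → v = t' := fun v hv => hl v (by simp [hv])
  by_cases hmA : m' ∈ VA
  · exact nomix p₃.symm hE₃ ht' hl' hV' (by grind) (by rintro rfl; exact hm0 hy)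
  · clear nomix
    exact F.false_of_hit B pA₀ pA₂ pA₃ (by grind) (by grind) (by grind) h23 (by grind) pS hS hSA
      hSB hpar p₃ hE₃ ht' (by grind) (by grind) (by grind) hl'
      (fun v hv hvA => hmA (hV' v hv hvA ▸ hvA)) (fun v hv hvS => hf v hv (by simp [hvS]))

/-- A path of `M` that avoids `y` yields an ear of the first path of a bad pair that jumps
over `y`. -/
lemma exists_ear_over {y : α} {VA₀ X V : Finset α} {E : Finset β} (p : G.IsPath b d V E)
    (hE : E ⊆ M) (hyV : y ∉ V) (hb : b ∈ VA₀) (hd : d ∈ X) (hX : ∀ v ∈ VA₀, v ∈ VB → False)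
    (nocross : ∀ {u m V E}, G.IsPath u m V E → E ⊆ M → u ∈ VB → m ∈ X →
      (∀ v ∈ V, v ∉ VA₀) → False) :
    ∃ s m VT ET, s ∈ VA₀ ∧ m ∈ X ∧ s ≠ y ∧ m ≠ y ∧ G.IsPath s m VT ET ∧ ET ⊆ M ∧ y ∉ VT ∧
      (∀ v ∈ VT, v ∉ VB) ∧ (∀ v ∈ VT, v ∈ VA₀ → v = s) ∧ (∀ v ∈ VT, v ∈ X → v = m) := by
  -- Behind its last vertex `s` on `A₀` the path cannot meet `B`, as it would go on from there to
  -- `d` while avoiding `A₀`, against `nocross`.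
  obtain ⟨s, V₁, E₁, V₂, E₂, hs, p₁, p₂, rfl, rfl, -, -, hl⟩ :=
    p.exists_last (X := VA₀) ⟨b, p.left_mem, hb⟩
  have s2 := p₂.left_mem
  have hE₂ : E₂ ⊆ M := (Finset.union_subset_iff.1 hE).2
  have hV₂B : ∀ v ∈ V₂, v ∉ VB := by
    intro v hv hvB
    obtain ⟨U₁, D₁, U₂, D₂, q₁, q₂, rfl, rfl, hU, -⟩ := p₂.exists_split hv
    have hq := q₁.left_mem
    refine nocross q₂ (Finset.union_subset_iff.1 hE₂).2 hvB (m := d) hd ?_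
    intro u hu hu0
    have := hl u (by simp [hu]) hu0
    subst this
    have := hU u hq hu
    subst this
    exact hX u hu0 hvB
  clear nocross
  obtain ⟨m, VT, ET, V₄, E₄, hm, pT, -, rfl, rfl, h34, -, hf⟩ :=
    p₂.exists_first (X := X) ⟨d, p₂.right_mem, hd⟩
  have := pT.left_mem
  have := pT.right_mem
  refine ⟨s, m, VT, ET, hs, hm, by grind, by grind, pT, (Finset.union_subset_iff.1 hE₂).1, by grind,
    by grind, by grind, hf⟩

/-- The ear jumps over `y`, where `S₁` starts, so it is not odd by `false_of_inside`. Rerouting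
along it leaves a bad pair whose first path runs through `m`, and the bypassed segment from `m` back
to `y` followed by `S₁` is a connection from `m`. The configuration recurs with a shorter segment
before the odd ear. -/
lemma exists_before_of_ear {VA VB VS VS₁ VA₀ VA₀' VA₁ VA₂ VA₃ VT : Finset α}
    {EA EB ES ES₁ EA₀ EA₀' EA₁ EA₂ EA₃ ET : Finset β} {s y x z t m : α}
    (X : G.Before w M a b c d EP ER VA EA VB EB y x z t (VA₀ ∪ VA₀') (EA₀ ∪ EA₀') VA₁ EA₁ VA₂ EA₂
      VA₃ EA₃ VS ES VS₁ ES₁)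
    (pA₀ : G.IsPath b s VA₀ EA₀) (pA₀' : G.IsPath s y VA₀' EA₀') (h00 : ∀ v ∈ VA₀, v ∈ VA₀' → v = s)
    (hsy : s ≠ y) (pT : G.IsPath s m VT ET) (hT : ET ⊆ M) (hTA : ∀ v ∈ VT, v ∈ VA → v = s ∨ v = m)
    (hTB : ∀ v ∈ VT, v ∉ VB) (hTS : ∀ v ∈ VT, v ∈ VS → v = m)
    (hTS₁ : ∀ v ∈ VT, v ∉ VS₁) (hm : m ∈ VA₁) (hmy : m ≠ y) :
    ∃ VA VC₀ EA EC₀ VC₁ EC₁ V E, G.Before w M a b c d EP ER VA EA VB EB m x z t VC₀ EC₀ VC₁ EC₁ VA₂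
      EA₂ VA₃ EA₃ VS ES V E ∧ EC₁.card < EA₁.card := by
  obtain ⟨B, -, pA₁, pA₂, pA₃, hVA, hEA, h01, h02, h12, h03, h13, h23, hxz, pS, hS, hSA, hSB,
    hpar, pS₁, hS₁, hS₁A, hS₁B, ht⟩ := X
  obtain ⟨VD₀, ED₀, VD₁, ED₁, pD₀, pD₁, rfl, rfl, hD, -⟩ := pA₁.exists_split hm
  have d0 := pD₀.left_mem
  have d1 := pD₁.left_mem
  have d2 := pD₀.right_mem
  have d4 := pD₁.right_mem
  have x2 := pA₂.left_mem
  have z3 := pA₃.left_mem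
  have y0 := pA₀'.right_mem
  have s0 := pA₀.right_mem
  have s1 := pA₀'.left_mem
  have hyn : y ∉ VA₀ := fun h => hsy (h00 y h y0).symm
  have hyd : y ∉ VD₁ := fun h => hmy (hD y d0 h).symm
  have g1 : ∀ v ∈ VA₀, v ∉ VD₀ := fun v h h' => hyn (h01 v (by simp [h]) (by simp [h']) ▸ h)
  have g1' : ∀ v ∈ VA₀, v ∉ VD₁ := fun v h h' => hyn (h01 v (by simp [h]) (by simp [h']) ▸ h)
  have gx : x ∉ VA₀ := fun h => g1' x h d4
  have g2 : ∀ v ∈ VA₀, v ∉ VA₂ := by grind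
  have g3 : ∀ v ∈ VA₀, v ∉ VA₃ := by grind
  have g4 : ∀ v ∈ VA₀', v ∉ VA₃ := by grind
  have g5 : ∀ v ∈ VA₀', v ∉ VD₁ := by grind
  have hsm : s ≠ m := by rintro rfl; exact g1' _ s0 d1
  have hsM : EA₀ ⊆ M ∧ EA₀' ⊆ M ∧ ED₀ ⊆ M ∧ ED₁ ⊆ M ∧ EA₂ ⊆ M ∧ EA₃ ⊆ M := by
    have := B.subA
    simp only [hEA, Finset.union_subset_iff] at this
    tauto
  have hdis := B.disj
  have hcard : ED₁.card < (ED₀ ∪ ED₁).card := by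
    have := pD₀.card_append pD₁ hD
    have := (pD₀.edges_nonempty hmy.symm).card_pos
    omega
  have q₁ := pD₁.append pA₂ (by grind)
  have q := q₁.append pA₃ (by grind)
  have r := pA₀'.append pD₀ (by grind)
  have k := pA₀'.card_append pD₀ (by grind)
  by_cases hodd : (ET.card + EA₀'.card + ED₀.card) % 2 = 1
  · exact (F.false_of_inside B pA₀ pA₀' pD₀ q (by grind) (by grind) h00 (by grind) (by grind)
      (by grind) (by grind) (by grind) pT hT hTA hTB hodd pS₁ hS₁ ht hS₁B hS₁A).elim
  have B' := F.reroute B pA₀ r q (by grind) (by grind) (by grind) (by grind) (by grind) hsm pT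
    hT hTA hTB (by omega)
  have u := pD₀.symm.append pS₁ (by grind)
  have z2 := pA₂.right_mem
  refine ⟨_, _, _, _, _, _, _, _, ⟨B', pA₀.append pT (by grind), pD₁, pA₂, pA₃, by grind, by grind,
    by grind, by grind, by grind, by grind, by grind, h23, hxz, pS, hS, by grind, hSB, hpar, u,
    by grind, by grind, by grind, ht⟩, hcard⟩

set_option maxHeartbeats 1000000 in
/-- If every vertex is avoided by some path, then no path to the second path of a bad pair starts
before an odd ear of the first one. -/
lemma false_of_before
    (hW : ∀ y, y ≠ b → y ≠ d → ∃ V E, G.IsPath b d V E ∧ E ⊆ M ∧ y ∉ V)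
    (hb : ∃ V E, G.IsPath a d V E ∧ E ⊆ M ∧ b ∉ V) (n : ℕ) :
    ∀ {VA VB VS VS₁ VA₀ VA₁ VA₂ VA₃ : Finset α} {EA EB ES ES₁ EA₀ EA₁ EA₂ EA₃ : Finset β}
    {y x z t : α}, G.Before w M a b c d EP ER VA EA VB EB y x z t VA₀ EA₀ VA₁ EA₁ VA₂ EA₂ VA₃ EA₃
      VS ES VS₁ ES₁ → EA₁.card ≤ n → False := by
  -- Induction on the length of the segment `A₁` between the start `y` of the connection and the
  -- start `x` of the odd ear, for all bad pairs at once, since rerouting changes the pair.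
  induction n using Nat.strong_induction_on with
  | _ n ih =>
  intro VA VB VS VS₁ VA₀ VA₁ VA₂ VA₃ EA EB ES ES₁ EA₀ EA₁ EA₂ EA₃ y x z t X hn
  have X' := X
  obtain ⟨B, pA₀, pA₁, pA₂, pA₃, hVA, hEA, h01, h02, h12, h03, h13, h23, hxz, pS, hS, hSA, hSB,
    hpar, pS₁, hS₁, hS₁A, hS₁B, ht⟩ := X'
  have hdis := B.disj
  have y0 := pA₀.right_mem
  have y1 := pA₁.left_mem
  have x1 := pA₁.right_mem
  have x2 := pA₂.left_mem
  have z2 := pA₂.right_mem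
  have z3 := pA₃.left_mem
  have d3 := pA₃.right_mem
  have b0 := pA₀.left_mem
  have a₀₁ := pA₀.append pA₁ h01
  have hyd : y ≠ d := by rintro rfl; exact h03 _ y0 d3
  -- no other path to `VB` beyond `y`
  have nomix : ∀ {m t' V E}, G.IsPath m t' V E → E ⊆ M → t' ∈ VB → (∀ v ∈ V, v ∈ VB → v = t') →
      (∀ v ∈ V, v ∈ VA → v = m) → m ∈ VA₁ ∨ m ∈ VA₂ ∨ m ∈ VA₃ → m ≠ y → False := by
    intro m t' V E p hE ht' hpB hpA hm hmy
    by_cases h1 : m ∈ VA₁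
    · obtain ⟨_, _, _, _, X', hc⟩ := X.advance p hE ht' hpB hpA h1 hmy
      exact ih _ (hc.trans_le hn) X' le_rfl
    · exact F.false_of_mixed_beyond B pA₀ pA₁ pA₂ pA₃ hVA hEA h01 h02 h12 h03 h13 h23 hxz pS hS hSA
        hSB hpar pS₁ hS₁ hS₁A hS₁B ht p hE ht' hpB hpA (by tauto) (by rintro rfl; exact h1 x1)
  have nocross : ∀ {u m V E}, G.IsPath u m V E → E ⊆ M → u ∈ VB →
      m ∈ VA₁ ∪ VA₂ ∪ VA₃ ∪ VS → (∀ v ∈ V, v ∉ VA₀) → False := by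
    intro u m V E p hE hu hm hV
    exact F.false_of_walk B a₀₁ pA₂ pA₃ hVA hEA h02 h12 h03 h13 h23 y0 pS hS hSA hSB hpar
      nomix p hE hu (by simpa [or_assoc] using hm) hV
  clear nomix
  -- If `y = b`, then `A₀` is the single vertex `b`, and the path from `a` to `d` that avoids `b`
  -- violates `nocross`.
  have hyb : y ≠ b := by
    rintro rfl
    obtain ⟨V, E, p, hE, hbV⟩ := hb
    refine nocross p hE B.pathB.left_mem (by simp [d3]) ?_
    intro v hv hv0
    rw [pA₀.eq_singleton.1, Finset.mem_singleton] at hv0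
    exact hbV (hv0 ▸ hv)
  -- A path from `b` to `d` that avoids `y` contains an ear jumping over `y`. Its end `m` on `A₁`,
  -- `A₂`, `A₃` or inside `S` distinguishes the cases; only the first needs the induction
  -- hypothesis.
  obtain ⟨V, E, p, hE, hyV⟩ := hW y hyb hyd
  clear hW hb
  obtain ⟨s, m, VT, ET, hs, hm, hsy, hmy, pT, hT, hyT, hTB, hT0, hTX⟩ :=
    F.exists_ear_over (VB := VB) (VA₀ := VA₀) (X := VA₁ ∪ VA₂ ∪ VA₃ ∪ VS) p hE hyV b0 (by simp [d3])
      (fun v hv => hdis v (by simp [hVA, hv])) nocross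
  have sT := pT.left_mem
  have mT := pT.right_mem
  -- Otherwise one could walk from `t` back along `S₁` to the common vertex and on along `T` to `m`.
  -- This walk avoids `A₀`, as `T` meets `A₀` only in `s`, and `S₁` meets `A` only in `y`.
  have hTS₁ : ∀ v ∈ VT, v ∉ VS₁ := by
    intro v hv hv'
    obtain ⟨U₁, D₁, U₂, D₂, q₁, q₂, rfl, rfl, hU, -⟩ := pT.exists_split hv
    obtain ⟨U₃, D₃, U₄, D₄, q₃, q₄, rfl, rfl, hU', -⟩ := pS₁.exists_split hv'
    obtain ⟨U, D, q, hUq, hDq⟩ := q₄.symm.exists_trans q₂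
    have := q₃.left_mem
    have := q₁.left_mem
    refine nocross q ?_ ht hm ?_
    · simp only [Finset.union_subset_iff] at hT hS₁
      exact hDq.trans (Finset.union_subset hS₁.2 hT.2)
    · clear ih nocross X
      intro u hu hu0
      have := hUq hu
      have := hT0 u
      have := hS₁A u
      grind
  clear nocross p hyV hE
  have hTS : ∀ v ∈ VT, v ∈ VS → v = m := fun v hv hv' => hTX v hv (by simp [hv'])
  obtain ⟨VC₀, EC₀, VC₁, EC₁, pC₀, pC₁, rfl, rfl, hC, -⟩ := pA₀.exists_split hs
  by_cases hm1 : m ∈ VA₁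
  · have hTA : ∀ v ∈ VT, v ∈ VA → v = s ∨ v = m := by
      clear ih X
      grind
    obtain ⟨_, _, _, _, _, _, _, _, X', hc⟩ := F.exists_before_of_ear X pC₀ pC₁ hC hsy pT hT hTA hTB
      hTS hTS₁ hm1 hmy
    exact ih _ (hc.trans_le hn) X' le_rfl
  clear ih X
  have c0 := pC₀.right_mem
  have c1 := pC₁.left_mem
  have c2 := pC₁.right_mem
  have s1 := pS₁.left_mem
  have sS := pS.left_mem
  have zS := pS.right_mem
  have g0 : y ∉ VC₀ := fun h => hsy (hC y h c2).symm
  have g1 : ∀ v ∈ VC₀, v ∉ VA₁ := by grind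
  have gx : x ∉ VC₀ := fun h => g1 x h x1
  have g2 : ∀ v ∈ VC₀, v ∉ VA₂ := by grind
  have g3 : ∀ v ∈ VC₀, v ∉ VA₃ := by grind
  have f1 : ∀ v ∈ VC₁, v ∈ VA₁ → v = y := fun v hv => h01 v (by simp [hv])
  have f2 : ∀ v ∈ VC₁, v ∈ VA₂ → v = x := fun v hv => h02 v (by simp [hv])
  have f3 : ∀ v ∈ VC₁, v ∉ VA₃ := fun v hv => h03 v (by simp [hv])
  have sz : s ≠ z := by rintro rfl; exact g3 _ c0 z3
  have sx : s ≠ x := by rintro rfl; exact gx c0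
  have hmx : m ≠ x := by rintro rfl; exact hm1 x1
  have hSS₁ : ∀ v ∈ VS, v ∈ VS₁ → v ∈ VA :=
    F.mem_of_mem_inter B a₀₁ pA₂ pA₃ hVA hEA (by grind) h23 (by grind) pS hS hSA hSB hpar
      pS₁ hS₁ ht hS₁B hS₁A (by grind)
  by_cases hm2 : m ∈ VA₂
  · have hTA : ∀ v ∈ VT, v ∈ VA → v = s ∨ v = m := by grind
    obtain ⟨VD₀, ED₀, VD₁, ED₁, pD₀, pD₁, rfl, rfl, hD, -⟩ := pA₂.exists_split hm2
    have d0 := pD₀.left_mem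
    have d1 := pD₁.left_mem
    have d2 := pD₀.right_mem
    have d4 := pD₁.right_mem
    have k := pD₀.card_append pD₁ hD
    have hxD : x ∉ VD₁ := fun h => hmx (hD x d0 h).symm
    have hzD : z ∈ VD₀ → z = m := fun h => hD z h d4
    exact F.false_of_ear_mid B pC₀ pC₁ pA₁ pD₀ pD₁ pA₃ (by grind) (by grind) hC f1 (by grind)
      hD (by grind) g1 (by grind) (by grind) g3 (by grind) (by grind) f3
      (by grind) h13 hmx hxz (by grind) pS hS hSA hSB (by omega) pS₁ hS₁ hS₁A hS₁B ht hSS₁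
      pT hT hTA hTB hTS hTS₁
  by_cases hm3 : m ∈ VA₃
  · have hTA : ∀ v ∈ VT, v ∈ VA → v = s ∨ v = m := by grind
    obtain ⟨VD₀, ED₀, VD₁, ED₁, pD₀, pD₁, rfl, rfl, hD, -⟩ := pA₃.exists_split hm3
    have d0 := pD₀.left_mem
    have d1 := pD₁.left_mem
    have d2 := pD₀.right_mem
    have hzD : z ∉ VD₁ := fun h => hm2 (hD z d0 h ▸ z2)
    exact F.false_of_ear_over B pC₀ pC₁ pA₁ pA₂ pD₀ pD₁ (by grind) (by grind) hC f1 h12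
      (by grind) hD g1 g2 (by grind) (by grind) f2 (by grind) (by grind)
      (by grind) (by grind) (by grind) hxz pS hS hSA hSB hpar pS₁ hS₁ hS₁A hS₁B ht hSS₁
      pT hT hTA hTB hTS hTS₁
  · have hmS : m ∈ VS := by simpa [hm1, hm2, hm3] using hm
    have hmA : m ∉ VA := by
      intro h
      rcases hSA m hmS h with h | h
      · exact hmx h
      · exact hm2 (h ▸ z2)
    obtain ⟨VD₀, ED₀, VD₁, ED₁, pD₀, pD₁, rfl, rfl, hD, -⟩ := pS.exists_split hmS
    have k := pD₀.card_append pD₁ hD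
    exact F.false_of_ear_hit B pC₀ pC₁ pA₁ pA₂ pA₃ (by grind) (by grind) hC f1 h12 h23 g1 g2 g3
      f2 f3 h13 hxz pD₀ pD₁ hS hD (by grind) hmA (by grind) (by omega) pS₁ hS₁ hS₁A hS₁B ht
      (by grind) pT hT (by grind) hTB (by grind) hTS₁

end Frame

end Linkage

end Graph

/-! ### Ears are even, and there are no bad pairs -/

namespace Graph

section Linkage

variable {α β : Type*} [DecidableEq α] [DecidableEq β] {G : Graph α β} {w : Finset β → ZMod 2}
  {M EP ER : Finset β} {VP VR : Finset α} {a b c d : α} {e₀ f₀ : β} {VA VB VS V : Finset α}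
  {EA EB ES E : Finset β}

/-- The configuration has two symmetries. `mirror` exchanges `P` with `R` and reverses `A` and `B`,
which handles connections that start after an odd ear. `swap` exchanges `A` with `B`, which handles
ears of `B`. -/
lemma Bad.mirror (B : G.Bad w M a b c d EP ER VA EA VB EB) :
    G.Bad w M c d a b ER EP VA EA VB EB :=
  ⟨B.pathA.symm, B.pathB.symm, B.subA, B.subB, B.disj, by have := B.even; omega, by
    rw [Finset.union_right_comm]; exact B.weight⟩

lemma Bad.swap (B : G.Bad w M a b c d EP ER VA EA VB EB) :
    G.Bad w M b a d c EP ER VB EB VA EA :=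
  ⟨B.pathB, B.pathA, B.subB, B.subA, fun v h h' => B.disj v h' h, by have := B.even; omega, by
    rw [Finset.union_comm EB]; exact B.weight⟩

/-- The vertex `u` divides a path from `a` to `b` after `E₀.card` edges. -/
def Cut (G : Graph α β) (a b : α) (V : Finset α) (E : Finset β) (u : α) (k : ℕ) : Prop :=
  ∃ V₀ E₀ V₁ E₁, G.IsPath a u V₀ E₀ ∧ G.IsPath u b V₁ E₁ ∧ V = V₀ ∪ V₁ ∧ E = E₀ ∪ E₁ ∧
    (∀ v ∈ V₀, v ∈ V₁ → v = u) ∧ k = E₀.card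

lemma IsPath.exists_cut {u : α} (h : G.IsPath a b V E) (hu : u ∈ V) : ∃ k, G.Cut a b V E u k := by
  obtain ⟨V₀, E₀, V₁, E₁, p₀, p₁, h1, h2, h3, -⟩ := h.exists_split hu
  exact ⟨_, V₀, E₀, V₁, E₁, p₀, p₁, h1, h2, h3, rfl⟩

namespace Frame

lemma mirror (F : G.Frame w M a b c d VP VR EP ER e₀ f₀) :
    G.Frame w M c d a b VR VP ER EP f₀ e₀ where
  theta := F.theta
  k4 := F.k4
  delta := F.delta
  pathP := F.pathR
  pathR := F.pathP
  ne_P := F.ne_R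
  ne_R := F.ne_P
  meet v h h' := by have := F.meet v h' h; tauto
  meetP := F.meetR
  meetR := F.meetP
  memP := F.memR
  memR := F.memP
  notMem_P := F.notMem_R
  notMem_R := F.notMem_P
  notMem_M := F.notMem_M'
  notMem_M' := F.notMem_M
  zero V C hC h h' h'' := F.zero V C hC (by rwa [Finset.union_right_comm]) h' h''.symm

lemma swap (F : G.Frame w M a b c d VP VR EP ER e₀ f₀) :
    G.Frame w M b a d c VP VR EP ER e₀ f₀ where
  theta := F.theta
  k4 := F.k4
  delta := F.delta
  pathP := F.pathP.symm
  pathR := F.pathR.symm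
  ne_P := F.ne_P.symm
  ne_R := F.ne_R.symm
  meet v h h' := (F.meet v h h').symm
  meetP g hg v h h' := (F.meetP g hg v h h').symm
  meetR g hg v h h' := (F.meetR g hg v h h').symm
  memP := F.memP
  memR := F.memR
  notMem_P := F.notMem_P
  notMem_R := F.notMem_R
  notMem_M := F.notMem_M
  notMem_M' := F.notMem_M'
  zero := F.zero

variable (F : G.Frame w M a b c d VP VR EP ER e₀ f₀)

include F

/-- Ears of the first path of a bad pair are even. -/
lemma even_of_ear (B : G.Bad w M a b c d EP ER VA EA VB EB)
    (hW : ∀ y, y ≠ b → y ≠ d → ∃ V E, G.IsPath b d V E ∧ E ⊆ M ∧ y ∉ V)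
    (hb : ∃ V E, G.IsPath a d V E ∧ E ⊆ M ∧ b ∉ V) (hd : ∃ V E, G.IsPath c b V E ∧ E ⊆ M ∧ d ∉ V)
    {x z : α} {VA₀ VA₁ VA₂ : Finset α} {EA₀ EA₁ EA₂ : Finset β}
    (pA₀ : G.IsPath b x VA₀ EA₀) (pA₁ : G.IsPath x z VA₁ EA₁) (pA₂ : G.IsPath z d VA₂ EA₂)
    (hVA : VA = VA₀ ∪ VA₁ ∪ VA₂) (hEA : EA = EA₀ ∪ EA₁ ∪ EA₂) (h01 : ∀ v ∈ VA₀, v ∈ VA₁ → v = x)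
    (h12 : ∀ v ∈ VA₁, v ∈ VA₂ → v = z) (h02 : ∀ v ∈ VA₀, v ∉ VA₂)
    (pS : G.IsPath x z VS ES) (hS : ES ⊆ M) (hSA : ∀ v ∈ VS, v ∈ VA → v = x ∨ v = z)
    (hSB : ∀ v ∈ VS, v ∉ VB) : (ES.card + EA₁.card) % 2 = 0 := by
  by_contra hne
  have hpar : (ES.card + EA₁.card) % 2 = 1 := by omega
  have hdis := B.disj
  have x0 := pA₀.right_mem
  have x1 := pA₁.left_mem
  have z1 := pA₁.right_mem
  have z2 := pA₂.left_mem
  have d2 := pA₂.right_mem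
  have hxz : x ≠ z := by rintro rfl; exact h02 _ x0 z2
  -- Any path of `M` from `a` on `B` to `d` on `A` contains a connection from `B` to `A ∪ S`.
  -- Wherever this ends, one of the preceding lemmas applies: inside `S`, before, after or strictly
  -- between the ends of the ear.
  obtain ⟨V, E, p, hE, -⟩ := id hb
  obtain ⟨t, V₁, E₁, V₂, E₂, ht, p₁, p₂, rfl, rfl, -, -, hl⟩ :=
    p.exists_last (X := VB) ⟨a, p.left_mem, B.pathB.left_mem⟩
  obtain ⟨m, V₃, E₃, V₄, E₄, hm, p₃, p₄, rfl, rfl, h34, -, hf⟩ :=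
    p₂.exists_first (X := VA ∪ VS) ⟨d, p₂.right_mem, by simp [hVA, d2]⟩
  have hE₃ : E₃ ⊆ M := by
    simp only [Finset.union_subset_iff] at hE
    tauto
  have hB₃ : ∀ v ∈ V₃, v ∈ VB → v = t := fun v hv => hl v (by simp [hv])
  have hA₃ : ∀ v ∈ V₃, v ∈ VA → v = m := fun v hv hv' => hf v hv (by simp [hv'])
  by_cases hmA : m ∈ VA
  swap
  · exact F.false_of_hit B pA₀ pA₁ pA₂ hVA hEA h01 h12 h02 pS hS hSA hSB hpar p₃ hE₃ ht
      (by grind) (by grind) (by grind) hB₃ (fun v hv hv' => hmA (hA₃ v hv hv' ▸ hv'))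
      (fun v hv hv' => hf v hv (by simp [hv']))
  have hm' : m ∈ VA₀ ∨ m ∈ VA₁ ∨ m ∈ VA₂ := by grind
  rcases hm' with hm' | hm' | hm'
  · obtain ⟨VC₀, EC₀, VC₁, EC₁, pC₀, pC₁, hVC, hEC, hC, -⟩ := pA₀.exists_split hm'
    exact F.false_of_before hW hb EC₁.card ⟨B, pC₀, pC₁, pA₁, pA₂, by grind, by grind, hC, by grind,
      by grind, by grind, by grind, h12, hxz, pS, hS, hSA, hSB, hpar, p₃.symm, hE₃, hA₃, hB₃, ht⟩
      le_rfl
  · obtain ⟨VC₀, EC₀, VC₁, EC₁, pC₀, pC₁, hVC, hEC, hC, -⟩ := pA₁.exists_split hm'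
    have c0 := pC₀.left_mem
    have c1 := pC₁.right_mem
    have := pC₀.card_append pC₁ hC
    -- At an end of the ear the connection counts as one before it (or, mirrored, after it), with a
    -- trivial segment in between.
    by_cases hmx : m = x
    · subst hmx
      exact F.false_of_before hW hb 0 ⟨B, pA₀, .nil m, pA₁, pA₂, by grind, by grind, by grind,
        by grind, by grind, by grind, by grind, h12, hxz, pS, hS, hSA, hSB, hpar, p₃.symm, hE₃, hA₃,
        hB₃, ht⟩ (by simp)
    by_cases hmz : m = z
    · subst hmz
      exact F.mirror.false_of_before (fun y h h' => by
          obtain ⟨V, E, p, h⟩ := hW y h' h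
          exact ⟨V, E, p.symm, h⟩) hd 0
        ⟨B.mirror, pA₂.symm, .nil m, pA₁.symm, pA₀.symm, by grind, by grind, by grind, by grind,
          by grind, by grind, by grind, by grind, hxz.symm, pS.symm, hS, by grind, hSB, hpar,
          p₃.symm, hE₃, hA₃, hB₃, ht⟩ (by simp)
    exact F.false_of_inside B pA₀ pC₀ pC₁ pA₂ (by grind) (by grind) (by grind) hC (by grind)
      (by grind) h02 (by grind) pS hS hSA hSB (by rw [hEC] at hpar; omega) p₃.symm hE₃ ht hB₃ hA₃
  · obtain ⟨VC₀, EC₀, VC₁, EC₁, pC₀, pC₁, hVC, hEC, hC, -⟩ := pA₂.exists_split hm'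
    exact F.mirror.false_of_before (fun y h h' => by
          obtain ⟨V, E, p, h⟩ := hW y h' h
          exact ⟨V, E, p.symm, h⟩) hd EC₀.card
        ⟨B.mirror, pC₁.symm, pC₀.symm, pA₁.symm, pA₀.symm, by grind, by grind, by grind, by grind,
          by grind, by grind, by grind, by grind, hxz.symm, pS.symm, hS, by grind, hSB, hpar,
          p₃.symm, hE₃, hA₃, hB₃, ht⟩ le_rfl

/-- Ears of the first path of a bad pair are even, in terms of the segments before their ends. -/
lemma exists_cut_of_ear (B : G.Bad w M a b c d EP ER VA EA VB EB)
    (hW : ∀ y, y ≠ b → y ≠ d → ∃ V E, G.IsPath b d V E ∧ E ⊆ M ∧ y ∉ V)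
    (hb : ∃ V E, G.IsPath a d V E ∧ E ⊆ M ∧ b ∉ V) (hd : ∃ V E, G.IsPath c b V E ∧ E ⊆ M ∧ d ∉ V)
    {x z : α} {k : ℕ} (hx : G.Cut b d VA EA x k) (hz : z ∈ VA)
    (hxz : x ≠ z) (pS : G.IsPath x z VS ES) (hS : ES ⊆ M) (hSA : ∀ v ∈ VS, v ∈ VA → v = x ∨ v = z)
    (hSB : ∀ v ∈ VS, v ∉ VB) : ∃ k', G.Cut b d VA EA z k' ∧ (ES.card + k + k') % 2 = 0 := by
  obtain ⟨VA₀, EA₀, VA₁, EA₁, pA₀, pA₁, hVA, hEA, h01, rfl⟩ := hx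
  have x0 := pA₀.right_mem
  have x1 := pA₁.left_mem
  by_cases hz : z ∈ VA₁
  · obtain ⟨VC₀, EC₀, VC₁, EC₁, pC₀, pC₁, hVC, hEC, hC, -⟩ := pA₁.exists_split hz
    have c0 := pC₀.left_mem
    have c1 := pC₁.left_mem
    have c2 := pC₀.right_mem
    have k := pA₀.card_append pC₀ (by grind)
    have h1 := F.even_of_ear B hW hb hd pA₀ pC₀ pC₁ (by grind) (by grind) (by grind) hC (by grind)
      pS hS hSA hSB
    exact ⟨_, ⟨_, _, _, _, pA₀.append pC₀ (by grind), pC₁, by grind, by grind, by grind, rfl⟩,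
      by omega⟩
  · obtain ⟨VC₀, EC₀, VC₁, EC₁, pC₀, pC₁, hVC, hEC, hC, -⟩ := pA₀.exists_split
      (by grind : z ∈ VA₀)
    have c0 := pC₁.left_mem
    have c1 := pC₀.right_mem
    have c2 := pC₁.right_mem
    have k := pC₀.card_append pC₁ hC
    have h1 := F.even_of_ear B hW hb hd pC₀ pC₁ pA₁ (by grind) (by grind) hC (by grind) (by grind)
      pS.symm hS (by grind) hSB
    exact ⟨_, ⟨_, _, _, _, pC₀, pC₁.append pA₁ (by grind), by grind, by grind, by grind, rfl⟩,
      by rw [hEC]; omega⟩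

/-- The parity of paths of `M` is determined by the distances along the paths of a bad pair. -/
lemma card_mod_two (B : G.Bad w M a b c d EP ER VA EA VB EB)
    (hA : ∀ {x z k VS ES}, G.Cut b d VA EA x k → z ∈ VA → x ≠ z → G.IsPath x z VS ES → ES ⊆ M →
      (∀ v ∈ VS, v ∈ VA → v = x ∨ v = z) → (∀ v ∈ VS, v ∉ VB) →
      ∃ k', G.Cut b d VA EA z k' ∧ (ES.card + k + k') % 2 = 0)
    (hB : ∀ {x z k VS ES}, G.Cut a c VB EB x k → z ∈ VB → x ≠ z → G.IsPath x z VS ES → ES ⊆ M →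
      (∀ v ∈ VS, v ∈ VB → v = x ∨ v = z) → (∀ v ∈ VS, v ∉ VA) →
      ∃ k', G.Cut a c VB EB z k' ∧ (ES.card + k + k') % 2 = 0) (n : ℕ) :
    ∀ {u k V E}, G.Cut b d VA EA u k ∨ (∃ l, G.Cut a c VB EB u l ∧ (k + l + EP.card) % 2 = 1) → G.IsPath u d V E →
      E ⊆ M → E.card ≤ n → (E.card + k + EA.card) % 2 = 0 := by
  have hdis := B.disj
  have hdA := B.pathA.right_mem
  -- Vertices of `A` are labelled by their distance from `b` along `A`, vertices `u` of `B` by their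
  -- distance `l` from `a` along `B` plus `|P| + 1`, modulo 2. A path of `M` without inner vertices
  -- on `A ∪ B` changes the label by its length: by `hA` and `hB` if both ends are on the same path,
  -- by `odd_of_mixed` otherwise.
  have step : ∀ {u k m V E}, G.Cut b d VA EA u k ∨ (∃ l, G.Cut a c VB EB u l ∧ (k + l + EP.card) % 2 = 1) →
      m ∈ VA ∪ VB → u ≠ m → G.IsPath u m V E → E ⊆ M → (∀ v ∈ V, v ∈ VA ∪ VB → v = u ∨ v = m) →
      ∃ k', (G.Cut b d VA EA m k' ∨ ∃ l, G.Cut a c VB EB m l ∧ (k' + l + EP.card) % 2 = 1) ∧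
        (E.card + k + k') % 2 = 0 := by
    intro u k m V E hu hm hum p hE hV
    have pu := p.left_mem
    have pm := p.right_mem
    rcases Finset.mem_union.1 hm with hmA | hmB
    · have hmB := hdis m hmA
      rcases hu with hu | ⟨l, hu, hk⟩
      · have huA : u ∈ VA := by
          obtain ⟨V₀, E₀, V₁, E₁, p₀, p₁, h1, -⟩ := hu
          simp [h1, p₀.right_mem]
        have := hdis u huA
        obtain ⟨k', h, h'⟩ := hA hu hmA hum p hE (fun v hv hv' => hV v hv (by simp [hv']))
          (fun v hv hv' => by
            rcases hV v hv (by simp [hv']) with rfl | rfl <;> contradiction)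
        exact ⟨k', .inl h, h'⟩
      · obtain ⟨V₀, E₀, V₁, E₁, p₀, p₁, h1, h2, h3, rfl⟩ := hu
        obtain ⟨k', hc⟩ := B.pathA.exists_cut hmA
        refine ⟨k', .inl hc, ?_⟩
        obtain ⟨W₀, D₀, W₁, D₁, q₀, q₁, g1, g2, g3, rfl⟩ := hc
        have huB : u ∈ VB := by simp [h1, p₀.right_mem]
        have := F.odd_of_mixed B q₀ q₁ g1 g2 g3 p₀ p₁ h1 h2 h3 p.symm hE (by grind) (by grind)
        omega
    · have hmA : m ∉ VA := fun h => hdis m h hmB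
      rcases hu with hu | ⟨l, hu, hk⟩
      · obtain ⟨V₀, E₀, V₁, E₁, p₀, p₁, h1, h2, h3, rfl⟩ := hu
        obtain ⟨l, hc⟩ := B.pathB.exists_cut hmB
        refine ⟨l + EP.card + 1, .inr ⟨l, hc, by omega⟩, ?_⟩
        obtain ⟨W₀, D₀, W₁, D₁, q₀, q₁, g1, g2, g3, rfl⟩ := hc
        have huA : u ∈ VA := by simp [h1, p₀.right_mem]
        have := F.odd_of_mixed B p₀ p₁ h1 h2 h3 q₀ q₁ g1 g2 g3 p hE (by grind) (by grind)
        omega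
      · have huB : u ∈ VB := by
          obtain ⟨V₀, E₀, V₁, E₁, p₀, p₁, h1, -⟩ := hu
          simp [h1, p₀.right_mem]
        have : u ∉ VA := fun h => hdis u h huB
        obtain ⟨k', h, h'⟩ := hB hu hmB hum p hE (fun v hv hv' => hV v hv (by simp [hv']))
          (fun v hv hv' => by
            rcases hV v hv (by simp [hv']) with rfl | rfl <;> contradiction)
        exact ⟨k' + EP.card + 1, .inr ⟨k', h, by omega⟩, by omega⟩
  induction n using Nat.strong_induction_on with
  | _ n ih =>
  intro u k V E hu p hE hn
  by_cases hud : u = d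
  · subst hud
    rw [p.eq_singleton.2]
    rcases hu with ⟨V₀, E₀, V₁, E₁, p₀, p₁, h1, h2, h3, rfl⟩ |
      ⟨_, ⟨V₀, E₀, V₁, E₁, p₀, p₁, h1, h2, h3, rfl⟩, -⟩
    · rw [h2, p₁.eq_singleton.2]
      simp
      omega
    · exact absurd (by rw [h1]; simp [p₀.right_mem]) (hdis _ hdA)
  cases p with
  | nil => exact absurd rfl hud
  | @cons _ u' _ e V E h p hx =>
    -- Cut at the first return to `A ∪ B`. The first part is covered by `step`, the rest is shorter.
    obtain ⟨m, V₁, E₁, V₂, E₂, hm, p₁, p₂, rfl, rfl, h12, hd, hf⟩ :=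
      p.exists_first (X := VA ∪ VB) ⟨d, p.right_mem, by simp [hdA]⟩
    have m1 := p₁.right_mem
    have hc : (insert e (E₁ ∪ E₂)).card = (insert e E₁).card + E₂.card := by
      have : e ∉ E₁ ∪ E₂ := fun he => hx (p.mem_of_inc he h.inc_left)
      have := Finset.card_union_of_disjoint hd
      rw [Finset.card_insert_of_notMem (by grind), Finset.card_insert_of_notMem (by grind)]
      omega
    have h1 : 0 < (insert e E₁).card := Finset.card_pos.2 ⟨e, by simp⟩
    have hsub := hE
    rw [Finset.insert_subset_iff, Finset.union_subset_iff] at hsub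
    obtain ⟨k', hk', hp⟩ := step (m := m) hu hm (by rintro rfl; exact hx (by simp [m1]))
      (.cons h p₁ (by grind)) (Finset.insert_subset hsub.1 hsub.2.1) (by grind)
    have := ih _ (by omega : E₂.card < n) hk' p₂ hsub.2.2 le_rfl
    omega

/-- There are no bad pairs if `M` is sufficiently connected. -/
lemma not_bad (hL : ∀ k, ∃ V E, G.IsPath b d V E ∧ E ⊆ M ∧ E.card % 2 = k % 2)
    (hW : ∀ y, y ≠ b → y ≠ d → ∃ V E, G.IsPath b d V E ∧ E ⊆ M ∧ y ∉ V)
    (hb : ∃ V E, G.IsPath a d V E ∧ E ⊆ M ∧ b ∉ V) (hd : ∃ V E, G.IsPath c b V E ∧ E ⊆ M ∧ d ∉ V)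
    (hW' : a ≠ c → ∀ y, y ≠ a → y ≠ c → ∃ V E, G.IsPath a c V E ∧ E ⊆ M ∧ y ∉ V)
    (ha : a ≠ c → ∃ V E, G.IsPath b c V E ∧ E ⊆ M ∧ a ∉ V)
    (hc : a ≠ c → ∃ V E, G.IsPath d a V E ∧ E ⊆ M ∧ c ∉ V) :
    ¬ G.Bad w M a b c d EP ER VA EA VB EB := by
  intro B
  -- A path from `b` to `d` of the parity opposite to that of `A`; the label of `b` is `0`.
  obtain ⟨V, E, p, hE, hp⟩ := hL (EA.card + 1)
  have := F.card_mod_two B (F.exists_cut_of_ear B hW hb hd) (by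
    intro x z k VS ES hx hz hxz
    -- If `a = c`, then `B` is a single vertex and has no ears.
    by_cases hac : a = c
    · have h1 := B.pathB
      subst hac
      obtain ⟨V₀, E₀, V₁, E₁, p₀, p₁, h2, -⟩ := hx
      have hx : x ∈ VB := by simp [h2, p₀.right_mem]
      rw [h1.eq_singleton.1, Finset.mem_singleton] at hx hz
      exact absurd (hx.trans hz.symm) hxz
    · exact F.swap.exists_cut_of_ear B.swap (hW' hac) (ha hac) (hc hac) hx hz hxz) E.card
    (k := 0) (.inl ⟨_, _, _, _, .nil b, B.pathA, by simp [B.pathA.left_mem], by simp, by simp, rfl⟩)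
    p hE le_rfl
  omega

end Frame

end Linkage

end Graph

/-! ### Subgraphs built from an odd circuit by ears -/

namespace Graph

/-- A subgraph obtained from an odd circuit by adding ears. -/
inductive IsEarUnion {α β : Type*} [DecidableEq α] [DecidableEq β] (G : Graph α β) :
    Finset α → Finset β → Prop
  | circuit {V : Finset α} {C : Finset β} (h : G.IsCirc V C) (hC : C.card % 2 = 1) :
      IsEarUnion G V C
  | ear {V V' : Finset α} {N E : Finset β} {x y : α} (h : IsEarUnion G V N) (hx : x ∈ V)
      (hy : y ∈ V) (hxy : x ≠ y) (p : G.IsPath x y V' E) (hp : ∀ v ∈ V', v ∈ V → v = x ∨ v = y)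
      (hE : Disjoint E N) : IsEarUnion G (V ∪ V') (N ∪ E)

section EarUnion

variable {α β : Type*} [DecidableEq α] [DecidableEq β] {G : Graph α β} {w : Finset β → ZMod 2}
  {x y a b : α} {V V' V₁ V₂ : Finset α} {E E₁ E₂ N C F T : Finset β}

namespace IsEarUnion

lemma mem_of_inc {e : β} (h : G.IsEarUnion V N) (he : e ∈ N) (hx : G.Inc e x) : x ∈ V := by
  induction h with
  | circuit h hC => exact h.mem_of_inc he hx
  | ear h _ _ _ p hp _ ih =>
    rcases Finset.mem_union.1 he with he | he
    · exact Finset.mem_union_left _ (ih he)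
    · exact Finset.mem_union_right _ (p.mem_of_inc he hx)

lemma nonempty (h : G.IsEarUnion V N) : N.Nonempty := by
  induction h with
  | circuit h hC => exact h.nonempty
  | ear h _ _ _ p hp _ ih => exact ih.mono Finset.subset_union_left

lemma mem_of_isPath (h : G.IsEarUnion V N) (p : G.IsPath x y V' E) (hE : E ⊆ N) (hx : x ∈ V) :
    V' ⊆ V := by
  intro v hv
  by_cases hxy : x = y
  · subst hxy
    rw [p.eq_singleton.1, Finset.mem_singleton] at hv
    exact hv ▸ hx
  · obtain ⟨e, he, hi⟩ := p.exists_inc hxy hv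
    exact h.mem_of_inc (hE he) hi

/-- Any two vertices are joined by paths of both parities. -/
lemma exists_isPath_card (h : G.IsEarUnion V N) (ha : a ∈ V) (hb : b ∈ V) (hab : a ≠ b) (k : ℕ) :
    ∃ V' E, G.IsPath a b V' E ∧ E ⊆ N ∧ E.card % 2 = k % 2 := by
  induction h generalizing a b k with
  | circuit h hC =>
    -- The two arcs of an odd circuit have different parities.
    obtain ⟨V₁, E₁, V₂, E₂, p₁, p₂, hi, hd, rfl, rfl⟩ := h.exists_split ha hb hab
    rw [Finset.card_union_of_disjoint hd] at hC
    by_cases hk : E₁.card % 2 = k % 2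
    · exact ⟨_, _, p₁, Finset.subset_union_left, hk⟩
    · exact ⟨_, _, p₂, Finset.subset_union_right, by omega⟩
  | @ear V V' N E x y h hx hy hxy p hp hE ih =>
    have hxp := p.left_mem
    have hyp := p.right_mem
    -- one end on the ear
    have one : ∀ {a b : α} (k : ℕ), a ∈ V → b ∈ V' → b ∉ V →
        ∃ V'' E'', G.IsPath a b V'' E'' ∧ E'' ⊆ N ∪ E ∧ E''.card % 2 = k % 2 := by
      clear ha hb hab
      intro a b k ha hb hbV
      obtain ⟨W₀, D₀, W₁, D₁, q₀, q₁, rfl, rfl, hq, -⟩ := p.exists_split hb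
      have := q₀.left_mem
      have := q₁.right_mem
      -- Walk within `V` to an end of the ear other than `a`, with the parity that the remaining
      -- walk along the ear requires.
      by_cases hax : a = x
      · have hay : a ≠ y := by rintro rfl; exact hxy hax.symm
        obtain ⟨U, D, r, hr, hk⟩ := ih ha hy hay (k + D₁.card)
        have hU := h.mem_of_isPath r hr ha
        have hm : ∀ v ∈ U, v ∈ W₁ → v = y := by
          intro v hv hv'
          have := hU hv
          grind
        have := r.card_append q₁.symm hm
        exact ⟨_, _, r.append q₁.symm hm, by grind, by omega⟩
      · obtain ⟨U, D, r, hr, hk⟩ := ih ha hx hax (k + D₀.card)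
        have hU := h.mem_of_isPath r hr ha
        have hm : ∀ v ∈ U, v ∈ W₀ → v = x := by
          intro v hv hv'
          have := hU hv
          grind
        have := r.card_append q₀ hm
        exact ⟨_, _, r.append q₀ hm, by grind, by omega⟩
    have two : ∀ {a b : α} (k : ℕ) {W₀ W₁ D₀ D₁}, a ∈ V' → a ∉ V → b ∉ V → a ≠ b → b ∈ W₁ →
        G.IsPath x a W₀ D₀ → G.IsPath a y W₁ D₁ → V' = W₀ ∪ W₁ → E = D₀ ∪ D₁ →
        (∀ v ∈ W₀, v ∈ W₁ → v = a) →
        ∃ V'' E'', G.IsPath a b V'' E'' ∧ E'' ⊆ N ∪ E ∧ E''.card % 2 = k % 2 := by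
      clear ha hb hab
      intro a b k W₀ W₁ D₀ D₁ ha haV hbV hab hb q₀ q₁ hV' hE' hq
      obtain ⟨W₂, D₂, W₃, D₃, q₂, q₃, rfl, rfl, hq', -⟩ := q₁.exists_split hb
      -- Both vertices are on the ear, in the order `x`, `a`, `b`, `y`. Leave `a` towards `x`, cross
      -- `V` to `y` with the required parity, and return to `b`.
      obtain ⟨U, D, r, hr, hk⟩ := ih hx hy hxy (k + D₀.card + D₃.card)
      have hU := h.mem_of_isPath r hr hx
      have := q₀.left_mem
      have := q₃.right_mem
      have := q₂.left_mem
      have h1 : ∀ v ∈ W₀, v ∈ U → v = x := by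
        intro v hv hv'
        have := hU hv'
        grind
      have h2 : ∀ v ∈ W₀ ∪ U, v ∈ W₃ → v = y := by
        intro v hv hv'
        have := @hU v
        grind
      have := q₀.symm.card_append r h1
      have := (q₀.symm.append r h1).card_append q₃.symm h2
      exact ⟨_, _, (q₀.symm.append r h1).append q₃.symm h2, by grind, by omega⟩
    by_cases haV : a ∈ V <;> by_cases hbV : b ∈ V
    · obtain ⟨V'', E'', q, hq, hk⟩ := ih haV hbV hab k
      exact ⟨V'', E'', q, hq.trans Finset.subset_union_left, hk⟩
    · exact one k haV (by grind) hbV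
    · obtain ⟨V'', E'', q, hq, hk⟩ := one k hbV (by grind : a ∈ V') haV
      exact ⟨V'', E'', q.symm, hq, hk⟩
    · have ha' : a ∈ V' := by grind
      have hb' : b ∈ V' := by grind
      obtain ⟨W₀, D₀, W₁, D₁, q₀, q₁, h1, h2, hq, -⟩ := p.exists_split ha'
      by_cases hb1 : b ∈ W₁
      · exact two k ha' haV hbV hab hb1 q₀ q₁ h1 h2 hq
      · obtain ⟨W₂, D₂, W₃, D₃, q₂, q₃, rfl, rfl, hq', -⟩ := q₀.exists_split (by grind : b ∈ W₀)
        have := q₃.right_mem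
        obtain ⟨V'', E'', q, hq, hk⟩ := two k hb' hbV haV hab.symm (W₁ := W₃ ∪ W₁)
          (by grind) q₂ (q₃.append q₁ (by grind)) (by grind) (by grind) (by grind)
        exact ⟨V'', E'', q.symm, hq, hk⟩

/-- The subgraph remains connected if a vertex is removed. -/
lemma exists_isPath_notMem {z : α} (h : G.IsEarUnion V N) (ha : a ∈ V) (hb : b ∈ V)
    (haz : a ≠ z) (hbz : b ≠ z) : ∃ V' E, G.IsPath a b V' E ∧ E ⊆ N ∧ z ∉ V' := by
  by_cases hab : a = b
  · subst hab
    exact ⟨_, _, .nil a, by simp, by simpa using haz.symm⟩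
  induction h generalizing a b with
  | circuit h hC =>
    obtain ⟨V₁, E₁, V₂, E₂, p₁, p₂, hi, hd, rfl, rfl⟩ := h.exists_split ha hb hab
    by_cases hz : z ∈ V₁
    · exact ⟨_, _, p₂, Finset.subset_union_right, by grind⟩
    · exact ⟨_, _, p₁, Finset.subset_union_left, hz⟩
  | @ear V V' N E x y h hx hy hxy p hp hE ih =>
    have step : ∀ {a : α}, a ∈ V ∪ V' → a ≠ z → ∃ u V'' E'', u ∈ V ∧ G.IsPath a u V'' E'' ∧
        E'' ⊆ N ∪ E ∧ z ∉ V'' := by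
      intro a ha haz
      by_cases haV : a ∈ V
      · exact ⟨a, _, _, haV, .nil a, by simp, by simpa using haz.symm⟩
      · obtain ⟨W₀, D₀, W₁, D₁, q₀, q₁, rfl, rfl, hq, -⟩ := p.exists_split (by grind : a ∈ V')
        by_cases hz : z ∈ W₁
        · exact ⟨x, _, _, hx, q₀.symm, by grind, by grind⟩
        · exact ⟨y, _, _, hy, q₁, by grind, hz⟩
    obtain ⟨u, U₁, D₁, hu, q₁, hD₁, hz₁⟩ := step ha haz
    obtain ⟨v, U₂, D₂, hv, q₂, hD₂, hz₂⟩ := step hb hbz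
    have hq : ∃ U D, G.IsPath u v U D ∧ D ⊆ N ∧ z ∉ U := by
      have huz : u ≠ z := by rintro rfl; exact hz₁ q₁.right_mem
      have hvz : v ≠ z := by rintro rfl; exact hz₂ q₂.right_mem
      by_cases huv : u = v
      · subst huv
        exact ⟨_, _, .nil u, by simp, by simpa using huz.symm⟩
      · exact ih hu hv huz hvz huv
    obtain ⟨U₃, D₃, q₃, hD₃, hz₃⟩ := hq
    obtain ⟨U₄, D₄, q₄, hU₄, hD₄⟩ := q₁.exists_trans q₃
    obtain ⟨U₅, D₅, q₅, hU₅, hD₅⟩ := q₄.exists_trans q₂.symm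
    exact ⟨_, _, q₅, by grind, by grind⟩

/-- A circuit that is not within an ear union uses all of an added ear. -/
lemma exists_isPath_of_isCirc (h : G.IsEarUnion V N) (hx : x ∈ V) (hy : y ∈ V) (hxy : x ≠ y)
    (p : G.IsPath x y V₁ E) (hp : ∀ v ∈ V₁, v ∈ V → v = x ∨ v = y) (hE : Disjoint E N)
    (hC : G.IsCirc V₂ C) (hCN : C ⊆ N ∪ E) :
    C ⊆ N ∨ ∃ W T, G.IsPath x y W T ∧ T ⊆ N ∧ C = T ∪ E ∧ C.card = T.card + E.card := by
  rcases p.subset_or_disjoint (K := C) (fun z _ => hC.degPar_eq) (by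
    intro z hz hzx hzy g hg hgz
    rcases Finset.mem_union.1 (hCN hg) with h' | h'
    · have := hp z hz (h.mem_of_inc h' hgz)
      tauto
    · exact h') with hEC | hEC
  · right
    -- If the circuit contains the ear, then it passes through `x` and `y`, and the ear is one of
    -- its two arcs between them; the other arc lies in `N`.
    obtain ⟨e, he, hex⟩ := p.exists_inc hxy p.left_mem
    obtain ⟨f, hf, hfy⟩ := p.exists_inc hxy p.right_mem
    obtain ⟨W₁, T₁, W₂, T₂, q₁, q₂, hi, hd, rfl, rfl⟩ :=
      hC.exists_split (hC.mem_of_inc (hEC he) hex) (hC.mem_of_inc (hEC hf) hfy) hxy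
    have hcard := Finset.card_union_of_disjoint hd
    rcases IsPath.eq_or_eq_of_isCirc hd hC q₁ p hxy hEC with rfl | rfl
    · refine ⟨W₂, T₂, q₂, ?_, Finset.union_comm _ _, by omega⟩
      intro g hg
      have := hCN (Finset.mem_union_right _ hg)
      have := Finset.disjoint_right.1 hd hg
      grind
    · refine ⟨W₁, T₁, q₁, ?_, rfl, hcard⟩
      intro g hg
      have := hCN (Finset.mem_union_left _ hg)
      have := Finset.disjoint_left.1 hd hg
      grind
  · left
    intro g hg
    have := hCN hg
    have := Finset.disjoint_right.1 hEC hg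
    grind

/-- A function that sums to zero on the even circuits sums to zero on all circuits, up to a
constant. -/
lemma exists_sum_eq_zero {f : β → ZMod 2} (h : G.IsEarUnion V N)
    (hf : ∀ V' C, G.IsCirc V' C → C ⊆ N → C.card % 2 = 0 → ∑ e ∈ C, f e = 0) :
    ∃ c, ∀ V' C, G.IsCirc V' C → C ⊆ N → ∑ e ∈ C, (f e + c) = 0 := by
  have hsum : ∀ (C : Finset β) (c : ZMod 2), ∑ e ∈ C, (f e + c) = ∑ e ∈ C, f e + C.card * c := by
    intro C c
    rw [Finset.sum_add_distrib, Finset.sum_const, nsmul_eq_mul]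
  have hev : ∀ (C : Finset β), C.card % 2 = 0 → (C.card : ZMod 2) = 0 := fun C hC =>
    (ZMod.natCast_eq_zero_iff _ _).2 (Nat.dvd_of_mod_eq_zero hC)
  induction h with
  | @circuit V C h hC =>
    -- The only circuit is `C`. Its length is odd, so adding the constant `∑ e ∈ C, f e` to `f`
    -- changes the sum over `C` by exactly this amount.
    refine ⟨∑ e ∈ C, f e, fun V' C' hC' hs => ?_⟩
    rw [h.eq_of_subset hC' hs, hsum, (ZMod.natCast_eq_one_iff_odd).2 (Nat.odd_iff.2 hC), one_mul]
    exact CharTwo.add_self_eq_zero _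
  | @ear V V' N E x y h hx hy hxy p hp hE ih =>
    obtain ⟨c, hc⟩ := ih fun V' C hC hs => hf V' C hC (hs.trans Finset.subset_union_left)
    refine ⟨c, fun V'' C hC hs => ?_⟩
    rcases h.exists_isPath_of_isCirc hx hy hxy p hp hE hC hs with hs | ⟨W, T, q, hT, rfl, hk⟩
    · exact hc _ _ hC hs
    · obtain ⟨U, D, r, hD, hpar⟩ := h.exists_isPath_card hx hy hxy E.card
      have hU := h.mem_of_isPath r hD hx
      have hdE : ∀ {T}, T ⊆ N → Disjoint T E := fun hT =>
        Finset.disjoint_of_subset_left hT hE.symm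
      have hne : D ≠ E := by
        rintro rfl
        exact (p.edges_nonempty hxy).ne_empty (Finset.disjoint_self_iff_empty _ |>.1 (hdE hD))
      have hDC := r.isCirc p hxy (fun v hv hv' => hp v hv' (hU hv)) hne
      have heven : (D ∪ E).card % 2 = 0 := by
        rw [Finset.card_union_of_disjoint (hdE hD)]; omega
      have h1 := hf _ _ hDC (by grind) heven
      have h2 : ∑ e ∈ D ∪ E, (f e + c) = 0 := by rw [hsum, h1, hev _ heven]; simp
      rw [Finset.sum_union (hdE hD)] at h2
      rw [Finset.sum_union (hdE hT), sum_eq_of_isPath hc q r hT hD, h2]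

/-- An ear union is properly within a larger one, or each circuit lies within it or avoids it. -/
lemma exists_ear (h : G.IsEarUnion V N) (hC : G.IsCirc V₂ C) (hCN : ¬ C ⊆ N)
    (hd : ¬ Disjoint C N) : ∃ V' E, G.IsEarUnion (V ∪ V') (N ∪ E) ∧ E ⊆ C ∧ ¬ E ⊆ N := by
  obtain ⟨g, hg, hgN⟩ := Finset.not_subset.1 hCN
  obtain ⟨f, hf, hfN⟩ := Finset.not_disjoint_iff.1 hd
  obtain ⟨s, t, hl, hs, ht, hst⟩ := hC.exists_isLink hf
  have hsV := h.mem_of_inc hfN hl.inc_left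
  have htV := h.mem_of_inc hfN hl.inc_right
  -- `C` without `g` is a path. With its first and last vertices `m₁`, `m₂` on `V`, the arc of `C`
  -- through `g` between them is the new ear.
  obtain ⟨u, v, E, huv, hgl, p, hgE, rfl⟩ := hC.exists_path hg
  obtain ⟨m₁, W₁, D₁, W₂, D₂, hm₁, p₁, p₂, rfl, rfl, h12, hd12, hf1⟩ :=
    p.exists_first (X := V) ⟨s, hs, hsV⟩
  obtain ⟨m₂, W₃, D₃, W₄, D₄, hm₂, p₃, p₄, rfl, rfl, h34, hd34, hf4⟩ :=
    p₂.exists_last (X := V) ⟨m₁, p₂.left_mem, hm₁⟩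
  have i1 := p₁.left_mem
  have i2 := p₄.right_mem
  have i3 := p₃.left_mem
  have i4 := p₃.right_mem
  have i5 := p₄.left_mem
  -- The ends `s`, `t` of the edge `f` are two vertices of `C` on `V`, and only `m₁` would be one if
  -- `m₁ = m₂`.
  have hne : m₁ ≠ m₂ := by
    rintro rfl
    have := p₃.eq_singleton.1
    grind
  have huW : u ∉ W₄ := by
    intro hu
    have := h12 u i1 (by simp [hu])
    have := h34 m₁ i3
    grind
  have c := IsPath.cons hgl p₄.symm huW
  have q := p₁.symm.append c (by
    intro v hv hv'
    have := h12 v hv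
    have := h34 v
    grind)
  refine ⟨_, _, .ear h hm₁ hm₂ hne q ?_ ?_, ?_, ?_⟩
  · intro v hv hvV
    have := hf1 v
    have := hf4 v
    grind
  · have hinner : ∀ {e z}, G.Inc e z → z ∉ V → e ∉ N := fun hi hz he => hz (h.mem_of_inc he hi)
    rw [Finset.disjoint_left]
    intro e he heN
    rcases Finset.mem_union.1 he with he | he
    · obtain ⟨z, z', hl, hz, hz', hzz⟩ := p₁.exists_isLink he
      exact hzz ((hf1 z hz (h.mem_of_inc heN hl.inc_left)).trans
        (hf1 z' hz' (h.mem_of_inc heN hl.inc_right)).symm)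
    · rcases Finset.mem_insert.1 he with rfl | he
      · exact hgN heN
      · obtain ⟨z, z', hl, hz, hz', hzz⟩ := p₄.exists_isLink he
        exact hzz ((hf4 z hz (h.mem_of_inc heN hl.inc_left)).trans
          (hf4 z' hz' (h.mem_of_inc heN hl.inc_right)).symm)
  · grind
  · intro hs
    exact hgN (hs (by simp))

end IsEarUnion

end EarUnion

end Graph

/-! ### Potentials: bipartite case and normalization -/

namespace Graph

section Potential

variable {α β : Type*} [DecidableEq α] [DecidableEq β] {G : Graph α β} {w : Finset β → ZMod 2}
  {x y a b c d : α} {V V' V₁ V₂ VP VR : Finset α} {E E₁ E₂ N C F T EP ER L : Finset β} {e₀ f₀ : β}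

/-- The three relations between the weights of the even circuits. -/
structure Rels (G : Graph α β) (w : Finset β → ZMod 2) : Prop where
  theta : G.ThetaRel w
  k4 : G.K4Rel w
  delta : G.DeltaRel w

/-- In each relation every edge lies in an even number of the circuits involved, so the sums of `f`
cancel. -/
lemma Rels.add_sum (h : G.Rels w) (f : β → ZMod 2) : G.Rels fun C => w C + ∑ e ∈ C, f e := by
  have two : ∀ p : ZMod 2, p + p = 0 := by decide
  constructor
  · intro x y V₁ E₁ V₂ E₂ V₃ E₃ hxy p₁ p₂ p₃ i₁ i₂ i₃ n₁ n₂ n₃ k₁ k₂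
    have key := h.theta hxy p₁ p₂ p₃ i₁ i₂ i₃ n₁ n₂ n₃ k₁ k₂
    beta_reduce
    rw [Finset.sum_union ((p₁.eq_or_disjoint p₂ i₁).resolve_left n₁),
      Finset.sum_union ((p₁.eq_or_disjoint p₃ i₂).resolve_left n₂),
      Finset.sum_union ((p₂.eq_or_disjoint p₃ i₃).resolve_left n₃)]
    linear_combination key + two (∑ e ∈ E₁, f e) + two (∑ e ∈ E₂, f e) + two (∑ e ∈ E₃, f e)
  · intro x y z t VA EA VB EB VC EC VD ED VS ES VT ET n₁ n₂ n₃ n₄ n₅ n₆ pA pB pC pD pS pT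
      hAB hBC hCD hDA hAC hBD hSA hSB hSC hSD hTA hTB hTC hTD hST k₁ k₂ k₃
    have key := h.k4 n₁ n₂ n₃ n₄ n₅ n₆ pA pB pC pD pS pT
      hAB hBC hCD hDA hAC hBD hSA hSB hSC hSD hTA hTB hTC hTD hST k₁ k₂ k₃
    have d₁ := pA.disjoint_edges pB hAB
    have d₂ := pB.disjoint_edges pC hBC
    have d₃ := pC.disjoint_edges pD hCD
    have d₄ := (pD.disjoint_edges pA hDA).symm
    have d₅ := pA.disjoint_edges pC (m := x) (fun v h h' => absurd h' (hAC v h))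
    have d₆ := pB.disjoint_edges pD (m := x) (fun v h h' => absurd h' (hBD v h))
    have d₇ := pS.disjoint_edges pA hSA
    have d₈ := pS.disjoint_edges pB hSB
    have d₉ := pS.disjoint_edges pC hSC
    have d₁₀ := pS.disjoint_edges pD hSD
    have d₁₁ := pT.disjoint_edges pA hTA
    have d₁₂ := pT.disjoint_edges pB hTB
    have d₁₃ := pT.disjoint_edges pC hTC
    have d₁₄ := pT.disjoint_edges pD hTD
    have d₁₅ := pS.disjoint_edges pT (m := x) (fun v h h' => absurd h' (hST v h))
    have su : ∀ {A B C D : Finset β}, Disjoint A B → Disjoint A C → Disjoint A D → Disjoint B C →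
        Disjoint B D → Disjoint C D → ∑ e ∈ A ∪ B ∪ C ∪ D, f e =
          ∑ e ∈ A, f e + ∑ e ∈ B, f e + ∑ e ∈ C, f e + ∑ e ∈ D, f e := by
      intro A B C D h1 h2 h3 h4 h5 h6
      rw [Finset.sum_union (by simp only [Finset.disjoint_union_left]; exact ⟨⟨h3, h5⟩, h6⟩),
        Finset.sum_union (Finset.disjoint_union_left.2 ⟨h2, h4⟩), Finset.sum_union h1]
    beta_reduce
    rw [su d₁ d₅ d₄ d₂ d₆ d₃, su d₁₅ d₇ d₉ d₁₁ d₁₃ d₅, su d₁₅ d₈ d₁₀ d₁₂ d₁₄ d₆]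
    linear_combination key + two (∑ e ∈ EA, f e) + two (∑ e ∈ EB, f e) + two (∑ e ∈ EC, f e) +
      two (∑ e ∈ ED, f e) + two (∑ e ∈ ES, f e) + two (∑ e ∈ ET, f e)
  · intro s₁ t₁ s₂ t₂ s₃ t₃ VP₁ P₁ VQ₁ Q₁ VP₂ P₂ VQ₂ Q₂ VP₃ P₃ VQ₃ Q₃ VJ₁ J₁ VJ₂ J₂ VJ₃ J₃
      m₁ m₂ m₃ m₄ m₅ m₆ m₇ m₈ m₉ o₁ o₂ o₃ p₁ q₁ p₂ q₂ p₃ q₃ j₁ j₂ j₃ i₁ i₂ i₃ c₁₂ c₂₃ c₃₁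
      u₁ u₂ u₃ u₄ u₅ u₆ u₇ u₈ u₉ v₁ v₂ v₃ k₁ k₂ k₃ k₄
    have key := h.delta m₁ m₂ m₃ m₄ m₅ m₆ m₇ m₈ m₉ o₁ o₂ o₃ p₁ q₁ p₂ q₂ p₃ q₃ j₁ j₂ j₃ i₁ i₂ i₃
      c₁₂ c₂₃ c₃₁ u₁ u₂ u₃ u₄ u₅ u₆ u₇ u₈ u₉ v₁ v₂ v₃ k₁ k₂ k₃ k₄
    simp only [Finset.mem_union] at c₁₂ c₂₃ c₃₁ u₁ u₂ u₃ u₄ u₅ u₆ u₇ u₈ u₉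
    have dis : ∀ {x y x' y' m : α} {V V' : Finset α} {E E' : Finset β}, G.IsPath x y V E →
        G.IsPath x' y' V' E' → (∀ v ∈ V, v ∈ V' → v = m) → Disjoint E E' :=
      fun p q h => p.disjoint_edges q h
    have a₁ := dis p₁ p₂ fun v h h' => (c₁₂ v (.inl h) (.inl h')).1
    have a₂ := dis p₁ q₂ fun v h h' => (c₁₂ v (.inl h) (.inr h')).1
    have a₃ := dis q₁ p₂ fun v h h' => (c₁₂ v (.inr h) (.inl h')).1
    have a₄ := dis q₁ q₂ fun v h h' => (c₁₂ v (.inr h) (.inr h')).1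
    have a₅ := dis p₂ p₃ fun v h h' => (c₂₃ v (.inl h) (.inl h')).1
    have a₆ := dis p₂ q₃ fun v h h' => (c₂₃ v (.inl h) (.inr h')).1
    have a₇ := dis q₂ p₃ fun v h h' => (c₂₃ v (.inr h) (.inl h')).1
    have a₈ := dis q₂ q₃ fun v h h' => (c₂₃ v (.inr h) (.inr h')).1
    have a₉ := dis p₁ p₃ fun v h h' => (c₃₁ v (.inl h') (.inl h)).1
    have a₁₀ := dis p₁ q₃ fun v h h' => (c₃₁ v (.inr h') (.inl h)).1
    have a₁₁ := dis q₁ p₃ fun v h h' => (c₃₁ v (.inl h') (.inr h)).1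
    have a₁₂ := dis q₁ q₃ fun v h h' => (c₃₁ v (.inr h') (.inr h)).1
    have b₁ := dis p₁ j₁ fun v h h' => u₁ v (.inl h) h'
    have b₂ := dis q₁ j₁ fun v h h' => u₁ v (.inr h) h'
    have b₃ := dis p₁ j₃ fun v h h' => u₂ v (.inl h) h'
    have b₄ := dis q₁ j₃ fun v h h' => u₂ v (.inr h) h'
    have b₅ := dis (m := s₁) p₁ j₂ fun v h h' => absurd h' (u₃ v (.inl h))
    have b₆ := dis (m := s₁) q₁ j₂ fun v h h' => absurd h' (u₃ v (.inr h))
    have b₇ := dis p₂ j₂ fun v h h' => u₄ v (.inl h) h'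
    have b₈ := dis q₂ j₂ fun v h h' => u₄ v (.inr h) h'
    have b₉ := dis p₂ j₁ fun v h h' => u₅ v (.inl h) h'
    have b₁₀ := dis q₂ j₁ fun v h h' => u₅ v (.inr h) h'
    have b₁₁ := dis (m := s₁) p₂ j₃ fun v h h' => absurd h' (u₆ v (.inl h))
    have b₁₂ := dis (m := s₁) q₂ j₃ fun v h h' => absurd h' (u₆ v (.inr h))
    have b₁₃ := dis p₃ j₃ fun v h h' => u₇ v (.inl h) h'
    have b₁₄ := dis q₃ j₃ fun v h h' => u₇ v (.inr h) h'
    have b₁₅ := dis p₃ j₂ fun v h h' => u₈ v (.inl h) h'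
    have b₁₆ := dis q₃ j₂ fun v h h' => u₈ v (.inr h) h'
    have b₁₇ := dis (m := s₁) p₃ j₁ fun v h h' => absurd h' (u₉ v (.inl h))
    have b₁₈ := dis (m := s₁) q₃ j₁ fun v h h' => absurd h' (u₉ v (.inr h))
    have e₁ := dis (m := s₁) j₁ j₂ fun v h h' => absurd h' (v₁ v h)
    have e₂ := dis (m := s₁) j₂ j₃ fun v h h' => absurd h' (v₂ v h)
    have e₃ := dis (m := s₁) j₁ j₃ fun v h h' => absurd h (v₃ v h')
    have sj : ∑ e ∈ J₁ ∪ J₂ ∪ J₃, f e = ∑ e ∈ J₁, f e + ∑ e ∈ J₂, f e + ∑ e ∈ J₃, f e := by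
      rw [Finset.sum_union (Finset.disjoint_union_left.2 ⟨e₃, e₂⟩), Finset.sum_union e₁]
    have su : ∀ {A B C : Finset β}, Disjoint A B → Disjoint A C → Disjoint B C →
        Disjoint A (J₁ ∪ J₂ ∪ J₃) → Disjoint B (J₁ ∪ J₂ ∪ J₃) → Disjoint C (J₁ ∪ J₂ ∪ J₃) →
        ∑ e ∈ A ∪ B ∪ C ∪ (J₁ ∪ J₂ ∪ J₃), f e =
          ∑ e ∈ A, f e + ∑ e ∈ B, f e + ∑ e ∈ C, f e + ∑ e ∈ J₁ ∪ J₂ ∪ J₃, f e := by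
      intro A B C h1 h2 h3 h4 h5 h6
      rw [Finset.sum_union (by simp only [Finset.disjoint_union_left]; exact ⟨⟨h4, h5⟩, h6⟩),
        Finset.sum_union (Finset.disjoint_union_left.2 ⟨h2, h3⟩), Finset.sum_union h1]
    have dj : ∀ {A : Finset β}, Disjoint A J₁ → Disjoint A J₂ → Disjoint A J₃ →
        Disjoint A (J₁ ∪ J₂ ∪ J₃) := fun h1 h2 h3 => by
      simp only [Finset.disjoint_union_right]; exact ⟨⟨h1, h2⟩, h3⟩
    beta_reduce
    rw [su a₁ a₉ a₅ (dj b₁ b₅ b₃) (dj b₉ b₇ b₁₁) (dj b₁₇ b₁₅ b₁₃),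
      su a₂ a₁₀ a₈ (dj b₁ b₅ b₃) (dj b₁₀ b₈ b₁₂) (dj b₁₈ b₁₆ b₁₄),
      su a₃ a₁₂ a₆ (dj b₂ b₆ b₄) (dj b₉ b₇ b₁₁) (dj b₁₈ b₁₆ b₁₄),
      su a₄ a₁₁ a₇ (dj b₂ b₆ b₄) (dj b₁₀ b₈ b₁₂) (dj b₁₇ b₁₅ b₁₃)]
    linear_combination key + two (∑ e ∈ P₁, f e) + two (∑ e ∈ P₂, f e) + two (∑ e ∈ P₃, f e) +
      two (∑ e ∈ Q₁, f e) + two (∑ e ∈ Q₂, f e) + two (∑ e ∈ Q₃, f e) +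
      2 * two (∑ e ∈ J₁ ∪ J₂ ∪ J₃, f e)

/-- The weights of the even circuits within `F` are the sums of an edge function. -/
def HasPotential (G : Graph α β) (w : Finset β → ZMod 2) (F : Finset β) : Prop :=
  ∃ f : β → ZMod 2, ∀ V C, G.IsCirc V C → C ⊆ F → C.card % 2 = 0 → w C = ∑ e ∈ C, f e

lemma HasPotential.of_add_sum {f : β → ZMod 2}
    (h : G.HasPotential (fun C => w C + ∑ e ∈ C, f e) F) : G.HasPotential w F := by
  obtain ⟨g, hg⟩ := h
  refine ⟨fun e => g e + f e, fun V C hC hs hk => ?_⟩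
  have := hg V C hC hs hk
  rw [Finset.sum_add_distrib, ← this, add_assoc, CharTwo.add_self_eq_zero, add_zero]

lemma hasPotential_of_const {κ : ZMod 2} {e : β}
    (h₀ : ∀ V C, G.IsCirc V C → C ⊆ F → C.card % 2 = 0 → e ∉ C → w C = 0)
    (h₁ : ∀ V C, G.IsCirc V C → C ⊆ F → C.card % 2 = 0 → e ∈ C → w C = κ) :
    G.HasPotential w F := by
  refine ⟨fun g => if g = e then κ else 0, fun V C hC hs hk => ?_⟩
  rw [Finset.sum_ite_eq']
  split_ifs with he
  · exact h₁ V C hC hs hk he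
  · exact h₀ V C hC hs hk he

/-- Adding a potential of `E` to the weights preserves the relations and makes the weights vanish on
`E`. So zero weights on `E` may be assumed. -/
lemma HasPotential.normalize (h : G.HasPotential w E) (hw : G.Rels w)
    (H : ∀ w', G.Rels w' → (∀ V C, G.IsCirc V C → C ⊆ E → C.card % 2 = 0 → w' C = 0) →
      G.HasPotential w' F) : G.HasPotential w F := by
  obtain ⟨f, hf⟩ := h
  refine .of_add_sum (H _ (hw.add_sum f) fun V C hC hs hk => ?_)
  rw [hf V C hC hs hk]
  exact CharTwo.add_self_eq_zero _

lemma IsPath.subset_or_disjoint_of_inc (p : G.IsPath x y V E) (hC : G.IsCirc V' C) (hCL : C ⊆ L ∪ E)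
    (hL : ∀ g ∈ L, ∀ v, G.Inc g v → v ∈ V → v = x ∨ v = y) : E ⊆ C ∨ Disjoint E C := by
  refine p.subset_or_disjoint (fun z _ => hC.degPar_eq) fun z hz hzx hzy g hg hgz => ?_
  rcases Finset.mem_union.1 (hCL hg) with h | h
  · have := hL g h z hgz hz
    tauto
  · exact h

/-- A subgraph without odd circuits. -/
lemma hasPotential_of_bipartite {e : β} (hw : G.Rels w)
    (hF : ∀ V C, G.IsCirc V C → C ⊆ F → C.card % 2 = 0)
    (h : G.HasPotential w (F.erase e)) : G.HasPotential w F := by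
  refine h.normalize hw fun w hw h₀ => ?_
  -- A circuit through `e` is a path between the ends of `e`, closed by `e`. When a segment of the
  -- path is exchanged, the two segments and the rest form a theta graph, which has even circuits
  -- only. The circuit of the two segments avoids `e` and has weight zero, so the weight does not
  -- change.
  have key : ∀ V C V' C', G.IsCirc V C → C ⊆ F → e ∈ C → G.IsCirc V' C' → C' ⊆ F → e ∈ C' →
      w C = w C' := by
    intro V C V' C' hC hCF he hC' hCF' he'
    obtain ⟨x, y, E, hxy, hl, p, heE, rfl⟩ := hC.exists_path he
    obtain ⟨x', y', E', -, hl', p', heE', rfl⟩ := hC'.exists_path he'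
    have hp' : G.IsPath x y V' E' := by
      rcases hl.eq_and_eq_or_eq_and_eq hl' with ⟨rfl, rfl⟩ | ⟨rfl, rfl⟩
      · exact p'
      · exact p'.symm
    refine eq_of_exchange (N := F.erase e) (h := fun E => w (insert e E)) ?_ p hp'
      (by grind) (by grind)
    intro s t V₀ E₀ V₁ E₁ V₁' E₁' V₂ E₂ p₀ p₁ p₁' p₂ hst hne h1 h2 h3 h4 h5 h6 n₀ n₁ n₁' n₂
    have hxs := p₀.left_mem
    have hyt := p₂.right_mem
    have he₀ : e ∉ E₀ := fun h => by simpa using n₀ h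
    have he₁ : e ∉ E₁ := fun h => by simpa using n₁ h
    have he₁' : e ∉ E₁' := fun h => by simpa using n₁' h
    have he₂ : e ∉ E₂ := fun h => by simpa using n₂ h
    have q₁ := p₀.symm.append (IsPath.single hl hxy) (by grind)
    have q := q₁.append p₂.symm (by grind)
    have i₁ : ∀ v ∈ V₁, v ∈ V₀ ∪ {x, y} ∪ V₂ → v = s ∨ v = t := by
      have := p₁.left_mem
      have := p₁.right_mem
      grind
    have i₂ : ∀ v ∈ V₁', v ∈ V₀ ∪ {x, y} ∪ V₂ → v = s ∨ v = t := by grind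
    have g₁ : E₁ ≠ E₀ ∪ {e} ∪ E₂ := by
      intro h
      have := Finset.ext_iff.1 h e
      grind
    have g₂ : E₁' ≠ E₀ ∪ {e} ∪ E₂ := by
      intro h
      have := Finset.ext_iff.1 h e
      grind
    obtain ⟨_, c₁, k₁⟩ := IsCirc.of_theta p₁ p₁' hst h4 hne
    obtain ⟨_, c₂, k₂⟩ := IsCirc.of_theta p₁ q hst i₁ g₁
    have heF : e ∈ F := hCF he
    have nF : E₀ ∪ {e} ∪ E₂ ⊆ F := by grind
    have nF₁ : E₁ ⊆ F := n₁.trans (Finset.erase_subset _ _)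
    have nF₁' : E₁' ⊆ F := n₁'.trans (Finset.erase_subset _ _)
    have z₁ := hF _ _ c₁ (Finset.union_subset nF₁ nF₁')
    have z₂ := hF _ _ c₂ (Finset.union_subset nF₁ nF)
    have key := hw.theta hst p₁ p₁' q h4 i₁ i₂ hne g₁ g₂ (by omega) (by omega)
    rw [h₀ _ _ c₁ (Finset.union_subset n₁ n₁') z₁, zero_add] at key
    have e₁ : insert e (E₀ ∪ E₁ ∪ E₂) = E₁ ∪ (E₀ ∪ {e} ∪ E₂) := by grind
    have e₂ : insert e (E₀ ∪ E₁' ∪ E₂) = E₁' ∪ (E₀ ∪ {e} ∪ E₂) := by grind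
    change w (insert e (E₀ ∪ E₁ ∪ E₂)) = w (insert e (E₀ ∪ E₁' ∪ E₂))
    rw [e₁, e₂]
    exact CharTwo.add_eq_zero.1 key
  by_cases hex : ∃ V C, G.IsCirc V C ∧ C ⊆ F ∧ e ∈ C
  · obtain ⟨V, C, hC, hCF, he⟩ := hex
    refine hasPotential_of_const (e := e) (κ := w C) (fun V' C' hC' hs hk he' => ?_)
      fun V' C' hC' hs _ he' => key _ _ _ _ hC' hs he' hC hCF he
    exact h₀ V' C' hC' (fun g hg => Finset.mem_erase.2 ⟨by rintro rfl; exact he' hg, hs hg⟩) hk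
  · push Not at hex
    refine hasPotential_of_const (e := e) (κ := 0) (fun V' C' hC' hs hk he' => ?_)
      fun V' C' hC' hs _ he' => absurd he' (hex _ _ hC' hs)
    exact h₀ V' C' hC' (fun g hg => Finset.mem_erase.2 ⟨by rintro rfl; exact he' hg, hs hg⟩) hk

/-- The even circuits through an ear have the same weight, if those avoiding it have weight zero. -/
lemma IsEarUnion.exists_const (h : G.IsEarUnion V N) (hx : x ∈ V) (hy : y ∈ V) (hxy : x ≠ y)
    (p : G.IsPath x y V₁ E) (hp : ∀ v ∈ V₁, v ∈ V → v = x ∨ v = y) (hE : Disjoint E N)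
    (h₀ : ∀ V C, G.IsCirc V C → C ⊆ N → C.card % 2 = 0 → w C = 0) (hN : G.HasPotential w (N ∪ E)) :
    ∃ κ, ∀ V C, G.IsCirc V C → C ⊆ N ∪ E → C.card % 2 = 0 → ¬ C ⊆ N → w C = κ := by
  obtain ⟨f, hf⟩ := hN
  -- The potential `f` sums to zero over the even circuits of `N`, so `f + c` sums to zero over all
  -- of them, and the sums of `f + c` over paths of `N` depend on the ends only. On an even circuit
  -- the summand `c` does not count.
  obtain ⟨c, hc⟩ := h.exists_sum_eq_zero (f := f) fun V' C hC hs hk => by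
    rw [← hf V' C hC (hs.trans Finset.subset_union_left) hk, h₀ V' C hC hs hk]
  obtain ⟨U, D, r, hD, -⟩ := h.exists_isPath_card hx hy hxy 0
  refine ⟨∑ e ∈ D, (f e + c) + ∑ e ∈ E, (f e + c), fun V' C hC hs hk hCN => ?_⟩
  rcases h.exists_isPath_of_isCirc hx hy hxy p hp hE hC hs with hs' | ⟨W, T, q, hT, rfl, -⟩
  · exact absurd hs' hCN
  · have h1 : ∑ e ∈ T ∪ E, (f e + c) = w (T ∪ E) := by
      rw [Finset.sum_add_distrib, Finset.sum_const, nsmul_eq_mul,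
        (ZMod.natCast_eq_zero_iff _ _).2 (Nat.dvd_of_mod_eq_zero hk), zero_mul, add_zero,
        hf _ _ hC hs hk]
    rw [← h1, Finset.sum_union (Finset.disjoint_of_subset_left hT hE.symm),
      sum_eq_of_isPath hc q r hT hD]

end Potential

end Graph

/-! ### The last two ears -/

namespace Graph

section Potential

variable {α β : Type*} [DecidableEq α] [DecidableEq β] {G : Graph α β} {w : Finset β → ZMod 2}
  {x y a b c d : α} {V V' V₁ V₂ VP VR VA VB Vq Vr VR₁ VR₂ VR₃ : Finset α}
  {E E₁ E₂ N C F T EP ER EA EB Eq Er ER₁ ER₂ ER₃ : Finset β} {e₀ f₀ : β}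

/-- A path contains no circuit, so `sum_eq_of_isPath` applies to every edge function, in particular
to the indicator function of one edge. -/
lemma IsPath.eq_of_subset_of_subset (h : G.IsPath x y V E) (p : G.IsPath a b V₁ E₁)
    (q : G.IsPath a b V₂ E₂) (hp : E₁ ⊆ E) (hq : E₂ ⊆ E) : E₁ = E₂ := by
  ext e
  have := sum_eq_of_isPath (N := E) (f := fun g => if g = e then 1 else 0)
    (fun V C hC hCE => absurd hCE (h.not_isCirc hC)) p q hp hq
  rw [Finset.sum_ite_eq', Finset.sum_ite_eq'] at this
  split_ifs at this <;> simp_all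

/-- A path that contains the path `R` consists of `R` and two disjoint paths. -/
lemma IsPath.exists_linkage (h : G.IsPath x y V E) (pR : G.IsPath c d VR ER) (hcd : c ≠ d)
    (hR : ER ⊆ E) : ∃ V₀ E₀ V₁ E₁, (G.IsPath x d V₀ E₀ ∧ G.IsPath c y V₁ E₁ ∨
      G.IsPath x c V₀ E₀ ∧ G.IsPath d y V₁ E₁) ∧ E = E₀ ∪ ER ∪ E₁ ∧ Disjoint E₀ ER ∧
      Disjoint E₁ ER ∧ (∀ v ∈ V₀, v ∉ V₁) ∧ E.card = E₀.card + ER.card + E₁.card := by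
  wlog hord : ∃ V₀ E₀ V₁ E₁, G.IsPath x c V₀ E₀ ∧ G.IsPath c y V₁ E₁ ∧ V = V₀ ∪ V₁ ∧ E = E₀ ∪ E₁ ∧
    (∀ v ∈ V₀, v ∈ V₁ → v = c) ∧ d ∈ V₁ generalizing c d
  · obtain ⟨V₀, E₀, V₁, E₁, h1, h2⟩ := this pR.symm hcd.symm (by
      obtain ⟨e, he, hi⟩ := pR.exists_inc hcd pR.right_mem
      obtain ⟨f, hf, hj⟩ := pR.exists_inc hcd pR.left_mem
      have hd := h.mem_of_inc (hR he) hi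
      have hc := h.mem_of_inc (hR hf) hj
      obtain ⟨V₀, E₀, V₁, E₁, p₀, p₁, rfl, rfl, h01, -⟩ := h.exists_split hd
      refine ⟨V₀, E₀, V₁, E₁, p₀, p₁, rfl, rfl, h01, ?_⟩
      by_contra hc'
      obtain ⟨V₂, E₂, V₃, E₃, p₂, p₃, rfl, rfl, h23, -⟩ := p₀.exists_split (by grind : c ∈ V₀)
      have := p₃.right_mem
      exact hord ⟨_, _, _, _, p₂, p₃.append p₁ (by grind), by grind, by grind, by grind, by grind⟩)
    exact ⟨V₀, E₀, V₁, E₁, h1.symm, h2⟩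
  obtain ⟨V₀, E₀, V₁, E₁, p₀, p₁, rfl, rfl, h01, hd⟩ := hord
  obtain ⟨V₂, E₂, V₃, E₃, p₂, p₃, rfl, rfl, h23, -⟩ := p₁.exists_split hd
  obtain rfl : E₂ = ER := h.eq_of_subset_of_subset p₂ pR (by grind) hR
  have i := p₂.left_mem
  have j := p₂.right_mem
  have k := p₃.left_mem
  refine ⟨V₀, E₀, V₃, E₃, .inr ⟨p₀, p₃⟩, by grind, p₀.disjoint_edges p₂ (m := c) (by grind),
    (p₂.disjoint_edges p₃ h23).symm, by grind, ?_⟩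
  rw [p₀.card_append (p₂.append p₃ h23) h01, p₂.card_append p₃ h23]
  omega

namespace IsEarUnion

/-- Both ends of the last ear are on the previous ear. -/
lemma hasPotential_of_mem_ear (hw : G.Rels w) (h : G.IsEarUnion V N) (hc : c ∈ V) (hd : d ∈ V)
    (hcd : c ≠ d) (hab : a ≠ b) (p₁ : G.IsPath c a VR₁ ER₁) (p₂ : G.IsPath a b VR₂ ER₂)
    (p₃ : G.IsPath b d VR₃ ER₃) (h12 : ∀ v ∈ VR₁, v ∈ VR₂ → v = a) (h23 : ∀ v ∈ VR₂, v ∈ VR₃ → v = b)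
    (h13 : ∀ v ∈ VR₁, v ∉ VR₃) (hR : ∀ v, v ∈ VR₁ ∨ v ∈ VR₂ ∨ v ∈ VR₃ → v ∈ V → v = c ∨ v = d)
    (hRN : Disjoint (ER₁ ∪ ER₂ ∪ ER₃) N) (pP : G.IsPath a b VP EP)
    (hP : ∀ v ∈ VP, v ∈ V ∨ v ∈ VR₁ ∨ v ∈ VR₂ ∨ v ∈ VR₃ → v = a ∨ v = b)
    (hPN : Disjoint EP (N ∪ (ER₁ ∪ ER₂ ∪ ER₃)))
    (h₀ : ∀ V C, G.IsCirc V C → C ⊆ N ∪ (ER₁ ∪ ER₂ ∪ ER₃) → C.card % 2 = 0 → w C = 0)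
    (ih : ∀ F' ⊂ N ∪ (ER₁ ∪ ER₂ ∪ ER₃) ∪ EP, G.HasPotential w F') :
    G.HasPotential w (N ∪ (ER₁ ∪ ER₂ ∪ ER₃) ∪ EP) := by
  have c1 := p₁.left_mem
  have a1 := p₁.right_mem
  have a2 := p₂.left_mem
  have b2 := p₂.right_mem
  have b3 := p₃.left_mem
  have d3 := p₃.right_mem
  have aP := pP.left_mem
  have bP := pP.right_mem
  obtain ⟨e₀, he₀⟩ := pP.edges_nonempty hab
  obtain ⟨f₀, hf₀⟩ := p₂.edges_nonempty hab
  have hf : f₀ ∉ ER₁ ∧ f₀ ∉ ER₃ ∧ f₀ ∉ EP ∧ f₀ ∉ N := by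
    refine ⟨Finset.disjoint_right.1 (p₁.disjoint_edges p₂ h12) hf₀,
      Finset.disjoint_left.1 (p₂.disjoint_edges p₃ h23) hf₀,
      Finset.disjoint_right.1 hPN (by simp [hf₀]), Finset.disjoint_left.1 hRN (by simp [hf₀])⟩
  have heN : e₀ ∉ N ∪ (ER₁ ∪ ER₂ ∪ ER₃) := Finset.disjoint_left.1 hPN he₀
  have s₁ := p₁.append pP (by grind)
  have s := s₁.append p₃ (by grind)
  have k₁ := p₁.card_append pP (by grind)
  have k₂ := s₁.card_append p₃ (by grind)
  have hs : ∀ v ∈ VR₁ ∪ VP ∪ VR₃, v ∈ V → v = c ∨ v = d := by grind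
  have hsN : Disjoint (ER₁ ∪ EP ∪ ER₃) N := by
    simp only [Finset.disjoint_union_left, Finset.disjoint_union_right] at hRN hPN ⊢
    tauto
  -- `R₁PR₃` is an ear of `N` as well. Together with `N` it omits `R₂`, so the induction hypothesis
  -- yields a common weight `κ` of the even circuits that use it.
  obtain ⟨κ, hκ⟩ := h.exists_const hc hd hcd s hs hsN
    (fun V C hC hs hk => h₀ V C hC (hs.trans Finset.subset_union_left) hk)
    (ih _ ⟨by grind, fun h => by have := h (x := f₀) (by simp [hf₀]); grind⟩)
  refine hasPotential_of_const (e := e₀) (κ := κ) (fun U C hC hs hk he => ?_)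
    fun U C hC hs hk he => ?_
  · refine h₀ U C hC ?_ hk
    rcases pP.subset_or_disjoint_of_inc (L := N ∪ (ER₁ ∪ ER₂ ∪ ER₃)) hC hs (by
      intro g hg v hgv hv
      refine hP v hv ?_
      simp only [Finset.mem_union] at hg
      rcases hg with hg | (hg | hg) | hg
      · exact .inl (h.mem_of_inc hg hgv)
      · exact .inr (.inl (p₁.mem_of_inc hg hgv))
      · exact .inr (.inr (.inl (p₂.mem_of_inc hg hgv)))
      · exact .inr (.inr (.inr (p₃.mem_of_inc hg hgv)))) with hd | hd
    · exact absurd (hd he₀) he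
    · intro g hg
      have := hs hg
      have := Finset.disjoint_right.1 hd hg
      grind
  · have hCN : ¬ C ⊆ N := fun h => heN (Finset.mem_union_left _ (h he))
    rcases p₂.subset_or_disjoint_of_inc (L := N ∪ ER₁ ∪ ER₃ ∪ EP) hC (by grind) (by
      intro g hg v hgv hv
      simp only [Finset.mem_union] at hg
      rcases hg with ((hg | hg) | hg) | hg
      · have := hR v (by simp [hv]) (h.mem_of_inc hg hgv)
        grind
      · exact .inl (h12 v (p₁.mem_of_inc hg hgv) hv)
      · exact .inr (h23 v hv (p₃.mem_of_inc hg hgv))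
      · exact hP v (pP.mem_of_inc hg hgv) (by simp [hv])) with hd' | hd'
    · have hPC : EP ⊆ C := by
        rcases pP.subset_or_disjoint_of_inc (L := N ∪ (ER₁ ∪ ER₂ ∪ ER₃)) hC hs (by
          intro g hg v hgv hv
          refine hP v hv ?_
          simp only [Finset.mem_union] at hg
          rcases hg with hg | (hg | hg) | hg
          · exact .inl (h.mem_of_inc hg hgv)
          · exact .inr (.inl (p₁.mem_of_inc hg hgv))
          · exact .inr (.inr (.inl (p₂.mem_of_inc hg hgv)))
          · exact .inr (.inr (.inr (p₃.mem_of_inc hg hgv)))) with hd | hd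
        · exact hd
        · exact absurd he (Finset.disjoint_left.1 hd he₀)
      -- A circuit that contains both `P` and `R₂` is `P ∪ R₂`.
      have hne : EP ≠ ER₂ := by rintro rfl; exact hf.2.2.1 hf₀
      have hi : ∀ v ∈ VP, v ∈ VR₂ → v = a ∨ v = b := fun v hv hv' => hP v hv (by simp [hv'])
      obtain ⟨_, hc', hk'⟩ := IsCirc.of_theta pP p₂ hab hi hne
      obtain rfl := hC.eq_of_subset hc' (Finset.union_subset hPC hd')
      -- `P`, `R₂` and `R₁DR₃`, with `D` of suitable parity, form a theta graph with even circuits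
      -- only. Its circuit that avoids `P` has weight zero, the one that avoids `R₂` has weight `κ`;
      -- hence `P ∪ R₂` has weight `κ` too.
      obtain ⟨U, D, r, hD, hpar⟩ := h.exists_isPath_card hc hd hcd (ER₁ ∪ EP ∪ ER₃).card
      have hU := h.mem_of_isPath r hD hc
      have hU' : ∀ v ∈ U, v ∈ VR₁ ∨ v ∈ VR₂ ∨ v ∈ VR₃ → v = c ∨ v = d :=
        fun v hv hv' => hR v hv' (hU hv)
      have cU := r.left_mem
      have dU := r.right_mem
      have t₁ := p₁.symm.append r (by grind)
      have t := t₁.append p₃.symm (by grind)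
      have l₁ := p₁.symm.card_append r (by grind)
      have l₂ := t₁.card_append p₃.symm (by grind)
      have i₂ : ∀ v ∈ VR₂, v ∈ VR₁ ∪ U ∪ VR₃ → v = a ∨ v = b := by grind
      have i₁ : ∀ v ∈ VP, v ∈ VR₁ ∪ U ∪ VR₃ → v = a ∨ v = b := by
        intro v hv hv'
        refine hP v hv ?_
        have := @hU v
        grind
      have n₁ : EP ≠ ER₁ ∪ D ∪ ER₃ := by
        intro h
        have := Finset.ext_iff.1 h e₀
        grind
      have n₂ : ER₂ ≠ ER₁ ∪ D ∪ ER₃ := by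
        intro h
        have := Finset.ext_iff.1 h f₀
        grind
      have key := hw.theta hab pP p₂ t hi i₁ i₂ hne n₁ n₂ (by omega) (by omega)
      obtain ⟨_, c₁, m₁⟩ := IsCirc.of_theta pP t hab i₁ n₁
      obtain ⟨_, c₂, m₂⟩ := IsCirc.of_theta p₂ t hab i₂ n₂
      rw [hκ _ _ c₁ (by grind) (by omega) (fun h => heN (by have := h (x := e₀) (by simp [he₀]); grind)),
        h₀ _ _ c₂ (by grind) (by omega), add_zero] at key
      exact CharTwo.add_eq_zero.1 key
    · refine hκ U C hC ?_ hk hCN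
      intro g hg
      have := hs hg
      have := Finset.disjoint_right.1 hd' hg
      grind

/-- Disjoint paths that close two ears with ends in an ear union. -/
lemma eq_zero_of_linkage (hw : G.Rels w) (h : G.IsEarUnion V N) (hc : c ∈ V) (hd : d ∈ V)
    (ha : a ∈ V) (hb : b ∈ V) (hcd : c ≠ d) (hab : a ≠ b) (pR : G.IsPath c d VR ER)
    (hR : ∀ v ∈ VR, v ∈ V → v = c ∨ v = d) (hRN : Disjoint ER N) (pP : G.IsPath a b VP EP)
    (hP : ∀ v ∈ VP, v ∈ V ∨ v ∈ VR → v = a ∨ v = b) (hPN : Disjoint EP (N ∪ ER)) (hbR : b ∉ VR)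
    (he : e₀ ∈ EP) (hf : f₀ ∈ ER)
    (h₀ : ∀ V C, G.IsCirc V C → C ⊆ N ∪ EP ∪ ER → C.card % 2 = 0 → (e₀ ∉ C ∨ f₀ ∉ C) → w C = 0)
    (pA : G.IsPath b d VA EA) (pB : G.IsPath a c VB EB) (hA : EA ⊆ N) (hB : EB ⊆ N)
    (hdis : ∀ v ∈ VA, v ∉ VB) (hk : (EA.card + EP.card + EB.card + ER.card) % 2 = 0) :
    w (EA ∪ EB ∪ EP ∪ ER) = 0 := by
  by_contra hne
  have cR := pR.left_mem
  have dR := pR.right_mem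
  have hbd : b ≠ d := by rintro rfl; exact hbR dR
  have hbc : b ≠ c := by rintro rfl; exact hbR cR
  have had : a ≠ d := by rintro rfl; exact hdis _ pA.right_mem pB.left_mem
  simp only [Finset.disjoint_union_right] at hPN
  have F : G.Frame w N a b c d VP VR EP ER e₀ f₀ :=
    { theta := hw.theta
      k4 := hw.k4
      delta := hw.delta
      pathP := pP
      pathR := pR
      ne_P := hab
      ne_R := hcd
      meet := fun v hv hv' => by
        rcases hP v hv (.inr hv') with rfl | rfl
        · have := hR v hv' ha
          grind
        · exact absurd hv' hbR
      meetP := fun g hg v hgv hv => hP v hv (.inl (h.mem_of_inc hg hgv))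
      meetR := fun g hg v hgv hv => hR v hv (h.mem_of_inc hg hgv)
      memP := he
      memR := hf
      notMem_P := fun h => Finset.disjoint_left.1 hPN.2 h hf
      notMem_R := fun h => Finset.disjoint_left.1 hPN.2 he h
      notMem_M := fun h => Finset.disjoint_left.1 hPN.1 he h
      notMem_M' := fun h => Finset.disjoint_left.1 hRN hf h
      zero := h₀ }
  -- A nonzero weight would make the two paths a bad pair. The ear union `N` supplies paths of both
  -- parities and paths avoiding a given vertex.
  refine F.not_bad (fun k => h.exists_isPath_card hb hd hbd k)
    (fun y hy hy' => h.exists_isPath_notMem hb hd hy.symm hy'.symm)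
    (h.exists_isPath_notMem ha hd hab hbd.symm) (h.exists_isPath_notMem hc hb hcd hbd)
    (fun _ y hy hy' => h.exists_isPath_notMem ha hc hy.symm hy'.symm)
    (fun hac => h.exists_isPath_notMem hb hc hab.symm hac.symm)
    (fun hac => h.exists_isPath_notMem hd ha hcd.symm hac)
    ⟨pA, pB, hA, hB, hdis, hk, by
      generalize w (EA ∪ EB ∪ EP ∪ ER) = q at *
      revert hne; revert q; decide⟩

/-- A path that closes two ears, the second of which starts inside the first. -/
lemma eq_zero_of_inner_linkage (hw : G.Rels w) (h : G.IsEarUnion V N) (hc : c ∈ V) (hd : d ∈ V)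
    (ha : a ∉ V) (hb : b ∈ V) (hcd : c ≠ d) (hab : a ≠ b) (pq : G.IsPath c a Vq Eq)
    (pr : G.IsPath a d Vr Er) (hqr : ∀ v ∈ Vq, v ∈ Vr → v = a)
    (hR : ∀ v, v ∈ Vq ∨ v ∈ Vr → v ∈ V → v = c ∨ v = d) (hRN : Disjoint (Eq ∪ Er) N)
    (pP : G.IsPath a b VP EP)
    (hP : ∀ v ∈ VP, v ∈ V ∨ v ∈ Vq ∨ v ∈ Vr → v = a ∨ v = b) (hPN : Disjoint EP (N ∪ (Eq ∪ Er)))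
    (hbq : b ∉ Vq) (hbr : b ∉ Vr) (he : e₀ ∈ EP) (hf : f₀ ∈ Er)
    (h₀ : ∀ V C, G.IsCirc V C → C ⊆ N ∪ Eq ∪ EP ∪ Er → C.card % 2 = 0 → (e₀ ∉ C ∨ f₀ ∉ C) → w C = 0)
    (pA : G.IsPath b d VA EA) (hA : EA ⊆ N ∪ Eq) (haA : a ∉ VA)
    (hk : (EA.card + EP.card + Er.card) % 2 = 0) : w (EA ∪ EP ∪ Er) = 0 := by
  by_contra hne
  have cq := pq.left_mem
  have aq := pq.right_mem
  have ar := pr.left_mem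
  have dr := pr.right_mem
  have hbd : b ≠ d := by rintro rfl; exact hbr dr
  have hbc : b ≠ c := by rintro rfl; exact hbq cq
  have had : a ≠ d := by rintro rfl; exact ha hd
  have hac : a ≠ c := by rintro rfl; exact ha hc
  have hdq : d ∉ Vq := fun h => had (hqr d h dr).symm
  have hcr : c ∉ Vr := fun h => hac (hqr c cq h).symm
  simp only [Finset.disjoint_union_right] at hPN
  simp only [Finset.disjoint_union_left] at hRN
  have dqr := pq.disjoint_edges pr hqr
  -- The segment `q` is joined to `N`, and only `r` plays the role of the second path. It starts at
  -- `a` like `P`, so the second path of the bad pair is the single vertex `a`.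
  have F : G.Frame w (N ∪ Eq) a b a d VP Vr EP Er e₀ f₀ :=
    { theta := hw.theta
      k4 := hw.k4
      delta := hw.delta
      pathP := pP
      pathR := pr
      ne_P := hab
      ne_R := had
      meet := fun v hv hv' => by
        rcases hP v hv (.inr (.inr hv')) with rfl | rfl
        · simp
        · exact absurd hv' hbr
      meetP := fun g hg v hgv hv => by
        rcases Finset.mem_union.1 hg with hg | hg
        · exact hP v hv (.inl (h.mem_of_inc hg hgv))
        · exact hP v hv (.inr (.inl (pq.mem_of_inc hg hgv)))
      meetR := fun g hg v hgv hv => by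
        rcases Finset.mem_union.1 hg with hg | hg
        · rcases hR v (.inr hv) (h.mem_of_inc hg hgv) with rfl | rfl
          · exact absurd hv hcr
          · simp
        · exact .inl (hqr v (pq.mem_of_inc hg hgv) hv)
      memP := he
      memR := hf
      notMem_P := fun h => Finset.disjoint_left.1 hPN.2.2 h hf
      notMem_R := fun h => Finset.disjoint_left.1 hPN.2.2 he h
      notMem_M := fun h => by
        rcases Finset.mem_union.1 h with h | h
        · exact Finset.disjoint_left.1 hPN.1 he h
        · exact Finset.disjoint_left.1 hPN.2.1 he h
      notMem_M' := fun h => by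
        rcases Finset.mem_union.1 h with h | h
        · exact Finset.disjoint_left.1 hRN.2 hf h
        · exact Finset.disjoint_left.1 dqr h hf
      zero := h₀ }
  have sub : N ⊆ N ∪ Eq := Finset.subset_union_left
  refine F.not_bad (VB := {a}) (EB := ∅) (fun k => ?_) (fun y hy hy' => ?_) ?_ ?_ (by simp) (by simp)
    (by simp) ⟨pA, .nil a, hA, by simp, by grind, by simpa using hk, by
      rw [Finset.union_empty]
      generalize w (EA ∪ EP ∪ Er) = q at *
      revert hne; revert q; decide⟩
  · obtain ⟨U, D, p, hD, hp⟩ := h.exists_isPath_card hb hd hbd k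
    exact ⟨U, D, p, hD.trans sub, hp⟩
  · obtain ⟨U, D, p, hD, hp⟩ := h.exists_isPath_notMem hb hd hy.symm hy'.symm
    exact ⟨U, D, p, hD.trans sub, hp⟩
  · obtain ⟨U, D, p, hD, hp⟩ := h.exists_isPath_notMem hc hd hbc.symm hbd.symm
    obtain ⟨U', D', p', hU', hD'⟩ := pq.symm.exists_trans p
    exact ⟨U', D', p', by grind, by grind⟩
  · obtain ⟨U, D, p, hD, hp⟩ := h.exists_isPath_notMem hc hb hcd hbd
    obtain ⟨U', D', p', hU', hD'⟩ := pq.symm.exists_trans p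
    exact ⟨U', D', p', by grind, by grind⟩

end IsEarUnion

end Potential

end Graph

/-! ### Existence of a potential -/

namespace Graph

section Potential

variable {α β : Type*} [DecidableEq α] [DecidableEq β] {G : Graph α β} {w : Finset β → ZMod 2}
  {x y a b c d : α} {V V' V₁ V₂ VP VR VA VB Vq Vr VR₁ VR₂ VR₃ : Finset α}
  {E E₁ E₂ N C F T EP ER EA EB Eq Er ER₁ ER₂ ER₃ : Finset β} {e₀ f₀ : β}

namespace IsEarUnion

/-- Both ends of the last ear are outside the previous ear, except possibly one common end. -/
lemma hasPotential_of_mem (hw : G.Rels w) (h : G.IsEarUnion V N) (hc : c ∈ V) (hd : d ∈ V)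
    (ha : a ∈ V) (hb : b ∈ V) (hcd : c ≠ d) (hab : a ≠ b) (pR : G.IsPath c d VR ER)
    (hR : ∀ v ∈ VR, v ∈ V → v = c ∨ v = d) (hRN : Disjoint ER N) (pP : G.IsPath a b VP EP)
    (hP : ∀ v ∈ VP, v ∈ V ∨ v ∈ VR → v = a ∨ v = b) (hPN : Disjoint EP (N ∪ ER)) (hbR : b ∉ VR)
    (h₀ : ∀ V C, G.IsCirc V C → C ⊆ N ∪ ER → C.card % 2 = 0 → w C = 0)
    (ih : ∀ F' ⊂ N ∪ ER ∪ EP, G.HasPotential w F') : G.HasPotential w (N ∪ ER ∪ EP) := by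
  obtain ⟨e₀, he₀⟩ := pP.edges_nonempty hab
  obtain ⟨f₀, hf₀⟩ := pR.edges_nonempty hcd
  have hPN' : Disjoint EP N ∧ Disjoint EP ER := by simpa using hPN
  have heN : e₀ ∉ N := Finset.disjoint_left.1 hPN'.1 he₀
  have heR : e₀ ∉ ER := Finset.disjoint_left.1 hPN'.2 he₀
  have hfP : f₀ ∉ EP := Finset.disjoint_right.1 hPN'.2 hf₀
  have hfN : f₀ ∉ N := Finset.disjoint_left.1 hRN hf₀
  obtain ⟨κ, hκ⟩ := h.exists_const ha hb hab pP (fun v hv hv' => hP v hv (.inl hv')) hPN'.1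
    (fun V C hC hs hk => h₀ V C hC (hs.trans Finset.subset_union_left) hk)
    (ih _ ⟨by grind, fun h => by have := h (x := f₀) (by simp [hf₀]); grind⟩)
  -- Even circuits through `P` that avoid `R` have the common weight `κ`. Adding `κ` at `e₀` makes
  -- every even circuit that misses `e₀` or `f₀` weightless, so the zero function is a potential if
  -- the circuits through both also have weight zero.
  refine .of_add_sum (f := fun g => if g = e₀ then κ else 0) ⟨fun _ => 0, ?_⟩
  have hw' := hw.add_sum fun g => if g = e₀ then κ else 0
  set w' : Finset β → ZMod 2 := fun C => w C + ∑ g ∈ C, if g = e₀ then κ else 0 with hw'_def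
  have hout : ∀ {C}, e₀ ∉ C → w' C = w C := fun he => by simp [hw'_def, he]
  have hin : ∀ {C}, e₀ ∈ C → w' C = w C + κ := fun he => by simp [hw'_def, he]
  have zero : ∀ V C, G.IsCirc V C → C ⊆ N ∪ EP ∪ ER → C.card % 2 = 0 → (e₀ ∉ C ∨ f₀ ∉ C) →
      w' C = 0 := by
    intro U C hC hs hk hor
    by_cases he : e₀ ∈ C
    · have hf : f₀ ∉ C := by tauto
      rw [hin he]
      rcases pR.subset_or_disjoint_of_inc (L := N ∪ EP) hC hs (by
        intro g hg v hgv hv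
        refine hR v hv ?_
        rcases Finset.mem_union.1 hg with hg | hg
        · exact h.mem_of_inc hg hgv
        · rcases hP v (pP.mem_of_inc hg hgv) (.inr hv) with rfl | rfl
          · exact ha
          · exact hb) with hd | hd
      · exact absurd (hd hf₀) hf
      · rw [hκ U C hC (by
          intro g hg
          have := hs hg
          have := Finset.disjoint_right.1 hd hg
          grind) hk fun h => heN (h he)]
        exact CharTwo.add_self_eq_zero _
    · rw [hout he]
      refine h₀ U C hC ?_ hk
      rcases pP.subset_or_disjoint_of_inc (L := N ∪ ER) hC (by grind) (by
        intro g hg v hgv hv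
        rcases Finset.mem_union.1 hg with hg | hg
        · exact hP v hv (.inl (h.mem_of_inc hg hgv))
        · exact hP v hv (.inr (pR.mem_of_inc hg hgv))) with hd | hd
      · exact absurd (hd he₀) he
      · intro g hg
        have := hs hg
        have := Finset.disjoint_right.1 hd hg
        grind
  intro U C hC hs hk
  rw [Finset.sum_const_zero]
  by_cases hef : e₀ ∈ C ∧ f₀ ∈ C
  swap
  · exact zero U C hC (by grind) hk (by tauto)
  obtain ⟨heC, hfC⟩ := hef
  have cR := pR.left_mem
  have dR := pR.right_mem
  rcases (IsEarUnion.ear h hc hd hcd pR hR hRN).exists_isPath_of_isCirc (Finset.mem_union_left _ ha)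
    (Finset.mem_union_left _ hb) hab pP (fun v hv hv' => hP v hv (Finset.mem_union.1 hv')) hPN hC hs
    with hs' | ⟨W, T, q, hT, rfl, hcard⟩
  · exact absurd (hs' heC) (by simp [heN, heR])
  have hRT : ER ⊆ T := by
    rcases pR.subset_or_disjoint_of_inc (L := N ∪ EP) hC (by grind) (by
      intro g hg v hgv hv
      refine hR v hv ?_
      rcases Finset.mem_union.1 hg with hg | hg
      · exact h.mem_of_inc hg hgv
      · rcases hP v (pP.mem_of_inc hg hgv) (.inr hv) with rfl | rfl
        · exact ha
        · exact hb) with hd | hd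
    · intro g hg
      have := hd hg
      have := Finset.disjoint_right.1 hPN'.2 hg
      grind
    · exact absurd hfC (Finset.disjoint_left.1 hd hf₀)
  have sub : ∀ {D : Finset β}, D ⊆ T → Disjoint D ER → D ⊆ N := fun hD hdis g hg => by
    have := hT (hD hg)
    have := Finset.disjoint_left.1 hdis hg
    grind
  obtain ⟨V₀, E₀, V₁, E₁, hp, rfl, d₀, d₁, h01, hk'⟩ := q.symm.exists_linkage pR hcd hRT
  -- `R` may be traversed in either direction. The second case is the first one with `c` and `d`
  -- exchanged.
  rcases hp with ⟨p₀, p₁⟩ | ⟨p₀, p₁⟩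
  · have := h.eq_zero_of_linkage hw' hc hd ha hb hcd hab pR hR hRN pP hP hPN hbR he₀ hf₀ zero p₀
      p₁.symm (sub (by grind) d₀) (sub (by grind) d₁) h01 (by omega)
    rw [← this]
    congr 1
    grind
  · have := h.eq_zero_of_linkage hw' hd hc ha hb hcd.symm hab pR.symm (fun v hv hv' =>
      (hR v hv hv').symm) hRN pP hP hPN hbR he₀ hf₀ zero p₀ p₁.symm (sub (by grind) d₀)
      (sub (by grind) d₁) h01 (by omega)
    rw [← this]
    congr 1
    grind

/-- One end of the last ear is inside the previous ear, and the other one is outside. -/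
lemma hasPotential_of_inner (hw : G.Rels w) (h : G.IsEarUnion V N) (hc : c ∈ V) (hd : d ∈ V)
    (ha : a ∉ V) (hb : b ∈ V) (hcd : c ≠ d) (hab : a ≠ b) (pq : G.IsPath c a Vq Eq)
    (pr : G.IsPath a d Vr Er) (hqr : ∀ v ∈ Vq, v ∈ Vr → v = a)
    (hR : ∀ v, v ∈ Vq ∨ v ∈ Vr → v ∈ V → v = c ∨ v = d) (hRN : Disjoint (Eq ∪ Er) N)
    (pP : G.IsPath a b VP EP)
    (hP : ∀ v ∈ VP, v ∈ V ∨ v ∈ Vq ∨ v ∈ Vr → v = a ∨ v = b) (hPN : Disjoint EP (N ∪ (Eq ∪ Er)))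
    (hbq : b ∉ Vq) (hbr : b ∉ Vr)
    (h₀ : ∀ V C, G.IsCirc V C → C ⊆ N ∪ (Eq ∪ Er) → C.card % 2 = 0 → w C = 0)
    (ih : ∀ F' ⊂ N ∪ (Eq ∪ Er) ∪ EP, G.HasPotential w F') :
    G.HasPotential w (N ∪ (Eq ∪ Er) ∪ EP) := by
  have cq := pq.left_mem
  have aq := pq.right_mem
  have ar := pr.left_mem
  have dr := pr.right_mem
  have hbd : b ≠ d := by rintro rfl; exact hbr dr
  have hbc : b ≠ c := by rintro rfl; exact hbq cq
  have had : a ≠ d := by rintro rfl; exact ha hd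
  have hac : a ≠ c := by rintro rfl; exact ha hc
  have hdq : d ∉ Vq := fun h => had (hqr d h dr).symm
  have hcr : c ∉ Vr := fun h => hac (hqr c cq h).symm
  obtain ⟨e₀, he₀⟩ := pP.edges_nonempty hab
  obtain ⟨f₀, hf₀⟩ := pr.edges_nonempty had
  have dqr := pq.disjoint_edges pr hqr
  have hPN' : Disjoint EP N ∧ Disjoint EP Eq ∧ Disjoint EP Er := by simpa using hPN
  have hRN' : Disjoint Eq N ∧ Disjoint Er N := by simpa using hRN
  have heN : e₀ ∉ N := Finset.disjoint_left.1 hPN'.1 he₀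
  have heq : e₀ ∉ Eq := Finset.disjoint_left.1 hPN'.2.1 he₀
  have her : e₀ ∉ Er := Finset.disjoint_left.1 hPN'.2.2 he₀
  have hfP : f₀ ∉ EP := Finset.disjoint_right.1 hPN'.2.2 hf₀
  have hfN : f₀ ∉ N := Finset.disjoint_left.1 hRN'.2 hf₀
  have hfq : f₀ ∉ Eq := Finset.disjoint_right.1 dqr hf₀
  have s := pq.append pP (fun v hv hv' => by
    rcases hP v hv' (.inr (.inl hv)) with rfl | rfl
    · rfl
    · exact absurd hv hbq)
  -- Without `r`, the segment `q` followed by `P` is an ear of `N` from `c` to `b`.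
  obtain ⟨κ, hκ⟩ := h.exists_const hc hb hbc.symm s (by
      intro v hv hv'
      have := hR v
      have := hP v
      grind) (by simp only [Finset.disjoint_union_left]; tauto)
    (fun V C hC hs hk => h₀ V C hC (hs.trans Finset.subset_union_left) hk)
    (ih _ ⟨by grind, fun h => by have := h (x := f₀) (by simp [hf₀]); grind⟩)
  refine .of_add_sum (f := fun g => if g = e₀ then κ else 0) ⟨fun _ => 0, ?_⟩
  have hw' := hw.add_sum fun g => if g = e₀ then κ else 0
  set w' : Finset β → ZMod 2 := fun C => w C + ∑ g ∈ C, if g = e₀ then κ else 0 with hw'_def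
  have hout : ∀ {C}, e₀ ∉ C → w' C = w C := fun he => by simp [hw'_def, he]
  have hin : ∀ {C}, e₀ ∈ C → w' C = w C + κ := fun he => by simp [hw'_def, he]
  have hEr : ∀ {U C}, G.IsCirc U C → C ⊆ N ∪ (Eq ∪ Er) ∪ EP → Er ⊆ C ∨ Disjoint Er C := by
    intro U C hC hs
    refine pr.subset_or_disjoint_of_inc (L := N ∪ Eq ∪ EP) hC (by grind) ?_
    intro g hg v hgv hv
    simp only [Finset.mem_union] at hg
    rcases hg with (hg | hg) | hg
    · have := hR v (.inr hv) (h.mem_of_inc hg hgv)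
      grind
    · exact .inl (hqr v (pq.mem_of_inc hg hgv) hv)
    · have := hP v (pP.mem_of_inc hg hgv) (.inr (.inr hv))
      grind
  have zero : ∀ V C, G.IsCirc V C → C ⊆ N ∪ Eq ∪ EP ∪ Er → C.card % 2 = 0 → (e₀ ∉ C ∨ f₀ ∉ C) →
      w' C = 0 := by
    intro U C hC hs hk hor
    by_cases he : e₀ ∈ C
    · have hf : f₀ ∉ C := by tauto
      rw [hin he]
      rcases hEr hC (by grind) with hd | hd
      · exact absurd (hd hf₀) hf
      · rw [hκ U C hC (by
          intro g hg
          have := hs hg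
          have := Finset.disjoint_right.1 hd hg
          grind) hk fun h => heN (h he)]
        exact CharTwo.add_self_eq_zero _
    · rw [hout he]
      refine h₀ U C hC ?_ hk
      rcases pP.subset_or_disjoint_of_inc (L := N ∪ (Eq ∪ Er)) hC (by grind) (by
        intro g hg v hgv hv
        simp only [Finset.mem_union] at hg
        rcases hg with hg | hg | hg
        · exact hP v hv (.inl (h.mem_of_inc hg hgv))
        · exact hP v hv (.inr (.inl (pq.mem_of_inc hg hgv)))
        · exact hP v hv (.inr (.inr (pr.mem_of_inc hg hgv)))) with hd | hd
      · exact absurd (hd he₀) he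
      · intro g hg
        have := hs hg
        have := Finset.disjoint_right.1 hd hg
        grind
  intro U C hC hs hk
  rw [Finset.sum_const_zero]
  by_cases hef : e₀ ∈ C ∧ f₀ ∈ C
  swap
  · exact zero U C hC (by grind) hk (by tauto)
  obtain ⟨heC, hfC⟩ := hef
  have pR := pq.append pr hqr
  have hR' : ∀ v ∈ Vq ∪ Vr, v ∈ V → v = c ∨ v = d := fun v hv => hR v (Finset.mem_union.1 hv)
  rcases (IsEarUnion.ear h hc hd hcd pR hR' hRN).exists_isPath_of_isCirc (x := a)
    (by simp [aq]) (Finset.mem_union_left _ hb) hab pP (fun v hv hv' => hP v hv (by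
      simpa using hv')) hPN hC hs with hs' | ⟨W, T, q, hT, rfl, hcard⟩
  · exact absurd (hs' heC) (by simp [heN, heq, her])
  have hRT : Er ⊆ T := by
    rcases hEr hC hs with hd | hd
    · intro g hg
      have := hd hg
      have := Finset.disjoint_right.1 hPN'.2.2 hg
      grind
    · exact absurd hfC (Finset.disjoint_left.1 hd hf₀)
  obtain ⟨V₀, E₀, V₁, E₁, hp, rfl, d₀, d₁, h01, hk'⟩ := q.symm.exists_linkage pr had hRT
  -- The path from `b` to `a` contains `r`, which has the end `a`. So `r` is its final segment,
  -- traversed from `d` to `a`, and the other order is impossible.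
  rcases hp with ⟨p₀, p₁⟩ | ⟨p₀, p₁⟩
  · obtain ⟨hV₁, rfl⟩ := p₁.eq_singleton
    rw [Finset.card_empty] at hk'
    have := h.eq_zero_of_inner_linkage hw' hc hd ha hb hcd hab pq pr hqr hR hRN pP hP hPN hbq hbr
      he₀ hf₀ zero p₀ (by
        intro g hg
        have := hT (x := g) (by simp [hg])
        have := Finset.disjoint_left.1 d₀ hg
        grind) (fun h => h01 a h (by simp [hV₁])) (by omega)
    rw [← this]
    congr 1
    grind
  · exact absurd p₁.right_mem (h01 a p₀.right_mem)

/-- The last ear is added to an ear union with an ear. -/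
lemma hasPotential_of_two_ears (hw : G.Rels w) (h : G.IsEarUnion V N) (hc : c ∈ V) (hd : d ∈ V)
    (hcd : c ≠ d) (pR : G.IsPath c d VR ER) (hR : ∀ v ∈ VR, v ∈ V → v = c ∨ v = d)
    (hRN : Disjoint ER N) (ha : a ∈ V ∪ VR) (hb : b ∈ V ∪ VR) (hab : a ≠ b)
    (pP : G.IsPath a b VP EP) (hP : ∀ v ∈ VP, v ∈ V ∪ VR → v = a ∨ v = b)
    (hPN : Disjoint EP (N ∪ ER))
    (h₀ : ∀ V C, G.IsCirc V C → C ⊆ N ∪ ER → C.card % 2 = 0 → w C = 0)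
    (ih : ∀ F' ⊂ N ∪ ER ∪ EP, G.HasPotential w F') : G.HasPotential w (N ∪ ER ∪ EP) := by
  have key : ∀ {a b}, a ∈ V ∪ VR → b ∈ V ∪ VR → a ≠ b → G.IsPath a b VP EP →
      (∀ v ∈ VP, v ∈ V ∪ VR → v = a ∨ v = b) → b ∉ VR → G.HasPotential w (N ∪ ER ∪ EP) := by
    intro a b ha hb hab pP hP hbR
    have hbV : b ∈ V := by grind
    have hP' : ∀ v ∈ VP, v ∈ V ∨ v ∈ VR → v = a ∨ v = b :=
      fun v hv hv' => hP v hv (Finset.mem_union.2 hv')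
    by_cases haV : a ∈ V
    · exact h.hasPotential_of_mem hw hc hd haV hbV hcd hab pR hR hRN pP hP' hPN hbR h₀ ih
    · obtain ⟨Vq, Eq, Vr, Er, pq, pr, rfl, rfl, hqr, -⟩ := pR.exists_split (by grind : a ∈ VR)
      exact h.hasPotential_of_inner hw hc hd haV hbV hcd hab pq pr hqr (by grind) hRN pP (by grind)
        hPN (by grind) (by grind) h₀ ih
  by_cases hbR : b ∈ VR
  swap
  · exact key ha hb hab pP hP hbR
  by_cases haR : a ∈ VR
  swap
  · exact key hb ha hab.symm pP.symm (fun v hv hv' => (hP v hv hv').symm) haR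
  have inner : ∀ {a b VR₁ ER₁ VR₂ ER₂}, a ≠ b → G.IsPath c a VR₁ ER₁ → G.IsPath a d VR₂ ER₂ →
      VR = VR₁ ∪ VR₂ → ER = ER₁ ∪ ER₂ → (∀ v ∈ VR₁, v ∈ VR₂ → v = a) → b ∈ VR₂ →
      G.IsPath a b VP EP → (∀ v ∈ VP, v ∈ V ∪ VR → v = a ∨ v = b) →
      G.HasPotential w (N ∪ ER ∪ EP) := by
    intro a b VR₁ ER₁ VR₂ ER₂ hab p₁ p₂ h1 h2 h12 hb pP hP
    obtain ⟨Vq, Eq, Vr, Er, pq, pr, rfl, rfl, hqr, -⟩ := p₂.exists_split hb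
    have e₁ : ER = ER₁ ∪ Eq ∪ Er := by rw [h2, Finset.union_assoc]
    have := pq.left_mem
    subst h1 e₁
    exact h.hasPotential_of_mem_ear hw hc hd hcd hab p₁ pq pr (by grind) hqr (by grind) (by grind)
      hRN pP (by grind) hPN h₀ ih
  obtain ⟨VR₁, ER₁, VR₂, ER₂, p₁, p₂, h1, h2, h12, -⟩ := pR.exists_split haR
  by_cases hb2 : b ∈ VR₂
  · exact inner hab p₁ p₂ h1 h2 h12 hb2 pP hP
  · obtain ⟨VR₃, ER₃, VR₄, ER₄, p₃, p₄, rfl, rfl, h34, -⟩ := p₁.exists_split (by grind : b ∈ VR₁)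
    have := p₄.right_mem
    exact inner hab.symm p₃ (p₄.append p₂ (by grind)) (by grind) (by grind) (by grind) (by grind)
      pP.symm (fun v hv hv' => (hP v hv hv').symm)

lemma hasPotential_of_ear (hw : G.Rels w) (h : G.IsEarUnion V N) (ha : a ∈ V) (hb : b ∈ V)
    (hab : a ≠ b) (pP : G.IsPath a b VP EP) (hP : ∀ v ∈ VP, v ∈ V → v = a ∨ v = b)
    (hPN : Disjoint EP N)
    (h₀ : ∀ V C, G.IsCirc V C → C ⊆ N → C.card % 2 = 0 → w C = 0)
    (ih : ∀ F' ⊂ N ∪ EP, G.HasPotential w F') : G.HasPotential w (N ∪ EP) := by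
  have h' := h
  cases h with
  | ear h hc hd hcd pR hR hRN =>
    exact h.hasPotential_of_two_ears hw hc hd hcd pR hR hRN ha hb hab pP hP hPN h₀ ih
  | circuit hC hodd =>
    obtain ⟨V₁, E₁, V₂, E₂, p₁, p₂, hi, hd, rfl, rfl⟩ := hC.exists_split ha hb hab
    rw [Finset.card_union_of_disjoint hd] at hodd
    -- Only one arc of the odd circuit closes the ear to an even circuit, so there is just one even
    -- circuit.
    have uniq : ∀ U K, G.IsCirc U K → K ⊆ E₁ ∪ E₂ ∪ EP → K.card % 2 = 0 →
        ∃ T, (T = E₁ ∨ T = E₂) ∧ K = T ∪ EP ∧ (T.card + EP.card) % 2 = 0 := by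
      intro U K hK hs hk
      rcases h'.exists_isPath_of_isCirc ha hb hab pP hP hPN hK hs with hs' | ⟨W, T, q, hT, rfl, hc⟩
      · rw [hC.eq_of_subset hK hs', Finset.card_union_of_disjoint hd] at hk
        omega
      · exact ⟨T, p₁.eq_or_eq_of_isCirc hd hC q hab hT, rfl, by omega⟩
    obtain ⟨e, he⟩ := pP.edges_nonempty hab
    have heK : ∀ U K, G.IsCirc U K → K ⊆ E₁ ∪ E₂ ∪ EP → K.card % 2 = 0 → e ∈ K := by
      intro U K hK hs hk
      obtain ⟨T, -, rfl, -⟩ := uniq U K hK hs hk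
      simp [he]
    by_cases hex : ∃ U K, G.IsCirc U K ∧ K ⊆ E₁ ∪ E₂ ∪ EP ∧ K.card % 2 = 0
    · obtain ⟨U, K, hK, hs, hk⟩ := hex
      refine hasPotential_of_const (e := e) (κ := w K)
        (fun U' K' hK' hs' hk' he' => absurd (heK U' K' hK' hs' hk') he') ?_
      intro U' K' hK' hs' hk' _
      obtain ⟨T, hT, rfl, hT'⟩ := uniq U K hK hs hk
      obtain ⟨S, hS, rfl, hS'⟩ := uniq U' K' hK' hs' hk'
      have : S = T := by
        rcases hT with rfl | rfl <;> rcases hS with rfl | rfl <;> first | rfl | omega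
      rw [this]
    · push Not at hex
      exact ⟨fun _ => 0, fun U K hK hs hk => absurd hk (hex U K hK hs)⟩

end IsEarUnion

lemma hasPotential_of_isEarUnion (hw : G.Rels w) (h : G.IsEarUnion V N)
    (ih : ∀ F' ⊂ N, ∀ w, G.Rels w → G.HasPotential w F') : G.HasPotential w N := by
  cases h with
  | circuit hC hodd =>
    refine ⟨fun _ => 0, fun U K hK hs hk => ?_⟩
    rw [hC.eq_of_subset hK hs] at hk
    omega
  | @ear V V' N E x y h ha hb hab pP hP hPN =>
    have hss : N ⊂ N ∪ E := by
      obtain ⟨e, he⟩ := pP.edges_nonempty hab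
      exact ⟨Finset.subset_union_left, fun h' =>
        Finset.disjoint_left.1 hPN he (h' (Finset.mem_union_right _ he))⟩
    exact (ih N hss w hw).normalize hw fun w' hw' h₀ =>
      h.hasPotential_of_ear hw' ha hb hab pP hP hPN h₀ fun F' hF' => ih F' hF' w' hw'

/-- Weights of the even circuits that satisfy the three relations are the sums of an edge
function. -/
theorem Rels.hasPotential (hw : G.Rels w) (F : Finset β) : G.HasPotential w F := by
  induction F using Finset.strongInduction generalizing w with
  | H F ih =>
  by_cases hodd : ∃ V C, G.IsCirc V C ∧ C ⊆ F ∧ C.card % 2 = 1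
  swap
  · push Not at hodd
    rcases F.eq_empty_or_nonempty with rfl | ⟨e, he⟩
    · exact ⟨fun _ => 0, fun V C hC hs _ =>
        absurd (Finset.subset_empty.1 hs) hC.nonempty.ne_empty⟩
    · exact hasPotential_of_bipartite hw (fun V C hC hs => by have := hodd V C hC hs; omega)
        (ih _ (Finset.erase_ssubset he) hw)
  obtain ⟨V₀, C₀, hC₀, hs₀, hk₀⟩ := hodd
  classical
  -- A maximal ear union. If it is not all of `F`, no circuit of `F` straddles it (`exists_ear`), so
  -- potentials of `N` and of `F \ N` can be glued.
  obtain ⟨N, hN⟩ := (F.powerset.filter fun N => ∃ V, G.IsEarUnion V N).exists_maximal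
    ⟨C₀, by simp only [Finset.mem_filter, Finset.mem_powerset]; exact ⟨hs₀, V₀, .circuit hC₀ hk₀⟩⟩
  have hN₁ := hN.1
  simp only [Finset.mem_filter, Finset.mem_powerset] at hN₁
  obtain ⟨hNF, V, h⟩ := hN₁
  by_cases hNe : N = F
  · subst hNe
    exact hasPotential_of_isEarUnion hw h fun F' hF' w hw => ih F' hF' hw
  have hdich : ∀ U C, G.IsCirc U C → C ⊆ F → C ⊆ N ∨ C ⊆ F \ N := by
    intro U C hC hs
    by_contra hcon
    rw [not_or] at hcon
    obtain ⟨V', E, hE, hEC, hEN⟩ := h.exists_ear hC hcon.1 (by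
      rw [Finset.disjoint_left]
      intro hd
      exact hcon.2 fun g hg => Finset.mem_sdiff.2 ⟨hs hg, hd hg⟩)
    refine hEN (Finset.subset_union_right.trans (hN.2 ?_ Finset.subset_union_left))
    simp only [Finset.mem_filter, Finset.mem_powerset]
    exact ⟨Finset.union_subset hNF (hEC.trans hs), _, hE⟩
  obtain ⟨f, hf⟩ := ih N (hNF.ssubset_of_ne hNe) hw
  obtain ⟨g, hg⟩ := ih (F \ N) (Finset.sdiff_ssubset hNF h.nonempty) hw
  refine ⟨fun e => if e ∈ N then f e else g e, fun U C hC hs hk => ?_⟩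
  rcases hdich U C hC hs with hs' | hs'
  · rw [hf U C hC hs' hk]
    exact Finset.sum_congr rfl fun e he => (if_pos (hs' he)).symm
  · rw [hg U C hC hs' hk]
    exact Finset.sum_congr rfl fun e he => (if_neg (Finset.mem_sdiff.1 (hs' he)).2).symm

end Potential

end Graph

/-! ### Traversals and clockwise parity -/

namespace Graph

/-- A path of `G` from `x` to `y` together with the parity of the number of its edges that `t`
directs from `x` towards `y`. -/
inductive IsPathPar {α β : Type*} [DecidableEq α] [DecidableEq β] (G : Graph α β) (t : β → α) :
    α → α → Finset α → Finset β → ZMod 2 → Prop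
  | nil (x : α) : IsPathPar G t x x {x} ∅ 0
  | cons {x y z : α} {e : β} {V : Finset α} {E : Finset β} {p : ZMod 2} (h : G.IsLink e x y)
      (q : IsPathPar G t y z V E p) (hx : x ∉ V) :
      IsPathPar G t x z (insert x V) (insert e E) ((if t e = x then 1 else 0) + p)

section Traversal

variable {α β : Type*} {G H : Graph α β} {n n' : ℕ} {v : ZMod n → α} {e : ZMod n → β}
  {v' : ZMod n' → α} {e' : ZMod n' → β} {t : β → α}

lemma _root_.ZMod.forall_of_succ [NeZero n] {P : ZMod n → Prop} (h : ∀ i, P i → P (i + 1))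
    {i : ZMod n} (hi : P i) (j : ZMod n) : P j := by
  have key : ∀ k : ℕ, P (i + k) := by
    intro k
    induction k with
    | zero => simpa using hi
    | succ k ih => rw [Nat.cast_succ, ← add_assoc]; exact h _ ih
  have := key (j - i).val
  rwa [ZMod.natCast_zmod_val, add_sub_cancel] at this

/-- Every edge of `G` is assigned one of its ends. -/
def IsTail (G : Graph α β) (t : β → α) : Prop := ∀ g ∈ E(G), ∃ y, G.IsLink g (t g) y

lemma IsTail.mono (hHG : H ≤ G) (ht : G.IsTail t) : H.IsTail t := by
  intro g hg
  obtain ⟨y, hy⟩ := ht g (hHG.edgeSet_mono hg)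
  exact ⟨y, (hHG.isLink_iff hg).2 hy⟩

/-- Even length excludes loops, whose direction would be ambiguous. -/
lemma IsCircuitSeq.succ_ne (h : G.IsCircuitSeq n v e) (hn : Even n) (i : ZMod n) :
    v (i + 1) ≠ v i := by
  have := h.pos
  have : Fact (1 < n) := ⟨by obtain ⟨k, rfl⟩ := hn; omega⟩
  intro hi
  simpa using h.injective_vertex hi

lemma IsCircuitSeq.mono (hHG : H ≤ G) (h : H.IsCircuitSeq n v e) : G.IsCircuitSeq n v e :=
  ⟨h.pos, h.injective_vertex, h.injective_edge, fun i => (h.isLink i).mono hHG⟩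

lemma ncard_cast [NeZero n] (P : ZMod n → Prop) [DecidablePred P] :
    (({i | P i}.ncard : ℕ) : ZMod 2) = ∑ i, if P i then 1 else 0 := by
  rw [Set.ncard_eq_toFinset_card', Finset.sum_boole]
  simp

/-- If the two traversals pass one edge in the same sense, they do so at every edge and the counts
are equal. Otherwise they differ at every edge, and the counts add up to the length, which is even.
-/
lemma IsCircuitSeq.agreement_eq (h : G.IsCircuitSeq n v e) (h' : G.IsCircuitSeq n' v' e')
    (hn : Even n) (hn' : Even n') (hr : Set.range e = Set.range e') (ht : G.IsTail t) :
    (({i | t (e i) = v i}.ncard : ℕ) : ZMod 2) = (({i | t (e' i) = v' i}.ncard : ℕ) : ZMod 2) := by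
  classical
  have := NeZero.of_pos h.pos
  have := NeZero.of_pos h'.pos
  have : ∀ j, ∃ i, e i = e' j := fun j => by
    have : e' j ∈ Set.range e := hr ▸ Set.mem_range_self j
    exact this
  choose σ hσ using this
  have hσb : Function.Bijective σ := by
    refine ⟨fun i j hij => h'.injective_edge (by rw [← hσ, ← hσ, hij]), fun i => ?_⟩
    have : e i ∈ Set.range e' := hr ▸ Set.mem_range_self i
    obtain ⟨j, hj⟩ := this
    exact ⟨j, h.injective_edge (by rw [hσ, hj])⟩
  have step : ∀ j, v (σ j) = v' j → v (σ (j + 1)) = v' (j + 1) := by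
    intro j hj
    have l1 := h.isLink (σ j)
    have l2 := h'.isLink j
    rw [hσ, hj] at l1
    have h1 := l1.right_unique l2
    have l3 := h.isLink (σ (j + 1))
    have l4 := h'.isLink (j + 1)
    rw [hσ] at l3
    rcases l3.eq_and_eq_or_eq_and_eq l4 with ⟨h2, -⟩ | ⟨-, h2⟩
    · exact h2
    · have h3 := hσb.1 (add_right_cancel (h.injective_vertex (h2.trans h1.symm)))
      have : v' (j + 1) = v' j := by rw [h3]
      exact absurd this (h'.succ_ne hn' j)
  rw [ncard_cast, ncard_cast, ← (Equiv.ofBijective σ hσb).sum_comp, ← CharTwo.add_eq_zero,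
    ← Finset.sum_add_distrib]
  have key : ∀ j, ((if t (e (σ j)) = v (σ j) then 1 else 0) +
      (if t (e' j) = v' j then 1 else 0) : ZMod 2) = if v (σ j) = v' j then 0 else 1 := by
    intro j
    obtain ⟨y, hy⟩ := ht (e' j) (h'.isLink j).edge_mem
    have l1 := h.isLink (σ j)
    have l2 := h'.isLink j
    have h1 := h.succ_ne hn (σ j)
    have h2 := h'.succ_ne hn' j
    rw [hσ] at l1 ⊢
    have h3 := l1.eq_and_eq_or_eq_and_eq l2
    have h4 := hy.eq_and_eq_or_eq_and_eq l2
    have two : (1 : ZMod 2) + 1 = 0 := by decide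
    split_ifs <;> grind
  simp only [Equiv.ofBijective_apply, key]
  by_cases hex : ∃ j, v (σ j) = v' j
  · obtain ⟨j, hj⟩ := hex
    have := ZMod.forall_of_succ step hj
    simp [this]
  · push Not at hex
    simp only [hex, if_false, Finset.sum_const, Finset.card_univ, ZMod.card]
    simpa using (ZMod.natCast_eq_zero_iff_even).2 hn'

/-- The clockwise parity that the tail function `t` gives to an even circuit `C` of `G`. -/
noncomputable def cwParity (G : Graph α β) (t : β → α) (C : Set β) : ZMod 2 :=
  open Classical in
  if h : ∃ q : ZMod 2, ∃ (n : ℕ) (v : ZMod n → α) (e : ZMod n → β), G.IsCircuitSeq n v e ∧ Even n ∧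
    Set.range e = C ∧ q = ({i | t (e i) = v i}.ncard : ℕ) then h.choose else 0

lemma IsCircuitSeq.cwParity_eq (h : G.IsCircuitSeq n v e) (hn : Even n) (ht : G.IsTail t) :
    G.cwParity t (Set.range e) = ({i | t (e i) = v i}.ncard : ℕ) := by
  have hex : ∃ q : ZMod 2, ∃ (m : ℕ) (v' : ZMod m → α) (e' : ZMod m → β), G.IsCircuitSeq m v' e' ∧
      Even m ∧ Set.range e' = Set.range e ∧ q = ({i | t (e' i) = v' i}.ncard : ℕ) :=
    ⟨_, n, v, e, h, hn, rfl, rfl⟩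
  rw [cwParity, dif_pos hex]
  obtain ⟨m, v', e', h', hm, hr, hq⟩ := hex.choose_spec
  rw [hq]
  exact h'.agreement_eq h hm hn hr ht

lemma cwParity_of_le (hHG : H ≤ G) (ht : G.IsTail t) {C : Set β} (hC : H.IsEvenCircuit C) :
    H.cwParity t C = G.cwParity t C := by
  obtain ⟨n, v, e, h, hn, rfl⟩ := hC
  rw [h.cwParity_eq hn (ht.mono hHG), (h.mono hHG).cwParity_eq hn ht]

lemma Orientation.agreement_eq (D : G.Orientation) (h : G.IsCircuitSeq n v e) (hn : Even n)
    (ht : ∀ g (hg : g ∈ E(G)), t g = D.tail ⟨g, hg⟩) :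
    D.agreement v e = {i | t (e i) = v i}.ncard := by
  unfold Orientation.agreement
  congr 1
  ext i
  have l := h.isLink i
  have hi := h.succ_ne hn i
  simp only [Set.mem_ofPred_eq, ht _ l.edge_mem]
  constructor
  · rintro ⟨_, h1, _⟩; exact h1
  · intro h1
    refine ⟨l.edge_mem, h1, ?_⟩
    have := D.isLink ⟨e i, l.edge_mem⟩
    rw [h1] at this
    exact this.right_unique l

lemma IsCircuitSeq.sum_range [NeZero n] [DecidableEq β] (h : G.IsCircuitSeq n v e) {C : Finset β}
    (hC : (C : Set β) = Set.range e) (f : β → ZMod 2) : ∑ i, f (e i) = ∑ g ∈ C, f g := by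
  have : C = Finset.univ.image e := by
    ext; rw [← Finset.mem_coe, hC]; simp
  rw [this, Finset.sum_image (fun _ _ _ _ hij => h.injective_edge hij)]

end Traversal

section PathPar

variable {α β : Type*} [DecidableEq α] [DecidableEq β] {G H : Graph α β} {t : β → α} {x y z : α}
  {V : Finset α} {E C : Finset β} {p : ZMod 2} {g : β}

lemma IsPathPar.isPath (h : G.IsPathPar t x y V E p) : G.IsPath x y V E := by
  induction h with
  | nil x => exact .nil x
  | cons h q hx ih => exact .cons h ih hx

lemma IsPath.exists_isPathPar (h : G.IsPath x y V E) (t : β → α) :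
    ∃ p, G.IsPathPar t x y V E p := by
  induction h with
  | nil x => exact ⟨0, .nil x⟩
  | cons h q hx ih => obtain ⟨p, ih⟩ := ih; exact ⟨_, .cons h ih hx⟩

lemma IsPathPar.snoc (h : G.IsPathPar t x y V E p) (hl : G.IsLink g y z) (hz : z ∉ V) :
    G.IsPathPar t x z (insert z V) (insert g E) (p + if t g = y then 1 else 0) := by
  induction h with
  | nil x =>
    have := IsPathPar.cons (t := t) hl (.nil z) (by simp at hz ⊢; exact fun h => hz h.symm)
    simpa [Finset.pair_comm, add_comm] using this
  | @cons a b c e V E p h q hx ih =>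
    have := IsPathPar.cons h (ih hl (by grind)) (by grind)
    rw [Finset.insert_comm, Finset.insert_comm g, add_assoc]
    exact this

lemma IsPathPar.exists_seq [Nonempty β] (h : G.IsPathPar t x y V E p) : ∃ (n : ℕ) (v : ℕ → α) (e : ℕ → β),
    v 0 = x ∧ v n = y ∧ (∀ i ≤ n, v i ∈ V) ∧ (∀ i ≤ n, ∀ j ≤ n, v i = v j → i = j) ∧
    (∀ i < n, G.IsLink (e i) (v i) (v (i + 1))) ∧ E = (Finset.range n).image e ∧
    p = ∑ i ∈ Finset.range n, if t (e i) = v i then 1 else 0 := by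
  induction h with
  | nil x =>
    exact ⟨0, fun _ => x, fun _ => Classical.arbitrary β, by simp⟩
  | @cons a b c g V E p h q hx ih =>
    obtain ⟨n, v, e, h0, hn, hV, hinj, hl, rfl, rfl⟩ := ih
    refine ⟨n + 1, fun i => Nat.casesOn i a v, fun i => Nat.casesOn i g e, rfl, hn, ?_, ?_, ?_, ?_, ?_⟩
    · rintro (_ | i) hi
      · simp
      · exact Finset.mem_insert_of_mem (hV i (by omega))
    · rintro (_ | i) hi (_ | j) hj hij
      · rfl
      · exact absurd (hV j (by omega)) (by rwa [← show a = v j from hij])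
      · exact absurd (hV i (by omega)) (by rwa [show v i = a from hij])
      · rw [hinj i (by omega) j (by omega) hij]
    · rintro (_ | i) hi
      · simpa [h0] using h
      · exact hl i (by omega)
    · ext z; simp only [Finset.mem_insert, Finset.mem_image, Finset.mem_range]
      constructor
      · rintro (rfl | ⟨i, hi, rfl⟩)
        · exact ⟨0, by omega, rfl⟩
        · exact ⟨i + 1, by omega, rfl⟩
      · rintro ⟨_ | i, hi, rfl⟩
        · left; rfl
        · right; exact ⟨i, by omega, rfl⟩
    · rw [Finset.sum_range_succ']; exact add_comm _ _

lemma IsPathPar.exists_isCircuitSeq (h : G.IsPathPar t x y V E p) (hl : G.IsLink g y x)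
    (hg : g ∉ E) : ∃ (n : ℕ) (v : ZMod n → α) (e : ZMod n → β),
      G.IsCircuitSeq n v e ∧ Set.range e = ↑(insert g E) ∧ n = (insert g E).card ∧
      (({i | t (e i) = v i}.ncard : ℕ) : ZMod 2) = p + if t g = y then 1 else 0 := by
  have : Nonempty β := ⟨g⟩
  obtain ⟨n, v, e, rfl, rfl, hV, hinj, hlink, rfl, rfl⟩ := h.exists_seq
  -- The path edges have the indices below `n`, and the closing edge `g` has the last index `n`.
  have hr : Set.range (fun i : ZMod (n + 1) => if i.val < n then e i.val else g) =
      ↑(insert g ((Finset.range n).image e)) := by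
    ext z
    simp only [Set.mem_range, Finset.coe_insert, Set.mem_insert_iff, Finset.mem_coe,
      Finset.mem_image, Finset.mem_range]
    constructor
    · rintro ⟨i, rfl⟩
      split_ifs with hi
      · exact Or.inr ⟨_, hi, rfl⟩
      · exact Or.inl rfl
    · rintro (rfl | ⟨i, hi, rfl⟩)
      · exact ⟨Fin.last n, if_neg (by simp [ZMod.val])⟩
      · exact ⟨Fin.mk i (by omega), if_pos (by simpa [ZMod.val])⟩
  have hv : ∀ i j : ZMod (n + 1), i.val = j.val → i = j := fun i j hij => ZMod.val_injective _ hij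
  have hlt : ∀ i : ZMod (n + 1), i.val < n + 1 := ZMod.val_lt
  have hgi : ∀ i, i < n → e i ≠ g := fun i hi hig =>
    hg (Finset.mem_image.2 ⟨i, by simpa using hi, hig⟩)
  have hinje : Function.Injective (fun i : ZMod (n + 1) => if i.val < n then e i.val else g) := by
    intro i j hij
    have h1 := hlt i
    have h2 := hlt j
    apply hv
    dsimp only at hij
    split_ifs at hij with hi hj hj
    · have l1 := hlink _ hi
      have l2 := hlink _ hj
      rw [hij] at l1
      rcases l1.eq_and_eq_or_eq_and_eq l2 with ⟨h3, -⟩ | ⟨h3, h4⟩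
      · exact hinj _ (by omega) _ (by omega) h3
      · have := hinj _ (by omega) _ (by omega) h3
        have := hinj _ (by omega) _ (by omega) h4
        omega
    · exact absurd hij (hgi _ hi)
    · exact absurd hij.symm (hgi _ hj)
    · omega
  refine ⟨n + 1, fun i => v i.val, fun i => if i.val < n then e i.val else g,
    ⟨by omega, fun i j hij => hv i j (hinj _ (by have := hlt i; omega) _
      (by have := hlt j; omega) hij), hinje, fun i => ?_⟩, hr, ?_, ?_⟩
  · have h1 : (i + 1).val = if i.val = n then 0 else i.val + 1 := by
      refine (Fin.val_add_one (n := n) i).trans ?_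
      congr 1
      exact propext (Fin.ext_iff (a := i) (b := Fin.last n))
    have h2 := hlt i
    rw [h1]
    by_cases hi : i.val = n
    · simpa [hi] using hl
    · have : i.val < n := by omega
      simpa [hi, this] using hlink _ this
  · have := congrArg Set.ncard hr
    rw [Set.ncard_coe_finset, ← Set.image_univ, Set.ncard_image_of_injective _ hinje,
      Set.ncard_univ, Nat.card_zmod] at this
    exact this
  · rw [ncard_cast]
    refine (Fin.sum_univ_eq_sum_range (fun i => if t (if i < n then e i else g) = v i then
      (1 : ZMod 2) else 0) (n + 1)).trans ?_
    rw [Finset.sum_range_succ]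
    congr 1
    · exact Finset.sum_congr rfl fun i hi => by simp [Finset.mem_range.1 hi]
    · simp

lemma IsPathPar.cwParity_eq (h : G.IsPathPar t x y V E p) (hl : G.IsLink g y x)
    (hg : g ∉ E) (hE : (insert g E).card % 2 = 0) (ht : G.IsTail t) :
    G.cwParity t ↑(insert g E) = p + if t g = y then 1 else 0 := by
  obtain ⟨n, v, e, hs, hr, rfl, hp⟩ := h.exists_isCircuitSeq hl hg
  rw [← hr, hs.cwParity_eq (Nat.even_iff.2 hE) ht, hp]

lemma IsCirc.isEvenCircuit (h : G.IsCirc V C) (hC : C.card % 2 = 0) :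
    G.IsEvenCircuit (C : Set β) := by
  obtain ⟨g, hg⟩ := h.nonempty
  obtain ⟨x, y, E, hxy, hl, h', hgE, rfl⟩ := h.exists_path hg
  obtain ⟨p, hp⟩ := h'.exists_isPathPar fun _ => x
  obtain ⟨n, v, e, hs, hr, rfl, -⟩ := hp.exists_isCircuitSeq hl.symm hgE
  exact ⟨_, v, e, hs, Nat.even_iff.2 hC, hr⟩

lemma IsEvenCircuit.exists_isCirc {C : Set β} (h : G.IsEvenCircuit C) :
    ∃ V C', G.IsCirc V C' ∧ (C' : Set β) = C ∧ C'.card % 2 = 0 := by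
  obtain ⟨n, v, e, h, hn, rfl⟩ := h
  have hpos := h.pos
  obtain ⟨m, rfl⟩ : ∃ m, n = m + 1 := ⟨n - 1, by omega⟩
  have hm : 0 < m := by obtain ⟨k, hk⟩ := hn; omega
  have cast_inj : ∀ i j : ℕ, i ≤ m → j ≤ m → (i : ZMod (m + 1)) = j → i = j := by
    intro i j hi hj hij
    have := congrArg ZMod.val hij
    rwa [ZMod.val_natCast_of_lt (by omega), ZMod.val_natCast_of_lt (by omega)] at this
  have key : ∀ k : ℕ, k ≤ m → G.IsPath (v 0) (v k) ((Finset.range (k + 1)).image fun i : ℕ => v i)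
      ((Finset.range k).image fun i : ℕ => e i) := by
    intro k
    induction k with
    | zero => intro; simpa using IsPath.nil (v 0)
    | succ k ih =>
      intro hk
      have hnot : v (k + 1 : ℕ) ∉ (Finset.range (k + 1)).image fun i : ℕ => v i := by
        simp only [Finset.mem_image, Finset.mem_range, not_exists, not_and]
        intro i hi hiv
        have := cast_inj _ _ (by omega) hk (h.injective_vertex hiv)
        omega
      have hl := h.isLink k
      rw [← Nat.cast_succ] at hl
      obtain ⟨p, hp⟩ := (ih (by omega)).exists_isPathPar fun _ => v 0
      have := (hp.snoc hl hnot).isPath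
      rwa [Finset.range_add_one (n := k + 1), Finset.image_insert, Finset.range_add_one (n := k),
        Finset.image_insert (s := Finset.range k) (f := fun i : ℕ => e i), ← Finset.range_add_one]
  have hl := h.isLink m
  have h0 : (m : ZMod (m + 1)) + 1 = 0 := by
    rw [← Nat.cast_succ, ZMod.natCast_self]
  rw [h0] at hl
  have hnot : e m ∉ (Finset.range m).image fun i : ℕ => e i := by
    simp only [Finset.mem_image, Finset.mem_range, not_exists, not_and]
    intro i hi hiv
    have := cast_inj _ _ (by omega) le_rfl (h.injective_edge hiv)
    omega
  have hne : v 0 ≠ v m := by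
    intro h1
    have := cast_inj 0 m (by omega) le_rfl (by simpa using h.injective_vertex h1)
    omega
  have himg : insert (e m) ((Finset.range m).image fun i : ℕ => e i) =
      (Finset.range (m + 1)).image fun i : ℕ => e i := by
    rw [Finset.range_add_one, Finset.image_insert]
  have := (key m le_rfl).isCirc_insert hl.symm hne hnot
  rw [himg] at this
  refine ⟨_, _, this, ?_, ?_⟩
  · ext z
    simp only [Finset.coe_image, Finset.coe_range,
      Set.mem_image, Set.mem_Iio, Set.mem_range]
    constructor
    · rintro ⟨i, -, rfl⟩; exact ⟨_, rfl⟩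
    · rintro ⟨i, rfl⟩; exact ⟨i.val, ZMod.val_lt i, by rw [ZMod.natCast_zmod_val]⟩
  · rw [Finset.card_image_of_injOn]
    · simpa using Nat.even_iff.1 hn
    · intro i hi j hj hij
      simp only [Finset.coe_range, Set.mem_Iio] at hi hj
      exact cast_inj _ _ (by omega) (by omega) (h.injective_edge hij)

end PathPar
end Graph

/-! ### Lifting circuits to an even vertex splitting -/

namespace Graph

section Splitting

variable {α β : Type*} [DecidableEq α] [DecidableEq β] {A B : Graph α β} {e f g : β}
  {u v w x y a b : α} {φ : α → α} {t : β → α} {V : Finset α} {E C : Finset β} {p : ZMod 2}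

/-- `A` arises from `B` by contracting the edges `e`, `f` at the vertex `v` of degree `2`. -/
structure IsSplit (B A : Graph α β) (e f : β) (u v w : α) (φ : α → α) : Prop where
  ne : e ≠ f
  ne_left : u ≠ v
  ne_right : w ≠ v
  left : B.IsLink e v u
  right : B.IsLink f v w
  deg : ∀ g, B.Inc g v → g = e ∨ g = f
  inj : ∀ x ∈ V(B), ∀ y ∈ V(B),
      φ x = φ y ↔ x = y ∨ (x ∈ ({u, v, w} : Set α) ∧ y ∈ ({u, v, w} : Set α))
  eq : A = (B.deleteEdges {e, f}).map φ

namespace IsSplit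

lemma isLink_iff (S : B.IsSplit A e f u v w φ) : A.IsLink g a b ↔
    ∃ a' b', B.IsLink g a' b' ∧ g ≠ e ∧ g ≠ f ∧ φ a' = a ∧ φ b' = b := by
  rw [S.eq]
  constructor
  · rintro ⟨a', b', h, rfl, rfl⟩
    simp only [deleteEdges_isLink, Set.mem_insert_iff, Set.mem_singleton_iff, not_or] at h
    exact ⟨a', b', h.1, h.2.1, h.2.2, rfl, rfl⟩
  · rintro ⟨a', b', h, h1, h2, rfl, rfl⟩
    exact ⟨a', b', by simp [h, h1, h2], rfl, rfl⟩

lemma isLink (S : B.IsSplit A e f u v w φ) (h : B.IsLink g a b) (he : g ≠ e) (hf : g ≠ f) :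
    A.IsLink g (φ a) (φ b) :=
  S.isLink_iff.2 ⟨a, b, h, he, hf, rfl, rfl⟩

lemma apply_eq (S : B.IsSplit A e f u v w φ) : φ u = φ v ∧ φ w = φ v := by
  constructor
  · exact (S.inj _ S.left.right_mem _ S.left.left_mem).2 (by simp)
  · exact (S.inj _ S.right.right_mem _ S.left.left_mem).2 (by simp)

lemma eq_of_apply_eq (S : B.IsSplit A e f u v w φ) (ha : a ∈ V(B)) (hb : b ∈ V(B))
    (h : φ a = φ b) (hv : φ a ≠ φ v) : a = b := by
  rcases (S.inj a ha b hb).1 h with h | ⟨h1, -⟩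
  · exact h
  · exact absurd ((S.inj a ha v S.left.left_mem).2 (Or.inr ⟨h1, by simp⟩)) hv

lemma eq_or_eq_of_apply_eq (S : B.IsSplit A e f u v w φ) (hl : B.IsLink g a b) (he : g ≠ e)
    (hf : g ≠ f) (h : φ a = φ v) : a = u ∨ a = w := by
  have hav : a ≠ v := by
    rintro rfl
    rcases S.deg g hl.inc_left with h | h
    exacts [he h, hf h]
  rcases (S.inj a hl.left_mem v S.left.left_mem).1 h with h | ⟨h1, -⟩
  · exact absurd h hav
  · simp only [Set.mem_insert_iff, Set.mem_singleton_iff] at h1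
    tauto

lemma isTail (S : B.IsSplit A e f u v w φ) (ht : B.IsTail t) : A.IsTail (φ ∘ t) := by
  intro g hg
  obtain ⟨a, b, h⟩ := exists_isLink_of_mem_edgeSet hg
  obtain ⟨a', b', h', he, hf, -, -⟩ := S.isLink_iff.1 h
  obtain ⟨y, hy⟩ := ht g h'.edge_mem
  exact ⟨_, S.isLink hy he hf⟩

lemma tail_iff (ht : B.IsTail t) (hl : B.IsLink g a b)
    (hab : φ a ≠ φ b) : φ (t g) = φ a ↔ t g = a := by
  obtain ⟨y, hy⟩ := ht g hl.edge_mem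
  rcases hy.eq_and_eq_or_eq_and_eq hl with ⟨h, -⟩ | ⟨h, -⟩
  · simp [h]
  · rw [h]
    exact ⟨fun h' => absurd h'.symm hab, fun h' => by rw [h']⟩

/-- Away from the contracted vertex `φ` is injective, so the path lifts edge by edge, with the same
tails. -/
lemma exists_isPathPar (S : B.IsSplit A e f u v w φ) (ht : B.IsTail t)
    (h : A.IsPathPar (φ ∘ t) a b V E p) (hx : φ v ∉ V) (hb : b ∈ V(A)) :
    ∃ a' b' V', B.IsPathPar t a' b' V' E p ∧ φ a' = a ∧ φ b' = b ∧
      ∀ z ∈ V', z ∈ V(B) ∧ φ z ∈ V := by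
  induction h with
  | nil a =>
    rw [S.eq] at hb
    obtain ⟨a', ha, rfl⟩ := hb
    exact ⟨a', a', {a'}, .nil a', rfl, rfl, by simpa using ha⟩
  | @cons a y b g V E p h q ha ih =>
    obtain ⟨y', b', V', q', rfl, rfl, hV⟩ := ih (by grind) hb
    obtain ⟨a', y'', h', he, hf, rfl, hy⟩ := S.isLink_iff.1 h
    have hy' := q'.isPath.left_mem
    have := S.eq_of_apply_eq h'.right_mem (hV _ hy').1 hy
      (by rw [hy]; rintro h1; exact hx (by rw [← h1]; simp [(hV _ hy').2]))
    subst this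
    refine ⟨a', b', insert a' V', ?_, rfl, rfl, ?_⟩
    · have h1 : a' ∉ V' := fun h1 => ha (hV _ h1).2
      have := IsPathPar.cons h' q' h1
      convert this using 2
      refine if_congr ?_ rfl rfl
      exact tail_iff ht h' (by rintro h2; exact ha (by rw [h2]; exact (hV _ hy').2))
    · intro z hz
      rcases Finset.mem_insert.1 hz with rfl | hz
      · exact ⟨h'.left_mem, by simp⟩
      · exact ⟨(hV z hz).1, by simp [(hV z hz).2]⟩

omit [DecidableEq α] [DecidableEq β] in
lemma _root_.Graph.IsTail.ite_eq [DecidableEq α] (ht : B.IsTail t) (hl : B.IsLink g a b) (hab : a ≠ b) :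
    (if t g = a then (1 : ZMod 2) else 0) = 1 + if t g = b then 1 else 0 := by
  have two : (1 : ZMod 2) + 1 = 0 := by decide
  obtain ⟨y, hy⟩ := ht g hl.edge_mem
  rcases hy.eq_and_eq_or_eq_and_eq hl with ⟨h, -⟩ | ⟨h, -⟩
  · simp [h, hab]
  · simp [h, hab.symm, two]

/-- The circuit is traversed as `v`, `u`, …, `b`, `w`, `v`. It passes `e` away from `v` but `f`
towards `v`, which accounts for the summand `1`. -/
lemma isCirc_through (ht : B.IsTail t) (h : B.IsPathPar t u b V E p) (hl : B.IsLink g b w)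
    (hw : w ∉ V) (hv : v ∉ V) (hvw : v ≠ w) (he : B.IsLink e v u) (hf : B.IsLink f v w)
    (hef : e ≠ f) (hfE : f ∉ E) (hfg : f ≠ g) (hc : (insert g E).card % 2 = 0)
    (hgE : g ∉ E) (heE : e ∉ E) (heg : e ≠ g) :
    (∃ V, B.IsCirc V (insert e (insert f (insert g E)))) ∧
    (insert e (insert f (insert g E))).card % 2 = 0 ∧
    B.cwParity t ↑(insert e (insert f (insert g E))) = p + (if t g = b then 1 else 0) +
      (1 + (if t e = v then 1 else 0) + if t f = v then 1 else 0) := by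
  have q := IsPathPar.cons he (h.snoc hl hw) (by simp [hv, hvw])
  have hfn : f ∉ insert e (insert g E) := by simp [hef.symm, hfE, hfg]
  have hc' : (insert f (insert e (insert g E))).card % 2 = 0 := by
    rw [Finset.card_insert_of_notMem hfn, Finset.card_insert_of_notMem (by simp [heE, heg])]
    omega
  rw [Finset.insert_comm e f]
  refine ⟨⟨_, q.isPath.isCirc_insert hf hvw hfn⟩, hc', ?_⟩
  rw [q.cwParity_eq hf.symm hfn hc' ht, ht.ite_eq hf.symm hvw.symm]
  ring

lemma degPar_insert {G : Graph α β} (hg : g ∉ E) :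
    G.degPar u (insert g E) = (open Classical in if G.Inc g u then 1 else 0) + G.degPar u E := by
  unfold degPar
  rw [Finset.sum_insert hg]

/-- The edge set of `B` that an edge set `C` of `A` lifts to. -/
noncomputable def lift (B : Graph α β) (e f : β) (u : α) (C : Finset β) : Finset β :=
  -- For a circuit `C` of `A` the degree at `u` in `B` is odd exactly if `C` passes the contracted
  -- vertex using one edge at `u` and one at `w`, with `u ≠ w`; the gap is then closed by `e` and
  -- `f`.
  if B.degPar u C = 1 then insert e (insert f C) else C

/-- The correction is the same for all circuits whose lift uses `e` and `f`, so it cancels over a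
family with an even number of such circuits. -/
lemma lift_spec (S : B.IsSplit A e f u v w φ) (ht : B.IsTail t) (hC : A.IsCirc V C)
    (hc : C.card % 2 = 0) : (∃ V, B.IsCirc V (lift B e f u C)) ∧ (lift B e f u C).card % 2 = 0 ∧
    B.cwParity t ↑(lift B e f u C) = A.cwParity (φ ∘ t) C + if B.degPar u C = 1 then
      (1 + (if t e = v then 1 else 0) + if t f = v then 1 else 0) else 0 := by
  have hedge : ∀ g ∈ C, g ≠ e ∧ g ≠ f := by
    intro g hg
    obtain ⟨a, b, hl, -⟩ := hC.exists_isLink hg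
    obtain ⟨-, -, -, h1, h2, -⟩ := S.isLink_iff.1 hl
    exact ⟨h1, h2⟩
  have hinc : ∀ g ∈ C, ∀ z, B.Inc g z → A.Inc g (φ z) := by
    rintro g hg z ⟨z', hz⟩
    exact (S.isLink hz (hedge g hg).1 (hedge g hg).2).inc_left
  have hu := S.apply_eq.1
  have hw := S.apply_eq.2
  by_cases hx : φ v ∈ V
  · obtain ⟨g, hg, hi⟩ := hC.exists_inc hx
    obtain ⟨b, E, hb, hl, q, hgE, rfl⟩ : ∃ b E, φ v ≠ b ∧ A.IsLink g (φ v) b ∧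
        A.IsPath (φ v) b V E ∧ g ∉ E ∧ C = insert g E := by
      obtain ⟨a, b, E, hab, hl, q, hgE, rfl⟩ := hC.exists_path hg
      rcases hi.eq_or_eq_of_isLink hl with rfl | rfl
      · exact ⟨b, E, hab, hl, q, hgE, rfl⟩
      · exact ⟨a, E, hab.symm, hl.symm, q.symm, hgE, rfl⟩
    generalize hxv : φ v = x₀ at *
    cases q with
    | nil => exact absurd rfl hb
    | @cons _ y _ g₀ V₁ E₁ h₀ q hxV =>
      obtain ⟨p, q⟩ := q.exists_isPathPar (φ ∘ t)
      obtain ⟨y', b', V', q', rfl, rfl, hV⟩ := S.exists_isPathPar ht q (hxv ▸ hxV) hl.right_mem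
      have hy' := q'.isPath.left_mem
      have hb' := q'.isPath.right_mem
      have hne : ∀ z ∈ V', φ z ≠ x₀ := fun z hz h => hxV (h ▸ (hV z hz).2)
      obtain ⟨u₀, y'', h₀', he₀, hf₀, hu₀, hy''⟩ := S.isLink_iff.1 h₀
      obtain ⟨u₁, b'', hl', he₁, hf₁, hu₁, hb''⟩ := S.isLink_iff.1 hl
      obtain rfl : y'' = y' := S.eq_of_apply_eq h₀'.right_mem (hV _ hy').1 hy''
        (by rw [hy'', hxv]; exact hne _ hy')
      obtain rfl : b'' = b' := S.eq_of_apply_eq hl'.right_mem (hV _ hb').1 hb''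
        (by rw [hb'', hxv]; exact hne _ hb')
      have hu₀' := S.eq_or_eq_of_apply_eq h₀' he₀ hf₀ (hu₀.trans hxv.symm)
      have hu₁' := S.eq_or_eq_of_apply_eq hl' he₁ hf₁ (hu₁.trans hxv.symm)
      have hg₀ : g₀ ∉ E₁ := fun h => by
        have := q.isPath.mem_of_inc h h₀.inc_left
        exact hxV this
      have hE₁ : ∀ h ∈ E₁, ¬ B.Inc h u := by
        intro h hh hi
        have := hinc h (by simp [hh]) u hi
        rw [hu] at this
        exact hxV (q.isPath.mem_of_inc hh this)
      have hE₁' : B.degPar u E₁ = 0 :=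
        Finset.sum_eq_zero fun h hh => by simp [hE₁ h hh]
      have huV : ∀ z, φ z = x₀ → z ∉ V' := fun z hz hzV => hne z hzV hz
      have inc₀ : B.Inc g₀ u ↔ u₀ = u := by
        constructor
        · intro h
          rcases h.eq_or_eq_of_isLink h₀' with h | h
          · exact h.symm
          · exact absurd hy' (huV _ (h ▸ hu))
        · rintro rfl; exact h₀'.inc_left
      have inc₁ : B.Inc g u ↔ u₁ = u := by
        constructor
        · intro h
          rcases h.eq_or_eq_of_isLink hl' with h | h
          · exact h.symm
          · exact absurd hb' (huV _ (h ▸ hu))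
        · rintro rfl; exact hl'.inc_left
      have hdeg : B.degPar u (insert g (insert g₀ E₁)) =
          (if u₁ = u then 1 else 0) + if u₀ = u then 1 else 0 := by
        rw [degPar_insert hgE, degPar_insert hg₀, hE₁', add_zero]
        simp only [inc₀, inc₁]
      have q₁ := IsPathPar.cons h₀' q' (huV _ hu₀)
      have q₂ := IsPathPar.cons h₀ q hxV
      have hA := q₂.cwParity_eq hl.symm hgE hc (S.isTail ht)
      have t₀ := tail_iff (φ := φ) ht h₀' (by rw [hu₀]; exact (hne _ hy').symm)
      have t₁ := tail_iff (φ := φ) ht hl'.symm (by rw [hu₁]; exact hne _ hb')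
      simp only [Function.comp_apply, ← hu₀, t₀, t₁] at hA
      unfold lift
      -- `u₀` and `u₁` are the ends in `B` of the two edges of `C` at the contracted vertex. If they
      -- coincide, then `C` is itself a circuit of `B`.
      by_cases h01 : u₀ = u₁
      · have h2 : B.degPar u (insert g (insert g₀ E₁)) ≠ 1 := by
          rw [hdeg, h01, CharTwo.add_self_eq_zero]; simp
        rw [if_neg h2, if_neg h2, add_zero, hA]
        subst h01
        refine ⟨⟨_, q₁.isPath.isCirc_insert hl' ?_ hgE⟩, hc, ?_⟩
        · rintro rfl; exact huV _ hu₀ hb'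
        · rw [q₁.cwParity_eq hl'.symm hgE hc ht]
      · have h2 : B.degPar u (insert g (insert g₀ E₁)) = 1 := by
          rw [hdeg]; grind
        rw [if_pos h2, if_pos h2, hA]
        have n1 := hedge g (by simp)
        have n2 : e ∉ insert g₀ E₁ ∧ f ∉ insert g₀ E₁ :=
          ⟨fun h => (hedge e (by simp [h])).1 rfl, fun h => (hedge f (by simp [h])).2 rfl⟩
        have hvV : ∀ {u'}, u' ≠ v → v ∉ insert u' V' := by
          intro u' hu'; simp [hu'.symm, huV v hxv]
        have huw : ∀ {z z'}, φ z = x₀ → z ≠ z' → z ∉ insert z' V' := by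
          intro z z' hz hzz; simp [hzz, huV z hz]
        rcases hu₀' with rfl | rfl <;> rcases hu₁' with rfl | rfl
        · exact absurd rfl h01
        · exact isCirc_through ht q₁ hl'.symm (huw hu₁ (Ne.symm h01)) (hvV S.ne_left) S.ne_right.symm
            S.left S.right S.ne n2.2 n1.2.symm hc hgE n2.1 n1.1.symm
        · have := isCirc_through ht q₁ hl'.symm (huw hu₁ (Ne.symm h01)) (hvV S.ne_right)
            S.ne_left.symm S.right S.left S.ne.symm n2.1 n1.1.symm hc hgE n2.2 n1.2.symm
          rw [Finset.insert_comm] at this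
          refine ⟨this.1, this.2.1, this.2.2.trans ?_⟩
          ring
        · exact absurd rfl h01
  · have hdeg : B.degPar u C = 0 := Finset.sum_eq_zero fun h hh => if_neg fun hi => hx (by
      rw [← hu]; exact hC.mem_of_inc hh (hinc h hh u hi))
    unfold lift
    have h2 : B.degPar u C ≠ 1 := by rw [hdeg]; simp
    rw [if_neg h2, if_neg h2, add_zero]
    obtain ⟨g, hg⟩ := hC.nonempty
    obtain ⟨a, b, E, hab, hl, q, hgE, rfl⟩ := hC.exists_path hg
    obtain ⟨p, q⟩ := q.exists_isPathPar (φ ∘ t)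
    obtain ⟨a', b', V', q', rfl, rfl, hV⟩ := S.exists_isPathPar ht q hx hl.right_mem
    have ha' := q'.isPath.left_mem
    have hb' := q'.isPath.right_mem
    obtain ⟨a'', b'', hl', he, hf, ha, hb⟩ := S.isLink_iff.1 hl
    have hne : ∀ z ∈ V', φ z ≠ φ v := fun z hz h => hx (h ▸ (hV z hz).2)
    obtain rfl : a'' = a' := S.eq_of_apply_eq hl'.left_mem (hV _ ha').1 ha
      (by rw [ha]; exact hne _ ha')
    obtain rfl : b'' = b' := S.eq_of_apply_eq hl'.right_mem (hV _ hb').1 hb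
      (by rw [hb]; exact hne _ hb')
    refine ⟨⟨_, q'.isPath.isCirc_insert hl' (by rintro rfl; exact hab rfl) hgE⟩, hc, ?_⟩
    rw [q'.cwParity_eq hl'.symm hgE hc ht, q.cwParity_eq hl.symm hgE hc (S.isTail ht)]
    simp only [Function.comp_apply, tail_iff ht hl'.symm hab.symm]

end IsSplit
end Splitting
end Graph

/-! ### Families of even circuits with constant parity sum -/

namespace Graph

section EvenFamily

variable {α β : Type*} [DecidableEq α] [DecidableEq β] {A B G H K : Graph α β} {e f : β}
  {u v w : α} {φ : α → α} {k : ℕ} {c : ZMod 2}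

/-- `G` has `k` even circuits that cover every edge an even number of times and whose clockwise
parities sum to `c` under every orientation. -/
def HasEvenFamily (G : Graph α β) (k : ℕ) (c : ZMod 2) : Prop :=
  ∃ F : Finset (Finset β), F.card = k ∧ (∀ C ∈ F, (∃ V, G.IsCirc V C) ∧ C.card % 2 = 0) ∧
    (∀ g, ∑ C ∈ F, (if g ∈ C then (1 : ZMod 2) else 0) = 0) ∧
    ∀ t, G.IsTail t → ∑ C ∈ F, G.cwParity t C = c

omit [DecidableEq α] [DecidableEq β] in
lemma exists_isTail [Nonempty α] (G : Graph α β) : ∃ t, G.IsTail t := by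
  have : ∀ g, ∃ x, g ∈ E(G) → ∃ y, G.IsLink g x y := by
    intro g
    by_cases hg : g ∈ E(G)
    · obtain ⟨x, y, h⟩ := exists_isLink_of_mem_edgeSet hg
      exact ⟨x, fun _ => ⟨y, h⟩⟩
    · exact ⟨Classical.arbitrary α, fun h => absurd h hg⟩
  choose t ht using this
  exact ⟨t, ht⟩

/-- The number of members whose lift uses `e` and `f` is, modulo 2, the sum of the degrees at `u`,
which is zero because the family covers every edge evenly. Hence `e` and `f` are covered evenly too,
and the corrections to the clockwise parities cancel. -/
lemma IsSplit.hasEvenFamily (S : B.IsSplit A e f u v w φ) (h : A.HasEvenFamily k c) :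
    B.HasEvenFamily k c := by
  obtain ⟨F, rfl, hF, hcov, hsum⟩ := h
  have : Nonempty α := ⟨u⟩
  have hedge : ∀ C ∈ F, e ∉ C ∧ f ∉ C := by
    intro C hC
    obtain ⟨⟨V, hV⟩, -⟩ := hF C hC
    constructor <;> intro hg
    · obtain ⟨a, b, hl, -⟩ := hV.exists_isLink hg
      obtain ⟨-, -, -, h1, -⟩ := S.isLink_iff.1 hl
      exact h1 rfl
    · obtain ⟨a, b, hl, -⟩ := hV.exists_isLink hg
      obtain ⟨-, -, -, -, h1, -⟩ := S.isLink_iff.1 hl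
      exact h1 rfl
  have hinj : Set.InjOn (IsSplit.lift B e f u) F := by
    intro C hC D hD hCD
    have hs : ∀ C ∈ F, IsSplit.lift B e f u C \ {e, f} = C := by
      intro C hC
      have := hedge C hC
      unfold IsSplit.lift
      ext g
      split_ifs <;> simp <;> grind
    rw [← hs C hC, hCD, hs D hD]
  have hdeg : ∑ C ∈ F, (if B.degPar u C = 1 then (1 : ZMod 2) else 0) = 0 := by
    have h1 : ∀ C ∈ F, (if B.degPar u C = 1 then (1 : ZMod 2) else 0) =
        ∑ g ∈ F.biUnion id, (if g ∈ C then 1 else 0) *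
          (open Classical in if B.Inc g u then 1 else 0) := by
      intro C hC
      have h2 : (if B.degPar u C = 1 then (1 : ZMod 2) else 0) = B.degPar u C := by
        generalize B.degPar u C = z
        revert z; decide
      rw [h2, degPar]
      simp only [ite_mul, one_mul, zero_mul, Finset.sum_ite_mem]
      rw [Finset.inter_eq_right.2]
      intro g hg
      exact Finset.mem_biUnion.2 ⟨C, hC, hg⟩
    rw [Finset.sum_congr rfl h1, Finset.sum_comm]
    refine Finset.sum_eq_zero fun g _ => ?_
    rw [← Finset.sum_mul, hcov, zero_mul]
  refine ⟨F.image (IsSplit.lift B e f u), Finset.card_image_of_injOn hinj, ?_, ?_, ?_⟩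
  · intro C hC
    obtain ⟨D, hD, rfl⟩ := Finset.mem_image.1 hC
    obtain ⟨⟨V, hV⟩, hc⟩ := hF D hD
    obtain ⟨t, ht⟩ := B.exists_isTail
    exact ⟨(S.lift_spec ht hV hc).1, (S.lift_spec ht hV hc).2.1⟩
  · intro g
    rw [Finset.sum_image hinj]
    by_cases hg : g = e ∨ g = f
    · refine (Finset.sum_congr rfl fun C hC => if_congr ?_ rfl rfl).trans hdeg
      have := hedge C hC
      unfold IsSplit.lift
      split_ifs <;> grind
    · refine (Finset.sum_congr rfl fun C hC => if_congr ?_ rfl rfl).trans (hcov g)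
      unfold IsSplit.lift
      split_ifs <;> grind
  · intro t ht
    rw [Finset.sum_image hinj, ← hsum _ (S.isTail ht)]
    have : ∀ C ∈ F, B.cwParity t (IsSplit.lift B e f u C) = A.cwParity (φ ∘ t) C +
        (if B.degPar u C = 1 then 1 else 0) *
          (1 + (if t e = v then 1 else 0) + if t f = v then 1 else 0) := by
      intro C hC
      obtain ⟨⟨V, hV⟩, hc⟩ := hF C hC
      rw [(S.lift_spec ht hV hc).2.2]
      simp
    rw [Finset.sum_congr rfl this, Finset.sum_add_distrib, ← Finset.sum_mul, hdeg, zero_mul,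
      add_zero]

lemma HasEvenFamily.of_splittings (h : A.HasEvenFamily k c)
    (hAB : Relation.ReflTransGen (fun A B : Graph α β => B.IsEvenVertexSplitting A) A B) :
    B.HasEvenFamily k c := by
  induction hAB with
  | refl => exact h
  | tail _ hs ih =>
    obtain ⟨e, f, u, v, w, φ, h1, h2, h3, h4, h5, h6, h7, h8⟩ := hs
    exact IsSplit.hasEvenFamily ⟨h1, h2, h3, h4, h5, h6, h7, h8⟩ ih

/-- If the even circuits of a finite `H` are exactly those of an even family, then their prescribed
clockwise parities can be realized only if they sum to `c`. -/
lemma HasEvenFamily.exists_finset (h : H.HasEvenFamily k c) (hk : H.numEvenCircuits = k)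
    (hE : E(H).Finite) : ∃ F : Finset (Finset β), F.card = k ∧
      (∀ C, C ∈ F ↔ (∃ V, H.IsCirc V C) ∧ C.card % 2 = 0) ∧
      (∀ t, H.IsTail t → ∑ C ∈ F, H.cwParity t C = c) ∧
      ∀ J : Set β → ZMod 2, (H.numPrescribedEven J : ZMod 2) = k + ∑ C ∈ F, J C := by
  obtain ⟨F, hFk, hF, -, hsum⟩ := h
  have hinj : Function.Injective fun C : Finset β => (C : Set β) := Finset.coe_injective
  have hsub : (fun C : Finset β => (C : Set β)) '' F ⊆ {C | H.IsEvenCircuit C} := by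
    rintro _ ⟨C, hC, rfl⟩
    obtain ⟨⟨V, hV⟩, hc⟩ := hF C hC
    exact hV.isEvenCircuit hc
  have hfin : {C | H.IsEvenCircuit C}.Finite := by
    refine hE.finite_subsets.subset ?_
    rintro C ⟨n, v, e, h, -, rfl⟩
    rintro _ ⟨i, rfl⟩
    exact (h.isLink i).edge_mem
  -- The family has as many members as there are even circuits, hence contains them all.
  have heq : (fun C : Finset β => (C : Set β)) '' F = {C | H.IsEvenCircuit C} := by
    refine Set.eq_of_subset_of_ncard_le hsub ?_ hfin
    rw [Set.ncard_image_of_injective _ hinj, Set.ncard_coe_finset, hFk]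
    exact hk.le
  have hmem : ∀ C : Finset β, H.IsEvenCircuit C → C ∈ F := by
    intro C hC
    have : (C : Set β) ∈ (fun C : Finset β => (C : Set β)) '' F := heq ▸ hC
    obtain ⟨D, hD, hDC⟩ := this
    exact hinj hDC ▸ hD
  refine ⟨F, hFk, fun C => ⟨hF C, ?_⟩, hsum, fun J => ?_⟩
  · rintro ⟨⟨V, hV⟩, hc⟩
    exact hmem C (hV.isEvenCircuit hc)
  · have : {C | H.IsEvenCircuit C ∧ J C = 0} =
        (fun C : Finset β => (C : Set β)) '' ↑(F.filter fun C : Finset β => J C = 0) := by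
      ext C
      constructor
      · rintro ⟨hC, hJ⟩
        have : C ∈ (fun C : Finset β => (C : Set β)) '' F := heq ▸ hC
        obtain ⟨D, hD, rfl⟩ := this
        exact ⟨D, by simpa using ⟨hD, hJ⟩, rfl⟩
      · rintro ⟨D, hD, rfl⟩
        rw [Finset.mem_coe, Finset.mem_filter] at hD
        obtain ⟨⟨V, hV⟩, hc⟩ := hF D hD.1
        exact ⟨hV.isEvenCircuit hc, hD.2⟩
    rw [numPrescribedEven, this, Set.ncard_image_of_injective _ hinj, Set.ncard_coe_finset,
      Finset.card_filter, ← hFk]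
    push_cast
    rw [Finset.card_eq_sum_ones, Nat.cast_sum, ← Finset.sum_add_distrib]
    -- The indicator of `J C = 0` is `1 + J C` in `ZMod 2`.
    refine Finset.sum_congr rfl fun C _ => ?_
    generalize J C = z
    revert z; decide

end EvenFamily

/-! ### Circuits of concrete graphs, checked by computation -/

section Code

variable {n m k : ℕ}

/-- Whether `L` lists the edges and further vertices of a path from `x` in `ofEnds ends`. -/
def pathCheck (ends : Fin m → Fin n × Fin n) : Fin n → List (Fin m × Fin n) → Bool
  | _, [] => true
  | x, (e, y) :: L => (ends e = (x, y) || ends e = (y, x)) && x ∉ ((e, y) :: L).map Prod.snd &&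
      e ∉ L.map Prod.fst && pathCheck ends y L

/-- The last vertex of a listed path. -/
def pathEnd : Fin n → List (Fin m × Fin n) → Fin n
  | x, [] => x
  | _, (_, y) :: L => pathEnd y L

/-- The number of edges of a listed path that are not traversed from their first to their second
end. -/
def pathFlips (ends : Fin m → Fin n × Fin n) : Fin n → List (Fin m × Fin n) → ZMod 2
  | _, [] => 0
  | x, (e, y) :: L => (if (ends e).1 = x then 0 else 1) + pathFlips ends y L

/-- The edges of a circuit, listed as a path and a closing edge. -/
def codeEdges (c : Fin n × List (Fin m × Fin n) × Fin m) : Finset (Fin m) :=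
  insert c.2.2 (c.2.1.map Prod.fst).toFinset

/-- Whether `c` lists an even circuit of `ofEnds ends`. -/
def codeCheck (ends : Fin m → Fin n × Fin n) (c : Fin n × List (Fin m × Fin n) × Fin m) : Bool :=
  pathCheck ends c.1 c.2.1 && c.2.2 ∉ c.2.1.map Prod.fst && pathEnd c.1 c.2.1 ≠ c.1 &&
    (ends c.2.2 = (pathEnd c.1 c.2.1, c.1) || ends c.2.2 = (c.1, pathEnd c.1 c.2.1)) &&
    (codeEdges c).card % 2 = 0

/-- The number of edges of a listed circuit that are not traversed from their first to their second
end. -/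
def codeFlips (ends : Fin m → Fin n × Fin n) (c : Fin n × List (Fin m × Fin n) × Fin m) : ZMod 2 :=
  pathFlips ends c.1 c.2.1 + if (ends c.2.2).1 = pathEnd c.1 c.2.1 then 0 else 1

variable {α β : Type*} [DecidableEq α] [DecidableEq β] {K : Graph α β}
  {ends : Fin m → Fin n × Fin n} {ν : Fin n → α} {ε : Fin m → β} {t : β → α}

lemma ite_tail_eq (hν : ν.Injective) (hl : ∀ i, K.IsLink (ε i) (ν (ends i).1) (ν (ends i).2))
    (ht : K.IsTail t) {i : Fin m} {x y : Fin n} (hxy : x ≠ y)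
    (hi : ends i = (x, y) ∨ ends i = (y, x)) :
    (if t (ε i) = ν x then (1 : ZMod 2) else 0) =
      (if t (ε i) = ν (ends i).1 then 1 else 0) + if (ends i).1 = x then 0 else 1 := by
  have h1 := hl i
  rcases hi with hi | hi
  · simp [hi]
  · rw [hi] at h1 ⊢
    rw [ht.ite_eq h1.symm (hν.ne hxy)]
    simp [hxy.symm, add_comm]

lemma isPathPar_of_pathCheck (hν : ν.Injective) (hε : ε.Injective)
    (hl : ∀ i, K.IsLink (ε i) (ν (ends i).1) (ν (ends i).2)) (ht : K.IsTail t) :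
    ∀ (L : List (Fin m × Fin n)) (x : Fin n), pathCheck ends x L = true →
      K.IsPathPar t (ν x) (ν (pathEnd x L)) ((insert x (L.map Prod.snd).toFinset).image ν)
        ((L.map Prod.fst).toFinset.image ε)
        (∑ i ∈ (L.map Prod.fst).toFinset, (if t (ε i) = ν (ends i).1 then 1 else 0) +
          pathFlips ends x L)
  | [], x, _ => by simpa [pathFlips, pathEnd] using IsPathPar.nil (ν x)
  | (e, y) :: L, x, h => by
    simp only [pathCheck, Bool.and_eq_true, Bool.or_eq_true, decide_eq_true_eq] at h
    obtain ⟨⟨⟨h1, h2⟩, h3⟩, h4⟩ := h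
    have ih := isPathPar_of_pathCheck hν hε hl ht L y h4
    have hxy : x ≠ y := by rintro rfl; simp at h2
    have hlink : K.IsLink (ε e) (ν x) (ν y) := by
      have := hl e
      rcases h1 with h1 | h1 <;> rw [h1] at this
      · exact this
      · exact this.symm
    have hx : ν x ∉ (insert y (L.map Prod.snd).toFinset).image ν := by
      rw [Finset.mem_image]
      rintro ⟨z, hz, hzx⟩
      rw [hν hzx] at hz
      exact h2 (by simpa using hz)
    have := IsPathPar.cons hlink ih hx
    rw [ite_tail_eq hν hl ht hxy h1] at this
    simp only [List.map_cons, List.toFinset_cons, Finset.image_insert, pathEnd, pathFlips] at this ⊢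
    rw [Finset.sum_insert (by simpa using h3)]
    convert this using 1
    ring

lemma cwParity_of_codeCheck (hν : ν.Injective) (hε : ε.Injective)
    (hl : ∀ i, K.IsLink (ε i) (ν (ends i).1) (ν (ends i).2)) (ht : K.IsTail t)
    {c : Fin n × List (Fin m × Fin n) × Fin m} (hc : codeCheck ends c = true) :
    (∃ V, K.IsCirc V ((codeEdges c).image ε)) ∧ ((codeEdges c).image ε).card % 2 = 0 ∧
      K.cwParity t ↑((codeEdges c).image ε) =
        ∑ i ∈ codeEdges c, (if t (ε i) = ν (ends i).1 then 1 else 0) + codeFlips ends c := by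
  obtain ⟨x, L, g⟩ := c
  simp only [codeCheck, Bool.and_eq_true, Bool.or_eq_true, decide_eq_true_eq] at hc
  obtain ⟨⟨⟨⟨h1, h2⟩, h3⟩, h4⟩, h5⟩ := hc
  have q := isPathPar_of_pathCheck hν hε hl ht L x h1
  have hlink : K.IsLink (ε g) (ν (pathEnd x L)) (ν x) := by
    have := hl g
    rcases h4 with h4 | h4 <;> rw [h4] at this
    · exact this
    · exact this.symm
  have hg : ε g ∉ (L.map Prod.fst).toFinset.image ε := by
    rw [Finset.mem_image]
    rintro ⟨z, hz, hzx⟩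
    rw [hε hzx] at hz
    exact h2 (by simpa using hz)
  have hcard : ((codeEdges (x, L, g)).image ε).card % 2 = 0 := by
    rwa [Finset.card_image_of_injective _ hε]
  refine ⟨⟨(insert x (L.map Prod.snd).toFinset).image ν, ?_⟩, hcard, ?_⟩
  · have := q.isPath.isCirc_insert hlink.symm (hν.ne (Ne.symm h3)) hg
    rwa [← Finset.image_insert] at this
  · simp only [codeEdges, Finset.image_insert] at hcard ⊢
    rw [q.cwParity_eq hlink hg hcard ht, ite_tail_eq hν hl ht h3 h4,
      Finset.sum_insert (by simpa using h2), codeFlips]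
    ring

omit [DecidableEq α] [DecidableEq β] in
lemma IsIsomorphic.exists_code (h : K.IsIsomorphic (ofEnds ends)) :
    ∃ (ν : Fin n → α) (ε : Fin m → β), ν.Injective ∧ ε.Injective ∧
      ∀ i, K.IsLink (ε i) (ν (ends i).1) (ν (ends i).2) := by
  obtain ⟨f, g, hf, hg, h⟩ := h
  have h1 : ∀ j : Fin n, ∃ x ∈ V(K), f x = j := fun j => hf.surjOn (Set.mem_univ j)
  have h2 : ∀ i : Fin m, ∃ x ∈ E(K), g x = i := fun i => hg.surjOn (Set.mem_univ i)
  choose ν hν hfν using h1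
  choose ε hε hgε using h2
  refine ⟨ν, ε, fun i j hij => by rw [← hfν i, hij, hfν], fun i j hij => by rw [← hgε i, hij, hgε],
    fun i => ?_⟩
  rw [h _ (hε i) _ (hν _) _ (hν _), hfν, hfν, hgε]
  exact Or.inl rfl

/-- The clockwise parity of a listed circuit is a sum over its edges of a term that depends on the
tail function but not on the sense, plus the number of edges listed against their reference
direction. The former cancel because every edge is covered evenly, so `c` is the total number of
flips. All hypotheses can be decided. -/
lemma IsIsomorphic.hasEvenFamily (h : K.IsIsomorphic (ofEnds ends)) {c : ZMod 2}
    (F : Fin k → Fin n × List (Fin m × Fin n) × Fin m) (h1 : ∀ i, codeCheck ends (F i) = true)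
    (h2 : ∀ i j, codeEdges (F i) = codeEdges (F j) → i = j)
    (h3 : ∀ g, ∑ i, (if g ∈ codeEdges (F i) then (1 : ZMod 2) else 0) = 0)
    (h4 : ∑ i, codeFlips ends (F i) = c) : K.HasEvenFamily k c := by
  obtain ⟨ν, ε, hν, hε, hl⟩ := h.exists_code
  have hinj : Function.Injective fun i => (codeEdges (F i)).image ε := fun i j hij =>
    h2 i j (Finset.image_injective hε hij)
  refine ⟨Finset.univ.image fun i => (codeEdges (F i)).image ε, ?_, ?_, ?_, ?_⟩
  · rw [Finset.card_image_of_injective _ hinj, Finset.card_univ, Fintype.card_fin]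
  · intro C hC
    obtain ⟨i, -, rfl⟩ := Finset.mem_image.1 hC
    have : Nonempty α := ⟨ν (F i).1⟩
    obtain ⟨t, ht⟩ := K.exists_isTail
    have := cwParity_of_codeCheck hν hε hl ht (h1 i)
    exact ⟨this.1, this.2.1⟩
  · intro g
    rw [Finset.sum_image hinj.injOn]
    by_cases hg : ∃ j, ε j = g
    · obtain ⟨j, rfl⟩ := hg
      exact (Finset.sum_congr rfl fun i _ => if_congr (by simp [hε.eq_iff]) rfl rfl).trans (h3 j)
    · refine Finset.sum_eq_zero fun i _ => if_neg ?_
      rw [Finset.mem_image]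
      rintro ⟨j, -, hj⟩
      exact hg ⟨j, hj⟩
  · intro t ht
    rw [Finset.sum_image hinj.injOn, ← h4, Finset.sum_congr rfl fun i _ =>
      (cwParity_of_codeCheck hν hε hl ht (h1 i)).2.2, Finset.sum_add_distrib]
    suffices ∑ i, ∑ j ∈ codeEdges (F i), (if t (ε j) = ν (ends j).1 then (1 : ZMod 2) else 0) = 0 by
      rw [this, zero_add]
    have : ∀ i, ∑ j ∈ codeEdges (F i), (if t (ε j) = ν (ends j).1 then (1 : ZMod 2) else 0) =
        ∑ j, (if j ∈ codeEdges (F i) then 1 else 0) * if t (ε j) = ν (ends j).1 then 1 else 0 := by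
      intro i
      simp only [ite_mul, one_mul, zero_mul, Finset.sum_ite_mem, Finset.univ_inter]
    simp only [this]
    rw [Finset.sum_comm]
    refine Finset.sum_eq_zero fun j _ => ?_
    rw [← Finset.sum_mul, h3, zero_mul]

end Code
end Graph

/-! ### Even families of the nine base graphs -/

namespace Graph

section Families

variable {α β : Type*} [DecidableEq α] [DecidableEq β] {K H : Graph α β}

/-- Each entry consists of a start vertex, a list of steps (edge, next vertex) and the edge that
closes the circuit. -/
lemma IsIsomorphic.hasEvenFamily_O1 (h : K.IsIsomorphic graphO1) :
    K.HasEvenFamily 3 0 :=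
  h.hasEvenFamily ![(0, [(0, 2), (3, 1), (4, 3)], 1),
    (0, [(0, 2), (3, 1), (5, 4)], 2),
    (0, [(1, 3), (4, 1), (5, 4)], 2)]
    (by decide) (by decide) (by decide) (by decide)

lemma IsIsomorphic.hasEvenFamily_O2 (h : K.IsIsomorphic graphO2) :
    K.HasEvenFamily 3 0 :=
  h.hasEvenFamily ![(0, [(0, 4), (1, 1), (6, 2), (8, 3), (5, 6)], 4),
    (0, [(0, 4), (1, 1), (7, 3), (8, 2), (3, 5)], 2),
    (0, [(2, 5), (3, 2), (6, 1), (7, 3), (5, 6)], 4)]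
    (by decide) (by decide) (by decide) (by decide)

lemma IsIsomorphic.hasEvenFamily_E1 (h : K.IsIsomorphic graphE1) :
    K.HasEvenFamily 3 1 :=
  h.hasEvenFamily ![(0, [(0, 1)], 1),
    (0, [(0, 1)], 2),
    (0, [(1, 1)], 2)]
    (by decide) (by decide) (by decide) (by decide)

lemma IsIsomorphic.hasEvenFamily_E2 (h : K.IsIsomorphic graphE2) :
    K.HasEvenFamily 3 1 :=
  h.hasEvenFamily ![(0, [(0, 1), (3, 2), (5, 3)], 2),
    (0, [(0, 1), (4, 3), (5, 2)], 1),
    (0, [(1, 2), (3, 1), (4, 3)], 2)]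
    (by decide) (by decide) (by decide) (by decide)

lemma IsIsomorphic.hasEvenFamily_E3 (h : K.IsIsomorphic graphE3) :
    K.HasEvenFamily 3 1 :=
  h.hasEvenFamily ![(0, [(0, 4), (1, 1), (2, 5), (3, 2), (4, 6), (5, 3), (6, 7)], 7),
    (0, [(0, 4), (1, 1), (9, 3), (5, 6), (4, 2)], 8),
    (0, [(7, 7), (6, 3), (9, 1), (2, 5), (3, 2)], 8)]
    (by decide) (by decide) (by decide) (by decide)

lemma IsIsomorphic.hasEvenFamily_Delta1 (h : K.IsIsomorphic graphDelta1) :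
    K.HasEvenFamily 4 0 :=
  h.hasEvenFamily ![(0, [(0, 1), (9, 3), (3, 4), (10, 6), (6, 7)], 11),
    (0, [(0, 1), (9, 3), (5, 5), (4, 4), (10, 6), (8, 8), (7, 7)], 11),
    (0, [(2, 2), (1, 1), (9, 3), (3, 4), (10, 6), (8, 8), (7, 7)], 11),
    (0, [(2, 2), (1, 1), (9, 3), (5, 5), (4, 4), (10, 6), (6, 7)], 11)]
    (by decide) (by decide) (by decide) (by decide)

lemma IsIsomorphic.hasEvenFamily_Delta2 (h : K.IsIsomorphic graphDelta2) :
    K.HasEvenFamily 4 0 :=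
  h.hasEvenFamily ![(0, [(2, 2), (1, 1), (9, 3), (5, 5), (4, 4), (8, 7), (7, 6)], 10),
    (0, [(2, 2), (1, 1), (9, 3), (3, 4), (6, 6)], 10),
    (0, [(0, 1), (9, 3), (5, 5), (4, 4), (6, 6)], 10),
    (0, [(0, 1), (9, 3), (3, 4), (8, 7), (7, 6)], 10)]
    (by decide) (by decide) (by decide) (by decide)

lemma IsIsomorphic.hasEvenFamily_Delta3 (h : K.IsIsomorphic graphDelta3) :
    K.HasEvenFamily 4 0 :=
  h.hasEvenFamily ![(0, [(0, 1), (3, 3), (6, 5)], 9),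
    (0, [(0, 1), (5, 4), (4, 3), (8, 6), (7, 5)], 9),
    (0, [(2, 2), (1, 1), (3, 3), (8, 6), (7, 5)], 9),
    (0, [(2, 2), (1, 1), (5, 4), (4, 3), (6, 5)], 9)]
    (by decide) (by decide) (by decide) (by decide)

lemma IsIsomorphic.hasEvenFamily_Delta4 (h : K.IsIsomorphic graphDelta4) :
    K.HasEvenFamily 4 0 :=
  h.hasEvenFamily ![(0, [(2, 2), (1, 1), (5, 4), (4, 3), (8, 5)], 7),
    (0, [(2, 2), (1, 1), (3, 3)], 6),
    (0, [(0, 1), (5, 4), (4, 3)], 6),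
    (0, [(0, 1), (3, 3), (8, 5)], 7)]
    (by decide) (by decide) (by decide) (by decide)

end Families
end Graph

/-! ### Path systems and their contraction -/

namespace Graph

section Subdivision

/-- A multigraph with vertices `Fin k`, whose edge `i` joins `σ i` and `τ i`, and a matching `Jn` of
edges that may be contracted: no edge is parallel to one of them. -/
structure IsShape {m k : ℕ} (σ τ : Fin m → Fin k) (Jn : Fin m → Bool) : Prop where
  matching : ∀ i j, Jn i → Jn j → i ≠ j → σ i ≠ σ j ∧ σ i ≠ τ j ∧ τ i ≠ σ j ∧ τ i ≠ τ j
  parallel : ∀ i j, Jn i → i ≠ j → ¬ ((σ i = σ j ∨ σ i = τ j) ∧ (τ i = σ j ∨ τ i = τ j))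
  -- Every branch vertex then lies on a path other than the `i`-th, so it is not an inner vertex of
  -- the `i`-th path.
  cover : ∀ i x, ∃ j, j ≠ i ∧ (x = σ j ∨ x = τ j)
  loopless : ∀ i, Jn i → σ i ≠ τ i

/-- Paths of `G` that replace the edges `i` from `σ i` to `τ i` of a multigraph, where the edges in
`Jn` may have been contracted. -/
structure IsPathSystem {α β : Type*} [DecidableEq α] [DecidableEq β] {m k : ℕ} (G : Graph α β)
    (σ τ : Fin m → Fin k) (Jn : Fin m → Bool) (b : Fin k → α) (V : Fin m → Finset α)
    (E : Fin m → Finset β) : Prop where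
  path : ∀ i, G.IsPath (b (σ i)) (b (τ i)) (V i) (E i)
  meet : ∀ i j, i ≠ j → ∀ v ∈ V i, v ∈ V j → v = b (σ i) ∨ v = b (τ i)
  disj : ∀ i j, i ≠ j → Disjoint (E i) (E j)
  trivial : ∀ i, E i = ∅ → Jn i
  inj : ∀ x y, b x = b y → x = y ∨
    ∃ i, Jn i ∧ E i = ∅ ∧ (x = σ i ∧ y = τ i ∨ x = τ i ∧ y = σ i)

/-- `H` is the union of a path system. -/
structure IsSubdiv {α β : Type*} [DecidableEq α] [DecidableEq β] {m k : ℕ} (H : Graph α β)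
    (σ τ : Fin m → Fin k) (Jn : Fin m → Bool) (b : Fin k → α) (V : Fin m → Finset α)
    (E : Fin m → Finset β) : Prop extends H.IsPathSystem σ τ Jn b V E where
  vert : ∀ v, v ∈ V(H) ↔ ∃ i, v ∈ V i
  edge : ∀ e, e ∈ E(H) ↔ ∃ i, e ∈ E i

variable {α β : Type*} [DecidableEq α] [DecidableEq β] {G H : Graph α β} {m k : ℕ}
  {σ τ : Fin m → Fin k} {Jn : Fin m → Bool} {b : Fin k → α} {V : Fin m → Finset α}
  {E : Fin m → Finset β}

lemma IsPath.map {x y : α} {V : Finset α} {E : Finset β} (h : H.IsPath x y V E) {F : Set β}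
    (φ : α → α) (hφ : ∀ a ∈ V, ∀ b ∈ V, φ a = φ b → a = b) (hE : ∀ e ∈ E, e ∉ F) :
    ((H.deleteEdges F).map φ).IsPath (φ x) (φ y) (V.image φ) E := by
  induction h with
  | nil x => simpa using IsPath.nil (φ x)
  | @cons x y z e V E hl p hx ih =>
    rw [Finset.image_insert]
    refine .cons ⟨x, y, ?_, rfl, rfl⟩ (ih (by grind) (by grind)) ?_
    · simpa using ⟨hl, hE e (by simp)⟩
    · rw [Finset.mem_image]
      rintro ⟨a, ha, hax⟩
      have := hφ a (by simp [ha]) x (by simp) hax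
      exact hx (this ▸ ha)

lemma IsPath.exists_cons_cons {x y : α} {V : Finset α} {E : Finset β} (h : H.IsPath x y V E)
    (hE : 2 ≤ E.card) : ∃ v w e f V₂ E₂, H.IsLink e x v ∧ H.IsLink f v w ∧ H.IsPath w y V₂ E₂ ∧
      v ∉ V₂ ∧ x ∉ insert v V₂ ∧ V = insert x (insert v V₂) ∧ E = insert e (insert f E₂) := by
  cases h with
  | nil => simp at hE
  | cons he q hx =>
    cases q with
    | nil => simp at hE
    | cons hf q hy => exact ⟨_, _, _, _, _, _, he, hf, q, hy, hx, rfl, rfl⟩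

/-- The first two edges of the path are contracted into its start. Their middle vertex `v` is on no
other path. If the third vertex `w` is on another path, it is the end `b (τ i)`, the path `i` has
length two and belongs to `Jn`, and no other path contains both of its ends, since it would be
parallel. So the other paths remain paths, and the only new coincidence of branch vertices is that
of the ends of a path in `Jn`. -/
lemma IsSubdiv.exists_contraction (S : H.IsSubdiv σ τ Jn b V E) (hS : IsShape σ τ Jn) {i : Fin m}
    (hi : 2 ≤ (E i).card) (hJ : Jn i ∨ 3 ≤ (E i).card) : ∃ (K : Graph α β) (b' : Fin k → α)
      (V' : Fin m → Finset α) (E' : Fin m → Finset β), H.IsEvenVertexSplitting K ∧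
      K.IsSubdiv σ τ Jn b' V' E' ∧ (E' i).card + 2 = (E i).card ∧ ∀ j, j ≠ i → E' j = E j := by
  obtain ⟨v, w, e, f, V₂, E₂, he, hf, p, hv, hs, hV, hE⟩ := (S.path i).exists_cons_cons hi
  have hw := p.left_mem
  have ht := p.right_mem
  have hsv : b (σ i) ≠ v := by grind
  have hsw : b (σ i) ≠ w := by grind
  have hvw : v ≠ w := by grind
  have hef : e ≠ f := by
    rintro rfl
    rcases he.eq_and_eq_or_eq_and_eq hf with ⟨h, -⟩ | ⟨h, -⟩
    exacts [hsv h, hsw h]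
  have heE : e ∉ E₂ := fun h => hs (by simp [p.mem_of_inc h he.inc_left])
  have hfE : f ∉ E₂ := fun h => hv (p.mem_of_inc h hf.inc_left)
  have hvj : ∀ j, j ≠ i → v ∉ V j := by
    intro j hj hvj
    rcases S.meet i j hj.symm v (by simp [hV]) hvj with h | h
    exacts [hsv h.symm, hv (h ▸ ht)]
  have hcard : E₂.card + 2 = (E i).card := by
    rw [hE, Finset.card_insert_of_notMem (by simp [hef, heE]), Finset.card_insert_of_notMem hfE]
  have hwt : w = b (τ i) ∨ 3 ≤ (E i).card := by
    by_contra! h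
    have := p.edges_nonempty h.1
    have := Finset.card_pos.2 this
    omega
  have hwt' : w = b (τ i) → E₂ = ∅ := by
    rintro rfl
    exact p.eq_singleton.2
  have hJi : w = b (τ i) → Jn i := by
    intro h
    rcases hJ with hJ | hJ
    · exact hJ
    · rw [← hcard, hwt' h] at hJ
      simp at hJ
  have hne : E i ≠ ∅ := by rw [hE]; simp
  -- labels of the ends of a contractible path
  have hlab : ∀ x y, Jn i → (y = σ i ∨ y = τ i) → b x = b y → x = y := by
    intro x y hJi hy h
    rcases S.inj x y h with h | ⟨l, hl, hl0, h⟩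
    · exact h
    · have hli : i ≠ l := by rintro rfl; exact hne hl0
      obtain ⟨m1, m2, m3, m4⟩ := hS.matching i l hJi hl hli
      rcases h with ⟨-, rfl⟩ | ⟨-, rfl⟩ <;> rcases hy with hy | hy
      exacts [absurd hy.symm m2, absurd hy.symm m4, absurd hy.symm m1, absurd hy.symm m3]
  have hends : ∀ j, j ≠ i → w ∈ V j → w = b (τ i) := by
    intro j hj h
    exact (S.meet i j hj.symm w (by simp [hV, hw]) h).resolve_left hsw.symm
  have hboth : ∀ j, j ≠ i → ¬ (b (σ i) ∈ V j ∧ w ∈ V j) := by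
    rintro j hj ⟨h1, h2⟩
    have h3 := hends j hj h2
    have hJi := hJi h3
    have h4 := S.meet j i hj _ h1 (by simp [hV])
    have h5 := S.meet j i hj _ h2 (by simp [hV, hw])
    rw [h3] at h5
    refine hS.parallel i j hJi hj.symm ⟨?_, ?_⟩
    · rcases h4 with h4 | h4
      · exact .inl (hlab _ _ hJi (.inl rfl) h4.symm).symm
      · exact .inr (hlab _ _ hJi (.inl rfl) h4.symm).symm
    · rcases h5 with h5 | h5
      · exact .inl (hlab _ _ hJi (.inr rfl) h5.symm).symm
      · exact .inr (hlab _ _ hJi (.inr rfl) h5.symm).symm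
  obtain ⟨φ, hφ⟩ : ∃ φ : α → α, ∀ x, φ x = if x = v ∨ x = w then b (σ i) else x := ⟨_, fun _ => rfl⟩
  have hφ' : ∀ x y, φ x = φ y ↔
      x = y ∨ ((x = b (σ i) ∨ x = v ∨ x = w) ∧ (y = b (σ i) ∨ y = v ∨ y = w)) := by
    intro x y
    rw [hφ, hφ]
    grind
  have hφs : φ (b (σ i)) = b (σ i) := by rw [hφ]; simp
  have hφv : φ v = b (σ i) := by rw [hφ]; simp
  have hφw : φ w = b (σ i) := by rw [hφ]; simp
  refine ⟨(H.deleteEdges {e, f}).map φ, φ ∘ b,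
    fun j => if j = i then V₂.image φ else (V j).image φ, fun j => if j = i then E₂ else E j,
    ⟨e, f, b (σ i), v, w, φ, hef, hsv, hvw.symm, he.symm, hf, ?_, ?_, rfl⟩, ?_, ?_, ?_⟩
  · intro g hg
    obtain ⟨j, hj⟩ := (S.edge g).1 hg.edge_mem
    by_cases hji : j = i
    · subst hji
      rw [hE] at hj
      have : g ∉ E₂ := fun h => hv (p.mem_of_inc h hg)
      simpa [this] using hj
    · exact absurd ((S.path j).mem_of_inc hj hg) (hvj j hji)
  · intro x _ y _
    simpa using hφ' x y
  · have hVi : ∀ x, x = b (σ i) ∨ x = v ∨ x = w → x ∈ V i := by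
      rintro x (rfl | rfl | rfl) <;> simp [hV, hw]
    refine ⟨⟨fun j => ?_, fun j l hjl z hj hl => ?_, fun j l hjl => ?_, fun j hj => ?_,
      fun x y hxy => ?_⟩, fun z => ?_, fun g => ?_⟩
    · by_cases hji : j = i
      · subst hji
        simp only [if_true]
        have := p.map (F := {e, f}) φ (by
          intro x hx y hy hxy
          rcases (hφ' x y).1 hxy with h | ⟨h1, h2⟩
          · exact h
          · have n1 : ∀ z ∈ V₂, z = b (σ j) ∨ z = v ∨ z = w → z = w := by
              rintro z hz (rfl | rfl | rfl)
              · exact absurd (Finset.mem_insert_of_mem hz) hs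
              · exact absurd hz hv
              · rfl
            exact (n1 x hx h1).trans (n1 y hy h2).symm) (by
          intro g hg
          simp only [Set.mem_insert_iff, Set.mem_singleton_iff, not_or]
          constructor <;> rintro rfl <;> contradiction)
        rwa [hφw, ← hφs] at this
      · simp only [hji, if_false]
        refine (S.path j).map φ ?_ ?_
        · intro x hx y hy hxy
          rcases (hφ' x y).1 hxy with h | ⟨h1, h2⟩
          · exact h
          · have n1 : ∀ z ∈ V j, z ≠ v := fun z hz h => hvj j hji (h ▸ hz)
            rcases h1 with h1 | h1 | h1 <;> rcases h2 with h2 | h2 | h2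
            · exact h1.trans h2.symm
            · exact absurd h2 (n1 y hy)
            · exact absurd ⟨h1 ▸ hx, h2 ▸ hy⟩ (hboth j hji)
            · exact absurd h1 (n1 x hx)
            · exact absurd h1 (n1 x hx)
            · exact absurd h1 (n1 x hx)
            · exact absurd ⟨h2 ▸ hy, h1 ▸ hx⟩ (hboth j hji)
            · exact absurd h2 (n1 y hy)
            · exact h1.trans h2.symm
        · intro g hg
          have := Finset.disjoint_left.1 (S.disj j i hji) hg
          rw [hE] at this
          simp only [Set.mem_insert_iff, Set.mem_singleton_iff, not_or]
          simp only [Finset.mem_insert, not_or] at this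
          exact ⟨this.1, this.2.1⟩
    · obtain ⟨x, hx, rfl⟩ : ∃ x ∈ V j, φ x = z := by
        split_ifs at hj with h
        · obtain ⟨x, hx, rfl⟩ := Finset.mem_image.1 hj
          exact ⟨x, by simp [h, hV, hx], rfl⟩
        · simpa using hj
      obtain ⟨y, hy, hyx⟩ : ∃ y ∈ V l, φ y = φ x := by
        split_ifs at hl with h
        · obtain ⟨x, hx, hxy⟩ := Finset.mem_image.1 hl
          exact ⟨x, by simp [h, hV, hx], hxy⟩
        · simpa using hl
      have key : x = b (σ j) ∨ x = b (τ j) ∨ φ x = φ (b (σ j)) := by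
        rcases (hφ' y x).1 hyx with h | ⟨h1, h2⟩
        · exact (S.meet j l hjl _ hx (h ▸ hy)).elim .inl fun h => .inr (.inl h)
        · by_cases hji : j = i
          · exact .inr (.inr ((hφ' _ _).2 (.inr ⟨h2, .inl (by rw [hji])⟩)))
          · exact (S.meet j i hji x hx (hVi x h2)).elim .inl fun h => .inr (.inl h)
      simp only [Function.comp_apply]
      rcases key with h | h | h
      · exact .inl (by rw [h])
      · exact .inr (by rw [h])
      · exact .inl h
    · have hsub : ∀ j, (if j = i then E₂ else E j) ⊆ E j := by
        intro j
        split_ifs with h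
        · subst h; rw [hE]; intro g hg; simp [hg]
        · exact subset_rfl
      exact (S.disj j l hjl).mono (hsub j) (hsub l)
    · split_ifs at hj with h
      · subst h
        rcases hJ with hJ | hJ
        · exact hJ
        · rw [← hcard, hj] at hJ
          simp at hJ
      · exact S.trivial j hj
    · rcases (hφ' (b x) (b y)).1 hxy with h | ⟨h1, h2⟩
      · rcases S.inj x y h with h | ⟨l, hl, hl0, h⟩
        · exact .inl h
        · have hli : l ≠ i := by rintro rfl; exact hne hl0
          exact .inr ⟨l, hl, by simpa [hli] using hl0, h⟩
      · have hbr : ∀ x, b x = b (σ i) ∨ b x = v ∨ b x = w → b x = b (σ i) ∨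
            (b x = b (τ i) ∧ w = b (τ i)) := by
          intro x hx
          obtain ⟨j, hji, hj⟩ := hS.cover i x
          have hxj : b x ∈ V j := by
            rcases hj with rfl | rfl
            · exact (S.path j).left_mem
            · exact (S.path j).right_mem
          rcases hx with hx | hx | hx
          · exact .inl hx
          · exact absurd (hx ▸ hxj) (hvj j hji)
          · have := hends j hji (hx ▸ hxj)
            exact .inr ⟨hx.trans this, this⟩
        by_cases hxy' : b x = b y
        · rcases S.inj x y hxy' with h | ⟨l, hl, hl0, h⟩
          · exact .inl h
          · have hli : l ≠ i := by rintro rfl; exact hne hl0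
            exact .inr ⟨l, hl, by simpa [hli] using hl0, h⟩
        · right
          rcases hbr x h1 with h1 | ⟨h1, h3⟩ <;> rcases hbr y h2 with h2 | ⟨h2, h4⟩
          · exact absurd (h1.trans h2.symm) hxy'
          · have := hJi h4
            exact ⟨i, this, by simpa using hwt' h4, .inl ⟨hlab _ _ this (.inl rfl) h1,
              hlab _ _ this (.inr rfl) h2⟩⟩
          · have := hJi h3
            exact ⟨i, this, by simpa using hwt' h3, .inr ⟨hlab _ _ this (.inr rfl) h1,
              hlab _ _ this (.inl rfl) h2⟩⟩
          · exact absurd (h1.trans h2.symm) hxy'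
    · have : V((H.deleteEdges {e, f}).map φ) = φ '' V(H) := rfl
      rw [this, Set.mem_image]
      constructor
      · rintro ⟨x, hx, rfl⟩
        obtain ⟨j, hj⟩ := (S.vert x).1 hx
        refine ⟨j, ?_⟩
        split_ifs with h
        · subst h
          rw [hV] at hj
          simp only [Finset.mem_insert] at hj
          rw [Finset.mem_image]
          rcases hj with rfl | rfl | hj
          · exact ⟨w, hw, by rw [hφs, hφw]⟩
          · exact ⟨w, hw, by rw [hφv, hφw]⟩
          · exact ⟨x, hj, rfl⟩
        · exact Finset.mem_image_of_mem _ hj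
      · rintro ⟨j, hj⟩
        split_ifs at hj with h <;> obtain ⟨x, hx, rfl⟩ := Finset.mem_image.1 hj
        · exact ⟨x, (S.vert x).2 ⟨i, by simp [hV, hx]⟩, rfl⟩
        · exact ⟨x, (S.vert x).2 ⟨j, hx⟩, rfl⟩
    · have : E((H.deleteEdges {e, f}).map φ) = E(H) \ {e, f} := rfl
      rw [this, Set.mem_sdiff, S.edge]
      constructor
      · rintro ⟨⟨j, hj⟩, hg⟩
        refine ⟨j, ?_⟩
        split_ifs with h
        · subst h
          rw [hE] at hj
          simp only [Finset.mem_insert, Set.mem_insert_iff, Set.mem_singleton_iff] at hj hg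
          exact (hj.resolve_left fun h => hg (.inl h)).resolve_left fun h => hg (.inr h)
        · exact hj
      · rintro ⟨j, hj⟩
        simp only [Set.mem_insert_iff, Set.mem_singleton_iff, not_or]
        split_ifs at hj with h
        · subst h
          exact ⟨⟨j, by simp [hE, hj]⟩, by rintro rfl; exact heE hj, by rintro rfl; exact hfE hj⟩
        · have := Finset.disjoint_left.1 (S.disj j i h) hj
          rw [hE] at this
          simp only [Finset.mem_insert, not_or] at this
          exact ⟨⟨j, hj⟩, this.1, this.2.1⟩
  · simpa using hcard
  · intro j hj
    simp [hj]

/-- All paths can be shortened to length at most `2`, those in `Jn` to length at most `1`. -/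
lemma IsSubdiv.exists_reduced (hS : IsShape σ τ Jn) (S : H.IsSubdiv σ τ Jn b V E) :
    ∃ (K : Graph α β) (b' : Fin k → α) (V' : Fin m → Finset α) (E' : Fin m → Finset β),
      Relation.ReflTransGen (fun A B : Graph α β => B.IsEvenVertexSplitting A) K H ∧
      K.IsSubdiv σ τ Jn b' V' E' ∧
      ∀ i, (E' i).card = if Jn i then (E i).card % 2 else 2 - (E i).card % 2 := by
  induction hn : ∑ i, (E i).card using Nat.strong_induction_on generalizing H b V E with
  | _ n ih =>
    by_cases h : ∃ i, 2 ≤ (E i).card ∧ (Jn i ∨ 3 ≤ (E i).card)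
    · obtain ⟨i, hi, hJ⟩ := h
      obtain ⟨K, b', V', E', hK, S', hc, hE'⟩ := S.exists_contraction hS hi hJ
      have hlt : ∑ j, (E' j).card < n := by
        rw [← hn]
        refine Finset.sum_lt_sum (fun j _ => ?_) ⟨i, Finset.mem_univ i, by omega⟩
        by_cases hj : j = i
        · subst hj; omega
        · rw [hE' j hj]
      obtain ⟨L, b₂, V₂, E₂, hL, S₂, h₂⟩ := ih _ hlt S' rfl
      refine ⟨L, b₂, V₂, E₂, hL.tail hK, S₂, fun j => ?_⟩
      rw [h₂]
      by_cases hj : j = i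
      · subst hj
        have : (E' j).card % 2 = (E j).card % 2 := by omega
        rw [this]
      · rw [hE' j hj]
    · push Not at h
      refine ⟨H, b, V, E, .refl, S, fun i => ?_⟩
      have h1 := h i
      have h2 := S.trivial i
      rw [← Finset.card_eq_zero] at h2
      by_cases hJ : Jn i <;> simp only [hJ, if_true] at h1 h2 ⊢
      · have : (E i).card < 2 := by by_contra h3; exact (h1 (by omega)).1 rfl
        omega
      · simp at h1 h2 ⊢
        by_cases h3 : 2 ≤ (E i).card
        · have := h1 h3; omega
        · have := Finset.card_pos.2 (Finset.nonempty_iff_ne_empty.2 h2); omega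

end Subdivision
end Graph

namespace Graph

section Subdivision

variable {α β : Type*} [DecidableEq α] [DecidableEq β] {G H K : Graph α β} {m k : ℕ}
  {σ τ : Fin m → Fin k} {Jn : Fin m → Bool} {b : Fin k → α} {V : Fin m → Finset α}
  {E : Fin m → Finset β}

lemma IsPath.mem_vertexSet {x y z : α} {V : Finset α} {E : Finset β} (h : G.IsPath x y V E)
    (hE : E ≠ ∅) (hz : z ∈ V) : z ∈ V(G) := by
  have hxy : x ≠ y := by rintro rfl; exact hE h.eq_singleton.2
  obtain ⟨e, -, hi⟩ := h.exists_inc hxy hz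
  exact hi.vertex_mem

lemma IsPath.eq_of_isEmpty {x y : α} {V : Finset α} (h : G.IsPath x y V ∅) : x = y ∧ V = {x} := by
  have hxy : x = y := by
    by_contra hxy
    exact (h.edges_nonempty hxy).ne_empty rfl
  subst hxy
  exact ⟨rfl, h.eq_singleton.1⟩

lemma IsPath.of_isLink {x y : α} {V : Finset α} {E : Finset β} (h : G.IsPath x y V E)
    (hE : ∀ e ∈ E, ∀ x y, G.IsLink e x y → H.IsLink e x y) : H.IsPath x y V E := by
  induction h with
  | nil x => exact .nil x
  | cons hl p hx ih =>
    exact .cons (hE _ (by simp) _ _ hl) (ih fun e he => hE e (by simp [he])) hx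

lemma IsPathSystem.exists_isSubdiv (S : G.IsPathSystem σ τ Jn b V E) (hS : IsShape σ τ Jn) :
    ∃ H ≤ G, H.IsSubdiv σ τ Jn b V E := by
  have hV : ∀ i, ∀ v ∈ V i, v ∈ V(G) := by
    intro i v hv
    by_cases hi : E i = ∅
    -- A trivial path carries no edge, but its vertex is an end of another path. That one is not
    -- trivial, as the paths in `Jn` replace the edges of a matching.
    · have hbσ : b (σ i) ∈ V(G) := by
        obtain ⟨j, hji, hj⟩ := hS.cover i (σ i)
        have hEj : E j ≠ ∅ := by
          intro h
          have := hS.matching i j (S.trivial i hi) (S.trivial j h) hji.symm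
          rcases hj with hj | hj
          exacts [this.1 hj, this.2.1 hj]
        rcases hj with hj | hj <;> rw [hj]
        exacts [(S.path j).mem_vertexSet hEj (S.path j).left_mem,
          (S.path j).mem_vertexSet hEj (S.path j).right_mem]
      have h := S.path i
      rw [hi] at h
      rw [h.eq_of_isEmpty.2, Finset.mem_singleton] at hv
      rwa [hv]
    · exact (S.path i).mem_vertexSet hi hv
  let H : Graph α β :=
    { vertexSet := {v | ∃ i, v ∈ V i}
      IsLink := fun e x y => (∃ i, e ∈ E i) ∧ G.IsLink e x y
      edgeSet := {e | ∃ i, e ∈ E i}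
      isLink_symm := fun e _ => ⟨fun x y h => ⟨h.1, h.2.symm⟩⟩
      eq_or_eq_of_isLink_of_isLink := fun e x y v w h h' => h.2.left_eq_or_eq h'.2
      edge_mem_iff_exists_isLink := fun e => by
        constructor
        · rintro ⟨i, hi⟩
          obtain ⟨x, y, h, -⟩ := (S.path i).exists_isLink hi
          exact ⟨x, y, ⟨i, hi⟩, h⟩
        · rintro ⟨x, y, h, -⟩; exact h
      left_mem_of_isLink := by
        rintro e x y ⟨⟨i, hi⟩, h⟩
        exact ⟨i, (S.path i).mem_of_inc hi h.inc_left⟩ }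
  refine ⟨H, ⟨?_, fun e x y h => h.2⟩, ⟨⟨fun i => (S.path i).of_isLink ?_, S.meet, S.disj, S.trivial,
    S.inj⟩, fun v => Iff.rfl, fun e => Iff.rfl⟩⟩
  · rintro v ⟨i, hi⟩
    exact hV i v hi
  · intro e he x y h
    exact ⟨⟨i, he⟩, h⟩

lemma IsSubdiv.finite_edgeSet (S : H.IsSubdiv σ τ Jn b V E) : E(H).Finite :=
  (Finset.univ.biUnion E).finite_toSet.subset fun e he => by
    simpa using (S.edge e).1 he

/-- A circuit of a subdivision is the union of the paths that replace the edges of a set in which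
every vertex has even degree. -/
lemma IsSubdiv.exists_eq_biUnion (S : H.IsSubdiv σ τ Jn b V E) (hS : IsShape σ τ Jn)
    {W : Finset α} {C : Finset β} (hC : H.IsCirc W C) : ∃ I : Finset (Fin m), C = I.biUnion E ∧
      ∀ x, ∑ i ∈ I, ((if x = σ i then 1 else 0) + if x = τ i then (1 : ZMod 2) else 0) = 0 := by
  have hsub : ∀ i, E i ⊆ C ∨ Disjoint (E i) C := by
    intro i
    refine (S.path i).subset_or_disjoint (fun z _ => hC.degPar_eq) fun z hz hzσ hzτ g hg hi => ?_
    obtain ⟨j, hj⟩ := (S.edge g).1 (hC.mem_edgeSet hg)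
    by_cases hij : i = j
    · rwa [hij]
    · exact absurd (S.meet i j hij z hz ((S.path j).mem_of_inc hj hi)) (by simp [hzσ, hzτ])
  set I := Finset.univ.filter fun i => E i ≠ ∅ ∧ E i ⊆ C with hI
  have hCI : C = I.biUnion E := by
    ext g
    simp only [Finset.mem_biUnion, hI, Finset.mem_filter, Finset.mem_univ, true_and]
    constructor
    · intro hg
      obtain ⟨j, hj⟩ := (S.edge g).1 (hC.mem_edgeSet hg)
      refine ⟨j, ⟨Finset.ne_empty_of_mem hj, (hsub j).resolve_right fun h => ?_⟩, hj⟩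
      exact Finset.disjoint_left.1 h hj hg
    · rintro ⟨j, ⟨-, hj⟩, hg⟩
      exact hj hg
  -- `d x` is the degree of the label `x` in `I`, modulo 2. The circuit only guarantees that it sums
  -- to zero over all labels of the same vertex.
  obtain ⟨d, hd⟩ : ∃ d : Fin k → ZMod 2, ∀ x, d x =
      ∑ i ∈ I, ((if x = σ i then 1 else 0) + if x = τ i then 1 else 0) := ⟨_, fun _ => rfl⟩
  have hsum : ∀ x, ∑ y, (if b y = b x then d y else 0) = 0 := by
    intro x
    have h1 : H.degPar (b x) C = 0 := hC.degPar_eq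
    rw [hCI, degPar, Finset.sum_biUnion (fun i _ j _ hij => S.disj i j hij)] at h1
    refine Eq.trans ?_ h1
    have h2 : ∀ i, (∑ e ∈ E i, (open Classical in if H.Inc e (b x) then (1 : ZMod 2) else 0)) =
        ∑ y, if b y = b x then ((if y = σ i then 1 else 0) + if y = τ i then 1 else 0) else 0 := by
      intro i
      refine (S.path i).degPar_eq.trans ?_
      have h3 : ∀ c : Fin k, (if b x = b c then (1 : ZMod 2) else 0) =
          ∑ y, if b y = b x then (if y = c then 1 else 0) else 0 := by
        intro c
        rw [Finset.sum_eq_single c]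
        · simp [eq_comm]
        · intro y _ hy; simp [hy]
        · simp
      rw [h3, h3, ← Finset.sum_add_distrib]
      refine Finset.sum_congr rfl fun y _ => ?_
      split_ifs <;> rfl
    rw [Finset.sum_congr rfl fun i _ => h2 i, Finset.sum_comm]
    refine Finset.sum_congr rfl fun y _ => ?_
    split_ifs
    · exact hd y
    · simp
  -- A contracted path `l` identifies its two end labels, whose degrees are equal modulo 2. If they
  -- are odd, adding the index `l` corrects both and contributes no edges; by the matching property
  -- it affects no other contracted pair.
  refine ⟨I ∪ Finset.univ.filter fun i => E i = ∅ ∧ d (σ i) = 1, ?_, fun x => ?_⟩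
  · rw [hCI]
    ext g
    simp only [Finset.mem_biUnion, Finset.mem_union, Finset.mem_filter, Finset.mem_univ, true_and]
    constructor
    · rintro ⟨j, hj, hg⟩; exact ⟨j, .inl hj, hg⟩
    · rintro ⟨j, hj | hj, hg⟩
      · exact ⟨j, hj, hg⟩
      · simp [hj.1] at hg
  · rw [Finset.sum_union, ← hd]
    · by_cases hx : ∃ l, E l = ∅ ∧ (x = σ l ∨ x = τ l)
      · obtain ⟨l, hl0, hl⟩ := hx
        have hJl := S.trivial l hl0
        have hll := hS.loopless l hJl
        have hbl : b (σ l) = b (τ l) := by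
          by_contra h
          exact ((S.path l).edges_nonempty h).ne_empty hl0
        have hcls : ∀ y, b y = b (σ l) ↔ y = σ l ∨ y = τ l := by
          intro y
          constructor
          · intro h
            rcases S.inj y (σ l) h with h | ⟨i, hi, -, h⟩
            · exact .inl h
            · by_cases hil : i = l
              · subst hil; grind
              · have := hS.matching i l hi hJl hil
                grind
          · rintro (rfl | rfl)
            · rfl
            · exact hbl.symm
        have h1 := hsum (σ l)
        simp only [hcls] at h1
        rw [← Finset.sum_filter, show Finset.univ.filter (fun y => y = σ l ∨ y = τ l) =
          {σ l, τ l} from by ext; simp, Finset.sum_pair hll] at h1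
        have h2 : ∀ i ∈ Finset.univ.filter (fun i => E i = ∅ ∧ d (σ i) = 1), i ≠ l →
            (if x = σ i then 1 else 0) + (if x = τ i then (1 : ZMod 2) else 0) = 0 := by
          intro i hi hil
          simp only [Finset.mem_filter, Finset.mem_univ, true_and] at hi
          have := hS.matching i l (S.trivial i hi.1) hJl hil
          rw [if_neg, if_neg, add_zero] <;> grind
        by_cases hdl : d (σ l) = 1
        · rw [Finset.sum_eq_single l h2 (by simp [hl0, hdl])]
          rw [hdl] at h1
          rcases hl with rfl | rfl
          · simp [hll, hdl]; decide
          · simp [hll.symm, add_comm (d _), h1]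
        · rw [Finset.sum_eq_zero fun i hi => h2 i hi (by rintro rfl; simp [hdl] at hi), add_zero]
          have h0 : d (σ l) = 0 := by
            generalize d (σ l) = z at hdl ⊢
            revert hdl; revert z; decide
          rw [h0, zero_add] at h1
          rcases hl with rfl | rfl <;> assumption
      · have h1 := hsum x
        have hcls : ∀ y, b y = b x ↔ y = x := by
          intro y
          refine ⟨fun h => (S.inj y x h).resolve_right ?_, fun h => by rw [h]⟩
          rintro ⟨i, -, hi, h⟩
          exact hx ⟨i, hi, by tauto⟩
        simp only [hcls, Finset.sum_ite_eq', Finset.mem_univ, if_true] at h1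
        rw [h1, zero_add]
        refine Finset.sum_eq_zero fun i hi => ?_
        simp only [Finset.mem_filter, Finset.mem_univ, true_and] at hi
        rw [if_neg fun h => hx ⟨i, hi.1, .inl h⟩, if_neg fun h => hx ⟨i, hi.1, .inr h⟩, add_zero]
    · rw [Finset.disjoint_left]
      intro i hi hi'
      simp only [hI, Finset.mem_filter] at hi hi'
      exact hi.2.1 hi'.2.1

end Subdivision
end Graph

/-! ### Recognizing the base graphs -/

namespace Graph

section Labelling

variable {m k n l : ℕ}

/-- Whether two points of a subdivision with paths of lengths `len` coincide. The points are the
branch vertices and the middle vertices of the paths of length `2`. -/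
def ptEq (σ τ : Fin m → Fin k) (len : Fin m → ℕ) : Fin k ⊕ Fin m → Fin k ⊕ Fin m → Bool
  | .inl x, .inl y => x = y || ∃ i, len i = 0 ∧ (x = σ i ∧ y = τ i ∨ x = τ i ∧ y = σ i)
  | .inr i, .inr j => i = j
  | _, _ => false

/-- Whether a point occurs. -/
def ptOK (k : ℕ) (len : Fin m → ℕ) : Fin k ⊕ Fin m → Bool
  | .inl _ => true
  | .inr i => len i = 2

/-- Whether a path has a first or a second edge. -/
def edOK (len : Fin m → ℕ) : Fin m × Bool → Bool
  | (i, false) => len i ≠ 0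
  | (i, true) => len i = 2

/-- The ends of the first or second edge of a path. -/
def edEnds (σ τ : Fin m → Fin k) (len : Fin m → ℕ) :
    Fin m × Bool → (Fin k ⊕ Fin m) × (Fin k ⊕ Fin m)
  | (i, false) => (.inl (σ i), if len i = 2 then .inr i else .inl (τ i))
  | (i, true) => (.inr i, .inl (τ i))

/-- Whether `νc` and `εc` label the subdivision as the graph `ofEnds ends`. -/
structure IsLabelling (σ τ : Fin m → Fin k) (len : Fin m → ℕ) (ends : Fin l → Fin n × Fin n)
    (νc : Fin n → Fin k ⊕ Fin m) (εc : Fin l → Fin m × Bool) : Prop where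
  vertex_ok : ∀ j, ptOK k len (νc j)
  vertex_inj : ∀ i j, ptEq σ τ len (νc i) (νc j) → i = j
  vertex_surj : ∀ p, ptOK k len p → ∃ j, ptEq σ τ len p (νc j)
  edge_ok : ∀ j, edOK len (εc j)
  edge_inj : ∀ i j, εc i = εc j → i = j
  edge_surj : ∀ q, edOK len q → ∃ j, εc j = q
  isLink : ∀ j, (ptEq σ τ len (edEnds σ τ len (εc j)).1 (νc (ends j).1) ∧
      ptEq σ τ len (edEnds σ τ len (εc j)).2 (νc (ends j).2)) ∨
    (ptEq σ τ len (edEnds σ τ len (εc j)).1 (νc (ends j).2) ∧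
      ptEq σ τ len (edEnds σ τ len (εc j)).2 (νc (ends j).1))

variable {α β : Type*} {K : Graph α β}

lemma isIsomorphic_ofEnds {ends : Fin l → Fin n × Fin n} {ν : Fin n → α} {ε : Fin l → β}
    (hν : ν.Injective) (hνV : ∀ v, v ∈ V(K) ↔ ∃ j, ν j = v) (hε : ε.Injective)
    (hεE : ∀ e, e ∈ E(K) ↔ ∃ j, ε j = e)
    (hl : ∀ j, K.IsLink (ε j) (ν (ends j).1) (ν (ends j).2)) (j₀ : Fin l) :
    K.IsIsomorphic (ofEnds ends) := by
  have : Nonempty (Fin n) := ⟨(ends j₀).1⟩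
  have : Nonempty (Fin l) := ⟨j₀⟩
  refine ⟨Function.invFun ν, Function.invFun ε, ⟨fun _ _ => Set.mem_univ _, ?_, ?_⟩,
    ⟨fun _ _ => Set.mem_univ _, ?_, ?_⟩, ?_⟩
  · rintro v hv w hw h
    obtain ⟨i, rfl⟩ := (hνV v).1 hv
    obtain ⟨j, rfl⟩ := (hνV w).1 hw
    rw [Function.leftInverse_invFun hν, Function.leftInverse_invFun hν] at h
    rw [h]
  · intro i _
    exact ⟨ν i, (hνV _).2 ⟨i, rfl⟩, Function.leftInverse_invFun hν i⟩
  · rintro v hv w hw h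
    obtain ⟨i, rfl⟩ := (hεE v).1 hv
    obtain ⟨j, rfl⟩ := (hεE w).1 hw
    rw [Function.leftInverse_invFun hε, Function.leftInverse_invFun hε] at h
    rw [h]
  · intro i _
    exact ⟨ε i, (hεE _).2 ⟨i, rfl⟩, Function.leftInverse_invFun hε i⟩
  · intro e he x hx y hy
    obtain ⟨j, rfl⟩ := (hεE e).1 he
    obtain ⟨x, rfl⟩ := (hνV x).1 hx
    obtain ⟨y, rfl⟩ := (hνV y).1 hy
    rw [Function.leftInverse_invFun hε, Function.leftInverse_invFun hν,
      Function.leftInverse_invFun hν, (hl j).isLink_iff, hν.eq_iff, hν.eq_iff, hν.eq_iff, hν.eq_iff]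
    have : (ofEnds ends).IsLink j x y ↔ ends j = (x, y) ∨ ends j = (y, x) := Iff.rfl
    rw [this, Prod.ext_iff, Prod.ext_iff]

variable [DecidableEq α] [DecidableEq β] {σ τ : Fin m → Fin k} {Jn : Fin m → Bool} {b : Fin k → α}
  {V : Fin m → Finset α} {E : Fin m → Finset β}

lemma IsSubdiv.isIsomorphic (S : K.IsSubdiv σ τ Jn b V E) (hS : IsShape σ τ Jn) {len : Fin m → ℕ}
    (hlen : ∀ i, (E i).card = len i) (hlen' : ∀ i, len i ≤ 2) {ends : Fin l → Fin n × Fin n}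
    {νc : Fin n → Fin k ⊕ Fin m} {εc : Fin l → Fin m × Bool}
    (hL : IsLabelling σ τ len ends νc εc) (j₀ : Fin l) : K.IsIsomorphic (ofEnds ends) := by
  have hβ : Nonempty β := by
    have h := hL.edge_ok j₀
    generalize εc j₀ = q at h
    obtain ⟨i, c⟩ := q
    have : len i ≠ 0 := by
      cases c <;> simp only [edOK, decide_eq_true_eq] at h <;> omega
    have : (E i).Nonempty := Finset.card_pos.1 (by rw [hlen]; omega)
    exact ⟨this.choose⟩
  -- A uniform naming for all lengths: the middle vertex `z` is meaningful for length two only, the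
  -- edge `e true` likewise, and `e false` for positive length. The remaining values are arbitrary.
  have key : ∀ i, ∃ (z : α) (e : Bool → β), (len i = 0 → b (σ i) = b (τ i) ∧ V i = {b (σ i)} ∧ E i = ∅) ∧
      (len i = 1 → E i = {e false} ∧ V i = {b (σ i), b (τ i)} ∧
        K.IsLink (e false) (b (σ i)) (b (τ i))) ∧
      (len i = 2 → E i = {e false, e true} ∧ e false ≠ e true ∧ V i = {b (σ i), z, b (τ i)} ∧
        K.IsLink (e false) (b (σ i)) z ∧ K.IsLink (e true) z (b (τ i)) ∧
        z ≠ b (σ i) ∧ z ≠ b (τ i)) := by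
    intro i
    have p := S.path i
    have h1 := hlen i
    rcases Nat.lt_or_ge (len i) 2 with h2 | h2
    · rcases Nat.lt_or_ge (len i) 1 with h3 | h3
      · have h4 : E i = ∅ := Finset.card_eq_zero.1 (by omega)
        rw [h4] at p
        exact ⟨b (σ i), fun _ => Classical.arbitrary β,
          fun _ => ⟨p.eq_of_isEmpty.1, p.eq_of_isEmpty.2, h4⟩, by omega, by omega⟩
      · obtain ⟨e, he⟩ := Finset.card_eq_one.1 (show (E i).card = 1 by omega)
        obtain ⟨x, y, hl, -⟩ := p.exists_isLink (e := e) (by simp [he])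
        have hne : b (σ i) ≠ b (τ i) := by
          intro h
          rw [h] at p
          rw [p.eq_singleton.2] at he
          simp at he
        have hiσ : K.Inc e (b (σ i)) := by
          obtain ⟨f, hf, hi⟩ := p.exists_inc hne p.left_mem
          rw [he, Finset.mem_singleton] at hf
          exact hf ▸ hi
        have hiτ : K.Inc e (b (τ i)) := by
          obtain ⟨f, hf, hi⟩ := p.exists_inc hne p.right_mem
          rw [he, Finset.mem_singleton] at hf
          exact hf ▸ hi
        obtain ⟨z, hz⟩ := hiσ
        have hzτ := (hiτ.eq_or_eq_of_isLink hz).resolve_left hne.symm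
        subst hzτ
        refine ⟨b (σ i), fun _ => e, by omega, fun _ => ⟨he, ?_, hz⟩, by omega⟩
        exact (p.eq_singleton_of_isLink (e := e) (by simp [he]) hz).1
    · obtain ⟨v, w, e, f, V₂, E₂, he, hf, q, hv, hs, hV, hE⟩ := p.exists_cons_cons (by omega)
      have hw := q.left_mem
      have hE₂ : E₂ = ∅ := by
        rw [← Finset.card_eq_zero]
        have heE : e ∉ E₂ := fun h => hs (by simp [q.mem_of_inc h he.inc_left])
        have hfE : f ∉ E₂ := fun h => hv (q.mem_of_inc h hf.inc_left)
        have hef : e ≠ f := by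
          rintro rfl
          rcases he.eq_and_eq_or_eq_and_eq hf with ⟨h, -⟩ | ⟨h, -⟩
          · exact hs (by simp [h])
          · exact hs (by simp [h, hw])
        have := hlen' i
        rw [hE, Finset.card_insert_of_notMem (by simp [hef, heE]),
          Finset.card_insert_of_notMem hfE] at h1
        omega
      subst hE₂
      obtain ⟨rfl, rfl⟩ := q.eq_of_isEmpty
      refine ⟨v, fun c => if c then f else e, by omega, by omega, fun _ => ⟨by simpa using hE, ?_,
        by simpa using hV, by simpa using he, by simpa using hf, ?_, ?_⟩⟩
      · simp only [if_true]
        rintro h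
        simp only [Bool.false_eq_true, if_false] at h
        subst h
        rcases he.eq_and_eq_or_eq_and_eq hf with ⟨h, -⟩ | ⟨h, -⟩
        · exact hs (by simp [h])
        · exact hs (by simp [h])
      · rintro rfl; exact hs (by simp)
      · rintro rfl; exact hv (by simp)
  choose z e h0 h1 h2 using key
  have hlen0 : ∀ i, len i = 0 ∨ len i = 1 ∨ len i = 2 := fun i => by have := hlen' i; omega
  have heE : ∀ q, edOK len q → e q.1 q.2 ∈ E q.1 := by
    rintro ⟨i, c⟩ hq
    rcases hlen0 i with h | h | h <;> cases c <;> simp [edOK, h] at hq ⊢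
    · simp [(h1 i h).1]
    · simp [(h2 i h).1]
    · simp [(h2 i h).1]
  have hbV : ∀ i x, ∃ j, j ≠ i ∧ b x ∈ V j := by
    intro i x
    obtain ⟨j, hj, rfl | rfl⟩ := hS.cover i x
    · exact ⟨j, hj, (S.path j).left_mem⟩
    · exact ⟨j, hj, (S.path j).right_mem⟩
  have hzV : ∀ i, len i = 2 → z i ∈ V i ∧ ∀ j, j ≠ i → z i ∉ V j := by
    intro i hi
    obtain ⟨-, -, hV, -, -, n1, n2⟩ := h2 i hi
    have : z i ∈ V i := by simp [hV]
    exact ⟨this, fun j hj h => (S.meet i j hj.symm _ this h).elim n1 n2⟩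
  let pt : Fin k ⊕ Fin m → α := Sum.elim b z
  have pt_eq : ∀ p q, ptEq σ τ len p q → pt p = pt q := by
    rintro (x | i) (y | j) h <;> simp [ptEq] at h
    · rcases h with rfl | ⟨i, hi, ⟨rfl, rfl⟩ | ⟨rfl, rfl⟩⟩
      · rfl
      · exact (h0 i hi).1
      · exact (h0 i hi).1.symm
    · rw [h]
  have pt_inj : ∀ p q, ptOK k len p → ptOK k len q → pt p = pt q → ptEq σ τ len p q := by
    rintro (x | i) (y | j) hp hq h <;> simp only [ptOK, decide_eq_true_eq] at hp hq <;>
      simp only [ptEq, Bool.or_eq_true, decide_eq_true_eq]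
    · rcases S.inj x y h with h | ⟨i, -, hi, h⟩
      · exact .inl h
      · exact .inr ⟨i, by rw [← hlen, hi, Finset.card_empty], h⟩
    · obtain ⟨i, hi, hx⟩ := hbV j x
      exact absurd ((show b x = z j from h) ▸ hx) ((hzV j hq).2 i hi)
    · obtain ⟨j, hj, hx⟩ := hbV i y
      exact absurd ((show z i = b y from h).symm ▸ hx) ((hzV i hp).2 j hj)
    · by_contra hij
      exact (hzV i hp).2 j (Ne.symm hij) ((show z i = z j from h) ▸ (hzV j hq).1)
  refine isIsomorphic_ofEnds (ν := pt ∘ νc) (ε := fun j => e (εc j).1 (εc j).2) ?_ ?_ ?_ ?_ ?_ j₀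
  · intro i j hij
    exact hL.vertex_inj i j (pt_inj _ _ (hL.vertex_ok i) (hL.vertex_ok j) hij)
  · intro v
    rw [S.vert]
    have hpt : ∀ p, ptOK k len p → ∃ j, (pt ∘ νc) j = pt p := by
      intro p hp
      obtain ⟨j, hj⟩ := hL.vertex_surj p hp
      exact ⟨j, (pt_eq _ _ hj).symm⟩
    constructor
    · rintro ⟨i, hi⟩
      rcases hlen0 i with h | h | h
      · rw [(h0 i h).2.1, Finset.mem_singleton] at hi
        exact hi ▸ hpt (.inl (σ i)) rfl
      · rw [(h1 i h).2.1, Finset.mem_insert, Finset.mem_singleton] at hi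
        rcases hi with rfl | rfl
        · exact hpt (.inl (σ i)) rfl
        · exact hpt (.inl (τ i)) rfl
      · rw [(h2 i h).2.2.1, Finset.mem_insert, Finset.mem_insert, Finset.mem_singleton] at hi
        rcases hi with rfl | rfl | rfl
        · exact hpt (.inl (σ i)) rfl
        · exact hpt (.inr i) (by simpa [ptOK] using h)
        · exact hpt (.inl (τ i)) rfl
    · rintro ⟨j, rfl⟩
      have := hL.vertex_ok j
      simp only [Function.comp_apply]
      cases hj : νc j with
      | inl x =>
        obtain ⟨i, -, hi⟩ := hbV (εc j₀).1 x
        exact ⟨i, hi⟩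
      | inr i => exact ⟨i, (hzV i (by simpa [hj, ptOK] using this)).1⟩
  · intro i j hij
    apply hL.edge_inj
    have h3 := hL.edge_ok i
    have h4 := hL.edge_ok j
    dsimp only at hij
    generalize εc i = q at h3 hij ⊢
    generalize εc j = q' at h4 hij ⊢
    have h5 := heE _ h3
    have h6 := heE _ h4
    obtain ⟨i', c⟩ := q
    obtain ⟨j', d⟩ := q'
    have : i' = j' := by
      by_contra h
      exact Finset.disjoint_left.1 (S.disj i' j' h) h5 (hij ▸ h6)
    subst this
    congr 1
    cases c <;> cases d <;> simp only [edOK, decide_eq_true_eq] at h3 h4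
    · rfl
    · exact absurd hij (h2 _ h4).2.1
    · exact absurd hij.symm (h2 _ h3).2.1
    · rfl
  · intro g
    rw [S.edge]
    constructor
    · rintro ⟨i, hi⟩
      have : ∃ q, edOK len q ∧ e q.1 q.2 = g := by
        rcases hlen0 i with h | h | h
        · simp [(h0 i h).2.2] at hi
        · rw [(h1 i h).1, Finset.mem_singleton] at hi
          exact ⟨(i, false), by simp [edOK, h], hi.symm⟩
        · rw [(h2 i h).1, Finset.mem_insert, Finset.mem_singleton] at hi
          rcases hi with hi | hi
          · exact ⟨(i, false), by simp [edOK, h], hi.symm⟩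
          · exact ⟨(i, true), by simp [edOK, h], hi.symm⟩
      obtain ⟨q, hq, rfl⟩ := this
      obtain ⟨j, hj⟩ := hL.edge_surj q hq
      exact ⟨j, by rw [hj]⟩
    · rintro ⟨j, rfl⟩
      exact ⟨_, heE _ (hL.edge_ok j)⟩
  · intro j
    have hlink : ∀ q, edOK len q → K.IsLink (e q.1 q.2) (pt (edEnds σ τ len q).1)
        (pt (edEnds σ τ len q).2) := by
      rintro ⟨i, c⟩ hq
      rcases hlen0 i with h | h | h <;> cases c <;> simp [edOK, h] at hq <;>
        simp only [edEnds, h]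
      · exact (h1 i h).2.2
      · exact (h2 i h).2.2.2.1
      · exact (h2 i h).2.2.2.2.1
    have := hlink _ (hL.edge_ok j)
    rcases hL.isLink j with ⟨h3, h4⟩ | ⟨h3, h4⟩ <;> rw [pt_eq _ _ h3, pt_eq _ _ h4] at this
    · exact this
    · exact this.symm

/-- A path system whose paths have the parities of a labelled base graph spans an even splitting of
this graph. -/
lemma IsSubdiv.isEvenSplitting (S : K.IsSubdiv σ τ Jn b V E) (hS : IsShape σ τ Jn)
    {len : Fin m → ℕ} (hlen : ∀ i, len i = if Jn i then (E i).card % 2 else 2 - (E i).card % 2)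
    {ends : Fin l → Fin n × Fin n} {νc : Fin n → Fin k ⊕ Fin m} {εc : Fin l → Fin m × Bool}
    (hL : IsLabelling σ τ len ends νc εc) (j₀ : Fin l) : K.IsEvenSplitting (ofEnds ends) := by
  obtain ⟨K', b', V', E', hK, S', hc⟩ := S.exists_reduced hS
  refine ⟨K', S'.isIsomorphic hS (fun i => (hc i).trans (hlen i).symm) (fun i => ?_) hL j₀, hK⟩
  rw [hlen]
  split_ifs <;> omega

end Labelling
end Graph

/-! ### The relations for theta graphs and `K₄` -/

namespace Graph

section Relations

variable {α β : Type*} [DecidableEq α] [DecidableEq β] {G H : Graph α β} {J : Set β → ZMod 2}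
  {t : β → α} {k : ℕ} {c : ZMod 2}

/-- The even splittings whose prescribed clockwise parities cannot be realized. -/
def IsObstruction (H : Graph α β) (J : Set β → ZMod 2) : Prop :=
  ((H.IsEvenSplitting graphO1 ∨ H.IsEvenSplitting graphO2) ∧
      H.numEvenCircuits = 3 ∧ Even (H.numPrescribedEven J)) ∨
    ((H.IsEvenSplitting graphE1 ∨ H.IsEvenSplitting graphE2 ∨ H.IsEvenSplitting graphE3) ∧
      H.numEvenCircuits = 3 ∧ Odd (H.numPrescribedEven J)) ∨
    ((H.IsEvenSplitting graphDelta1 ∨ H.IsEvenSplitting graphDelta2 ∨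
        H.IsEvenSplitting graphDelta3 ∨ H.IsEvenSplitting graphDelta4) ∧
      H.numEvenCircuits = 4 ∧ Odd (H.numPrescribedEven J))

lemma hasEvenFamily_of_O (h : H.IsEvenSplitting graphO1 ∨ H.IsEvenSplitting graphO2) :
    H.HasEvenFamily 3 0 := by
  rcases h with ⟨K, hK, h⟩ | ⟨K, hK, h⟩
  exacts [hK.hasEvenFamily_O1.of_splittings h, hK.hasEvenFamily_O2.of_splittings h]

lemma hasEvenFamily_of_E (h : H.IsEvenSplitting graphE1 ∨ H.IsEvenSplitting graphE2 ∨
    H.IsEvenSplitting graphE3) : H.HasEvenFamily 3 1 := by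
  rcases h with ⟨K, hK, h⟩ | ⟨K, hK, h⟩ | ⟨K, hK, h⟩
  exacts [hK.hasEvenFamily_E1.of_splittings h, hK.hasEvenFamily_E2.of_splittings h,
    hK.hasEvenFamily_E3.of_splittings h]

lemma hasEvenFamily_of_Delta (h : H.IsEvenSplitting graphDelta1 ∨ H.IsEvenSplitting graphDelta2 ∨
    H.IsEvenSplitting graphDelta3 ∨ H.IsEvenSplitting graphDelta4) : H.HasEvenFamily 4 0 := by
  rcases h with ⟨K, hK, h⟩ | ⟨K, hK, h⟩ | ⟨K, hK, h⟩ | ⟨K, hK, h⟩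
  exacts [hK.hasEvenFamily_Delta1.of_splittings h, hK.hasEvenFamily_Delta2.of_splittings h,
    hK.hasEvenFamily_Delta3.of_splittings h, hK.hasEvenFamily_Delta4.of_splittings h]

lemma IsObstruction.exists_hasEvenFamily (h : H.IsObstruction J) : ∃ k c, H.HasEvenFamily k c ∧
    H.numEvenCircuits = k ∧ (H.numPrescribedEven J : ZMod 2) = k + c + 1 := by
  rcases h with ⟨h, h1, h2⟩ | ⟨h, h1, h2⟩ | ⟨h, h1, h2⟩
  · refine ⟨3, 0, hasEvenFamily_of_O h, h1, ?_⟩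
    rw [ZMod.natCast_eq_zero_iff_even.2 h2]; decide
  · refine ⟨3, 1, hasEvenFamily_of_E h, h1, ?_⟩
    rw [ZMod.natCast_eq_one_iff_odd.2 h2]; decide
  · refine ⟨4, 0, hasEvenFamily_of_Delta h, h1, ?_⟩
    rw [ZMod.natCast_eq_one_iff_odd.2 h2]; decide

/-- The clockwise parities sum to `c`, and the number of circuits prescribed to be even is `F.card`
plus the sum of `J`, modulo 2. As this differs from `F.card + c + 1`, the sum of `J` is `c` as well.
-/
lemma sum_eq_zero_of_hasEvenFamily (hHG : H ≤ G) (ht : G.IsTail t) (hE : E(H).Finite)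
    {F : Finset (Finset β)} (hF : ∀ C, C ∈ F ↔ (∃ V, H.IsCirc V C) ∧ C.card % 2 = 0)
    (h : H.HasEvenFamily F.card c)
    (hJ : H.numEvenCircuits = F.card → (H.numPrescribedEven J : ZMod 2) ≠ F.card + c + 1) :
    ∑ C ∈ F, (J C + G.cwParity t C) = 0 := by
  have hnum : H.numEvenCircuits = F.card := by
    have : {C | H.IsEvenCircuit C} = (fun C : Finset β => (C : Set β)) '' F := by
      ext C
      constructor
      · intro hC
        obtain ⟨V, C', hV, rfl, hc⟩ := IsEvenCircuit.exists_isCirc hC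
        exact ⟨C', (hF C').2 ⟨⟨V, hV⟩, hc⟩, rfl⟩
      · rintro ⟨C, hC, rfl⟩
        obtain ⟨⟨V, hV⟩, hc⟩ := (hF C).1 hC
        exact hV.isEvenCircuit hc
    rw [numEvenCircuits, this, Set.ncard_image_of_injective _ Finset.coe_injective,
      Set.ncard_coe_finset]
  have hJ := hJ hnum
  obtain ⟨F', -, hF', hsum, hP⟩ := h.exists_finset hnum hE
  obtain rfl : F' = F := by ext C; rw [hF, hF']
  rw [hP] at hJ
  have h1 := hsum t (ht.mono hHG)
  rw [Finset.sum_congr rfl fun C hC => cwParity_of_le hHG ht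
    (((hF C).1 hC).1.choose_spec.isEvenCircuit ((hF C).1 hC).2)] at h1
  rw [Finset.sum_add_distrib, h1]
  have : ∀ a b c : ZMod 2, a + b ≠ a + c + 1 → b + c = 0 := by decide
  exact this _ _ _ hJ

lemma sum_eq_zero_of_three (hJ : ¬ H.IsObstruction J) (hHG : H ≤ G) (ht : G.IsTail t)
    (hE : E(H).Finite) (h : H.IsEvenSplitting graphO1 ∨ H.IsEvenSplitting graphO2 ∨
      H.IsEvenSplitting graphE1 ∨ H.IsEvenSplitting graphE2 ∨ H.IsEvenSplitting graphE3)
    {C₁ C₂ C₃ : Finset β} (h₁₂ : C₁ ≠ C₂) (h₁₃ : C₁ ≠ C₃) (h₂₃ : C₂ ≠ C₃)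
    (hC : ∀ C ∈ [C₁, C₂, C₃], (∃ V, H.IsCirc V C) ∧ C.card % 2 = 0)
    (hC' : ∀ V C, H.IsCirc V C → C.card % 2 = 0 → C ∈ [C₁, C₂, C₃]) :
    J C₁ + G.cwParity t C₁ + (J C₂ + G.cwParity t C₂) + (J C₃ + G.cwParity t C₃) = 0 := by
  have hcard : ({C₁, C₂, C₃} : Finset (Finset β)).card = 3 := Finset.card_eq_three.2
    ⟨_, _, _, h₁₂, h₁₃, h₂₃, rfl⟩
  have key : ∀ c, H.HasEvenFamily 3 c → ((H.numEvenCircuits = 3) →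
      (H.numPrescribedEven J : ZMod 2) ≠ (3 : ℕ) + c + 1) →
      J C₁ + G.cwParity t C₁ + (J C₂ + G.cwParity t C₂) + (J C₃ + G.cwParity t C₃) = 0 := by
    intro c hc hn
    have := sum_eq_zero_of_hasEvenFamily (F := {C₁, C₂, C₃}) (J := J) (c := c) hHG ht hE
      (fun C => ⟨fun h => hC C (by simpa using h), fun h => by
        simpa using hC' _ C h.1.choose_spec h.2⟩) (by rwa [hcard]) (by rwa [hcard])
    rwa [Finset.sum_insert (by simp [h₁₂, h₁₃]), Finset.sum_pair h₂₃, ← add_assoc] at this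
  have h' : (H.IsEvenSplitting graphO1 ∨ H.IsEvenSplitting graphO2) ∨
      (H.IsEvenSplitting graphE1 ∨ H.IsEvenSplitting graphE2 ∨ H.IsEvenSplitting graphE3) := by
    rcases h with h | h | h | h | h <;> simp [h]
  rcases h' with h | h
  · refine key 0 (hasEvenFamily_of_O h) fun hn hp => hJ (.inl ⟨h, hn, ?_⟩)
    rw [← ZMod.natCast_eq_zero_iff_even, hp]; decide
  · refine key 1 (hasEvenFamily_of_E h) fun hn hp => hJ (.inr (.inl ⟨h, hn, ?_⟩))
    rw [← ZMod.natCast_eq_one_iff_odd, hp]; decide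

lemma sum_eq_zero_of_four (hJ : ¬ H.IsObstruction J) (hHG : H ≤ G) (ht : G.IsTail t)
    (hE : E(H).Finite) (h : H.IsEvenSplitting graphDelta1 ∨ H.IsEvenSplitting graphDelta2 ∨
      H.IsEvenSplitting graphDelta3 ∨ H.IsEvenSplitting graphDelta4)
    {C₁ C₂ C₃ C₄ : Finset β} (h₁₂ : C₁ ≠ C₂) (h₁₃ : C₁ ≠ C₃) (h₁₄ : C₁ ≠ C₄) (h₂₃ : C₂ ≠ C₃)
    (h₂₄ : C₂ ≠ C₄) (h₃₄ : C₃ ≠ C₄)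
    (hC : ∀ C ∈ [C₁, C₂, C₃, C₄], (∃ V, H.IsCirc V C) ∧ C.card % 2 = 0)
    (hC' : ∀ V C, H.IsCirc V C → C.card % 2 = 0 → C ∈ [C₁, C₂, C₃, C₄]) :
    J C₁ + G.cwParity t C₁ + (J C₂ + G.cwParity t C₂) + (J C₃ + G.cwParity t C₃) +
      (J C₄ + G.cwParity t C₄) = 0 := by
  have hcard : ({C₁, C₂, C₃, C₄} : Finset (Finset β)).card = 4 := by
    rw [Finset.card_insert_of_notMem (by simp [h₁₂, h₁₃, h₁₄]),
      Finset.card_eq_three.2 ⟨_, _, _, h₂₃, h₂₄, h₃₄, rfl⟩]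
  have := sum_eq_zero_of_hasEvenFamily (F := {C₁, C₂, C₃, C₄}) (J := J) (c := 0) hHG ht hE
    (fun C => ⟨fun h => hC C (by simpa using h), fun h => by
      simpa using hC' _ C h.1.choose_spec h.2⟩) (by rw [hcard]; exact hasEvenFamily_of_Delta h)
    (by
      rw [hcard]
      refine fun hn hp => hJ (.inr (.inr ⟨h, hn, ?_⟩))
      rw [← ZMod.natCast_eq_one_iff_odd, hp]; decide)
  rwa [Finset.sum_insert (by simp [h₁₂, h₁₃, h₁₄]), Finset.sum_insert (by simp [h₂₃, h₂₄]),
    Finset.sum_pair h₃₄, ← add_assoc, ← add_assoc] at this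

lemma isShape_theta : IsShape (m := 3) (k := 2) ![0, 0, 0] ![1, 1, 1] ![false, false, false] := by
  constructor <;> decide

lemma isShape_K4 : IsShape (m := 6) (k := 4) ![0, 1, 2, 3, 0, 1] ![1, 2, 3, 0, 2, 3]
    ![false, false, false, false, false, false] := by
  constructor <;> decide

/-- The elements of the cycle space. By `IsSubdiv.exists_eq_biUnion` every circuit of the
subdivision comes from one of them; this shows that no even circuit is overlooked. -/
lemma eq_of_even_theta : ∀ I : Finset (Fin 3), (∀ x : Fin 2, ∑ i ∈ I,
    ((if x = ![0, 0, 0] i then 1 else 0) + if x = ![1, 1, 1] i then (1 : ZMod 2) else 0) = 0) →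
    I = ∅ ∨ I = {0, 1} ∨ I = {0, 2} ∨ I = {1, 2} := by
  decide

set_option maxRecDepth 10000 in
lemma eq_of_even_K4 : ∀ I : Finset (Fin 6), (∀ x : Fin 4, ∑ i ∈ I,
    ((if x = ![0, 1, 2, 3, 0, 1] i then 1 else 0) +
      if x = ![1, 2, 3, 0, 2, 3] i then (1 : ZMod 2) else 0) = 0) →
    I = ∅ ∨ I = {0, 1, 4} ∨ I = {2, 3, 4} ∨ I = {0, 3, 5} ∨ I = {1, 2, 5} ∨
      I = {0, 1, 2, 3} ∨ I = {4, 5, 0, 2} ∨ I = {4, 5, 1, 3} := by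
  decide

theorem thetaRel (hJ : ∀ H ≤ G, ¬ H.IsObstruction J) (ht : G.IsTail t) :
    G.ThetaRel fun C => J C + G.cwParity t C := by
  intro x y V₁ E₁ V₂ E₂ V₃ E₃ hxy p₁ p₂ p₃ i₁ i₂ i₃ n₁ n₂ n₃ k₁ k₂
  have d₁ := (p₁.eq_or_disjoint p₂ i₁).resolve_left n₁
  have d₂ := (p₁.eq_or_disjoint p₃ i₂).resolve_left n₂
  have d₃ := (p₂.eq_or_disjoint p₃ i₃).resolve_left n₃
  have ne₁ := p₁.edges_nonempty hxy
  have ne₂ := p₂.edges_nonempty hxy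
  have ne₃ := p₃.edges_nonempty hxy
  have S : G.IsPathSystem ![0, 0, 0] ![1, 1, 1] ![false, false, false] ![x, y] ![V₁, V₂, V₃]
      ![E₁, E₂, E₃] := by
    refine ⟨?_, ?_, ?_, ?_, ?_⟩
    · simpa [Fin.forall_fin_succ] using ⟨p₁, p₂, p₃⟩
    · simp [Fin.forall_fin_succ]; grind
    · simp [Fin.forall_fin_succ, d₁, d₂, d₃, d₁.symm, d₂.symm, d₃.symm]
    · simp [Fin.forall_fin_succ, ne₁.ne_empty, ne₂.ne_empty, ne₃.ne_empty]
    · simp [Fin.forall_fin_succ, hxy, hxy.symm]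
  obtain ⟨H, hHG, S'⟩ := S.exists_isSubdiv isShape_theta
  have q₁ : H.IsPath x y V₁ E₁ := S'.path 0
  have q₂ : H.IsPath x y V₂ E₂ := S'.path 1
  have q₃ : H.IsPath x y V₃ E₃ := S'.path 2
  obtain ⟨W₁, c₁, l₁⟩ := IsCirc.of_theta q₁ q₂ hxy i₁ n₁
  obtain ⟨W₂, c₂, l₂⟩ := IsCirc.of_theta q₁ q₃ hxy i₂ n₂
  obtain ⟨W₃, c₃, l₃⟩ := IsCirc.of_theta q₂ q₃ hxy i₃ n₃
  have hsp : H.IsEvenSplitting graphO1 ∨ H.IsEvenSplitting graphO2 ∨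
      H.IsEvenSplitting graphE1 ∨ H.IsEvenSplitting graphE2 ∨ H.IsEvenSplitting graphE3 := by
    -- All three paths have the same parity. They reduce to length two if even and to length one if
    -- odd.
    rcases Nat.mod_two_eq_zero_or_one E₁.card with h | h
    · exact .inl (S'.isEvenSplitting isShape_theta (len := ![2, 2, 2])
        (by simp [Fin.forall_fin_succ]; omega) (νc := ![.inl 0, .inl 1, .inr 0, .inr 1, .inr 2])
        (εc := ![(0, false), (1, false), (2, false), (0, true), (1, true), (2, true)])
        (by constructor <;> decide) 0)
    · exact .inr (.inr (.inl (S'.isEvenSplitting isShape_theta (len := ![1, 1, 1])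
        (by simp [Fin.forall_fin_succ]; omega) (νc := ![.inl 0, .inl 1])
        (εc := ![(0, false), (1, false), (2, false)]) (by constructor <;> decide) 0)))
  obtain ⟨e₁, he₁⟩ := ne₁
  obtain ⟨e₂, he₂⟩ := ne₂
  rw [Finset.disjoint_left] at d₁ d₂ d₃
  refine sum_eq_zero_of_three (hJ H hHG) hHG ht S'.finite_edgeSet hsp ?_ ?_ ?_ ?_ ?_
  · intro h; have := Finset.ext_iff.1 h e₂; grind
  · intro h; have := Finset.ext_iff.1 h e₁; grind
  · intro h; have := Finset.ext_iff.1 h e₁; grind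
  · simp only [List.mem_cons, List.not_mem_nil, or_false, forall_eq_or_imp, forall_eq]
    exact ⟨⟨⟨_, c₁⟩, by omega⟩, ⟨⟨_, c₂⟩, by omega⟩, ⟨⟨_, c₃⟩, by omega⟩⟩
  · intro V C hC _
    obtain ⟨I, rfl, hI⟩ := S'.exists_eq_biUnion isShape_theta hC
    rcases eq_of_even_theta I hI with rfl | rfl | rfl | rfl
    · exact absurd hC.nonempty (by simp)
    · simp
    · simp
    · simp

lemma IsPath.isCirc_of_four {a b c d : α} {V₁ V₂ V₃ V₄ : Finset α} {E₁ E₂ E₃ E₄ : Finset β}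
    (p₁ : G.IsPath a b V₁ E₁) (p₂ : G.IsPath b c V₂ E₂) (p₃ : G.IsPath c d V₃ E₃)
    (p₄ : G.IsPath d a V₄ E₄) (hac : a ≠ c) (h₁₂ : ∀ v ∈ V₁, v ∈ V₂ → v = b)
    (h₂₃ : ∀ v ∈ V₂, v ∈ V₃ → v = c) (h₃₄ : ∀ v ∈ V₃, v ∈ V₄ → v = d)
    (h₄₁ : ∀ v ∈ V₄, v ∈ V₁ → v = a) (h₁₃ : ∀ v ∈ V₁, v ∉ V₃) (h₂₄ : ∀ v ∈ V₂, v ∉ V₄) :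
    ∃ V, G.IsCirc V (E₁ ∪ E₂ ∪ E₃ ∪ E₄) := by
  have q₁ := p₁.append p₂ h₁₂
  have q₂ := p₃.append p₄ h₃₄
  have hd : Disjoint (E₁ ∪ E₂) (E₃ ∪ E₄) := by
    rw [Finset.disjoint_union_left, Finset.disjoint_union_right, Finset.disjoint_union_right]
    exact ⟨⟨p₁.disjoint_edges p₃ (m := a) fun v h h' => absurd h' (h₁₃ v h),
      (p₄.disjoint_edges p₁ h₄₁).symm⟩, p₂.disjoint_edges p₃ h₂₃,
      p₂.disjoint_edges p₄ (m := a) fun v h h' => absurd h' (h₂₄ v h)⟩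
  have h := q₁.isCirc q₂.symm hac (by grind) fun h => by
    obtain ⟨e, he⟩ := q₁.edges_nonempty hac
    exact Finset.disjoint_left.1 hd he (h ▸ he)
  rw [← Finset.union_assoc (E₁ ∪ E₂)] at h
  exact ⟨_, h⟩

/-- As all triangles are odd, the paths of even length meet each triangle in an even number of
sides, so they form a cut of `K₄`: the empty set, one of four stars, or one of three circuits of
length four. These give `E₂`, `O₂` and `E₃`, respectively. -/
lemma isEvenSplitting_of_K4 {b : Fin 4 → α} {V : Fin 6 → Finset α}
    {EA EB EC ED ES ET : Finset β}
    (S' : H.IsSubdiv ![0, 1, 2, 3, 0, 1] ![1, 2, 3, 0, 2, 3]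
      ![false, false, false, false, false, false] b V ![EA, EB, EC, ED, ES, ET])
    (k₁ : (EA.card + EB.card + ES.card) % 2 = 1) (k₂ : (EC.card + ED.card + ES.card) % 2 = 1)
    (k₃ : (EA.card + ED.card + ET.card) % 2 = 1) :
    H.IsEvenSplitting graphO1 ∨ H.IsEvenSplitting graphO2 ∨
      H.IsEvenSplitting graphE1 ∨ H.IsEvenSplitting graphE2 ∨ H.IsEvenSplitting graphE3 := by
  rcases Nat.mod_two_eq_zero_or_one EA.card with h₁ | h₁ <;>
    rcases Nat.mod_two_eq_zero_or_one ES.card with h₂ | h₂ <;>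
    rcases Nat.mod_two_eq_zero_or_one ED.card with h₃ | h₃
  · have h : H.IsEvenSplitting graphO2 := S'.isEvenSplitting isShape_K4 (len := ![2, 1, 1, 2, 2, 1])
      (by simp [Fin.forall_fin_succ]; omega) (νc := ![.inl 0, .inl 1, .inl 2, .inl 3, .inr 0, .inr 4, .inr 3])
      (εc := ![(0, false), (0, true), (4, false), (4, true), (3, true), (3, false), (1, false), (5, false), (2, false)])
      (by constructor <;> decide) 0
    exact .inr (.inl h)
  · have h : H.IsEvenSplitting graphE3 := S'.isEvenSplitting isShape_K4 (len := ![2, 1, 2, 1, 2, 2])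
      (by simp [Fin.forall_fin_succ]; omega) (νc := ![.inl 0, .inl 1, .inl 3, .inl 2, .inr 0, .inr 5, .inr 2, .inr 4])
      (εc := ![(0, false), (0, true), (5, false), (5, true), (2, true), (2, false), (4, true), (4, false), (3, false), (1, false)])
      (by constructor <;> decide) 0
    exact .inr (.inr (.inr (.inr h)))
  · have h : H.IsEvenSplitting graphE3 := S'.isEvenSplitting isShape_K4 (len := ![2, 2, 2, 2, 1, 1])
      (by simp [Fin.forall_fin_succ]; omega) (νc := ![.inl 0, .inl 1, .inl 2, .inl 3, .inr 0, .inr 1, .inr 2, .inr 3])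
      (εc := ![(0, false), (0, true), (1, false), (1, true), (2, false), (2, true), (3, false), (3, true), (4, false), (5, false)])
      (by constructor <;> decide) 0
    exact .inr (.inr (.inr (.inr h)))
  · have h : H.IsEvenSplitting graphO2 := S'.isEvenSplitting isShape_K4 (len := ![2, 2, 1, 1, 1, 2])
      (by simp [Fin.forall_fin_succ]; omega) (νc := ![.inl 1, .inl 0, .inl 2, .inl 3, .inr 0, .inr 1, .inr 5])
      (εc := ![(0, true), (0, false), (1, false), (1, true), (5, false), (5, true), (4, false), (3, false), (2, false)])
      (by constructor <;> decide) 0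
    exact .inr (.inl h)
  · have h : H.IsEvenSplitting graphE3 := S'.isEvenSplitting isShape_K4 (len := ![1, 2, 1, 2, 2, 2])
      (by simp [Fin.forall_fin_succ]; omega) (νc := ![.inl 0, .inl 2, .inl 1, .inl 3, .inr 4, .inr 1, .inr 5, .inr 3])
      (εc := ![(4, false), (4, true), (1, true), (1, false), (5, false), (5, true), (3, false), (3, true), (0, false), (2, false)])
      (by constructor <;> decide) 0
    exact .inr (.inr (.inr (.inr h)))
  · have h : H.IsEvenSplitting graphO2 := S'.isEvenSplitting isShape_K4 (len := ![1, 2, 2, 1, 2, 1])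
      (by simp [Fin.forall_fin_succ]; omega) (νc := ![.inl 2, .inl 0, .inl 1, .inl 3, .inr 4, .inr 1, .inr 2])
      (εc := ![(4, true), (4, false), (1, true), (1, false), (2, false), (2, true), (0, false), (3, false), (5, false)])
      (by constructor <;> decide) 0
    exact .inr (.inl h)
  · have h : H.IsEvenSplitting graphO2 := S'.isEvenSplitting isShape_K4 (len := ![1, 1, 2, 2, 1, 2])
      (by simp [Fin.forall_fin_succ]; omega) (νc := ![.inl 3, .inl 0, .inl 1, .inl 2, .inr 3, .inr 5, .inr 2])
      (εc := ![(3, false), (3, true), (5, true), (5, false), (2, true), (2, false), (0, false), (4, false), (1, false)])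
      (by constructor <;> decide) 0
    exact .inr (.inl h)
  · have h : H.IsEvenSplitting graphE2 := S'.isEvenSplitting isShape_K4 (len := ![1, 1, 1, 1, 1, 1])
      (by simp [Fin.forall_fin_succ]; omega) (νc := ![.inl 0, .inl 1, .inl 2, .inl 3])
      (εc := ![(0, false), (4, false), (3, false), (1, false), (5, false), (2, false)])
      (by constructor <;> decide) 0
    exact .inr (.inr (.inr (.inl h)))

theorem k4Rel (hJ : ∀ H ≤ G, ¬ H.IsObstruction J) (ht : G.IsTail t) :
    G.K4Rel fun C => J C + G.cwParity t C := by
  intro x y z w VA EA VB EB VC EC VD ED VS ES VT ET hxy hxz hxw hyz hyw hzw pA pB pC pD pS pT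
    mAB mBC mCD mDA mAC mBD mSA mSB mSC mSD mTA mTB mTC mTD mST k₁ k₂ k₃
  have dAB := pA.disjoint_edges pB mAB
  have dBC := pB.disjoint_edges pC mBC
  have dCD := pC.disjoint_edges pD mCD
  have dDA := pD.disjoint_edges pA mDA
  have dAC := pA.disjoint_edges pC (m := x) fun v h h' => absurd h' (mAC v h)
  have dBD := pB.disjoint_edges pD (m := x) fun v h h' => absurd h' (mBD v h)
  have dSA := pS.disjoint_edges pA mSA
  have dSB := pS.disjoint_edges pB mSB
  have dSC := pS.disjoint_edges pC mSC
  have dSD := pS.disjoint_edges pD mSD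
  have dTA := pT.disjoint_edges pA mTA
  have dTB := pT.disjoint_edges pB mTB
  have dTC := pT.disjoint_edges pC mTC
  have dTD := pT.disjoint_edges pD mTD
  have dST := pS.disjoint_edges pT (m := x) fun v h h' => absurd h' (mST v h)
  have neA := pA.edges_nonempty hxy
  have neB := pB.edges_nonempty hyz
  have neC := pC.edges_nonempty hzw
  have neD := pD.edges_nonempty hxw.symm
  have neS := pS.edges_nonempty hxz
  have neT := pT.edges_nonempty hyw
  have S : G.IsPathSystem ![0, 1, 2, 3, 0, 1] ![1, 2, 3, 0, 2, 3]
      ![false, false, false, false, false, false] ![x, y, z, w] ![VA, VB, VC, VD, VS, VT]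
      ![EA, EB, EC, ED, ES, ET] := by
    refine ⟨?_, ?_, ?_, ?_, ?_⟩
    · simpa [Fin.forall_fin_succ] using ⟨pA, pB, pC, pD, pS, pT⟩
    · clear * - mAB mBC mCD mDA mAC mBD mSA mSB mSC mSD mTA mTB mTC mTD mST
      intro i j hij v hi hj
      fin_cases i <;> fin_cases j <;> simp at hij hi hj ⊢ <;> grind
    · simp [Fin.forall_fin_succ, dAB, dBC, dCD, dDA, dAC, dBD, dSA, dSB, dSC, dSD, dTA, dTB, dTC,
        dTD, dST, dAB.symm, dBC.symm, dCD.symm, dDA.symm, dAC.symm, dBD.symm, dSA.symm, dSB.symm,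
        dSC.symm, dSD.symm, dTA.symm, dTB.symm, dTC.symm, dTD.symm, dST.symm]
    · simp [Fin.forall_fin_succ, neA.ne_empty, neB.ne_empty, neC.ne_empty, neD.ne_empty,
        neS.ne_empty, neT.ne_empty]
    · simp [Fin.forall_fin_succ, hxy, hxz, hxw, hyz, hyw, hzw, hxy.symm, hxz.symm, hxw.symm,
        hyz.symm, hyw.symm, hzw.symm]
  obtain ⟨H, hHG, S'⟩ := S.exists_isSubdiv isShape_K4
  have qA : H.IsPath x y VA EA := S'.path 0
  have qB : H.IsPath y z VB EB := S'.path 1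
  have qC : H.IsPath z w VC EC := S'.path 2
  have qD : H.IsPath w x VD ED := S'.path 3
  have qS : H.IsPath x z VS ES := S'.path 4
  have qT : H.IsPath y w VT ET := S'.path 5
  obtain ⟨W₁, c₁⟩ := qA.isCirc_of_four qB qC qD hxz mAB mBC mCD mDA mAC mBD
  obtain ⟨W₂, c₂⟩ := qS.isCirc_of_four qC qT.symm qA.symm hxw mSC (fun v h h' => mTC v h' h) mTA
    (fun v h h' => mSA v h' h) mST (fun v h h' => mAC v h' h)
  obtain ⟨W₃, c₃⟩ := qS.isCirc_of_four qB.symm qT qD hxy mSB (fun v h h' => mTB v h' h) mTD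
    (fun v h h' => mSD v h' h) mST mBD
  rw [Finset.union_right_comm ES, Finset.union_right_comm (ES ∪ ET)] at c₂
  rw [Finset.union_right_comm ES] at c₃
  have hcard : ∀ I : Finset (Fin 6), (I.biUnion ![EA, EB, EC, ED, ES, ET]).card =
      ∑ i ∈ I, (![EA, EB, EC, ED, ES, ET] i).card := fun I =>
    Finset.card_biUnion fun i _ j _ h => S'.disj i j h
  have l₁ := hcard {0, 1, 2, 3}
  have l₂ := hcard {4, 5, 0, 2}
  have l₃ := hcard {4, 5, 1, 3}
  simp [Finset.sum_insert, ← Finset.union_assoc] at l₁ l₂ l₃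
  refine sum_eq_zero_of_three (hJ H hHG) hHG ht S'.finite_edgeSet
    (isEvenSplitting_of_K4 S' k₁ k₂ k₃) ?_ ?_ ?_ ?_ ?_
  · obtain ⟨e, he⟩ := neB
    rw [Finset.disjoint_left] at dAB dBC dSB dTB
    clear * - dAB dBC dSB dTB he
    intro h; have := Finset.ext_iff.1 h e; grind
  · obtain ⟨e, he⟩ := neA
    rw [Finset.disjoint_left] at dAB dSA dTA dDA
    clear * - dAB dSA dTA dDA he
    intro h; have := Finset.ext_iff.1 h e; grind
  · obtain ⟨e, he⟩ := neA
    rw [Finset.disjoint_left] at dAB dSA dTA dDA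
    clear * - dAB dSA dTA dDA he
    intro h; have := Finset.ext_iff.1 h e; grind
  · simp only [List.mem_cons, List.not_mem_nil, or_false, forall_eq_or_imp, forall_eq]
    exact ⟨⟨⟨_, c₁⟩, by omega⟩, ⟨⟨_, c₂⟩, by omega⟩, ⟨⟨_, c₃⟩, by omega⟩⟩
  · intro V C hC hc
    obtain ⟨I, rfl, hI⟩ := S'.exists_eq_biUnion isShape_K4 hC
    have hl := hcard I
    rcases eq_of_even_K4 I hI with rfl | rfl | rfl | rfl | rfl | rfl | rfl | rfl
    · exact absurd hC.nonempty (by simp)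
    -- The four triangles are odd.
    iterate 4
      · rw [hl] at hc
        simp [Finset.sum_insert] at hc
        omega
    · simp [Finset.union_assoc]
    · simp [Finset.union_assoc]
    · simp [Finset.union_assoc]

end Relations
end Graph

/-! ### The relation for rings of three odd circuits -/

namespace Graph

section Delta

lemma isShape_Delta : IsShape (m := 9) (k := 6) ![0, 0, 2, 2, 4, 4, 1, 3, 5] ![1, 1, 3, 3, 5, 5, 2, 4, 0]
    ![false, false, false, false, false, false, true, true, true] := by
  constructor <;> decide

set_option maxRecDepth 100000 in
-- The cycle space has dimension four. Its elements are the unions of odd circuits of the ring, and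
-- the sets that contain all joining edges and one arc of each odd circuit.
lemma eq_of_even_Delta : ∀ I : Finset (Fin 9), (∀ x : Fin 6, ∑ i ∈ I,
    ((if x = ![0, 0, 2, 2, 4, 4, 1, 3, 5] i then 1 else 0) +
      if x = ![1, 1, 3, 3, 5, 5, 2, 4, 0] i then (1 : ZMod 2) else 0) = 0) →
    I ∈ ([∅, {0, 1}, {2, 3}, {4, 5}, {0, 1, 2, 3}, {0, 1, 4, 5}, {2, 3, 4, 5}, {0, 1, 2, 3, 4, 5},
      {0, 2, 4, 6, 7, 8}, {0, 3, 5, 6, 7, 8}, {1, 2, 5, 6, 7, 8}, {1, 3, 4, 6, 7, 8},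
      {1, 3, 5, 6, 7, 8}, {1, 2, 4, 6, 7, 8}, {0, 3, 4, 6, 7, 8}, {0, 2, 5, 6, 7, 8}] :
        List (Finset (Fin 9))) := by
  decide

/-- The reduced lengths of the paths in a ring of three odd circuits, where `p i` says which of the
two paths of the circuit `i` is odd. -/
def deltaLen (p : Fin 3 → Bool) (j₁ j₂ j₃ : ℕ) : Fin 9 → ℕ :=
  ![if p 0 then 1 else 2, if p 0 then 2 else 1, if p 1 then 1 else 2, if p 1 then 2 else 1,
    if p 2 then 1 else 2, if p 2 then 2 else 1, j₁, j₂, j₃]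

lemma forall_fin_three_bool {P : (Fin 3 → Bool) → Prop} (h : ∀ p₀ p₁ p₂, P ![p₀, p₁, p₂])
    (p : Fin 3 → Bool) : P p := by
  have : p = ![p 0, p 1, p 2] := by ext i; fin_cases i <;> rfl
  rw [this]
  exact h _ _ _

/-- The digits in the names are the reduced lengths of the three joining paths, and the number of
zeros tells how many of them are contracted. The ring is rotated to match the numbering of the base
graph; `p` tells which arc of each odd circuit becomes the single edge of its triangle. -/
lemma isLabelling_Delta_000 : ∀ p : Fin 3 → Bool, IsLabelling (m := 9) (k := 6) (n := 6) (l := 9) ![0, 0, 2, 2, 4, 4, 1, 3, 5]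
    ![1, 1, 3, 3, 5, 5, 2, 4, 0] (deltaLen p 0 0 0)
    ![(0, 1), (1, 2), (2, 0), (1, 3), (3, 4), (4, 1), (3, 0), (0, 5), (5, 3)]
    ![.inl 0, .inl 1, .inr (if p 0 then 1 else 0), .inl 3, .inr (if p 1 then 3 else 2),
      .inr (if p 2 then 5 else 4)]
    ![(if p 0 then 0 else 1, false), (if p 0 then 1 else 0, true),
      (if p 0 then 1 else 0, false), (if p 1 then 2 else 3, false),
      (if p 1 then 3 else 2, true), (if p 1 then 3 else 2, false),
      (if p 2 then 4 else 5, false), (if p 2 then 5 else 4, true),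
      (if p 2 then 5 else 4, false)] := by
  refine forall_fin_three_bool fun p₀ p₁ p₂ => ?_

  constructor <;> revert p₀ p₁ p₂ <;> decide

lemma isLabelling_Delta_001 : ∀ p : Fin 3 → Bool, IsLabelling (m := 9) (k := 6) (n := 7) (l := 10) ![0, 0, 2, 2, 4, 4, 1, 3, 5]
    ![1, 1, 3, 3, 5, 5, 2, 4, 0] (deltaLen p 0 0 1)
    ![(0, 1), (1, 2), (2, 0), (1, 3), (3, 4), (4, 1), (3, 5), (5, 6), (6, 3), (5, 0)]
    ![.inl 0, .inl 1, .inr (if p 0 then 1 else 0), .inl 3, .inr (if p 1 then 3 else 2),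
      .inl 5, .inr (if p 2 then 5 else 4)]
    ![(if p 0 then 0 else 1, false), (if p 0 then 1 else 0, true),
      (if p 0 then 1 else 0, false), (if p 1 then 2 else 3, false),
      (if p 1 then 3 else 2, true), (if p 1 then 3 else 2, false),
      (if p 2 then 4 else 5, false), (if p 2 then 5 else 4, true),
      (if p 2 then 5 else 4, false), (8, false)] := by
  refine forall_fin_three_bool fun p₀ p₁ p₂ => ?_

  constructor <;> revert p₀ p₁ p₂ <;> decide

lemma isLabelling_Delta_010 : ∀ p : Fin 3 → Bool, IsLabelling (m := 9) (k := 6) (n := 7) (l := 10) ![0, 0, 2, 2, 4, 4, 1, 3, 5]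
    ![1, 1, 3, 3, 5, 5, 2, 4, 0] (deltaLen p 0 1 0)
    ![(0, 1), (1, 2), (2, 0), (1, 3), (3, 4), (4, 1), (3, 5), (5, 6), (6, 3), (5, 0)]
    ![.inl 4, .inl 5, .inr (if p 2 then 5 else 4), .inl 1, .inr (if p 0 then 1 else 0),
      .inl 3, .inr (if p 1 then 3 else 2)]
    ![(if p 2 then 4 else 5, false), (if p 2 then 5 else 4, true),
      (if p 2 then 5 else 4, false), (if p 0 then 0 else 1, false),
      (if p 0 then 1 else 0, true), (if p 0 then 1 else 0, false),
      (if p 1 then 2 else 3, false), (if p 1 then 3 else 2, true),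
      (if p 1 then 3 else 2, false), (7, false)] := by
  refine forall_fin_three_bool fun p₀ p₁ p₂ => ?_

  constructor <;> revert p₀ p₁ p₂ <;> decide

lemma isLabelling_Delta_011 : ∀ p : Fin 3 → Bool, IsLabelling (m := 9) (k := 6) (n := 8) (l := 11) ![0, 0, 2, 2, 4, 4, 1, 3, 5]
    ![1, 1, 3, 3, 5, 5, 2, 4, 0] (deltaLen p 0 1 1)
    ![(0, 1), (1, 2), (2, 0), (3, 4), (4, 5), (5, 3), (4, 6), (6, 7), (7, 4),
      (1, 3), (6, 0)]
    ![.inl 4, .inl 5, .inr (if p 2 then 5 else 4), .inl 0, .inl 1,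
      .inr (if p 0 then 1 else 0), .inl 3, .inr (if p 1 then 3 else 2)]
    ![(if p 2 then 4 else 5, false), (if p 2 then 5 else 4, true),
      (if p 2 then 5 else 4, false), (if p 0 then 0 else 1, false),
      (if p 0 then 1 else 0, true), (if p 0 then 1 else 0, false),
      (if p 1 then 2 else 3, false), (if p 1 then 3 else 2, true),
      (if p 1 then 3 else 2, false), (8, false), (7, false)] := by
  refine forall_fin_three_bool fun p₀ p₁ p₂ => ?_

  constructor <;> revert p₀ p₁ p₂ <;> decide

lemma isLabelling_Delta_100 : ∀ p : Fin 3 → Bool, IsLabelling (m := 9) (k := 6) (n := 7) (l := 10) ![0, 0, 2, 2, 4, 4, 1, 3, 5]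
    ![1, 1, 3, 3, 5, 5, 2, 4, 0] (deltaLen p 1 0 0)
    ![(0, 1), (1, 2), (2, 0), (1, 3), (3, 4), (4, 1), (3, 5), (5, 6), (6, 3), (5, 0)]
    ![.inl 2, .inl 3, .inr (if p 1 then 3 else 2), .inl 5, .inr (if p 2 then 5 else 4),
      .inl 1, .inr (if p 0 then 1 else 0)]
    ![(if p 1 then 2 else 3, false), (if p 1 then 3 else 2, true),
      (if p 1 then 3 else 2, false), (if p 2 then 4 else 5, false),
      (if p 2 then 5 else 4, true), (if p 2 then 5 else 4, false),
      (if p 0 then 0 else 1, false), (if p 0 then 1 else 0, true),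
      (if p 0 then 1 else 0, false), (6, false)] := by
  refine forall_fin_three_bool fun p₀ p₁ p₂ => ?_

  constructor <;> revert p₀ p₁ p₂ <;> decide

lemma isLabelling_Delta_101 : ∀ p : Fin 3 → Bool, IsLabelling (m := 9) (k := 6) (n := 8) (l := 11) ![0, 0, 2, 2, 4, 4, 1, 3, 5]
    ![1, 1, 3, 3, 5, 5, 2, 4, 0] (deltaLen p 1 0 1)
    ![(0, 1), (1, 2), (2, 0), (3, 4), (4, 5), (5, 3), (4, 6), (6, 7), (7, 4),
      (1, 3), (6, 0)]
    ![.inl 0, .inl 1, .inr (if p 0 then 1 else 0), .inl 2, .inl 3,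
      .inr (if p 1 then 3 else 2), .inl 5, .inr (if p 2 then 5 else 4)]
    ![(if p 0 then 0 else 1, false), (if p 0 then 1 else 0, true),
      (if p 0 then 1 else 0, false), (if p 1 then 2 else 3, false),
      (if p 1 then 3 else 2, true), (if p 1 then 3 else 2, false),
      (if p 2 then 4 else 5, false), (if p 2 then 5 else 4, true),
      (if p 2 then 5 else 4, false), (6, false), (8, false)] := by
  refine forall_fin_three_bool fun p₀ p₁ p₂ => ?_

  constructor <;> revert p₀ p₁ p₂ <;> decide

lemma isLabelling_Delta_110 : ∀ p : Fin 3 → Bool, IsLabelling (m := 9) (k := 6) (n := 8) (l := 11) ![0, 0, 2, 2, 4, 4, 1, 3, 5]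
    ![1, 1, 3, 3, 5, 5, 2, 4, 0] (deltaLen p 1 1 0)
    ![(0, 1), (1, 2), (2, 0), (3, 4), (4, 5), (5, 3), (4, 6), (6, 7), (7, 4),
      (1, 3), (6, 0)]
    ![.inl 2, .inl 3, .inr (if p 1 then 3 else 2), .inl 4, .inl 5,
      .inr (if p 2 then 5 else 4), .inl 1, .inr (if p 0 then 1 else 0)]
    ![(if p 1 then 2 else 3, false), (if p 1 then 3 else 2, true),
      (if p 1 then 3 else 2, false), (if p 2 then 4 else 5, false),
      (if p 2 then 5 else 4, true), (if p 2 then 5 else 4, false),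
      (if p 0 then 0 else 1, false), (if p 0 then 1 else 0, true),
      (if p 0 then 1 else 0, false), (7, false), (6, false)] := by
  refine forall_fin_three_bool fun p₀ p₁ p₂ => ?_

  constructor <;> revert p₀ p₁ p₂ <;> decide

lemma isLabelling_Delta_111 : ∀ p : Fin 3 → Bool, IsLabelling (m := 9) (k := 6) (n := 9) (l := 12) ![0, 0, 2, 2, 4, 4, 1, 3, 5]
    ![1, 1, 3, 3, 5, 5, 2, 4, 0] (deltaLen p 1 1 1)
    ![(0, 1), (1, 2), (2, 0), (3, 4), (4, 5), (5, 3), (6, 7), (7, 8), (8, 6),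
      (1, 3), (4, 6), (7, 0)]
    ![.inl 0, .inl 1, .inr (if p 0 then 1 else 0), .inl 2, .inl 3,
      .inr (if p 1 then 3 else 2), .inl 4, .inl 5, .inr (if p 2 then 5 else 4)]
    ![(if p 0 then 0 else 1, false), (if p 0 then 1 else 0, true),
      (if p 0 then 1 else 0, false), (if p 1 then 2 else 3, false),
      (if p 1 then 3 else 2, true), (if p 1 then 3 else 2, false),
      (if p 2 then 4 else 5, false), (if p 2 then 5 else 4, true),
      (if p 2 then 5 else 4, false), (6, false), (7, false), (8, false)] := by
  refine forall_fin_three_bool fun p₀ p₁ p₂ => ?_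

  constructor <;> revert p₀ p₁ p₂ <;> decide

variable {α β : Type*} [DecidableEq α] [DecidableEq β] {G H : Graph α β} {J : Set β → ZMod 2}
  {t : β → α}

lemma isEvenSplitting_of_Delta {b : Fin 6 → α} {V : Fin 9 → Finset α}
    {P₁ Q₁ P₂ Q₂ P₃ Q₃ J₁ J₂ J₃ : Finset β}
    (S : H.IsSubdiv ![0, 0, 2, 2, 4, 4, 1, 3, 5] ![1, 1, 3, 3, 5, 5, 2, 4, 0] ![false, false, false, false, false, false, true, true, true]
      b V ![P₁, Q₁, P₂, Q₂, P₃, Q₃, J₁, J₂, J₃])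
    (k₁ : (P₁.card + Q₁.card) % 2 = 1) (k₂ : (P₂.card + Q₂.card) % 2 = 1)
    (k₃ : (P₃.card + Q₃.card) % 2 = 1) :
    H.IsEvenSplitting graphDelta1 ∨ H.IsEvenSplitting graphDelta2 ∨
      H.IsEvenSplitting graphDelta3 ∨ H.IsEvenSplitting graphDelta4 := by
  have hp : ∀ P Q : Finset β, (P.card + Q.card) % 2 = 1 → ∃ p : Bool,
      (if p then 1 else 2) = 2 - P.card % 2 ∧ (if p then 2 else 1) = 2 - Q.card % 2 := by
    intro P Q h
    rcases Nat.mod_two_eq_zero_or_one P.card with h' | h'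
    · exact ⟨false, by simp; omega, by simp; omega⟩
    · exact ⟨true, by simp; omega, by simp; omega⟩
  obtain ⟨p₁, a₁, b₁⟩ := hp _ _ k₁
  obtain ⟨p₂, a₂, b₂⟩ := hp _ _ k₂
  obtain ⟨p₃, a₃, b₃⟩ := hp _ _ k₃
  obtain ⟨p, rfl, rfl, rfl⟩ : ∃ p : Fin 3 → Bool, p 0 = p₁ ∧ p 1 = p₂ ∧ p 2 = p₃ :=
    ⟨![p₁, p₂, p₃], rfl, rfl, rfl⟩
  have hlen : ∀ j₁ j₂ j₃, J₁.card % 2 = j₁ → J₂.card % 2 = j₂ → J₃.card % 2 = j₃ →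
      ∀ i, deltaLen p j₁ j₂ j₃ i = if ![false, false, false, false, false, false, true, true, true] i
        then (![P₁, Q₁, P₂, Q₂, P₃, Q₃, J₁, J₂, J₃] i).card % 2
        else 2 - (![P₁, Q₁, P₂, Q₂, P₃, Q₃, J₁, J₂, J₃] i).card % 2 := by
    rintro _ _ _ rfl rfl rfl i
    fin_cases i
    exacts [a₁, b₁, a₂, b₂, a₃, b₃, rfl, rfl, rfl]
  rcases Nat.mod_two_eq_zero_or_one J₁.card with h₁ | h₁ <;>
    rcases Nat.mod_two_eq_zero_or_one J₂.card with h₂ | h₂ <;>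
    rcases Nat.mod_two_eq_zero_or_one J₃.card with h₃ | h₃
  · have h : H.IsEvenSplitting graphDelta4 :=
      S.isEvenSplitting isShape_Delta (hlen 0 0 0 h₁ h₂ h₃) (isLabelling_Delta_000 p) 0
    exact .inr (.inr (.inr h))
  · have h : H.IsEvenSplitting graphDelta3 :=
      S.isEvenSplitting isShape_Delta (hlen 0 0 1 h₁ h₂ h₃) (isLabelling_Delta_001 p) 0
    exact .inr (.inr (.inl h))
  · have h : H.IsEvenSplitting graphDelta3 :=
      S.isEvenSplitting isShape_Delta (hlen 0 1 0 h₁ h₂ h₃) (isLabelling_Delta_010 p) 0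
    exact .inr (.inr (.inl h))
  · have h : H.IsEvenSplitting graphDelta2 :=
      S.isEvenSplitting isShape_Delta (hlen 0 1 1 h₁ h₂ h₃) (isLabelling_Delta_011 p) 0
    exact .inr (.inl h)
  · have h : H.IsEvenSplitting graphDelta3 :=
      S.isEvenSplitting isShape_Delta (hlen 1 0 0 h₁ h₂ h₃) (isLabelling_Delta_100 p) 0
    exact .inr (.inr (.inl h))
  · have h : H.IsEvenSplitting graphDelta2 :=
      S.isEvenSplitting isShape_Delta (hlen 1 0 1 h₁ h₂ h₃) (isLabelling_Delta_101 p) 0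
    exact .inr (.inl h)
  · have h : H.IsEvenSplitting graphDelta2 :=
      S.isEvenSplitting isShape_Delta (hlen 1 1 0 h₁ h₂ h₃) (isLabelling_Delta_110 p) 0
    exact .inr (.inl h)
  · have h : H.IsEvenSplitting graphDelta1 :=
      S.isEvenSplitting isShape_Delta (hlen 1 1 1 h₁ h₂ h₃) (isLabelling_Delta_111 p) 0
    exact .inl h

lemma IsPathSystem.mem_of_biUnion_eq {m k : ℕ} {σ τ : Fin m → Fin k} {Jn : Fin m → Bool}
    {b : Fin k → α} {V : Fin m → Finset α} {E : Fin m → Finset β}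
    (S : G.IsPathSystem σ τ Jn b V E) {I I' : Finset (Fin m)} (h : I.biUnion E = I'.biUnion E)
    {i : Fin m} (hi : Jn i = false) (hI : i ∈ I) : i ∈ I' := by
  have hne : (E i).Nonempty := by
    rw [Finset.nonempty_iff_ne_empty]
    intro h
    rw [S.trivial i h] at hi
    exact Bool.noConfusion hi
  obtain ⟨e, he⟩ := hne
  have : e ∈ I'.biUnion E := h ▸ Finset.mem_biUnion.2 ⟨i, hI, he⟩
  obtain ⟨j, hj, hej⟩ := Finset.mem_biUnion.1 this
  by_cases hij : i = j
  · rwa [hij]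
  · exact absurd hej (Finset.disjoint_left.1 (S.disj i j hij) he)

lemma IsPath.disjoint_of_subsingleton {x y x' y' : α} {V V' : Finset α} {E E' : Finset β}
    (h : G.IsPath x y V E) (h' : G.IsPath x' y' V' E')
    (hm : ∀ v w, v ∈ V → v ∈ V' → w ∈ V → w ∈ V' → v = w) : Disjoint E E' := by
  by_cases hv : ∃ v, v ∈ V ∧ v ∈ V'
  · obtain ⟨v, hv, hv'⟩ := hv
    exact h.disjoint_edges h' (m := v) fun w hw hw' => hm w v hw hw' hv hv'
  · exact h.disjoint_edges h' (m := x) fun w hw hw' => absurd ⟨w, hw, hw'⟩ hv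

lemma sum_eq_zero_of_Delta (hJ : ¬ H.IsObstruction J) (hHG : H ≤ G) (ht : G.IsTail t)
    {s₁ t₁ s₂ t₂ s₃ t₃ : α} {VP₁ VQ₁ VP₂ VQ₂ VP₃ VQ₃ VJ₁ VJ₂ VJ₃ W₁ W₂ W₃ W₄ : Finset α}
    {P₁ Q₁ P₂ Q₂ P₃ Q₃ J₁ J₂ J₃ : Finset β}
    (S' : H.IsSubdiv ![0, 0, 2, 2, 4, 4, 1, 3, 5] ![1, 1, 3, 3, 5, 5, 2, 4, 0]
      ![false, false, false, false, false, false, true, true, true]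
      ![s₁, t₁, s₂, t₂, s₃, t₃] ![VP₁, VQ₁, VP₂, VQ₂, VP₃, VQ₃, VJ₁, VJ₂, VJ₃]
      ![P₁, Q₁, P₂, Q₂, P₃, Q₃, J₁, J₂, J₃])
    (n₁ : s₁ ≠ t₁) (n₂ : s₂ ≠ t₂) (n₃ : s₃ ≠ t₃) (pq₁ : ∀ v ∈ VP₁, v ∈ VQ₁ → v = s₁ ∨ v = t₁)
    (pq₂ : ∀ v ∈ VP₂, v ∈ VQ₂ → v = s₂ ∨ v = t₂) (pq₃ : ∀ v ∈ VP₃, v ∈ VQ₃ → v = s₃ ∨ v = t₃)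
    (r₁ : H.IsCirc W₁ (P₁ ∪ P₂ ∪ P₃ ∪ (J₁ ∪ J₂ ∪ J₃)))
    (r₂ : H.IsCirc W₂ (P₁ ∪ Q₂ ∪ Q₃ ∪ (J₁ ∪ J₂ ∪ J₃)))
    (r₃ : H.IsCirc W₃ (Q₁ ∪ P₂ ∪ Q₃ ∪ (J₁ ∪ J₂ ∪ J₃)))
    (r₄ : H.IsCirc W₄ (Q₁ ∪ Q₂ ∪ P₃ ∪ (J₁ ∪ J₂ ∪ J₃)))
    (k₁ : (P₁.card + Q₁.card) % 2 = 1) (k₂ : (P₂.card + Q₂.card) % 2 = 1)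
    (k₃ : (P₃.card + Q₃.card) % 2 = 1)
    (k : (P₁.card + P₂.card + P₃.card + J₁.card + J₂.card + J₃.card) % 2 = 0) :
    J ↑(P₁ ∪ P₂ ∪ P₃ ∪ (J₁ ∪ J₂ ∪ J₃)) + G.cwParity t ↑(P₁ ∪ P₂ ∪ P₃ ∪ (J₁ ∪ J₂ ∪ J₃)) +
      (J ↑(P₁ ∪ Q₂ ∪ Q₃ ∪ (J₁ ∪ J₂ ∪ J₃)) + G.cwParity t ↑(P₁ ∪ Q₂ ∪ Q₃ ∪ (J₁ ∪ J₂ ∪ J₃))) +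
      (J ↑(Q₁ ∪ P₂ ∪ Q₃ ∪ (J₁ ∪ J₂ ∪ J₃)) + G.cwParity t ↑(Q₁ ∪ P₂ ∪ Q₃ ∪ (J₁ ∪ J₂ ∪ J₃))) +
      (J ↑(Q₁ ∪ Q₂ ∪ P₃ ∪ (J₁ ∪ J₂ ∪ J₃)) + G.cwParity t ↑(Q₁ ∪ Q₂ ∪ P₃ ∪ (J₁ ∪ J₂ ∪ J₃))) = 0 := by
  have hcard : ∀ I : Finset (Fin 9), (I.biUnion ![P₁, Q₁, P₂, Q₂, P₃, Q₃, J₁, J₂, J₃]).card =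
      ∑ i ∈ I, (![P₁, Q₁, P₂, Q₂, P₃, Q₃, J₁, J₂, J₃] i).card := fun I =>
    Finset.card_biUnion fun i _ j _ h => S'.disj i j h
  have e₁ : P₁ ∪ P₂ ∪ P₃ ∪ (J₁ ∪ J₂ ∪ J₃) =
      Finset.biUnion {0, 2, 4, 6, 7, 8} ![P₁, Q₁, P₂, Q₂, P₃, Q₃, J₁, J₂, J₃] := by
    simp [Finset.union_assoc]
  have e₂ : P₁ ∪ Q₂ ∪ Q₃ ∪ (J₁ ∪ J₂ ∪ J₃) =
      Finset.biUnion {0, 3, 5, 6, 7, 8} ![P₁, Q₁, P₂, Q₂, P₃, Q₃, J₁, J₂, J₃] := by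
    simp [Finset.union_assoc]
  have e₃ : Q₁ ∪ P₂ ∪ Q₃ ∪ (J₁ ∪ J₂ ∪ J₃) =
      Finset.biUnion {1, 2, 5, 6, 7, 8} ![P₁, Q₁, P₂, Q₂, P₃, Q₃, J₁, J₂, J₃] := by
    simp [Finset.union_assoc]
  have e₄ : Q₁ ∪ Q₂ ∪ P₃ ∪ (J₁ ∪ J₂ ∪ J₃) =
      Finset.biUnion {1, 3, 4, 6, 7, 8} ![P₁, Q₁, P₂, Q₂, P₃, Q₃, J₁, J₂, J₃] := by
    simp [Finset.union_assoc]
  have o₁ : (P₁ ∪ P₂ ∪ P₃ ∪ (J₁ ∪ J₂ ∪ J₃)).card % 2 = 0 := by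
    rw [e₁, hcard]; simp [Finset.sum_insert]; omega
  have o₂ : (P₁ ∪ Q₂ ∪ Q₃ ∪ (J₁ ∪ J₂ ∪ J₃)).card % 2 = 0 := by
    rw [e₂, hcard]; simp [Finset.sum_insert]; omega
  have o₃ : (Q₁ ∪ P₂ ∪ Q₃ ∪ (J₁ ∪ J₂ ∪ J₃)).card % 2 = 0 := by
    rw [e₃, hcard]; simp [Finset.sum_insert]; omega
  have o₄ : (Q₁ ∪ Q₂ ∪ P₃ ∪ (J₁ ∪ J₂ ∪ J₃)).card % 2 = 0 := by
    rw [e₄, hcard]; simp [Finset.sum_insert]; omega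
  have s₁' := isEvenSplitting_of_Delta S' k₁ k₂ k₃
  have q := S'.path
  have dg : ∀ {x y : α} {V V' : Finset α} {P Q : Finset β}, x ≠ y → H.IsPath x y V P →
      H.IsPath x y V' Q → (∀ v ∈ V, v ∈ V' → v = x ∨ v = y) → (P.card + Q.card) % 2 = 1 →
      H.IsCirc (V ∪ V') (P ∪ Q) :=
    fun hxy hp hq hi hk => hp.isCirc hq hxy hi (by rintro rfl; omega)
  have g₁ := dg n₁ (q 0) (q 1) pq₁ k₁
  have g₂ := dg n₂ (q 2) (q 3) pq₂ k₂
  have g₃ := dg n₃ (q 4) (q 5) pq₃ k₃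
  change H.IsCirc _ (P₁ ∪ Q₁) at g₁
  change H.IsCirc _ (P₂ ∪ Q₂) at g₂
  change H.IsCirc _ (P₃ ∪ Q₃) at g₃
  have f₁ : P₁ ∪ Q₁ = Finset.biUnion {0, 1} ![P₁, Q₁, P₂, Q₂, P₃, Q₃, J₁, J₂, J₃] := by simp
  have f₂ : P₂ ∪ Q₂ = Finset.biUnion {2, 3} ![P₁, Q₁, P₂, Q₂, P₃, Q₃, J₁, J₂, J₃] := by simp
  have f₃ : P₃ ∪ Q₃ = Finset.biUnion {4, 5} ![P₁, Q₁, P₂, Q₂, P₃, Q₃, J₁, J₂, J₃] := by simp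
  rw [f₁] at g₁
  rw [f₂] at g₂
  rw [f₃] at g₃
  rw [e₁] at r₁ o₁ ⊢
  rw [e₂] at r₂ o₂ ⊢
  rw [e₃] at r₃ o₃ ⊢
  rw [e₄] at r₄ o₄ ⊢
  have sub : ∀ {I I' : Finset (Fin 9)} {V V'} (i : Fin 9),
      H.IsCirc V (I.biUnion ![P₁, Q₁, P₂, Q₂, P₃, Q₃, J₁, J₂, J₃]) →
      H.IsCirc V' (I'.biUnion ![P₁, Q₁, P₂, Q₂, P₃, Q₃, J₁, J₂, J₃]) → I' ⊆ I →
      ![false, false, false, false, false, false, true, true, true] i = false → i ∈ I → i ∉ I' → False :=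
    fun i h h' hI hi hiI hiI' => hiI' (S'.mem_of_biUnion_eq
      (h.eq_of_subset h' (Finset.biUnion_subset_biUnion_of_subset_left _ hI)).symm hi hiI)
  have ne : ∀ {I I' : Finset (Fin 9)} (i : Fin 9), ![false, false, false, false, false, false, true, true, true] i = false → i ∈ I → i ∉ I' →
      I.biUnion ![P₁, Q₁, P₂, Q₂, P₃, Q₃, J₁, J₂, J₃] ≠
        I'.biUnion ![P₁, Q₁, P₂, Q₂, P₃, Q₃, J₁, J₂, J₃] :=
    fun i hi hiI hiI' h => hiI' (S'.mem_of_biUnion_eq h hi hiI)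
  refine sum_eq_zero_of_four hJ hHG ht S'.finite_edgeSet s₁'
    (ne 2 rfl (by decide) (by decide)) (ne 0 rfl (by decide) (by decide))
    (ne 0 rfl (by decide) (by decide)) (ne 0 rfl (by decide) (by decide))
    (ne 0 rfl (by decide) (by decide)) (ne 2 rfl (by decide) (by decide)) ?_ ?_
  · simp only [List.mem_cons, List.not_mem_nil, or_false, forall_eq_or_imp, forall_eq]
    exact ⟨⟨⟨_, r₁⟩, o₁⟩, ⟨⟨_, r₂⟩, o₂⟩, ⟨⟨_, r₃⟩, o₃⟩, ⟨_, r₄⟩, o₄⟩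
  · intro V C hC hc
    obtain ⟨I, rfl, hI⟩ := S'.exists_eq_biUnion isShape_Delta hC
    have hI := eq_of_even_Delta I hI
    rw [hcard] at hc
    clear * - hI hC hc sub g₁ g₂ g₃ k k₁ k₂ k₃
    simp only [List.mem_cons, List.not_mem_nil, or_false] at hI ⊢
    -- Apart from the four circuits in question: a single odd circuit is odd, a union of several
    -- properly contains a circuit and is not one itself, and the other four ways round the ring are
    -- odd because they differ from even ones by an odd number of exchanged arcs.
    rcases hI with rfl | rfl | rfl | rfl | rfl | rfl | rfl | rfl | rfl | rfl | rfl | rfl | rfl |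
      rfl | rfl | rfl
    · exact absurd hC.nonempty (by simp)
    iterate 3
      · simp [Finset.sum_insert] at hc
        omega
    · exact (sub 2 hC g₁ (by decide) rfl (by decide) (by decide)).elim
    · exact (sub 4 hC g₁ (by decide) rfl (by decide) (by decide)).elim
    · exact (sub 4 hC g₂ (by decide) rfl (by decide) (by decide)).elim
    · exact (sub 4 hC g₁ (by decide) rfl (by decide) (by decide)).elim
    · exact .inl rfl
    · exact .inr (.inl rfl)
    · exact .inr (.inr (.inl rfl))
    · exact .inr (.inr (.inr rfl))
    iterate 4
      · simp [Finset.sum_insert] at hc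
        omega

theorem deltaRel (hJ : ∀ H ≤ G, ¬ H.IsObstruction J) (ht : G.IsTail t) :
    G.DeltaRel fun C => J C + G.cwParity t C := by
  intro s₁ t₁ s₂ t₂ s₃ t₃ VP₁ P₁ VQ₁ Q₁ VP₂ P₂ VQ₂ Q₂ VP₃ P₃ VQ₃ Q₃ VJ₁ J₁ VJ₂ J₂ VJ₃ J₃
    n₁ n₂ n₃ n₁₂ n₁₃ n₂₃ m₁₂ m₁₃ m₂₃ l₁₂ l₂₃ l₃₁ p₁ q₁ p₂ q₂ p₃ q₃ j₁ j₂ j₃ pq₁ pq₂ pq₃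
    c₁₂ c₂₃ c₃₁ d₁₁ d₁₃ d₁₂ d₂₂ d₂₁ d₂₃ d₃₃ d₃₂ d₃₁ u₁₂ u₂₃ u₃₁ k₁ k₂ k₃ k
  obtain ⟨c₁₂a, c₁₂b, c₁₂c, c₁₂d⟩ := forall_mem_union₂ c₁₂
  obtain ⟨c₂₃a, c₂₃b, c₂₃c, c₂₃d⟩ := forall_mem_union₂ c₂₃
  obtain ⟨c₃₁a, c₃₁b, c₃₁c, c₃₁d⟩ := forall_mem_union₂ c₃₁
  replace d₁₁ := forall_mem_union₁ d₁₁
  replace d₁₃ := forall_mem_union₁ d₁₃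
  replace d₁₂ := forall_mem_union₁ d₁₂
  replace d₂₂ := forall_mem_union₁ d₂₂
  replace d₂₁ := forall_mem_union₁ d₂₁
  replace d₂₃ := forall_mem_union₁ d₂₃
  replace d₃₃ := forall_mem_union₁ d₃₃
  replace d₃₂ := forall_mem_union₁ d₃₂
  replace d₃₁ := forall_mem_union₁ d₃₁
  have S : G.IsPathSystem ![0, 0, 2, 2, 4, 4, 1, 3, 5] ![1, 1, 3, 3, 5, 5, 2, 4, 0]
      ![false, false, false, false, false, false, true, true, true]
      ![s₁, t₁, s₂, t₂, s₃, t₃] ![VP₁, VQ₁, VP₂, VQ₂, VP₃, VQ₃, VJ₁, VJ₂, VJ₃]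
      ![P₁, Q₁, P₂, Q₂, P₃, Q₃, J₁, J₂, J₃] := by
    have hp : ∀ i, G.IsPath (![s₁, t₁, s₂, t₂, s₃, t₃] (![0, 0, 2, 2, 4, 4, 1, 3, 5] i))
        (![s₁, t₁, s₂, t₂, s₃, t₃] (![1, 1, 3, 3, 5, 5, 2, 4, 0] i))
        (![VP₁, VQ₁, VP₂, VQ₂, VP₃, VQ₃, VJ₁, VJ₂, VJ₃] i)
        (![P₁, Q₁, P₂, Q₂, P₃, Q₃, J₁, J₂, J₃] i) := by
      intro i
      fin_cases i
      exacts [p₁, q₁, p₂, q₂, p₃, q₃, j₁, j₂, j₃]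
    refine ⟨hp, ?_, ?_, ?_, ?_⟩
    · clear * - pq₁ pq₂ pq₃ c₁₂a c₁₂b c₁₂c c₁₂d c₂₃a c₂₃b c₂₃c c₂₃d c₃₁a c₃₁b c₃₁c c₃₁d d₁₁ d₁₃ d₁₂
        d₂₂ d₂₁ d₂₃ d₃₃ d₃₂ d₃₁ u₁₂ u₂₃ u₃₁
      intro i j hij v hi hj
      fin_cases i <;> fin_cases j <;> simp at hij hi hj ⊢ <;> grind
    · have hlt : ∀ i j : Fin 9, i < j → Disjoint (![P₁, Q₁, P₂, Q₂, P₃, Q₃, J₁, J₂, J₃] i)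
          (![P₁, Q₁, P₂, Q₂, P₃, Q₃, J₁, J₂, J₃] j) := by
        intro i j hij
        -- The two arcs of an odd circuit share both ends and are distinct because of their
        -- parities. Any other two paths have at most one common vertex.
        by_cases h₁ : i = 0 ∧ j = 1
        · obtain ⟨rfl, rfl⟩ := h₁
          exact (p₁.eq_or_disjoint q₁ pq₁).resolve_left (by rintro rfl; omega)
        by_cases h₂ : i = 2 ∧ j = 3
        · obtain ⟨rfl, rfl⟩ := h₂
          exact (p₂.eq_or_disjoint q₂ pq₂).resolve_left (by rintro rfl; omega)
        by_cases h₃ : i = 4 ∧ j = 5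
        · obtain ⟨rfl, rfl⟩ := h₃
          exact (p₃.eq_or_disjoint q₃ pq₃).resolve_left (by rintro rfl; omega)
        refine (hp i).disjoint_of_subsingleton (hp j) ?_
        clear * - hij h₁ h₂ h₃ c₁₂a c₁₂b c₁₂c c₁₂d c₂₃a c₂₃b c₂₃c c₂₃d c₃₁a c₃₁b c₃₁c c₃₁d d₁₁ d₁₃
          d₁₂ d₂₂ d₂₁ d₂₃ d₃₃ d₃₂ d₃₁ u₁₂ u₂₃ u₃₁
        intro v w hv hv' hw hw'
        fin_cases i <;> fin_cases j <;> simp at hij h₁ h₂ h₃ hv hv' hw hw' <;> grind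
      intro i j hij
      rcases lt_or_gt_of_ne hij with h | h
      exacts [hlt i j h, (hlt j i h).symm]
    · have hne : ∀ {x y V E}, G.IsPath x y V E → x ≠ y → E ≠ ∅ :=
        fun h h' => (h.edges_nonempty h').ne_empty
      intro i h
      fin_cases i
      exacts [absurd h (hne p₁ n₁), absurd h (hne q₁ n₁), absurd h (hne p₂ n₂),
        absurd h (hne q₂ n₂), absurd h (hne p₃ n₃), absurd h (hne q₃ n₃), rfl, rfl, rfl]
    · have hem : ∀ {x y V E}, G.IsPath x y V E → x = y → E = ∅ := by
        rintro x y V E h rfl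
        exact h.eq_singleton.2
      intro x y h
      by_cases hxy : x = y
      · exact .inl hxy
      refine .inr ?_
      -- Only the two ends of a joining path may coincide, and the path is trivial then.
      fin_cases x <;> fin_cases y <;> first
        | exact absurd rfl hxy
        | exact absurd h n₁ | exact absurd h.symm n₁
        | exact absurd h n₂ | exact absurd h.symm n₂
        | exact absurd h n₃ | exact absurd h.symm n₃
        | exact absurd h n₁₂ | exact absurd h.symm n₁₂
        | exact absurd h n₁₃ | exact absurd h.symm n₁₃
        | exact absurd h n₂₃ | exact absurd h.symm n₂₃
        | exact absurd h m₁₂ | exact absurd h.symm m₁₂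
        | exact absurd h m₁₃ | exact absurd h.symm m₁₃
        | exact absurd h m₂₃ | exact absurd h.symm m₂₃
        | exact absurd h l₁₂ | exact absurd h.symm l₁₂
        | exact absurd h l₂₃ | exact absurd h.symm l₂₃
        | exact absurd h l₃₁ | exact absurd h.symm l₃₁
        | exact ⟨6, rfl, hem j₁ h, by decide⟩
        | exact ⟨6, rfl, hem j₁ h.symm, by decide⟩
        | exact ⟨7, rfl, hem j₂ h, by decide⟩
        | exact ⟨7, rfl, hem j₂ h.symm, by decide⟩
        | exact ⟨8, rfl, hem j₃ h, by decide⟩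
        | exact ⟨8, rfl, hem j₃ h.symm, by decide⟩
  obtain ⟨H, hHG, S'⟩ := S.exists_isSubdiv isShape_Delta
  have q : ∀ i, H.IsPath (![s₁, t₁, s₂, t₂, s₃, t₃] (![0, 0, 2, 2, 4, 4, 1, 3, 5] i))
      (![s₁, t₁, s₂, t₂, s₃, t₃] (![1, 1, 3, 3, 5, 5, 2, 4, 0] i))
      (![VP₁, VQ₁, VP₂, VQ₂, VP₃, VQ₃, VJ₁, VJ₂, VJ₃] i)
      (![P₁, Q₁, P₂, Q₂, P₃, Q₃, J₁, J₂, J₃] i) := S'.path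
  obtain ⟨W₁, r₁, -⟩ := isCirc_ring n₁ n₁₃ (q 0) (q 2) (q 4) (q 6) (q 7) (q 8)
    c₁₂a c₂₃a c₃₁a d₁₁.1 d₁₃.1 d₁₂.1 d₂₂.1 d₂₁.1 d₂₃.1
    d₃₃.1 d₃₂.1 d₃₁.1 u₁₂ u₂₃ u₃₁
  obtain ⟨W₂, r₂, -⟩ := isCirc_ring n₁ n₁₃ (q 0) (q 3) (q 5) (q 6) (q 7) (q 8)
    c₁₂b c₂₃d c₃₁c d₁₁.1 d₁₃.1 d₁₂.1 d₂₂.2 d₂₁.2 d₂₃.2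
    d₃₃.2 d₃₂.2 d₃₁.2 u₁₂ u₂₃ u₃₁
  obtain ⟨W₃, r₃, -⟩ := isCirc_ring n₁ n₁₃ (q 1) (q 2) (q 5) (q 6) (q 7) (q 8)
    c₁₂c c₂₃b c₃₁d d₁₁.2 d₁₃.2 d₁₂.2 d₂₂.1 d₂₁.1 d₂₃.1
    d₃₃.2 d₃₂.2 d₃₁.2 u₁₂ u₂₃ u₃₁
  obtain ⟨W₄, r₄, -⟩ := isCirc_ring n₁ n₁₃ (q 1) (q 3) (q 4) (q 6) (q 7) (q 8)
    c₁₂d c₂₃c c₃₁b d₁₁.2 d₁₃.2 d₁₂.2 d₂₂.2 d₂₁.2 d₂₃.2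
    d₃₃.1 d₃₂.1 d₃₁.1 u₁₂ u₂₃ u₃₁
  exact sum_eq_zero_of_Delta (hJ H hHG) hHG ht S' n₁ n₂ n₃ pq₁ pq₂ pq₃ r₁ r₂ r₃ r₄ k₁ k₂ k₃ k

end Delta
end Graph

/-! ### Orientations and potentials -/

namespace Graph

section Main

variable {α β : Type*} {G H : Graph α β} {J : Set β → ZMod 2} {t : β → α}

lemma Orientation.exists_isTail [Nonempty α] (D : G.Orientation) :
    ∃ t : β → α, G.IsTail t ∧ ∀ g (hg : g ∈ E(G)), t g = D.tail ⟨g, hg⟩ := by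
  classical
  refine ⟨fun g => if hg : g ∈ E(G) then D.tail ⟨g, hg⟩ else Classical.arbitrary α,
    fun g hg => ⟨D.head ⟨g, hg⟩, ?_⟩, fun g hg => dif_pos hg⟩
  simpa only [dif_pos hg] using D.isLink ⟨g, hg⟩

lemma IsObstruction.nonempty (h : H.IsObstruction J) : Nonempty α := by
  have hn : H.numEvenCircuits ≠ 0 := by
    rcases h with h | h | h <;> rw [h.2.1] <;> decide
  obtain ⟨C, n, v, e, hC, -⟩ := Set.nonempty_of_ncard_ne_zero hn
  exact ⟨v 0⟩

lemma IsObstruction.not_isParityCompatible (hE : E(G).Finite) (hHG : H ≤ G)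
    (h : H.IsObstruction J) : ¬ G.IsParityCompatible J := by
  classical
  rintro ⟨D, hD⟩
  have := h.nonempty
  obtain ⟨t, ht, htD⟩ := D.exists_isTail
  obtain ⟨k, c, hf, hk, hp⟩ := h.exists_hasEvenFamily
  obtain ⟨F, -, hF, hsum, hnum⟩ := hf.exists_finset hk (hE.subset hHG.edgeSet_mono)
  have hJ : ∀ C ∈ F, J C = H.cwParity t C := by
    intro C hC
    obtain ⟨⟨V, hV⟩, hc⟩ := (hF C).1 hC
    have hev := hV.isEvenCircuit hc
    rw [cwParity_of_le hHG ht hev]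
    obtain ⟨n, v, e, hs, hn, hr⟩ := hev
    rw [← hr, (hs.mono hHG).cwParity_eq hn ht, ← hD n v e (hs.mono hHG) hn,
      D.agreement_eq (hs.mono hHG) hn htD]
  -- The number of prescribed even circuits would be both `k + c` and `k + c + 1` modulo 2.
  have h1 := hnum J
  rw [Finset.sum_congr rfl hJ, hsum t (ht.mono hHG), hp] at h1
  simp at h1

/-- Reversing the edges with `f g ≠ 0` changes the clockwise parity of an even circuit by the sum of
`f` over it. Loops lie on no even circuit, so it does not matter that reversal leaves their tails
unchanged. -/
lemma isParityCompatible_of_potential (ht : G.IsTail t) (f : β → ZMod 2)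
    (hf : ∀ C : Finset β, G.IsEvenCircuit C → J C + G.cwParity t C = ∑ e ∈ C, f e) :
    G.IsParityCompatible J := by
  classical
  choose y hy using ht
  let D : G.Orientation :=
    { tail := fun g => if f g = 0 then t g else y g g.2
      head := fun g => if f g = 0 then y g g.2 else t g
      isLink := fun g => by
        by_cases h : f g = 0
        · simpa [h] using hy g g.2
        · simpa [h] using (hy g g.2).symm }
  refine ⟨D, fun n v e hs hn => ?_⟩
  have := NeZero.of_pos hs.pos
  have : Nonempty α := ⟨v 0⟩
  obtain ⟨t', ht', htD⟩ := D.exists_isTail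
  have hev : G.IsEvenCircuit (Set.range e) := ⟨n, v, e, hs, hn, rfl⟩
  obtain ⟨V, C, hC, hCr, hc⟩ := hev.exists_isCirc
  have h1 := hf C (hCr ▸ hev)
  rw [← hs.sum_range hCr f, hCr, hs.cwParity_eq hn fun g hg => ⟨_, hy g hg⟩, ncard_cast] at h1
  rw [D.agreement_eq hs hn htD, ncard_cast]
  have two : ∀ p : ZMod 2, p + p = 0 := by decide
  have key : ∀ i, (if t' (e i) = v i then 1 else 0 : ZMod 2) =
      (if t (e i) = v i then 1 else 0) + f (e i) := by
    intro i
    have hi := (hs.isLink i).edge_mem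
    have hne := hs.succ_ne hn i
    have hty := (hy _ hi).eq_and_eq_or_eq_and_eq (hs.isLink i)
    have : f (e i) = 0 ∨ f (e i) = 1 := by generalize f (e i) = p; revert p; decide
    have htt : t' (e i) = if f (e i) = 0 then t (e i) else y (e i) hi := htD _ hi
    have two : (1 : ZMod 2) + 1 = 0 := by decide
    rw [htt]
    rcases this with h | h <;> rcases hty with ⟨h1, h2⟩ | ⟨h1, h2⟩ <;>
      simp [h, h1, h2, hne, two]
  rw [Finset.sum_congr rfl fun i _ => key i, Finset.sum_add_distrib, ← h1, add_left_comm, two,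
    add_zero]

lemma isParityCompatible_of_forall_not_isObstruction (hE : E(G).Finite)
    (h : ∀ H ≤ G, ¬ H.IsObstruction J) : G.IsParityCompatible J := by
  classical
  rcases isEmpty_or_nonempty α with hα | hα
  -- Without vertices there are no circuits, and any choice of ends will do.
  · exact ⟨⟨fun g => (exists_isLink_of_mem_edgeSet g.2).choose,
      fun g => (exists_isLink_of_mem_edgeSet g.2).choose_spec.choose,
      fun g => (exists_isLink_of_mem_edgeSet g.2).choose_spec.choose_spec⟩,
      fun n v => isEmptyElim (v 0)⟩
  obtain ⟨t, ht⟩ := G.exists_isTail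
  have hR : G.Rels fun C => J C + G.cwParity t C :=
    ⟨thetaRel h ht, k4Rel h ht, deltaRel h ht⟩
  obtain ⟨f, hf⟩ := hR.hasPotential hE.toFinset
  refine isParityCompatible_of_potential ht f fun C hC => ?_
  obtain ⟨V, C', hC', hCC, hc⟩ := hC.exists_isCirc
  obtain rfl := Finset.coe_injective hCC
  exact hf V C' hC' (fun e he => hE.mem_toFinset.2 (hC'.mem_edgeSet he)) hc

end Main

end Graph
theorem theorem1 {α β : Type*} (G : Graph α β) (hV : V(G).Finite) (hE : E(G).Finite)
    (J : Set β → ZMod 2) :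
    ¬ G.IsParityCompatible J ↔
      ∃ H : Graph α β, H ≤ G ∧
        (((H.IsEvenSplitting Graph.graphO1 ∨ H.IsEvenSplitting Graph.graphO2) ∧
            H.numEvenCircuits = 3 ∧ Even (H.numPrescribedEven J)) ∨
          ((H.IsEvenSplitting Graph.graphE1 ∨ H.IsEvenSplitting Graph.graphE2 ∨
              H.IsEvenSplitting Graph.graphE3) ∧
            H.numEvenCircuits = 3 ∧ Odd (H.numPrescribedEven J)) ∨
          ((H.IsEvenSplitting Graph.graphDelta1 ∨ H.IsEvenSplitting Graph.graphDelta2 ∨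
              H.IsEvenSplitting Graph.graphDelta3 ∨ H.IsEvenSplitting Graph.graphDelta4) ∧
            H.numEvenCircuits = 4 ∧ Odd (H.numPrescribedEven J))) := by
  refine ⟨fun h => ?_, fun ⟨H, hHG, hH⟩ => Graph.IsObstruction.not_isParityCompatible hE hHG hH⟩
  by_contra hcon
  exact h (Graph.isParityCompatible_of_forall_not_isObstruction hE fun H hHG hH =>
    hcon ⟨H, hHG, hH⟩)
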